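/- Let $q\in\mathbb C$, $q\neq 0$, $q^4\neq 1$, put $p_1=q^2$, $p_2=q^{-1}$ and $$g(z)=\frac{G^+(z)}{G^-(z)},\qquad G^+(z)=(zp_1-1)(zp_2-1),\quad G^-(z)=(z-p_1)(z-p_2),$$ so that $g(z)=g(z^{-1})^{-1}$ and $G^\pm$ have no common zero. The functions $g(z)^{\pm1}$ are always expanded in powers of $z$ around $z=0$, and $\delta(z)=\sum_{n\in\mathbb Z}z^n$. **The algebra.** $U_q(g,\bar{\mathfrak s})$ is the $\mathbb Z/2$-graded associative unital $\mathbb C$-algebra generated by a central invertible element $q^{c/2}$, by $e^{\pm\bar a(0)}$, $\bar a(m)$ $(m<0)$, $\bar b(m)$ $(m>0)$, which are even, and by $x^\pm(n)$ $(n\in\mathbb Z)$, which are odd. (Thus $\bar a(m)=0$ for $m>0$, $\bar b(m)=0$ for $m<0$, and $e^{\bar b(0)}=e^{-\bar a(0)}$, i.e. $\bar a(0)=-\bar b(0)$.) Put $x^\pm(z)=\sum_n x^\pm(n)z^{-n}$ and $$\varphi(z)=\sum_m\varphi(m)z^{-m}=e^{\bar a(0)}\exp\Big[\sum_{m<0}\bar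 a(m)z^{-m}\Big],\qquad \psi(z)=\sum_m\psi(m)z^{-m}=e^{\bar b(0)}\exp\Big[\sum_{m>0}\bar b(m)z^{-m}\Big].$$ The relations are, coefficient by coefficient, $$\varphi(z)\varphi(w)=\varphi(w)\varphi(z),\quad \psi(z)\psi(w)=\psi(w)\psi(z),\quad \varphi(z)\psi(w)=\frac{g(\frac zw q^{-c})}{g(\frac zw q^{c})}\psi(w)\varphi(z),$$ $$\varphi(z)x^\pm(w)=g(\tfrac zw q^{\mp c/2})^{\pm1}x^\pm(w)\varphi(z),\qquad \psi(z)x^\pm(w)=g(\tfrac wz q^{\mp c/2})^{\mp1}x^\pm(w)\psi(z),$$ $$x^+(z)x^-(w)+x^-(w)x^+(z)=\frac1{q-q^{-1}}\Big(\delta(\tfrac zw q^{-c})\psi(wq^{c/2})-\delta(\tfrac zw q^{c})\varphi(zq^{c/2})\Big),$$ $$G^\mp(z/w)\,x^\pm(z)x^\pm(w)=-G^\pm(z/w)\,x^\pm(w)x^\pm(z),$$ together with the q-Serre relations: for $$Y^\pm(z_1,z_2,z_3)=\prod_{1\le i<j\le3}\frac{(z_i-p_1^{\pm1}z_j)(z_i-p_2^{\pm1}z_j)}{z_i-z_j}\;x^\pm(z_1)x^\pm(z_2)x^\pm(z_3),$$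 with $1/(z_i-z_j)$ expanded in $|z_i|>|z_j|$, the restriction of $Y^\pm$ to the line $z_1=z_2q^{\mp1}=z_3q^{\mp2}$ is $0$. The q-Serre relations, and the formulas below, are infinite sums, which are understood as follows. A generator with index $m$ has weight $m$, and $q^{\pm c/2}$, $e^{\pm\bar a(0)}$ have weight $0$. Let $U'$ be the algebra with all the relations above except the q-Serre relations, with the topology in which the left ideals generated by the products of generators of total weight $\ge N$ $(N\in\mathbb Z)$ form a basis of neighbourhoods of $0$. Let $\widehat U$ be the quotient of the completion of $U'$ by the closed two-sided ideal generated by the q-Serre relations; $U=U_q(g,\bar{\mathfrak s})$ is the image of $U'$ in $\widehat U$. Let $U_n\subset U$ be the span of the products of generators of weight $n$. The completed tensor square $U\,\widehat\otimes\,U$ consists of the formal sums $\sum_{n\in\mathbb Z}t_n$ with $t_n\in U\otimes U_n$ and $t_n=0$ for $n\ll0$, with the product determined by $(a\otimes b)(c\otimes d)=(-1)^{[b][c]}ac\otimes bd$ for homogeneous elements. **Theorem.** The sums defining the coefficients of $Y^\pm$ and of their restrictions to the lines converge in the completion of $U'$, and $U_q(g,\bar{\mathfrak s})$ is a $\mathbb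 Z/2$-graded topological Hopf algebra: there are parity-preserving maps, namely algebra homomorphisms $\Delta:U\to U\,\widehat\otimes\,U$ and $\varepsilon:U\to\mathbb C$ and a linear map $S:U\to\widehat U$ with $S(uv)=(-1)^{[u][v]}S(v)S(u)$ for homogeneous $u,v$, such that $(\Delta\otimes1)\Delta=(1\otimes\Delta)\Delta$ (componentwise), $(\varepsilon\otimes1)\Delta=1=(1\otimes\varepsilon)\Delta$ and $m(S\otimes1)\Delta=\varepsilon=m(1\otimes S)\Delta$ (as convergent sums in $\widehat U$), and which are given by the same formulas as for $U_q(g,\mathfrak s)$: with $c_1=c\otimes1$ and $c_2=1\otimes c$, $$\Delta(q^{c/2})=q^{c/2}\otimes q^{c/2},\quad \Delta(x^+(z))=x^+(z)\otimes1+\varphi(zq^{c_1/2})\otimes x^+(zq^{c_1}),\quad \Delta(x^-(z))=1\otimes x^-(z)+x^-(zq^{c_2})\otimes\psi(zq^{c_2/2}),$$ $$\Delta(\varphi(z))=\varphi(zq^{-c_2/2})\otimes\varphi(zq^{c_1/2}),\qquad \Delta(\psi(z))=\psi(zq^{c_2/2})\otimes\psi(zq^{-c_1/2}),$$ $$\varepsilon(q^{c/2})=1,\qquad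 \varepsilon(\varphi(z))=\varepsilon(\psi(z))=1,\qquad \varepsilon(x^\pm(z))=0,$$ $$S(q^{c/2})=q^{-c/2},\quad S(x^+(z))=-\varphi(zq^{-c/2})^{-1}x^+(zq^{-c}),\quad S(x^-(z))=-x^-(zq^{-c})\psi(zq^{-c/2})^{-1},$$ $$S(\varphi(z))=\varphi(z)^{-1},\qquad S(\psi(z))=\psi(z)^{-1}.$$ -/

import Mathlib

open scoped TensorProduct

noncomputable section

namespace SuperCurrent

/-! ### Generators -/

/-- The generators of the algebra.  The truncations `ā(m) = 0` for `m > 0`, `b̄(m) = 0` for `m < 0`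
and the identification `ā(0) = - b̄(0)` are built in:
* `gam`, `gamInv` are `q^{c/2}`, `q^{-c/2}`;
* `k`, `kInv` are `exp ā(0) = exp (- b̄(0))` and `exp (- ā(0)) = exp b̄(0)`;
* `a n` is `ā(-(n+1))` and `b n` is `b̄(n+1)`;
* `x 1 n` is `x⁺(n)` and `x (-1) n` is `x⁻(n)`. -/
inductive Gen : Type
  | gam : Gen
  | gamInv : Gen
  | k : Gen
  | kInv : Gen
  | a (n : ℕ) : Gen
  | b (n : ℕ) : Gen
  | x (s : ℤˣ) (n : ℤ) : Gen

/-- The mode number (coefficient index of `z^{-m}`) of a generator. -/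
def Gen.weight : Gen → ℤ
  | .gam => 0
  | .gamInv => 0
  | .k => 0
  | .kInv => 0
  | .a n => -((n : ℤ) + 1)
  | .b n => (n : ℤ) + 1
  | .x _ n => n

/-- `(-1)^{parity}`: the `x^±(n)` are odd, all other generators are even. -/
def Gen.sign : Gen → ℂ
  | .x _ _ => -1
  | _ => 1

/-! ### Currents, in any algebra with a choice of elements for the generators -/

section Modes

variable {R : Type*} [Ring R] [Algebra ℂ R]

/-- `q^{nc/2}`. -/
def gamPow (e : Gen → R) : ℤ → R
  | .ofNat n => e .gam ^ n
  | .negSucc n => e .gamInv ^ (n + 1)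

/-- Coefficient of `t^n` in `exp A(t) = ∑ A(t)^r / r!`, for `A` without constant term. -/
def expCoeff (A : PowerSeries R) (n : ℕ) : R :=
  ∑ r ∈ Finset.range (n + 1), ((r.factorial : ℂ)⁻¹) • PowerSeries.coeff n (A ^ r)

/-- `∑_{m<0} ā(m) z^{-m}`, a power series in `z`. -/
def aSeries (e : Gen → R) : PowerSeries R :=
  PowerSeries.mk fun n => match n with
    | 0 => 0
    | n + 1 => e (.a n)

/-- `∑_{m>0} b̄(m) z^{-m}`, a power series in `z⁻¹`. -/
def bSeries (e : Gen → R) : PowerSeries R :=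
  PowerSeries.mk fun n => match n with
    | 0 => 0
    | n + 1 => e (.b n)

/-- `φ(m)`, where `φ(z) = ∑ φ(m) z^{-m} = exp(ā(0)) exp(∑_{m<0} ā(m) z^{-m})`. -/
def phi (e : Gen → R) (m : ℤ) : R :=
  if m ≤ 0 then e .k * expCoeff (aSeries e) m.natAbs else 0

/-- `ψ(m)`, where `ψ(z) = ∑ ψ(m) z^{-m} = exp(b̄(0)) exp(∑_{m>0} b̄(m) z^{-m})`. -/
def psi (e : Gen → R) (m : ℤ) : R :=
  if 0 ≤ m then e .kInv * expCoeff (bSeries e) m.natAbs else 0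

/-- Coefficient of `z^{-m}` in `φ(z)⁻¹ = exp(-∑_{m<0} ā(m) z^{-m}) exp(-ā(0))`. -/
def phiInv (e : Gen → R) (m : ℤ) : R :=
  if m ≤ 0 then expCoeff (-aSeries e) m.natAbs * e .kInv else 0

/-- Coefficient of `z^{-m}` in `ψ(z)⁻¹ = exp(-∑_{m>0} b̄(m) z^{-m}) exp(-b̄(0))`. -/
def psiInv (e : Gen → R) (m : ℤ) : R :=
  if 0 ≤ m then expCoeff (-bSeries e) m.natAbs * e .k else 0

end Modes

/-! ### Structure functions -/

/-- `p₁ = q²`. -/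
def p₁ (q : ℂ) : ℂ := q ^ 2

/-- `p₂ = q⁻¹`. -/
def p₂ (q : ℂ) : ℂ := q⁻¹

/-- Expansion around `0` of `g(z) = (z p₁ - 1)(z p₂ - 1) / ((z - p₁)(z - p₂))`. -/
def gSeries (q : ℂ) : PowerSeries ℂ :=
  (PowerSeries.C (p₁ q) * PowerSeries.X - 1) * (PowerSeries.C (p₂ q) * PowerSeries.X - 1) *
    ((PowerSeries.X - PowerSeries.C (p₁ q)) * (PowerSeries.X - PowerSeries.C (p₂ q)))⁻¹

/-- Coefficient of `z^k` in the expansion of `g(z)^{s}` around `0`, `s = ±1`. -/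
def gCoeff (q : ℂ) (s : ℤˣ) (k : ℕ) : ℂ :=
  PowerSeries.coeff k (if s = 1 then gSeries q else (gSeries q)⁻¹)

/-- Coefficient of `z^k` in the expansion of `g(z q^{-c}) / g(z q^{c})` around `0`. -/
def gRatio (q : ℂ) {R : Type*} [Ring R] [Algebra ℂ R] (e : Gen → R) (k : ℕ) : R :=
  ∑ ij ∈ Finset.HasAntidiagonal.antidiagonal k,
    (gCoeff q 1 ij.1 * gCoeff q (-1) ij.2) • gamPow e (2 * ((ij.2 : ℤ) - (ij.1 : ℤ)))

/-- Coefficients of `z²`, `zw`, `w²` in `w² G^s(z/w)`, where `g = G⁺/G⁻`,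
`G⁺(z) = (z p₁ - 1)(z p₂ - 1)` and `G⁻(z) = (z - p₁)(z - p₂)`. -/
def GCoeff (q : ℂ) (s : ℤˣ) : Fin 3 → ℂ :=
  if s = 1 then ![p₁ q * p₂ q, -(p₁ q + p₂ q), 1] else ![1, -(p₁ q + p₂ q), p₁ q * p₂ q]

/-- Coefficients of `z²`, `zw`, `w²` in `(z - p₁^s w)(z - p₂^s w)`. -/
def fCoeff (q : ℂ) (s : ℤˣ) : Fin 3 → ℂ :=
  ![1, -(p₁ q ^ (s : ℤ) + p₂ q ^ (s : ℤ)), p₁ q ^ (s : ℤ) * p₂ q ^ (s : ℤ)]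

/-! ### The algebra defined by all relations except the q-Serre relations -/

/-- The generators as elements of the free algebra. -/
abbrev fr : Gen → FreeAlgebra ℂ Gen := FreeAlgebra.ι ℂ

/-- The defining relations other than the q-Serre relations, mode by mode; `g` is everywhere
expanded around `0` (in `z/w` for `φ(z)`, in `w/z` for `ψ(z)`). -/
inductive Rel (q : ℂ) : FreeAlgebra ℂ Gen → FreeAlgebra ℂ Gen → Prop
  | gam_gamInv : Rel q (fr .gam * fr .gamInv) 1
  | gamInv_gam : Rel q (fr .gamInv * fr .gam) 1
  | k_kInv : Rel q (fr .k * fr .kInv) 1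
  | kInv_k : Rel q (fr .kInv * fr .k) 1
  /-- `c` is central -/
  | gam_central (y : Gen) : Rel q (fr .gam * fr y) (fr y * fr .gam)
  /-- `φ(z) φ(w) = φ(w) φ(z)` -/
  | phi_phi (m n : ℤ) : Rel q (phi fr m * phi fr n) (phi fr n * phi fr m)
  /-- `ψ(z) ψ(w) = ψ(w) ψ(z)` -/
  | psi_psi (m n : ℤ) : Rel q (psi fr m * psi fr n) (psi fr n * psi fr m)
  /-- `φ(z) ψ(w) = g(z/w q^{-c}) / g(z/w q^{c}) ψ(w) φ(z)` -/
  | phi_psi (m n : ℤ) : Rel q (phi fr m * psi fr n)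
      (∑ k ∈ Finset.range (m.natAbs + 1), gRatio q fr k * (psi fr (n - k) * phi fr (m + k)))
  /-- `φ(z) x^±(w) = g(z/w q^{∓c/2})^{±1} x^±(w) φ(z)` -/
  | phi_x (s : ℤˣ) (m n : ℤ) : Rel q (phi fr m * fr (.x s n))
      (∑ k ∈ Finset.range (m.natAbs + 1), gCoeff q s k •
        (gamPow fr (-(s : ℤ) * k) * (fr (.x s (n - k)) * phi fr (m + k))))
  /-- `ψ(z) x^±(w) = g(w/z q^{∓c/2})^{∓1} x^±(w) ψ(z)` -/
  | psi_x (s : ℤˣ) (m n : ℤ) : Rel q (psi fr m * fr (.x s n))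
      (∑ k ∈ Finset.range (m.natAbs + 1), gCoeff q (-s) k •
        (gamPow fr (-(s : ℤ) * k) * (fr (.x s (n + k)) * psi fr (m - k))))
  /-- `{x⁺(z), x⁻(w)} = (δ(z/w q^{-c}) ψ(w q^{c/2}) - δ(z/w q^{c}) φ(z q^{c/2})) / (q - q⁻¹)` -/
  | xp_xm (m n : ℤ) : Rel q
      (fr (.x 1 m) * fr (.x (-1) n) + fr (.x (-1) n) * fr (.x 1 m))
      ((q - q⁻¹)⁻¹ • (gamPow fr (m - n) * psi fr (m + n) - gamPow fr (n - m) * phi fr (m + n)))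
  /-- `G^∓(z/w) x^±(z) x^±(w) = - G^±(z/w) x^±(w) x^±(z)` -/
  | x_x (s : ℤˣ) (m n : ℤ) : Rel q
      (∑ i : Fin 3, GCoeff q (-s) i • (fr (.x s (m + 2 - (i : ℕ))) * fr (.x s (n + (i : ℕ)))))
      (-∑ i : Fin 3, GCoeff q s i • (fr (.x s (n + (i : ℕ))) * fr (.x s (m + 2 - (i : ℕ)))))

/-- The algebra with the relations `Rel`. -/
def PreU (q : ℂ) : Type := RingQuot (Rel q)

instance (q : ℂ) : Ring (PreU q) := inferInstanceAs (Ring (RingQuot (Rel q)))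
instance (q : ℂ) : Algebra ℂ (PreU q) := inferInstanceAs (Algebra ℂ (RingQuot (Rel q)))

/-- The projection from the free algebra. -/
def PreU.mk (q : ℂ) : FreeAlgebra ℂ Gen →ₐ[ℂ] PreU q := RingQuot.mkAlgHom ℂ (Rel q)

/-- The generators in `PreU q`. -/
def PreU.gen (q : ℂ) (y : Gen) : PreU q := PreU.mk q (fr y)

theorem PreU.mk_surjective (q : ℂ) : Function.Surjective (PreU.mk q) :=
  RingQuot.mkAlgHom_surjective ℂ (Rel q)

/-! ### Topology: products of generators of large weight, on the right, are small -/

/-- The left ideal generated by the words of weight at least `N`. -/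
def smallIdeal (q : ℂ) (N : ℤ) : Ideal (PreU q) :=
  Ideal.span {u | ∃ w : List Gen, N ≤ (w.map Gen.weight).sum ∧ u = (w.map (PreU.gen q)).prod}

theorem smallIdeal_anti (q : ℂ) {M N : ℤ} (h : M ≤ N) : smallIdeal q N ≤ smallIdeal q M :=
  Ideal.span_mono fun _ ⟨w, hw, hu⟩ => ⟨w, h.trans hw, hu⟩

theorem smallIdeal_mul (q : ℂ) (v : PreU q) :
    ∀ N : ℤ, ∃ M : ℤ, ∀ u ∈ smallIdeal q M, u * v ∈ smallIdeal q N := by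
  obtain ⟨v, rfl⟩ := PreU.mk_surjective q v
  induction v using FreeAlgebra.induction with
  | grade0 r =>
    intro N
    refine ⟨N, fun u hu => ?_⟩
    rw [AlgHom.commutes, ← Algebra.commutes]
    exact Ideal.mul_mem_left _ _ hu
  | grade1 y =>
    intro N
    refine ⟨N - y.weight, fun u hu => ?_⟩
    refine Submodule.span_induction (p := fun u _ => u * PreU.mk q (fr y) ∈ smallIdeal q N)
      ?_ ?_ ?_ ?_ hu
    · rintro _ ⟨w, hw, rfl⟩
      refine Ideal.subset_span ⟨w ++ [y], ?_, ?_⟩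
      · simp only [List.map_append, List.sum_append, List.map_cons, List.map_nil, List.sum_cons,
          List.sum_nil]
        linarith
      · simp [PreU.gen]
    · simp
    · intro a b _ _ ha hb
      rw [add_mul]
      exact add_mem ha hb
    · intro c a _ ha
      rw [smul_eq_mul, mul_assoc]
      exact Ideal.mul_mem_left _ _ ha
  | mul a b ha hb =>
    intro N
    obtain ⟨M, hM⟩ := hb N
    obtain ⟨L, hL⟩ := ha M
    refine ⟨L, fun u hu => ?_⟩
    rw [map_mul, ← mul_assoc]
    exact hM _ (hL _ hu)
  | add a b ha hb =>
    intro N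
    obtain ⟨M, hM⟩ := hb N
    obtain ⟨L, hL⟩ := ha N
    refine ⟨max M L, fun u hu => ?_⟩
    rw [map_add, mul_add]
    exact add_mem (hL _ (smallIdeal_anti q (le_max_right _ _) hu))
      (hM _ (smallIdeal_anti q (le_max_left _ _) hu))

theorem smallBasis (q : ℂ) :
    RingSubgroupsBasis fun N : ℤ => (smallIdeal q N).toAddSubgroup where
  inter i j := ⟨max i j, le_inf (smallIdeal_anti q (le_max_left _ _))
    (smallIdeal_anti q (le_max_right _ _))⟩
  mul i := ⟨i, by
    rintro _ ⟨a, _, b, hb, rfl⟩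
    exact Ideal.mul_mem_left _ _ hb⟩
  leftMul x i := ⟨i, fun _ hb => Ideal.mul_mem_left _ _ hb⟩
  rightMul x i := by
    obtain ⟨M, hM⟩ := smallIdeal_mul q x i
    exact ⟨M, fun u hu => hM u hu⟩

/-- The topology of `PreU q`: the left ideals `smallIdeal q N` form a basis of neighbourhoods
of `0`.  (It is installed together with its uniform structure.) -/
@[reducible]
def PreU.topology (q : ℂ) : TopologicalSpace (PreU q) := (smallBasis q).topology

theorem PreU.topology_isTopologicalRing (q : ℂ) :
    @IsTopologicalRing (PreU q) (PreU.topology q) _ :=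
  (smallBasis q).toRingFilterBasis.isTopologicalRing

instance (q : ℂ) : UniformSpace (PreU q) :=
  letI := PreU.topology q
  haveI := PreU.topology_isTopologicalRing q
  IsTopologicalAddGroup.rightUniformSpace (PreU q)

instance (q : ℂ) : IsTopologicalRing (PreU q) := PreU.topology_isTopologicalRing q

theorem PreU.hasBasis_nhds_zero (q : ℂ) :
    (nhds (0 : PreU q)).HasBasis (fun _ : ℤ => True) fun N => (smallIdeal q N : Set (PreU q)) :=
  (smallBasis q).hasBasis_nhds_zero

instance (q : ℂ) : IsUniformAddGroup (PreU q) := isUniformAddGroup_of_addCommGroup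

instance (q : ℂ) : ContinuousConstSMul ℂ (PreU q) where
  continuous_const_smul c := by
    simp only [Algebra.smul_def]
    exact continuous_const_mul _

instance (q : ℂ) : UniformContinuousConstSMul ℂ (PreU q) :=
  uniformContinuousConstSMul_of_continuousConstSMul ℂ (PreU q)

/-- The completion of `PreU q`. -/
abbrev PreUHat (q : ℂ) : Type := UniformSpace.Completion (PreU q)


/-- The generators in `PreUHat q`. -/
def hatGen (q : ℂ) (y : Gen) : PreUHat q := ((PreU.gen q y : PreU q) : PreUHat q)

/-! ### The q-Serre relations -/

/-- Coefficient of `z₁^{-a} z₂^{-b} z₃^{-c}` in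
`∏_{i<j} (z_i - p₁^s z_j)(z_i - p₂^s z_j) x^s(z₁) x^s(z₂) x^s(z₃)`. -/
def tripleCoeff (q : ℂ) (s : ℤˣ) (a b c : ℤ) : PreUHat q :=
  ∑ i : Fin 3, ∑ j : Fin 3, ∑ k : Fin 3, (fCoeff q s i * fCoeff q s j * fCoeff q s k) •
    (hatGen q (.x s (a + 4 - (i : ℕ) - (j : ℕ))) * hatGen q (.x s (b + (i : ℕ) + 2 - (k : ℕ))) *
      hatGen q (.x s (c + (j : ℕ) + (k : ℕ))))

/-- `Y a b c` is the coefficient of `z₁^{-a} z₂^{-b} z₃^{-c}` in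
`Y^s(z₁,z₂,z₃) = ∏_{i<j} (z_i - p₁^s z_j)(z_i - p₂^s z_j)/(z_i - z_j) x^s(z₁) x^s(z₂) x^s(z₃)`,
with `1/(z_i - z_j) = ∑_{r ≥ 0} z_i^{-r-1} z_j^r` for `i < j`.  The summation index is
`(r₁₂, r₁₃, r₂₃)`. -/
def IsYCoeff (q : ℂ) (s : ℤˣ) (Y : ℤ → ℤ → ℤ → PreUHat q) : Prop :=
  ∀ a b c : ℤ, HasSum
    (fun r : ℕ × ℕ × ℕ => tripleCoeff q s (a - r.1 - r.2.1 - 2) (b + r.1 - r.2.2 - 1)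
      (c + r.2.1 + r.2.2)) (Y a b c)

/-- `z` is the coefficient of `u^{-n}` in the restriction of `Y(z₁,z₂,z₃)` to the line
`z₁ = z₂ q^{-s} = z₃ q^{-2s} = u`. -/
def IsLineCoeff (q : ℂ) (s : ℤˣ) (Y : ℤ → ℤ → ℤ → PreUHat q) (n : ℤ) (z : PreUHat q) : Prop :=
  HasSum (fun bc : ℤ × ℤ =>
    q ^ (-(s : ℤ) * (bc.1 + 2 * bc.2)) • Y (n - bc.1 - bc.2) bc.1 bc.2) z

/-- All coefficients of the restrictions of `Y^±(z₁,z₂,z₃)` to the lines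
`z₁ = z₂ q^{∓1} = z₃ q^{∓2}`. -/
def serreSet (q : ℂ) : Set (PreUHat q) :=
  {z | ∃ (s : ℤˣ) (Y : ℤ → ℤ → ℤ → PreUHat q) (n : ℤ), IsYCoeff q s Y ∧ IsLineCoeff q s Y n z}

/-- The closed two-sided ideal generated by the q-Serre relations. -/
def serreIdeal (q : ℂ) : Ideal (PreUHat q) :=
  (Ideal.span {y | ∃ z ∈ serreSet q, ∃ v, y = z * v}).closure

instance (q : ℂ) : (serreIdeal q).IsTwoSided where
  mul_mem_of_left {a} b ha := by
    refine map_mem_closure (f := fun a => a * b) (continuous_mul_const b) ha fun u hu => ?_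
    refine Submodule.span_induction (p := fun u _ => u * b ∈
      Ideal.span {y | ∃ z ∈ serreSet q, ∃ v, y = z * v}) ?_ ?_ ?_ ?_ hu
    · rintro _ ⟨z, hz, v, rfl⟩
      exact Ideal.subset_span ⟨z, hz, v * b, mul_assoc _ _ _⟩
    · simp
    · intro x y _ _ hx hy
      rw [add_mul]
      exact add_mem hx hy
    · intro c x _ hx
      rw [smul_eq_mul, mul_assoc]
      exact Ideal.mul_mem_left _ _ hx

/-! ### The algebra and its completion -/

/-- The completed algebra: `PreUHat q` modulo the q-Serre relations. -/
def UHat (q : ℂ) : Type := PreUHat q ⧸ serreIdeal q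

instance (q : ℂ) : Ring (UHat q) := inferInstanceAs (Ring (PreUHat q ⧸ serreIdeal q))
instance (q : ℂ) : Algebra ℂ (UHat q) := inferInstanceAs (Algebra ℂ (PreUHat q ⧸ serreIdeal q))

/-- The projection. -/
def UHat.mk (q : ℂ) : PreUHat q →ₐ[ℂ] UHat q := Ideal.Quotient.mkₐ ℂ (serreIdeal q)

/-- The quotient topology. -/
instance (q : ℂ) : TopologicalSpace (UHat q) :=
  TopologicalSpace.coinduced (UHat.mk q) inferInstance

/-- The inclusion of a topological algebra in its completion, for `PreU q`. -/
def PreU.coe (q : ℂ) : PreU q →ₐ[ℂ] PreUHat q :=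
  { UniformSpace.Completion.coeRingHom with commutes' := fun _ => rfl }

/-- The map from `PreU q` to the completed quotient. -/
def PreU.toUHat (q : ℂ) : PreU q →ₐ[ℂ] UHat q := (UHat.mk q).comp (PreU.coe q)

/-- The algebra `U_q(g, s̄)`: the subalgebra of the completed quotient generated by the modes. -/
def U (q : ℂ) : Subalgebra ℂ (UHat q) := (PreU.toUHat q).range

/-- The generators of `U_q(g, s̄)`. -/
def gen (q : ℂ) (y : Gen) : U q := (PreU.toUHat q).rangeRestrict (PreU.gen q y)

/-- The span of the words of weight `n` in the generators. -/
def weightSpace (q : ℂ) (n : ℤ) : Submodule ℂ (U q) :=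
  Submodule.span ℂ {u | ∃ w : List Gen, (w.map Gen.weight).sum = n ∧ u = (w.map (gen q)).prod}

/-! ### The parity automorphism and the `ℤ/2`-grading -/

section Naturality

variable {R S : Type*} [Ring R] [Algebra ℂ R] [Ring S] [Algebra ℂ S]

theorem map_gamPow (f : R →ₐ[ℂ] S) (e : Gen → R) (n : ℤ) :
    f (gamPow e n) = gamPow (fun y => f (e y)) n := by
  cases n <;> simp [gamPow]

theorem map_expCoeff (f : R →ₐ[ℂ] S) (A : PowerSeries R) (n : ℕ) :
    f (expCoeff A n) = expCoeff (PowerSeries.map (f : R →+* S) A) n := by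
  simp [expCoeff, map_sum, ← map_pow, PowerSeries.coeff_map]

theorem map_aSeries (f : R →ₐ[ℂ] S) (e : Gen → R) :
    PowerSeries.map (f : R →+* S) (aSeries e) = aSeries fun y => f (e y) := by
  ext n
  cases n <;> simp [aSeries]

theorem map_bSeries (f : R →ₐ[ℂ] S) (e : Gen → R) :
    PowerSeries.map (f : R →+* S) (bSeries e) = bSeries fun y => f (e y) := by
  ext n
  cases n <;> simp [bSeries]

theorem map_phi (f : R →ₐ[ℂ] S) (e : Gen → R) (m : ℤ) :
    f (phi e m) = phi (fun y => f (e y)) m := by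
  unfold phi
  split_ifs <;> simp [map_expCoeff, map_aSeries]

theorem map_psi (f : R →ₐ[ℂ] S) (e : Gen → R) (m : ℤ) :
    f (psi e m) = psi (fun y => f (e y)) m := by
  unfold psi
  split_ifs <;> simp [map_expCoeff, map_bSeries]

end Naturality

/-- The parity automorphism of the free algebra, with values in `PreU q`. -/
def freeParity (q : ℂ) : FreeAlgebra ℂ Gen →ₐ[ℂ] PreU q :=
  FreeAlgebra.lift ℂ fun y => y.sign • PreU.gen q y

theorem freeParity_fr (q : ℂ) (y : Gen) : freeParity q (fr y) = y.sign • PreU.mk q (fr y) := by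
  simp [freeParity, PreU.gen]

theorem freeParity_gamPow (q : ℂ) (n : ℤ) :
    freeParity q (gamPow fr n) = PreU.mk q (gamPow fr n) := by
  cases n <;> simp [gamPow, freeParity_fr, Gen.sign]

theorem freeParity_phi (q : ℂ) (m : ℤ) : freeParity q (phi fr m) = PreU.mk q (phi fr m) := by
  rw [map_phi, map_phi]
  have : aSeries (fun y => freeParity q (fr y)) = aSeries fun y => PreU.mk q (fr y) := by
    ext n
    cases n <;> simp [aSeries, freeParity_fr, Gen.sign]
  simp only [phi, this]
  simp [freeParity_fr, Gen.sign]

theorem freeParity_psi (q : ℂ) (m : ℤ) : freeParity q (psi fr m) = PreU.mk q (psi fr m) := by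
  rw [map_psi, map_psi]
  have : bSeries (fun y => freeParity q (fr y)) = bSeries fun y => PreU.mk q (fr y) := by
    ext n
    cases n <;> simp [bSeries, freeParity_fr, Gen.sign]
  simp only [psi, this]
  simp [freeParity_fr, Gen.sign]

theorem freeParity_gRatio (q : ℂ) (k : ℕ) :
    freeParity q (gRatio q fr k) = PreU.mk q (gRatio q fr k) := by
  simp [gRatio, freeParity_gamPow]

theorem PreU.mk_rel (q : ℂ) {a b : FreeAlgebra ℂ Gen} (h : Rel q a b) :
    PreU.mk q a = PreU.mk q b :=
  RingQuot.mkAlgHom_rel ℂ h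

theorem freeParity_rel (q : ℂ) {a b : FreeAlgebra ℂ Gen} (h : Rel q a b) :
    freeParity q a = freeParity q b := by
  have h' := PreU.mk_rel q h
  cases h with
  | gam_central y =>
    simp only [map_mul, freeParity_fr] at h' ⊢
    simp only [smul_mul_assoc, mul_smul_comm, h', smul_smul, mul_comm]
  | phi_x s m n =>
    simp only [map_mul, map_sum, map_smul, freeParity_fr, freeParity_phi, freeParity_gamPow,
      Gen.sign, mul_smul_comm, smul_mul_assoc] at h' ⊢
    simp only [h', Finset.smul_sum, smul_comm (-1 : ℂ)]
  | psi_x s m n =>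
    simp only [map_mul, map_sum, map_smul, freeParity_fr, freeParity_psi, freeParity_gamPow,
      Gen.sign, mul_smul_comm, smul_mul_assoc] at h' ⊢
    simp only [h', Finset.smul_sum, smul_comm (-1 : ℂ)]
  | _ =>
    simpa [freeParity_fr, freeParity_phi, freeParity_psi, freeParity_gamPow, freeParity_gRatio,
      Gen.sign] using h'

/-- The parity automorphism of `PreU q`: `x^±(n) ↦ -x^±(n)`, all other generators are fixed. -/
def PreU.parity (q : ℂ) : PreU q →ₐ[ℂ] PreU q :=
  RingQuot.liftAlgHom ℂ ⟨freeParity q, fun _ _ h => freeParity_rel q h⟩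

theorem PreU.parity_mk (q : ℂ) (a : FreeAlgebra ℂ Gen) :
    PreU.parity q (PreU.mk q a) = freeParity q a :=
  RingQuot.liftAlgHom_mkAlgHom_apply ℂ (freeParity q) _ a

theorem PreU.parity_gen (q : ℂ) (y : Gen) : PreU.parity q (PreU.gen q y) = y.sign • PreU.gen q y := by
  rw [PreU.gen, PreU.parity_mk, freeParity_fr]

theorem Gen.sign_mul_self (y : Gen) : y.sign * y.sign = 1 := by
  cases y <;> simp [Gen.sign]

theorem PreU.parity_parity (q : ℂ) (u : PreU q) : PreU.parity q (PreU.parity q u) = u := by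
  obtain ⟨a, rfl⟩ := PreU.mk_surjective q u
  have : ((PreU.parity q).comp (PreU.parity q)).comp (PreU.mk q) = PreU.mk q := by
    ext y
    have := PreU.parity_gen q y
    simp only [PreU.gen] at this
    simp [this, smul_smul, Gen.sign_mul_self]
  exact DFunLike.congr_fun this a

theorem PreU.parity_word (q : ℂ) (w : List Gen) :
    PreU.parity q ((w.map (PreU.gen q)).prod) =
      (w.map Gen.sign).prod • (w.map (PreU.gen q)).prod := by
  induction w with
  | nil => simp
  | cons y w ih =>
    simp only [List.map_cons, List.prod_cons, map_mul, ih, PreU.parity_gen, smul_mul_assoc,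
      mul_smul_comm, smul_smul]
    rw [mul_comm]

theorem PreU.parity_small (q : ℂ) (N : ℤ) {u : PreU q} (hu : u ∈ smallIdeal q N) :
    PreU.parity q u ∈ smallIdeal q N := by
  refine Submodule.span_induction (p := fun u _ => PreU.parity q u ∈ smallIdeal q N)
    ?_ ?_ ?_ ?_ hu
  · rintro _ ⟨w, hw, rfl⟩
    rw [PreU.parity_word, Algebra.smul_def]
    exact Ideal.mul_mem_left _ _ (Ideal.subset_span ⟨w, hw, rfl⟩)
  · simp
  · intro x y _ _ hx hy
    rw [map_add]
    exact add_mem hx hy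
  · intro c x _ hx
    rw [smul_eq_mul, map_mul]
    exact Ideal.mul_mem_left _ _ hx

theorem PreU.continuous_parity (q : ℂ) : Continuous (PreU.parity q) := by
  refine continuous_of_continuousAt_zero (PreU.parity q) ?_
  have hb := PreU.hasBasis_nhds_zero q
  rw [ContinuousAt, map_zero]
  exact (hb.tendsto_iff hb).2 fun N _ => ⟨N, trivial, fun u hu => PreU.parity_small q N hu⟩

/-- The parity automorphism of the completion of `PreU q`. -/
def PreUHat.parity (q : ℂ) : PreUHat q →ₐ[ℂ] PreUHat q :=
  { UniformSpace.Completion.mapRingHom (PreU.parity q : PreU q →+* PreU q)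
      (PreU.continuous_parity q) with
    commutes' := fun r => by
      refine (UniformSpace.Completion.mapRingHom_coe (f := (PreU.parity q : PreU q →+* PreU q))
        (PreU.continuous_parity q) (algebraMap ℂ (PreU q) r)).trans ?_
      exact congrArg _ (AlgHom.commutes (PreU.parity q) r) }

theorem PreUHat.parity_coe (q : ℂ) (u : PreU q) :
    PreUHat.parity q (u : PreUHat q) = ((PreU.parity q u : PreU q) : PreUHat q) :=
  UniformSpace.Completion.mapRingHom_coe (PreU.continuous_parity q) u

theorem PreUHat.continuous_parity (q : ℂ) : Continuous (PreUHat.parity q) :=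
  UniformSpace.Completion.continuous_map

theorem PreUHat.parity_hatGen_x (q : ℂ) (s : ℤˣ) (n : ℤ) :
    PreUHat.parity q (hatGen q (.x s n)) = -hatGen q (.x s n) := by
  rw [hatGen, PreUHat.parity_coe, PreU.parity_gen, Gen.sign, neg_one_smul,
    UniformSpace.Completion.coe_neg]

theorem PreUHat.parity_tripleCoeff (q : ℂ) (s : ℤˣ) (a b c : ℤ) :
    PreUHat.parity q (tripleCoeff q s a b c) = -tripleCoeff q s a b c := by
  simp [tripleCoeff, PreUHat.parity_hatGen_x, Finset.sum_neg_distrib]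

theorem PreUHat.parity_serreSet (q : ℂ) {z : PreUHat q} (hz : z ∈ serreSet q) :
    PreUHat.parity q z = -z := by
  obtain ⟨s, Y, n, hY, hz⟩ := hz
  have hY' : ∀ a b c, PreUHat.parity q (Y a b c) = -Y a b c := fun a b c => by
    have h := (hY a b c).map (PreUHat.parity q) (PreUHat.continuous_parity q)
    refine h.unique ?_
    have h2 := (hY a b c).neg
    refine (congrArg (fun f => HasSum f (-Y a b c)) ?_).mpr h2
    funext r
    exact PreUHat.parity_tripleCoeff q s _ _ _
  have h := hz.map (PreUHat.parity q) (PreUHat.continuous_parity q)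
  refine h.unique ?_
  refine (congrArg (fun f => HasSum f (-z)) ?_).mpr hz.neg
  funext r
  simp only [Function.comp_apply, map_smul, hY', smul_neg]

theorem PreUHat.parity_serreIdeal (q : ℂ) {z : PreUHat q} (hz : z ∈ serreIdeal q) :
    PreUHat.parity q z ∈ serreIdeal q := by
  refine map_mem_closure (PreUHat.continuous_parity q) hz fun u hu => ?_
  refine Submodule.span_induction (p := fun u _ => PreUHat.parity q u ∈
    Ideal.span {y | ∃ z ∈ serreSet q, ∃ v, y = z * v}) ?_ ?_ ?_ ?_ hu
  · rintro _ ⟨z, hz, v, rfl⟩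
    refine Ideal.subset_span ⟨z, hz, -PreUHat.parity q v, ?_⟩
    rw [map_mul, PreUHat.parity_serreSet q hz]
    simp
  · simp
  · intro x y _ _ hx hy
    rw [map_add]
    exact add_mem hx hy
  · intro c x _ hx
    rw [smul_eq_mul, map_mul]
    exact Ideal.mul_mem_left _ _ hx

/-- The parity automorphism of the completed algebra. -/
def UHat.parity (q : ℂ) : UHat q →ₐ[ℂ] UHat q :=
  Ideal.Quotient.liftₐ (serreIdeal q) ((UHat.mk q).comp (PreUHat.parity q)) fun _ hz =>
    Ideal.Quotient.eq_zero_iff_mem.2 (PreUHat.parity_serreIdeal q hz)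

theorem UHat.parity_toUHat (q : ℂ) (u : PreU q) :
    UHat.parity q (PreU.toUHat q u) = PreU.toUHat q (PreU.parity q u) :=
  congrArg (UHat.mk q) (PreUHat.parity_coe q u)

/-- The parity automorphism of `U_q(g, s̄)`. -/
def parity (q : ℂ) : U q →ₐ[ℂ] U q :=
  ((UHat.parity q).comp (U q).val).codRestrict (U q) (by
    rintro ⟨_, u, rfl⟩
    exact ⟨PreU.parity q u, (UHat.parity_toUHat q u).symm⟩)

theorem parity_gen (q : ℂ) (y : Gen) : parity q (gen q y) = y.sign • gen q y := by
  refine Subtype.ext ((UHat.parity_toUHat q (PreU.gen q y)).trans ?_)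
  rw [PreU.parity_gen, map_smul]
  rfl

theorem parity_parity (q : ℂ) (u : U q) : parity q (parity q u) = u := by
  obtain ⟨_, u, rfl⟩ := u
  refine Subtype.ext ?_
  have h : UHat.parity q (UHat.parity q (PreU.toUHat q u)) = PreU.toUHat q u := by
    rw [UHat.parity_toUHat, UHat.parity_toUHat, PreU.parity_parity]
  exact h

/-- The even part (`i = 0`) and the odd part (`i = 1`) of `U_q(g, s̄)`. -/
def parityPart (q : ℂ) (i : ZMod 2) : Submodule ℂ (U q) :=
  LinearMap.eqLocus (parity q).toLinearMap (((-1 : ℂ) ^ i.val) • LinearMap.id)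

theorem mem_parityPart (q : ℂ) (i : ZMod 2) (u : U q) :
    u ∈ parityPart q i ↔ parity q u = (-1 : ℂ) ^ i.val • u := Iff.rfl

instance (q : ℂ) : SetLike.GradedMonoid (parityPart q) where
  one_mem := by simp [mem_parityPart]
  mul_mem i j u v hu hv := by
    rw [mem_parityPart] at *
    rw [map_mul, hu, hv]
    simp only [smul_mul_assoc, mul_smul_comm, smul_smul]
    congr 1
    rw [← pow_add, ZMod.val_add, ← neg_one_pow_eq_pow_mod_two, add_comm]

/-- The even and odd components of an element. -/
def parityComponent (q : ℂ) (i : ZMod 2) : U q →ₗ[ℂ] parityPart q i :=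
  LinearMap.codRestrict (parityPart q i)
    ((2⁻¹ : ℂ) • (LinearMap.id + ((-1 : ℂ) ^ i.val) • (parity q).toLinearMap)) (fun u => by
      rw [mem_parityPart]
      have : ((-1 : ℂ) ^ i.val) * ((-1 : ℂ) ^ i.val) = 1 := by
        rw [← mul_pow]; simp
      simp only [LinearMap.smul_apply, LinearMap.add_apply, LinearMap.id_apply,
        AlgHom.toLinearMap_apply, map_smul, map_add, parity_parity, smul_add, smul_smul]
      rw [mul_left_comm, this, add_comm, mul_comm, mul_one])

theorem parityComponent_apply (q : ℂ) (i : ZMod 2) (u : U q) :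
    (parityComponent q i u : U q) = (2⁻¹ : ℂ) • (u + (-1 : ℂ) ^ i.val • parity q u) := rfl

theorem parityComponent_self (q : ℂ) (i : ZMod 2) (u : parityPart q i) :
    parityComponent q i u = u := by
  refine Subtype.ext ?_
  rw [parityComponent_apply, (mem_parityPart q i u).1 u.2, smul_smul, ← mul_pow]
  rw [neg_one_mul, neg_neg, one_pow, one_smul, ← two_smul ℂ (u : U q), smul_smul]
  norm_num

theorem parityComponent_ne (q : ℂ) (i j : ZMod 2) (h : i ≠ j) (u : parityPart q j) :
    parityComponent q i u = 0 := by
  refine Subtype.ext ?_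
  rw [parityComponent_apply, (mem_parityPart q j u).1 u.2, smul_smul, ← pow_add]
  have : (-1 : ℂ) ^ (i.val + j.val) = -1 := by
    have h1 : ∀ i j : ZMod 2, i ≠ j → i.val + j.val = 1 := by decide
    rw [h1 i j h, pow_one]
  rw [this]
  simp

instance (q : ℂ) : DirectSum.Decomposition (parityPart q) where
  decompose' u := ∑ i : ZMod 2, DirectSum.of (fun i => parityPart q i) i (parityComponent q i u)
  left_inv u := by
    rw [map_sum]
    simp only [DirectSum.coeAddMonoidHom_of, parityComponent_apply]
    change ∑ i : Fin 2, (2⁻¹ : ℂ) • (u + (-1 : ℂ) ^ (ZMod.val (n := 2) i) • parity q u) = u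
    rw [Fin.sum_univ_two]
    simp only [ZMod.val, Fin.val_zero, Fin.val_one, pow_zero, pow_one, one_smul, neg_smul,
      ← smul_add]
    rw [add_add_add_comm, add_neg_cancel, add_zero, ← two_smul ℂ u, smul_smul]
    norm_num
  right_inv u := by
    induction u using DirectSum.induction_on with
    | zero => simp
    | of i x =>
      rw [DirectSum.coeAddMonoidHom_of]
      beta_reduce
      rw [Finset.sum_eq_single i]
      · rw [parityComponent_self]
      · intro j _ hj
        rw [parityComponent_ne q j i hj, map_zero]
      · simp
    | add x y hx hy =>
      rw [map_add]
      simp only [map_add, Finset.sum_add_distrib] at hx hy ⊢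
      rw [hx, hy]

instance (q : ℂ) : GradedAlgebra (parityPart q) where

/-! ### Completed tensor square -/

/-- The tensor square, with multiplication
`(a ⊗ b)(c ⊗ d) = (-1)^{[b][c]} ac ⊗ bd` on homogeneous elements. -/
abbrev TensorSq (q : ℂ) : Type := parityPart q ᵍ⊗[ℂ] parityPart q

/-- Formal sums `∑_n t_n` of elements of the tensor square, `n ∈ ℤ`, with `t_n = 0` for `n ≪ 0`.
The exponent is a label that will be the weight of the second tensor factor
(see `completedTensor`). -/
abbrev FormalTensor (q : ℂ) : Type := HahnSeries ℤ (TensorSq q)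

/-- The completed tensor square: formal sums `∑_n t_n` such that the second tensor factor of `t_n`
has weight `n`, and `t_n = 0` for `n ≪ 0`. -/
def completedTensor (q : ℂ) : Submodule ℂ (FormalTensor q) where
  carrier := {t | ∀ n : ℤ, (GradedTensorProduct.of ℂ (parityPart q) (parityPart q)).symm (t.coeff n) ∈
    LinearMap.range (TensorProduct.map (LinearMap.id : U q →ₗ[ℂ] U q) (weightSpace q n).subtype)}
  add_mem' hs ht n := by
    rw [HahnSeries.coeff_add, map_add]
    exact add_mem (hs n) (ht n)
  zero_mem' n := by
    rw [HahnSeries.coeff_zero, map_zero]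
    exact zero_mem _
  smul_mem' c t ht n := by
    rw [HahnSeries.coeff_smul, map_smul]
    exact Submodule.smul_mem _ c (ht n)

/-- The component `Δ_n(u)` of `Δ(u) = ∑_n Δ_n(u)` whose second tensor factor has weight `n`. -/
def component {q : ℂ} (Δ : U q →ₐ[ℂ] FormalTensor q) (n : ℤ) : U q →ₗ[ℂ] U q ⊗[ℂ] U q where
  toFun u := (GradedTensorProduct.of ℂ (parityPart q) (parityPart q)).symm ((Δ u).coeff n)
  map_add' u v := by rw [map_add, HahnSeries.coeff_add, map_add]
  map_smul' c u := by rw [map_smul, HahnSeries.coeff_smul, map_smul, RingHom.id_apply]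

/-- The inclusion of `U_q(g, s̄)` in its completion. -/
def incl (q : ℂ) : U q →ₗ[ℂ] UHat q := (U q).val.toLinearMap

/-- `u ⊗ v ↦ f(u) h(v)`. -/
def mulMap {q : ℂ} (f h : U q →ₗ[ℂ] UHat q) : U q ⊗[ℂ] U q →ₗ[ℂ] UHat q :=
  (LinearMap.mul' ℂ (UHat q)).comp (TensorProduct.map f h)

/-- `Δ`, `ε`, `S` make `U_q(g, s̄)` a (topological) Hopf superalgebra: `Δ` takes values in the
completed tensor square, `S` takes values in the completion.  That `Δ` and `ε` are homomorphisms of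
algebras is part of their types. -/
structure IsHopfSuperalgebra (q : ℂ) (Δ : U q →ₐ[ℂ] FormalTensor q) (ε : U q →ₐ[ℂ] ℂ)
    (S : U q →ₗ[ℂ] UHat q) : Prop where
  comul_mem : ∀ u, Δ u ∈ completedTensor q
  comul_even : ∀ n u, TensorProduct.map (parity q).toLinearMap (parity q).toLinearMap
    (component Δ n u) = component Δ n (parity q u)
  counit_even : ∀ u, ε (parity q u) = ε u
  antipode_even : ∀ u, UHat.parity q (S u) = S (parity q u)
  /-- `(Δ ⊗ id) Δ = (id ⊗ Δ) Δ`, in the component of weight `m` in the second and weight `n` in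
  the third tensor factor -/
  coassoc : ∀ m n u, TensorProduct.assoc ℂ (U q) (U q) (U q)
      (TensorProduct.map (component Δ m) LinearMap.id (component Δ n u)) =
    TensorProduct.map LinearMap.id (component Δ n) (component Δ (m + n) u)
  /-- `(ε ⊗ id) Δ = id` -/
  counit_comul : ∀ u, HasSum (fun n : ℤ => incl q
    (TensorProduct.lid ℂ (U q) (TensorProduct.map ε.toLinearMap LinearMap.id (component Δ n u))))
    (incl q u)
  /-- `(id ⊗ ε) Δ = id` -/
  comul_counit : ∀ u, HasSum (fun n : ℤ => incl q
    (TensorProduct.rid ℂ (U q) (TensorProduct.map LinearMap.id ε.toLinearMap (component Δ n u))))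
    (incl q u)
  /-- `S(uv) = (-1)^{[u][v]} S(v) S(u)` -/
  antipode_mul : ∀ i j : ZMod 2, ∀ u ∈ parityPart q i, ∀ v ∈ parityPart q j,
    S (u * v) = (-1 : ℂ) ^ (i.val * j.val) • (S v * S u)
  /-- `m (S ⊗ id) Δ = ε` -/
  antipode_left : ∀ u, HasSum (fun n : ℤ => mulMap S (incl q) (component Δ n u))
    (algebraMap ℂ (UHat q) (ε u))
  /-- `m (id ⊗ S) Δ = ε` -/
  antipode_right : ∀ u, HasSum (fun n : ℤ => mulMap (incl q) S (component Δ n u))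
    (algebraMap ℂ (UHat q) (ε u))

/-- The formulas for the coproduct, the counit and the antipode, mode by mode
(`c₁ = c ⊗ 1`, `c₂ = 1 ⊗ c`; `coeff j` is the component of weight `j` in the second factor). -/
structure HasDrinfeldFormulas (q : ℂ) (Δ : U q →ₐ[ℂ] FormalTensor q) (ε : U q →ₐ[ℂ] ℂ)
    (S : U q →ₗ[ℂ] UHat q) : Prop where
  /-- `Δ(q^{c/2}) = q^{c/2} ⊗ q^{c/2}` -/
  comul_gam : ∀ j, (Δ (gen q .gam)).coeff j =
    if j = 0 then gen q .gam ᵍ⊗ₜ[ℂ] gen q .gam else 0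
  /-- `Δ(x⁺(z)) = x⁺(z) ⊗ 1 + φ(z q^{c₁/2}) ⊗ x⁺(z q^{c₁})` -/
  comul_x_pos : ∀ n j, (Δ (gen q (.x 1 n))).coeff j =
    (if j = 0 then gen q (.x 1 n) ᵍ⊗ₜ[ℂ] 1 else 0) +
      (phi (gen q) (n - j) * gamPow (gen q) (-(n + j))) ᵍ⊗ₜ[ℂ] gen q (.x 1 j)
  /-- `Δ(x⁻(z)) = 1 ⊗ x⁻(z) + x⁻(z q^{c₂}) ⊗ ψ(z q^{c₂/2})` -/
  comul_x_neg : ∀ n j, (Δ (gen q (.x (-1) n))).coeff j =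
    (if j = n then 1 ᵍ⊗ₜ[ℂ] gen q (.x (-1) n) else 0) +
      gen q (.x (-1) (n - j)) ᵍ⊗ₜ[ℂ] (psi (gen q) j * gamPow (gen q) (j - 2 * n))
  /-- `Δ(φ(z)) = φ(z q^{-c₂/2}) ⊗ φ(z q^{c₁/2})` -/
  comul_phi : ∀ n j, (Δ (phi (gen q) n)).coeff j =
    (phi (gen q) (n - j) * gamPow (gen q) (-j)) ᵍ⊗ₜ[ℂ]
      (gamPow (gen q) (n - j) * phi (gen q) j)
  /-- `Δ(ψ(z)) = ψ(z q^{c₂/2}) ⊗ ψ(z q^{-c₁/2})` -/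
  comul_psi : ∀ n j, (Δ (psi (gen q) n)).coeff j =
    (psi (gen q) (n - j) * gamPow (gen q) j) ᵍ⊗ₜ[ℂ]
      (gamPow (gen q) (-(n - j)) * psi (gen q) j)
  /-- `ε(q^{c/2}) = 1` -/
  counit_gam : ε (gen q .gam) = 1
  /-- `ε(φ(z)) = 1` -/
  counit_phi : ∀ n, ε (phi (gen q) n) = if n = 0 then 1 else 0
  /-- `ε(ψ(z)) = 1` -/
  counit_psi : ∀ n, ε (psi (gen q) n) = if n = 0 then 1 else 0
  /-- `ε(x^±(z)) = 0` -/
  counit_x : ∀ s n, ε (gen q (.x s n)) = 0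
  /-- `S(q^{c/2}) = q^{-c/2}` -/
  antipode_gam : S (gen q .gam) = incl q (gen q .gamInv)
  /-- `S(x⁺(z)) = -φ(z q^{-c/2})⁻¹ x⁺(z q^{-c})` -/
  antipode_x_pos : ∀ n, HasSum (fun l : ℤ => incl q
    (-(phiInv (gen q) (n - l) * gamPow (gen q) (n + l) * gen q (.x 1 l)))) (S (gen q (.x 1 n)))
  /-- `S(x⁻(z)) = -x⁻(z q^{-c}) ψ(z q^{-c/2})⁻¹` -/
  antipode_x_neg : ∀ n, HasSum (fun l : ℤ => incl q
    (-(gen q (.x (-1) (n - l)) * gamPow (gen q) (2 * n - l) * psiInv (gen q) l)))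
    (S (gen q (.x (-1) n)))
  /-- `S(φ(z)) = φ(z)⁻¹` -/
  antipode_phi : ∀ n, S (phi (gen q) n) = incl q (phiInv (gen q) n)
  /-- `S(ψ(z)) = ψ(z)⁻¹` -/
  antipode_psi : ∀ n, S (psi (gen q) n) = incl q (psiInv (gen q) n)

end SuperCurrent

end

noncomputable section

set_option linter.unusedSectionVars false

namespace SuperCurrent

theorem sum_range_antidiagonal {M : Type*} [AddCommMonoid M] {N : ℕ} {f : ℕ → ℕ → M}
    (hf : ∀ k l, N < k + l → f k l = 0) :
    ∑ K ∈ Finset.range (N + 1), ∑ kl ∈ Finset.HasAntidiagonal.antidiagonal K, f kl.1 kl.2 =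
      ∑ k ∈ Finset.range (N + 1), ∑ l ∈ Finset.range (N + 1), f k l := by
  rw [← Finset.sum_product', Finset.sum_sigma', ← Finset.sum_filter_add_sum_filter_not
    (Finset.range (N + 1) ×ˢ Finset.range (N + 1)) (fun kl => kl.1 + kl.2 ≤ N),
    Finset.sum_eq_zero (s := Finset.filter (fun kl : ℕ × ℕ => ¬ kl.1 + kl.2 ≤ N) _), add_zero]
  · refine Finset.sum_bij' (fun x _ => x.2) (fun kl _ => ⟨kl.1 + kl.2, kl⟩) ?_ ?_ ?_ ?_ ?_
    · rintro ⟨r, kl⟩ h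
      simp only [Finset.mem_sigma, Finset.mem_range, Finset.HasAntidiagonal.mem_antidiagonal,
        Finset.mem_filter, Finset.mem_product] at *
      omega
    · rintro kl h
      rw [Finset.mem_filter] at h
      exact Finset.mem_sigma.2 ⟨Finset.mem_range.2 (by dsimp only; omega),
        Finset.HasAntidiagonal.mem_antidiagonal.2 rfl⟩
    · rintro ⟨r, kl⟩ h
      simp only [Finset.mem_sigma, Finset.mem_range, Finset.HasAntidiagonal.mem_antidiagonal] at *
      obtain ⟨_, rfl⟩ := h
      rfl
    · intros; rfl
    · intros; rfl
  · intro kl hkl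
    simp only [Finset.mem_filter, not_le] at hkl
    exact hf _ _ hkl.2

/-! ### Exponentials of power series over noncommutative algebras -/

section Exponential

variable {R : Type*} [Ring R] [Algebra ℂ R]

theorem coeff_pow_eq_zero {R : Type*} [Ring R] {A : PowerSeries R} (hA : PowerSeries.coeff 0 A = 0) :
    ∀ {r n : ℕ}, n < r → PowerSeries.coeff n (A ^ r) = 0
  | 0, _, h => absurd h (Nat.not_lt_zero _)
  | r + 1, n, h => by
    rw [pow_succ', PowerSeries.coeff_mul]
    refine Finset.sum_eq_zero fun ij hij => ?_
    rw [Finset.HasAntidiagonal.mem_antidiagonal] at hij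
    rcases Nat.eq_zero_or_pos ij.1 with h0 | h0
    · rw [h0, hA, zero_mul]
    · rw [coeff_pow_eq_zero hA (by omega), mul_zero]

theorem expCoeff_eq_sum_range {A : PowerSeries R} (hA : PowerSeries.coeff 0 A = 0) {n N : ℕ}
    (h : n ≤ N) : expCoeff A n =
      ∑ r ∈ Finset.range (N + 1), ((r.factorial : ℂ)⁻¹) • PowerSeries.coeff n (A ^ r) := by
  refine Finset.sum_subset (fun r hr => ?_) fun r _ hr => ?_
  · simp only [Finset.mem_range] at *; omega
  · simp only [Finset.mem_range] at hr
    rw [coeff_pow_eq_zero hA (by omega), smul_zero]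

theorem expCoeff_zero_right {A : PowerSeries R} : expCoeff A 0 = 1 := by simp [expCoeff]

theorem expCoeff_zero (n : ℕ) : expCoeff (0 : PowerSeries R) n = if n = 0 then 1 else 0 := by
  rw [expCoeff, Finset.sum_range_succ']
  simp [PowerSeries.coeff_one]

theorem expCoeff_add {A B : PowerSeries R} (hA : PowerSeries.coeff 0 A = 0)
    (hB : PowerSeries.coeff 0 B = 0) (hAB : Commute A B) (n : ℕ) :
    expCoeff (A + B) n =
      ∑ ij ∈ Finset.HasAntidiagonal.antidiagonal n, expCoeff A ij.1 * expCoeff B ij.2 := by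
  have h1 : expCoeff (A + B) n = ∑ kl ∈ Finset.range (n + 1) ×ˢ Finset.range (n + 1),
      (((kl.1.factorial : ℂ)⁻¹ * (kl.2.factorial : ℂ)⁻¹)) •
        PowerSeries.coeff n (A ^ kl.1 * B ^ kl.2) := by
    have h2 : expCoeff (A + B) n = ∑ r ∈ Finset.range (n + 1),
        ∑ kl ∈ Finset.HasAntidiagonal.antidiagonal r, (((kl.1.factorial : ℂ)⁻¹ * (kl.2.factorial : ℂ)⁻¹)) •
          PowerSeries.coeff n (A ^ kl.1 * B ^ kl.2) := by
      refine Finset.sum_congr rfl fun r _ => ?_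
      rw [hAB.add_pow', map_sum, Finset.smul_sum]
      refine Finset.sum_congr rfl fun kl hkl => ?_
      rw [Finset.HasAntidiagonal.mem_antidiagonal] at hkl
      rw [map_nsmul, ← Nat.cast_smul_eq_nsmul ℂ, smul_smul]
      congr 1
      have h3 := Nat.add_choose_mul_factorial_mul_factorial kl.2 kl.1
      rw [add_comm kl.2, hkl, mul_right_comm] at h3
      have h4 : ((r.choose kl.1 : ℕ) : ℂ) * kl.1.factorial * kl.2.factorial = r.factorial := by
        exact_mod_cast h3
      have := Nat.cast_ne_zero (R := ℂ).2 (Nat.factorial_ne_zero kl.1)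
      have := Nat.cast_ne_zero (R := ℂ).2 (Nat.factorial_ne_zero kl.2)
      have := Nat.cast_ne_zero (R := ℂ).2 (Nat.factorial_ne_zero r)
      field_simp
      linear_combination h4
    rw [h2, Finset.sum_product, sum_range_antidiagonal (f := fun k l =>
      (((k.factorial : ℂ)⁻¹ * (l.factorial : ℂ)⁻¹)) • PowerSeries.coeff n (A ^ k * B ^ l))]
    intro k l hkl
    rw [PowerSeries.coeff_mul, Finset.sum_eq_zero, smul_zero]
    intro ij hij
    rw [Finset.HasAntidiagonal.mem_antidiagonal] at hij
    rcases lt_or_ge ij.1 k with h | h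
    · rw [coeff_pow_eq_zero hA h, zero_mul]
    · rw [coeff_pow_eq_zero hB (show ij.2 < l by omega), mul_zero]
  have h5 : ∀ ij ∈ Finset.HasAntidiagonal.antidiagonal n, expCoeff A ij.1 * expCoeff B ij.2 =
      ∑ kl ∈ Finset.range (n + 1) ×ˢ Finset.range (n + 1),
        (((kl.1.factorial : ℂ)⁻¹ * (kl.2.factorial : ℂ)⁻¹)) •
          (PowerSeries.coeff ij.1 (A ^ kl.1) * PowerSeries.coeff ij.2 (B ^ kl.2)) := by
    intro ij hij
    rw [Finset.HasAntidiagonal.mem_antidiagonal] at hij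
    rw [expCoeff_eq_sum_range hA (show ij.1 ≤ n by omega),
      expCoeff_eq_sum_range hB (show ij.2 ≤ n by omega), Finset.sum_mul_sum, Finset.sum_product]
    simp only [smul_mul_smul_comm]
  rw [h1, Finset.sum_congr rfl h5, Finset.sum_comm]
  simp only [PowerSeries.coeff_mul, Finset.smul_sum]

theorem expCoeff_mul_neg {A : PowerSeries R} (hA : PowerSeries.coeff 0 A = 0) (n : ℕ) :
    ∑ ij ∈ Finset.HasAntidiagonal.antidiagonal n, expCoeff A ij.1 * expCoeff (-A) ij.2 = if n = 0 then 1 else 0 := by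
  rw [← expCoeff_add hA (by rw [map_neg, hA, neg_zero]) ((Commute.refl A).neg_right), add_neg_cancel, expCoeff_zero]

theorem coeff_pow_mem {A : PowerSeries R} (S : Subalgebra ℂ R) :
    ∀ (r : ℕ) {n : ℕ}, (∀ i ≤ n, PowerSeries.coeff i A ∈ S) → PowerSeries.coeff n (A ^ r) ∈ S
  | 0, n, _ => by
    rw [pow_zero, PowerSeries.coeff_one]
    split_ifs
    · exact one_mem S
    · exact zero_mem S
  | r + 1, n, h => by
    rw [pow_succ', PowerSeries.coeff_mul]
    refine sum_mem fun ij hij => ?_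
    rw [Finset.HasAntidiagonal.mem_antidiagonal] at hij
    exact mul_mem (h _ (by omega)) (coeff_pow_mem S r fun i hi => h i (by omega))

theorem expCoeff_mem {A : PowerSeries R} (S : Subalgebra ℂ R) (h : ∀ i, PowerSeries.coeff i A ∈ S)
    (n : ℕ) : expCoeff A n ∈ S :=
  sum_mem fun r _ => S.smul_mem (coeff_pow_mem S r fun i _ => h i) _

/-- The coefficients of `A` are polynomials in those of `exp A`. -/
theorem coeff_mem_of_expCoeff_mem {A : PowerSeries R} (hA : PowerSeries.coeff 0 A = 0)
    (S : Subalgebra ℂ R) (h : ∀ n, expCoeff A n ∈ S) (n : ℕ) : PowerSeries.coeff n A ∈ S := by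
  induction n using Nat.strong_induction_on with
  | _ n ih =>
  rcases n with _ | n
  · rw [hA]; exact zero_mem S
  have h1 := h (n + 1)
  rw [expCoeff, Finset.sum_range_succ', Finset.sum_range_succ'] at h1
  simp only [zero_add, Nat.factorial_one, Nat.cast_one, inv_one, one_smul, pow_one, pow_zero,
    PowerSeries.coeff_one, Nat.succ_ne_zero, if_false, smul_zero, add_zero] at h1
  refine (add_mem_cancel_left (sum_mem fun r hr => S.smul_mem ?_ _)).1 h1
  rw [pow_succ', PowerSeries.coeff_mul]
  refine sum_mem fun ij hij => ?_
  rw [Finset.HasAntidiagonal.mem_antidiagonal] at hij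
  rcases Nat.eq_zero_or_pos ij.1 with h0 | h0
  · rw [h0, hA, zero_mul]; exact zero_mem S
  rcases Nat.eq_zero_or_pos ij.2 with h2 | h2
  · rw [h2, coeff_pow_eq_zero hA (by omega), mul_zero]; exact zero_mem S
  · exact mul_mem (ih _ (by omega)) (coeff_pow_mem S _ fun i hi => ih i (by omega))

theorem coeff_pow_scale {R : Type*} [Ring R] {A B : PowerSeries R} {c : R} (hc : ∀ y, Commute c y)
    (h : ∀ n, PowerSeries.coeff n B = c ^ n * PowerSeries.coeff n A) :
    ∀ r n : ℕ, PowerSeries.coeff n (B ^ r) = c ^ n * PowerSeries.coeff n (A ^ r)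
  | 0, n => by
    simp only [pow_zero, PowerSeries.coeff_one]
    split_ifs with h0 <;> simp [h0]
  | r + 1, n => by
    simp only [pow_succ', PowerSeries.coeff_mul, Finset.mul_sum]
    refine Finset.sum_congr rfl fun ij hij => ?_
    rw [Finset.HasAntidiagonal.mem_antidiagonal] at hij
    rw [h, coeff_pow_scale hc h r, ← hij, pow_add, mul_assoc, mul_assoc,
      ← mul_assoc (PowerSeries.coeff _ A), ← ((hc _).pow_left ij.2).eq, mul_assoc]

theorem expCoeff_scale {A B : PowerSeries R} {c : R} (hc : ∀ y, Commute c y)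
    (h : ∀ n, PowerSeries.coeff n B = c ^ n * PowerSeries.coeff n A) (n : ℕ) :
    expCoeff B n = c ^ n * expCoeff A n := by
  simp only [expCoeff, coeff_pow_scale hc h, Finset.mul_sum, mul_smul_comm]

end Exponential

/-! ### The defining relations in an arbitrary algebra -/

section Relations

variable {R : Type*} [Ring R] [Algebra ℂ R]

/-- The relations `Rel q` hold for the elements `e y`. -/
structure Relations (q : ℂ) (e : Gen → R) : Prop where
  gam_gamInv : e .gam * e .gamInv = 1
  gamInv_gam : e .gamInv * e .gam = 1
  k_kInv : e .k * e .kInv = 1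
  kInv_k : e .kInv * e .k = 1
  gam_central (y : Gen) : e .gam * e y = e y * e .gam
  phi_phi (m n : ℤ) : phi e m * phi e n = phi e n * phi e m
  psi_psi (m n : ℤ) : psi e m * psi e n = psi e n * psi e m
  phi_psi (m n : ℤ) : phi e m * psi e n =
    ∑ k ∈ Finset.range (m.natAbs + 1), gRatio q e k * (psi e (n - k) * phi e (m + k))
  phi_x (s : ℤˣ) (m n : ℤ) : phi e m * e (.x s n) =
    ∑ k ∈ Finset.range (m.natAbs + 1), gCoeff q s k •
        (gamPow e (-(s : ℤ) * k) * (e (.x s (n - k)) * phi e (m + k)))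
  psi_x (s : ℤˣ) (m n : ℤ) : psi e m * e (.x s n) =
    ∑ k ∈ Finset.range (m.natAbs + 1), gCoeff q (-s) k •
        (gamPow e (-(s : ℤ) * k) * (e (.x s (n + k)) * psi e (m - k)))
  xp_xm (m n : ℤ) : e (.x 1 m) * e (.x (-1) n) + e (.x (-1) n) * e (.x 1 m) =
    (q - q⁻¹)⁻¹ • (gamPow e (m - n) * psi e (m + n) - gamPow e (n - m) * phi e (m + n))
  x_x (s : ℤˣ) (m n : ℤ) :
    ∑ i : Fin 3, GCoeff q (-s) i • (e (.x s (m + 2 - (i : ℕ))) * e (.x s (n + (i : ℕ)))) =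
      -∑ i : Fin 3, GCoeff q s i • (e (.x s (n + (i : ℕ))) * e (.x s (m + 2 - (i : ℕ))))

theorem map_gRatio {S : Type*} [Ring S] [Algebra ℂ S] (q : ℂ) (f : R →ₐ[ℂ] S) (e : Gen → R)
    (k : ℕ) : f (gRatio q e k) = gRatio q (fun y => f (e y)) k := by
  simp [gRatio, map_gamPow]

theorem relations_of_rel {q : ℂ} (f : FreeAlgebra ℂ Gen →ₐ[ℂ] R)
    (h : ∀ a b, Rel q a b → f a = f b) : Relations q fun y => f (fr y) where
  gam_gamInv := by simpa using h _ _ .gam_gamInv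
  gamInv_gam := by simpa using h _ _ .gamInv_gam
  k_kInv := by simpa using h _ _ .k_kInv
  kInv_k := by simpa using h _ _ .kInv_k
  gam_central y := by simpa using h _ _ (.gam_central y)
  phi_phi m n := by simpa only [map_mul, map_phi] using h _ _ (.phi_phi m n)
  psi_psi m n := by simpa only [map_mul, map_psi] using h _ _ (.psi_psi m n)
  phi_psi m n := by
    simpa only [map_mul, map_psi, map_phi, map_sum, map_gRatio] using h _ _ (.phi_psi m n)
  phi_x s m n := by
    simpa only [map_mul, map_psi, map_phi, map_sum, map_smul, map_gamPow] using h _ _ (.phi_x s m n)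
  psi_x s m n := by
    simpa only [map_mul, map_psi, map_phi, map_sum, map_smul, map_gamPow] using h _ _ (.psi_x s m n)
  xp_xm m n := by
    simpa only [map_mul, map_psi, map_phi, map_add, map_sub, map_smul, map_gamPow]
      using h _ _ (.xp_xm m n)
  x_x s m n := by simpa only [map_mul, map_sum, map_neg, map_smul] using h _ _ (.x_x s m n)

theorem Relations.rel {q : ℂ} {f : FreeAlgebra ℂ Gen →ₐ[ℂ] R}
    (h : Relations q fun y => f (fr y)) {a b : FreeAlgebra ℂ Gen} (hab : Rel q a b) : f a = f b := by
  cases hab with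
  | gam_gamInv => simpa using h.gam_gamInv
  | gamInv_gam => simpa using h.gamInv_gam
  | k_kInv => simpa using h.k_kInv
  | kInv_k => simpa using h.kInv_k
  | gam_central y => simpa using h.gam_central y
  | phi_phi m n => simpa only [map_mul, map_phi] using h.phi_phi m n
  | psi_psi m n => simpa only [map_mul, map_psi] using h.psi_psi m n
  | phi_psi m n => simpa only [map_mul, map_psi, map_phi, map_sum, map_gRatio] using h.phi_psi m n
  | phi_x s m n =>
    simpa only [map_mul, map_psi, map_phi, map_sum, map_smul, map_gamPow] using h.phi_x s m n
  | psi_x s m n =>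
    simpa only [map_mul, map_psi, map_phi, map_sum, map_smul, map_gamPow] using h.psi_x s m n
  | xp_xm m n =>
    simpa only [map_mul, map_psi, map_phi, map_add, map_sub, map_smul, map_gamPow]
      using h.xp_xm m n
  | x_x s m n => simpa only [map_mul, map_sum, map_neg, map_smul] using h.x_x s m n

/-- The homomorphism from `PreU q` determined by elements that satisfy the relations. -/
def PreU.lift {q : ℂ} {e : Gen → R} (h : Relations q e) : PreU q →ₐ[ℂ] R :=
  RingQuot.liftAlgHom ℂ ⟨FreeAlgebra.lift ℂ e, fun _ _ hab =>
    Relations.rel (f := FreeAlgebra.lift ℂ e) (by simpa using h) hab⟩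

theorem PreU.lift_gen {q : ℂ} {e : Gen → R} (h : Relations q e) (y : Gen) :
    PreU.lift h (PreU.gen q y) = e y :=
  (RingQuot.liftAlgHom_mkAlgHom_apply ℂ (FreeAlgebra.lift ℂ e) _ (fr y)).trans (by simp)

theorem PreU.relations (q : ℂ) : Relations q (PreU.gen q) :=
  relations_of_rel (PreU.mk q) fun _ _ h => PreU.mk_rel q h

theorem Relations.map {S : Type*} [Ring S] [Algebra ℂ S] {q : ℂ} {e : Gen → R} (h : Relations q e)
    (f : R →ₐ[ℂ] S) : Relations q fun y => f (e y) := by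
  have := relations_of_rel (q := q) ((f.comp (PreU.lift h)).comp (PreU.mk q)) fun a b hab => by
    simp only [AlgHom.comp_apply, PreU.mk_rel q hab]
  refine (congrArg (Relations q) (funext fun y => ?_)).mp this
  exact congrArg f (PreU.lift_gen h y)

variable {q : ℂ} {e : Gen → R}

/-- `q^{c/2}` as a unit. -/
def Relations.gamUnit (h : Relations q e) : Rˣ := ⟨e .gam, e .gamInv, h.gam_gamInv, h.gamInv_gam⟩

theorem Relations.gamPow_eq (h : Relations q e) (n : ℤ) :
    gamPow e n = ((h.gamUnit ^ n : Rˣ) : R) := by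
  cases n with
  | ofNat n => simp [gamPow, Relations.gamUnit]
  | negSucc n => rw [zpow_negSucc, ← inv_pow]; simp [gamPow, Relations.gamUnit]

theorem Relations.gamPow_add (h : Relations q e) (m n : ℤ) :
    gamPow e (m + n) = gamPow e m * gamPow e n := by
  rw [h.gamPow_eq, h.gamPow_eq, h.gamPow_eq, zpow_add, Units.val_mul]

theorem gamPow_zero (e : Gen → R) : gamPow e 0 = 1 := pow_zero _

theorem gamPow_natCast (e : Gen → R) (n : ℕ) : gamPow e n = e .gam ^ n := rfl

theorem Relations.gamPow_mul_neg (h : Relations q e) (n : ℤ) : gamPow e n * gamPow e (-n) = 1 := by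
  rw [← h.gamPow_add, add_neg_cancel, gamPow_zero]

theorem Relations.gamPow_neg_natCast (h : Relations q e) (n : ℕ) :
    gamPow e (-n) = e .gamInv ^ n := by
  rw [h.gamPow_eq, zpow_neg, zpow_natCast, ← inv_pow, Units.val_pow_eq_pow_val]
  rfl

theorem Relations.commute_gamPow (h : Relations q e) {y : R} (hy : Commute (e .gam) y) (n : ℤ) :
    Commute (gamPow e n) y := by
  rw [h.gamPow_eq]
  have : Commute ((h.gamUnit : Rˣ) : R) y := hy
  exact this.units_zpow_left n

theorem phi_of_pos (e : Gen → R) {m : ℤ} (h : 0 < m) : phi e m = 0 := if_neg (by omega)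

theorem psi_of_neg (e : Gen → R) {m : ℤ} (h : m < 0) : psi e m = 0 := if_neg (by omega)

theorem phi_neg_natCast (e : Gen → R) (n : ℕ) : phi e (-n) = e .k * expCoeff (aSeries e) n := by
  rw [phi, if_pos (by omega), Int.natAbs_neg, Int.natAbs_natCast]

theorem psi_natCast (e : Gen → R) (n : ℕ) : psi e n = e .kInv * expCoeff (bSeries e) n := by
  rw [psi, if_pos (by omega), Int.natAbs_natCast]

theorem coeff_zero_aSeries (e : Gen → R) : PowerSeries.coeff 0 (aSeries e) = 0 := by simp [aSeries]

theorem coeff_zero_bSeries (e : Gen → R) : PowerSeries.coeff 0 (bSeries e) = 0 := by simp [bSeries]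

theorem coeff_succ_aSeries (e : Gen → R) (n : ℕ) :
    PowerSeries.coeff (n + 1) (aSeries e) = e (.a n) := by
  simp [aSeries]

theorem coeff_succ_bSeries (e : Gen → R) (n : ℕ) :
    PowerSeries.coeff (n + 1) (bSeries e) = e (.b n) := by
  simp [bSeries]

/-- If the modes of `k exp A` commute with `y`, then so do `k` and the modes of `A`. -/
theorem commute_coeff_of_commute_mul_expCoeff {y : R} (k : Rˣ) {A : PowerSeries R}
    (hA : PowerSeries.coeff 0 A = 0) (h : ∀ n, Commute y (k * expCoeff A n)) :
    Commute y k ∧ ∀ n, Commute y (PowerSeries.coeff n A) := by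
  have h0 : Commute y k := by simpa [expCoeff_zero_right] using h 0
  refine ⟨h0, fun n => ?_⟩
  have := coeff_mem_of_expCoeff_mem hA (Subalgebra.centralizer ℂ {y}) (fun n => by
    rw [Subalgebra.mem_centralizer_iff]
    rintro z rfl
    have h2 : Commute z (((k⁻¹ : Rˣ) : R) * (k * expCoeff A n)) := h0.units_inv_right.mul_right (h n)
    rwa [← mul_assoc, Units.inv_mul, one_mul] at h2) n
  exact (Subalgebra.mem_centralizer_iff ℂ).1 this y rfl

/-- `exp ā(0)` as a unit. -/
def Relations.kUnit (h : Relations q e) : Rˣ := ⟨e .k, e .kInv, h.k_kInv, h.kInv_k⟩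

theorem Relations.commute_phi (h : Relations q e) {y : R} (hy : ∀ m, Commute y (phi e m)) :
    Commute y (e .k) ∧ ∀ n, Commute y (e (.a n)) := by
  have := commute_coeff_of_commute_mul_expCoeff h.kUnit (coeff_zero_aSeries e) (y := y) (fun n => by
    have := hy (-n)
    rwa [phi_neg_natCast] at this)
  exact ⟨this.1, fun n => by simpa only [coeff_succ_aSeries] using this.2 (n + 1)⟩

theorem Relations.commute_psi (h : Relations q e) {y : R} (hy : ∀ m, Commute y (psi e m)) :
    Commute y (e .kInv) ∧ ∀ n, Commute y (e (.b n)) := by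
  have := commute_coeff_of_commute_mul_expCoeff h.kUnit⁻¹ (coeff_zero_bSeries e) (y := y)
    (fun n => by
      have := hy n
      rwa [psi_natCast] at this)
  exact ⟨this.1, fun n => by simpa only [coeff_succ_bSeries] using this.2 (n + 1)⟩

theorem Relations.commute_a_phi (h : Relations q e) (n : ℕ) (m : ℤ) :
    Commute (e (.a n)) (phi e m) := ((h.commute_phi fun l => h.phi_phi m l).2 n).symm

theorem Relations.commute_b_psi (h : Relations q e) (n : ℕ) (m : ℤ) :
    Commute (e (.b n)) (psi e m) := ((h.commute_psi fun l => h.psi_psi m l).2 n).symm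

theorem Relations.commute_a_k (h : Relations q e) (n : ℕ) : Commute (e (.a n)) (e .k) :=
  (h.commute_phi (h.commute_a_phi n)).1

theorem Relations.commute_a_a (h : Relations q e) (n m : ℕ) : Commute (e (.a n)) (e (.a m)) :=
  (h.commute_phi (h.commute_a_phi n)).2 m

theorem Relations.commute_b_kInv (h : Relations q e) (n : ℕ) : Commute (e (.b n)) (e .kInv) :=
  (h.commute_psi (h.commute_b_psi n)).1

theorem Relations.commute_b_b (h : Relations q e) (n m : ℕ) : Commute (e (.b n)) (e (.b m)) :=
  (h.commute_psi (h.commute_b_psi n)).2 m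

/-- `φ(z)` commutes with whatever commutes with its generators. -/
theorem commute_phi_of_commute {y : R} (hk : Commute y (e .k)) (ha : ∀ n, Commute y (e (.a n)))
    (m : ℤ) : Commute y (phi e m) := by
  unfold phi
  split_ifs
  · refine hk.mul_right ((Subalgebra.mem_centralizer_iff ℂ).1
      (expCoeff_mem (Subalgebra.centralizer ℂ {y}) (fun i => ?_) _) y rfl)
    rw [Subalgebra.mem_centralizer_iff]
    rintro z rfl
    cases i with
    | zero => rw [coeff_zero_aSeries, zero_mul, mul_zero]
    | succ i => rw [coeff_succ_aSeries]; exact ha i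
  · exact Commute.zero_right _

/-- `ψ(z)` commutes with whatever commutes with its generators. -/
theorem commute_psi_of_commute {y : R} (hk : Commute y (e .kInv)) (hb : ∀ n, Commute y (e (.b n)))
    (m : ℤ) : Commute y (psi e m) := by
  unfold psi
  split_ifs
  · refine hk.mul_right ((Subalgebra.mem_centralizer_iff ℂ).1
      (expCoeff_mem (Subalgebra.centralizer ℂ {y}) (fun i => ?_) _) y rfl)
    rw [Subalgebra.mem_centralizer_iff]
    rintro z rfl
    cases i with
    | zero => rw [coeff_zero_bSeries, zero_mul, mul_zero]
    | succ i => rw [coeff_succ_bSeries]; exact hb i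
  · exact Commute.zero_right _

end Relations

/-! ### Exchange relations between currents -/

section Exchange

variable {T : Type*} [Ring T]

/-- `u(z) v(w) = c(z/w) v(w) u(z)` if `τ = 1`, and `u(z) v(w) = c(w/z) v(w) u(z)` if `τ = -1`. -/
def Exch (τ : ℤˣ) (c : ℕ → T) (u v : ℤ → T) : Prop :=
  ∀ (m n : ℤ) (N : ℕ), m.natAbs ≤ N →
    u m * v n = ∑ k ∈ Finset.range (N + 1), c k * (v (n - τ * k) * u (m + τ * k))

/-- The modes `u(m)` vanish for `τ m > 0`. -/
def Truncated (τ : ℤˣ) (u : ℤ → T) : Prop := ∀ m : ℤ, 0 < (τ : ℤ) * m → u m = 0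

theorem Exch.of_natAbs {τ : ℤˣ} {c : ℕ → T} {u v : ℤ → T} (hu : Truncated τ u)
    (h : ∀ m n : ℤ, u m * v n =
      ∑ k ∈ Finset.range (m.natAbs + 1), c k * (v (n - τ * k) * u (m + τ * k))) : Exch τ c u v := by
  intro m n N hN
  rw [h]
  refine Finset.sum_subset (fun r hr => ?_) fun k _ hk => ?_
  · simp only [Finset.mem_range] at *; omega
  · simp only [Finset.mem_range] at hk
    rw [hu, mul_zero, mul_zero]
    rcases Int.units_eq_one_or τ with rfl | rfl <;> simp <;> omega

theorem Exch.rescale {τ : ℤˣ} {c : ℕ → T} {u v : ℤ → T} (h : Exch τ c u v) {p r : ℤ → T}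
    (hp : ∀ m n, p (m + n) = p m * p n) (hr : ∀ m n, r (m + n) = r m * r n)
    (hpc : ∀ m t, Commute (p m) t) (hrc : ∀ m t, Commute (r m) t) :
    Exch τ (fun k => c k * (p (-(τ * k)) * r (τ * k))) (fun m => u m * p m) fun n => v n * r n := by
  intro m n N hN
  have h1 : u m * p m * (v n * r n) = u m * v n * (p m * r n) := by
    rw [mul_assoc, ← mul_assoc (p m), (hpc m (v n)).eq]; simp only [mul_assoc]
  rw [h1, h m n N hN, Finset.sum_mul]
  refine Finset.sum_congr rfl fun k _ => ?_
  have h2 : p m * r n = p (-(τ * k)) * r (τ * k) * (r (n - τ * k) * p (m + τ * k)) := by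
    rw [show m = -((τ : ℤ) * k) + (m + τ * k) by ring, show n = τ * k + (n - τ * k) by ring, hp, hr,
      show -((τ : ℤ) * k) + (m + τ * k) + τ * k = m + τ * k by ring,
      show (τ : ℤ) * k + (n - τ * k) - τ * k = n - τ * k by ring]
    rw [mul_assoc, mul_assoc, (hpc (m + τ * k) _).eq, mul_assoc]
  rw [h2]
  have hz : Commute (p (-(τ * k)) * r (τ * k)) (v (n - τ * k) * u (m + τ * k)) :=
    (hpc _ _).mul_left (hrc _ _)
  rw [mul_assoc (c k), mul_assoc (c k), ← mul_assoc (v _ * u _), ← hz.eq, mul_assoc _ (v _ * u _),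
    mul_assoc (v _) (u _), ← mul_assoc (u _) (r _), ← (hrc _ (u _)).eq, mul_assoc (r _),
    ← mul_assoc (v _) (r _)]

end Exchange

/-! ### Currents with values in Laurent series -/

section Star

variable {T : Type*} [Ring T]

/-- Coefficient of `z^{-n}` in `u(z) v(z)`, where the exponent of the Laurent series keeps track of
the mode of the second factor. -/
def star (u v : ℤ → T) (n : ℤ) : HahnSeries ℤ T :=
  open Classical in
  if h : BddBelow (Function.support fun j => u (n - j) * v j) then
    HahnSeries.ofSuppBddBelow (fun j => u (n - j) * v j) h
  else 0

/-- The condition for `star u v` to be given by the expected formula. -/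
def Starrable (u v : ℤ → T) : Prop := Truncated 1 u ∨ Truncated (-1) v

theorem star_coeff {u v : ℤ → T} (h : Starrable u v) (n j : ℤ) :
    (star u v n).coeff j = u (n - j) * v j := by
  have hb : BddBelow (Function.support fun j => u (n - j) * v j) := by
    rcases h with h | h
    · refine ⟨n, fun j hj => ?_⟩
      by_contra hjn
      exact hj (by dsimp only; rw [h (n - j) (by simp at hjn ⊢; omega), zero_mul])
    · refine ⟨0, fun j hj => ?_⟩
      by_contra hjn
      exact hj (by dsimp only; rw [h j (by simp at hjn ⊢; omega), mul_zero])
  rw [star, dif_pos hb]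
  rfl

theorem star_eq_zero {τ : ℤˣ} {u v : ℤ → T} (hu : Truncated τ u) (hv : Truncated τ v)
    (h : Starrable u v) : Truncated τ (star u v) := by
  intro m hm
  ext j
  rw [star_coeff h, HahnSeries.coeff_zero]
  rcases lt_or_ge 0 ((τ : ℤ) * j) with h1 | h1
  · rw [hv j h1, mul_zero]
  · rw [hu (m - j) (by rw [mul_sub]; omega), zero_mul]

theorem hasSum_coeff_mul [TopologicalSpace T] (s t : HahnSeries ℤ T) (j : ℤ) :
    HasSum (fun i => s.coeff i * t.coeff (j - i)) ((s * t).coeff j) := by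
  rw [HahnSeries.coeff_mul]
  have : ∑ ij ∈ Finset.antidiagonal s.isPWO_support t.isPWO_support j, s.coeff ij.1 * t.coeff ij.2
      = ∑ i ∈ (Finset.antidiagonal s.isPWO_support t.isPWO_support j).image Prod.fst,
        s.coeff i * t.coeff (j - i) := by
    rw [Finset.sum_image]
    · refine Finset.sum_congr rfl fun ij hij => ?_
      rw [Finset.mem_antidiagonal] at hij
      rw [show j - ij.1 = ij.2 by omega]
    · intro a ha b hb hab
      rw [Finset.mem_coe, Finset.mem_antidiagonal] at ha hb
      exact Prod.ext hab (by omega)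
  rw [this]
  refine hasSum_sum_of_ne_finset_zero fun i hi => ?_
  by_contra h0
  refine hi (Finset.mem_image.2 ⟨(i, j - i), ?_, rfl⟩)
  rw [Finset.mem_antidiagonal]
  exact ⟨left_ne_zero_of_mul h0, right_ne_zero_of_mul h0, by simp⟩

theorem hasSum_coeff_mul' [TopologicalSpace T] (s t : HahnSeries ℤ T) (j : ℤ) :
    HasSum (fun i => s.coeff (j - i) * t.coeff i) ((s * t).coeff j) := by
  have := (Equiv.subLeft j).hasSum_iff.2 (hasSum_coeff_mul s t j)
  simpa [Function.comp_def] using this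

theorem coeff_C_mul' (c : T) (s : HahnSeries ℤ T) (j : ℤ) :
    (HahnSeries.C c * s).coeff j = c * s.coeff j := HahnSeries.coeff_single_zero_mul

theorem coeff_mul_C' (c : T) (s : HahnSeries ℤ T) (j : ℤ) :
    (s * HahnSeries.C c).coeff j = s.coeff j * c := HahnSeries.coeff_mul_single_zero

theorem commute_C {c : T} {s : HahnSeries ℤ T} (hc : ∀ j, Commute c (s.coeff j)) :
    Commute (HahnSeries.C c) s := by
  ext j
  rw [coeff_C_mul', coeff_mul_C', (hc j).eq]

theorem Exch.star {τ : ℤˣ} {c d : ℕ → T} {u v u' v' : ℤ → T} (hu : Truncated τ u)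
    (hv : Truncated τ v) (hst : Starrable u v) (hst' : Starrable u' v') (h1 : Exch τ c u u')
    (h2 : Exch τ d v v') (hvu : ∀ m n, Commute (v m) (u' n)) (huv : ∀ m n, Commute (u m) (v' n))
    (hd : ∀ k t, Commute (d k) t) :
    Exch τ (fun K => HahnSeries.C (∑ kl ∈ Finset.HasAntidiagonal.antidiagonal K, c kl.1 * d kl.2))
      (star u v) (star u' v') := by
  intro m n N hN
  let A : ℕ → ℕ → HahnSeries ℤ T := fun k l => HahnSeries.C (c k * d l) *
    (SuperCurrent.star u' v' (n - τ * (k + l : ℕ)) * SuperCurrent.star u v (m + τ * (k + l : ℕ)))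
  have hsum : ∑ K ∈ Finset.range (N + 1),
      HahnSeries.C (∑ kl ∈ Finset.HasAntidiagonal.antidiagonal K, c kl.1 * d kl.2) *
        (SuperCurrent.star u' v' (n - τ * K) * SuperCurrent.star u v (m + τ * K)) =
      ∑ k ∈ Finset.range (N + 1), ∑ l ∈ Finset.range (N + 1), A k l := by
    rw [← sum_range_antidiagonal]
    · refine Finset.sum_congr rfl fun K _ => ?_
      rw [map_sum, Finset.sum_mul]
      refine Finset.sum_congr rfl fun kl hkl => ?_
      rw [Finset.HasAntidiagonal.mem_antidiagonal] at hkl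
      subst hkl
      rfl
    · intro k l hkl
      simp only [A]
      rw [star_eq_zero hu hv hst, mul_zero, mul_zero]
      rcases Int.units_eq_one_or τ with rfl | rfl <;> simp <;> omega
  rw [hsum]
  ext j
  let _ : TopologicalSpace T := ⊥
  have _ : DiscreteTopology T := ⟨rfl⟩
  let G : ℤ → ℕ → ℕ → T := fun i k l => c k * d l *
    (u' (n - τ * k - (j - i)) * v' (j - i - τ * l) * (u (m + τ * k - i) * v (i + τ * l)))
  have hA : ∀ k l, HasSum (fun i => G i k l) ((A k l).coeff j) := by
    intro k l
    have h := (hasSum_coeff_mul' (SuperCurrent.star u' v' (n - τ * (k + l : ℕ)))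
      (SuperCurrent.star u v (m + τ * (k + l : ℕ))) j).mul_left (c k * d l)
    have h' := (Equiv.addRight ((τ : ℤ) * l)).hasSum_iff.2 h
    simp only [A]
    rw [coeff_C_mul']
    refine (congrArg (fun f => HasSum f _) ?_).mp h'
    funext i
    simp only [Function.comp_apply, Equiv.coe_addRight, star_coeff hst, star_coeff hst', G]
    rw [show n - (τ : ℤ) * (k + l : ℕ) - (j - (i + τ * l)) = n - τ * k - (j - i) by
        push_cast; ring, show j - (i + (τ : ℤ) * l) = j - i - τ * l by ring,
      show m + (τ : ℤ) * (k + l : ℕ) - (i + τ * l) = m + τ * k - i by push_cast; ring]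
  have hL : ∀ i, (SuperCurrent.star u v m).coeff i * (SuperCurrent.star u' v' n).coeff (j - i) =
      ∑ k ∈ Finset.range (N + 1), ∑ l ∈ Finset.range (N + 1), G i k l := by
    intro i
    rw [star_coeff hst, star_coeff hst']
    by_cases hi : 0 < (τ : ℤ) * i
    · rw [hv i hi, mul_zero, zero_mul]
      refine (Finset.sum_eq_zero fun k _ => Finset.sum_eq_zero fun l _ => ?_).symm
      simp only [G]
      rw [hv (i + τ * l), mul_zero, mul_zero, mul_zero]
      rcases Int.units_eq_one_or τ with rfl | rfl <;> simp at hi ⊢ <;> omega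
    by_cases hmi : 0 < (τ : ℤ) * (m - i)
    · rw [hu _ hmi, zero_mul, zero_mul]
      refine (Finset.sum_eq_zero fun k _ => Finset.sum_eq_zero fun l _ => ?_).symm
      simp only [G]
      rw [hu (m + τ * k - i), zero_mul, mul_zero, mul_zero]
      rcases Int.units_eq_one_or τ with rfl | rfl <;> simp at hmi ⊢ <;> omega
    have hN1 : (m - i).natAbs ≤ N ∧ i.natAbs ≤ N := by
      rcases Int.units_eq_one_or τ with rfl | rfl <;> simp at hi hmi <;> omega
    have h3 : u (m - i) * v i * (u' (n - (j - i)) * v' (j - i)) =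
        u (m - i) * u' (n - (j - i)) * (v i * v' (j - i)) := by
      rw [mul_assoc, ← mul_assoc (v i), (hvu _ _).eq]; simp only [mul_assoc]
    rw [h3, h1 _ _ N hN1.1, h2 _ _ N hN1.2, Finset.sum_mul_sum]
    refine Finset.sum_congr rfl fun k _ => Finset.sum_congr rfl fun l _ => ?_
    simp only [G]
    rw [show n - (j - i) - (τ : ℤ) * k = n - τ * k - (j - i) by ring,
      show m - i + (τ : ℤ) * k = m + τ * k - i by ring, mul_assoc (c k), ← mul_assoc _ (d l),
      ← (hd l _).eq, mul_assoc (d l), ← mul_assoc (c k), mul_assoc (u' _) (u _),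
      ← mul_assoc (u _) (v' _), (huv _ _).eq]
    simp only [mul_assoc]
  have hfin := hasSum_sum (s := Finset.range (N + 1)) fun k _ =>
    hasSum_sum (s := Finset.range (N + 1)) fun l _ => hA k l
  have := (hasSum_coeff_mul (SuperCurrent.star u v m) (SuperCurrent.star u' v' n) j).unique
    ((congrArg (fun f => HasSum f _) (funext fun i => (hL i).symm)).mp hfin)
  rw [this]
  simp only [HahnSeries.coeff_sum]

end Star

/-! ### Structure functions and quadratic relations -/

theorem p₁_ne_zero {q : ℂ} (hq : q ≠ 0) : p₁ q ≠ 0 := pow_ne_zero 2 hq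

theorem p₂_ne_zero {q : ℂ} (hq : q ≠ 0) : p₂ q ≠ 0 := inv_ne_zero hq

theorem gSeries_mul {q : ℂ} (hq : q ≠ 0) :
    ((PowerSeries.X - PowerSeries.C (p₁ q)) * (PowerSeries.X - PowerSeries.C (p₂ q))) * gSeries q =
      (PowerSeries.C (p₁ q) * PowerSeries.X - 1) * (PowerSeries.C (p₂ q) * PowerSeries.X - 1) := by
  rw [gSeries, mul_left_comm, PowerSeries.mul_inv_cancel, mul_one]
  simp [p₁_ne_zero hq, p₂_ne_zero hq]

theorem constantCoeff_gSeries {q : ℂ} (hq : q ≠ 0) :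
    p₁ q * p₂ q * PowerSeries.constantCoeff (gSeries q) = 1 := by
  have := congrArg PowerSeries.constantCoeff (gSeries_mul hq)
  simpa using this

theorem gSeries_mul_inv {q : ℂ} (hq : q ≠ 0) : gSeries q * (gSeries q)⁻¹ = 1 :=
  PowerSeries.mul_inv_cancel _ fun h => by
    have := constantCoeff_gSeries hq
    rw [h, mul_zero] at this
    exact zero_ne_one this

/-- The recursion for the coefficients of `g` obtained from `G⁻ g = G⁺`. -/
theorem gCoeff_recursion {q : ℂ} (hq : q ≠ 0) :
    p₁ q * p₂ q * gCoeff q 1 0 = 1 ∧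
    p₁ q * p₂ q * gCoeff q 1 1 - (p₁ q + p₂ q) * gCoeff q 1 0 = -(p₁ q + p₂ q) ∧
    ∀ k, p₁ q * p₂ q * gCoeff q 1 (k + 2) - (p₁ q + p₂ q) * gCoeff q 1 (k + 1) + gCoeff q 1 k =
      if k = 0 then p₁ q * p₂ q else 0 := by
  have h : PowerSeries.C (p₁ q * p₂ q) * gSeries q -
      PowerSeries.X * (PowerSeries.C (p₁ q + p₂ q) * gSeries q) +
      PowerSeries.X * (PowerSeries.X * gSeries q) =
      1 + PowerSeries.X * (PowerSeries.C (-(p₁ q + p₂ q)) +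
        PowerSeries.X * (PowerSeries.C (p₁ q * p₂ q))) := by
    have := gSeries_mul hq
    simp only [map_add, map_mul, map_neg]
    linear_combination this
  refine ⟨?_, ?_, fun k => ?_⟩
  · simpa [gCoeff] using constantCoeff_gSeries hq
  · have h1 := congrArg (PowerSeries.coeff 1) h
    simp only [map_add, map_sub, PowerSeries.coeff_succ_X_mul, PowerSeries.coeff_C_mul,
      PowerSeries.coeff_zero_X_mul, PowerSeries.coeff_C, PowerSeries.coeff_one] at h1
    simpa [gCoeff] using h1
  · have h1 := congrArg (PowerSeries.coeff (k + 2)) h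
    simp only [map_add, map_sub, PowerSeries.coeff_succ_X_mul, PowerSeries.coeff_C_mul,
      PowerSeries.coeff_C, PowerSeries.coeff_one, show k + 2 = (k + 1) + 1 from rfl] at h1
    simp only [Nat.succ_ne_zero, if_false, zero_add, add_mul, map_add,
      PowerSeries.coeff_C_mul] at h1
    simp only [gCoeff, if_true]
    linear_combination h1

section Quadratic

variable {T : Type*} [Ring T] [Algebra ℂ T]

/-- `f(z, w) u(z) v(w) = ε f(w, z) v(w) u(z)`, where `f(z, w) = (z - p₁^s w)(z - p₂^s w)`. -/
def QuadRel (q : ℂ) (s : ℤˣ) (ε : ℂ) (u v : ℤ → T) : Prop :=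
  ∀ m n : ℤ, ∑ i : Fin 3, fCoeff q s i • (u (m + 2 - (i : ℕ)) * v (n + (i : ℕ))) =
    ε • ∑ i : Fin 3, fCoeff q s i • (v (n + 2 - (i : ℕ)) * u (m + (i : ℕ)))

theorem QuadRel.symm {q : ℂ} {s : ℤˣ} {ε : ℂ} (hε : ε * ε = 1) {u v : ℤ → T}
    (h : QuadRel q s ε u v) : QuadRel q s ε v u := by
  intro m n
  rw [h n m, smul_smul, hε, one_smul]

theorem QuadRel.add_left {q : ℂ} {s : ℤˣ} {ε : ℂ} {u u' v : ℤ → T}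
    (h : QuadRel q s ε u v) (h' : QuadRel q s ε u' v) : QuadRel q s ε (fun n => u n + u' n) v := by
  intro m n
  simp only [add_mul, mul_add, smul_add, Finset.sum_add_distrib, h m n, h' m n]

theorem QuadRel.add_right {q : ℂ} {s : ℤˣ} {ε : ℂ} {u v v' : ℤ → T}
    (h : QuadRel q s ε u v) (h' : QuadRel q s ε u v') : QuadRel q s ε u fun n => v n + v' n := by
  intro m n
  simp only [add_mul, mul_add, smul_add, Finset.sum_add_distrib, h m n, h' m n]

theorem x_x_iff_quadRel {q : ℂ} (hq : q ≠ 0) (s : ℤˣ) (x : ℤ → T) :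
    (∀ m n : ℤ, ∑ i : Fin 3, GCoeff q (-s) i • (x (m + 2 - (i : ℕ)) * x (n + (i : ℕ))) =
      -∑ i : Fin 3, GCoeff q s i • (x (n + (i : ℕ)) * x (m + 2 - (i : ℕ)))) ↔
    QuadRel q s (-1) x x := by
  have h1 := p₁_ne_zero hq
  have h2 := p₂_ne_zero hq
  refine forall₂_congr fun m n => ?_
  simp only [Fin.sum_univ_three, neg_one_smul]
  have e0 : m + 2 - ((0 : Fin 3) : ℕ) = m + 2 := by simp
  have e1 : m + 2 - ((1 : Fin 3) : ℕ) = m + 1 := by simp; ring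
  have e2 : m + 2 - ((2 : Fin 3) : ℕ) = m := by simp
  have e0' : n + 2 - ((0 : Fin 3) : ℕ) = n + 2 := by simp
  have e1' : n + 2 - ((1 : Fin 3) : ℕ) = n + 1 := by simp; ring
  have e2' : n + 2 - ((2 : Fin 3) : ℕ) = n := by simp
  rw [e0, e1, e2, e0', e1', e2']
  rcases Int.units_eq_one_or s with rfl | rfl
  · simp only [GCoeff, fCoeff, Units.val_one, zpow_one]
    simp
    constructor <;> intro h <;> rw [h] <;> abel
  · simp only [GCoeff, fCoeff, Units.val_neg, Units.val_one, zpow_neg, zpow_one, neg_neg]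
    have h3 : (p₁ q)⁻¹ + (p₂ q)⁻¹ = (p₁ q * p₂ q)⁻¹ * (p₁ q + p₂ q) := by field_simp; ring
    rw [h3, ← mul_inv]
    have h4 : p₁ q * p₂ q ≠ 0 := mul_ne_zero h1 h2
    generalize p₁ q * p₂ q = c at *
    generalize p₁ q + p₂ q = d at *
    have h5 : Function.Injective fun t : T => c • t := smul_right_injective T h4
    conv_rhs => rw [← h5.eq_iff]
    simp [smul_smul, smul_add, h4]
    constructor <;> intro h <;> rw [h] <;> abel

/-- The polynomial form of an exchange relation with structure function `g`. -/
theorem Exch.polynomial {q : ℂ} (hq : q ≠ 0) {τ : ℤˣ} {u v : ℤ → T}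
    (h : Exch τ (fun k => algebraMap ℂ T (gCoeff q 1 k)) u v) (m n : ℤ) :
    (p₁ q * p₂ q) • (u m * v n) - (p₁ q + p₂ q) • (u (m + τ) * v (n - τ)) +
        u (m + τ * 2) * v (n - τ * 2) =
      v n * u m - (p₁ q + p₂ q) • (v (n - τ) * u (m + τ)) +
        (p₁ q * p₂ q) • (v (n - τ * 2) * u (m + τ * 2)) := by
  set V : ℕ → T := fun e => v (n - τ * e) * u (m + τ * e) with hV
  set N : ℕ := m.natAbs + 4
  have hτ : (τ : ℤ).natAbs = 1 := Int.units_natAbs τ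
  have h' : ∀ (j N' : ℕ), j ≤ 2 → N ≤ N' + j → u (m + τ * j) * v (n - τ * j) =
      ∑ k ∈ Finset.range (N' + 1), gCoeff q 1 k • V (k + j) := by
    intro j N' hj hN'
    rw [h (m + τ * j) (n - τ * j) N' (by
      rcases Int.units_eq_one_or τ with rfl | rfl <;> simp [N] at hN' ⊢ <;> omega)]
    refine Finset.sum_congr rfl fun k _ => ?_
    rw [← Algebra.smul_def]
    simp only [hV]
    congr 3 <;> push_cast <;> ring
  have h0 := h' 0 (N + 2) (by omega) (by omega)
  have h1 := h' 1 (N + 1) (by omega) (by omega)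
  have h2 := h' 2 N (by omega) (by omega)
  simp only [Nat.cast_zero, mul_zero, add_zero, sub_zero, Nat.cast_one, mul_one, Nat.cast_ofNat]
    at h0 h1 h2
  rw [Finset.sum_range_succ', Finset.sum_range_succ'] at h0
  rw [Finset.sum_range_succ'] at h1
  obtain ⟨r0, r1, r2⟩ := gCoeff_recursion hq
  have key : ∑ k ∈ Finset.range (N + 1), ((p₁ q * p₂ q) • gCoeff q 1 (k + 2) • V (k + 2) -
      (p₁ q + p₂ q) • gCoeff q 1 (k + 1) • V (k + 2) + gCoeff q 1 k • V (k + 2)) =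
      (p₁ q * p₂ q) • V 2 := by
    rw [Finset.sum_eq_single 0]
    · rw [smul_smul, smul_smul, ← sub_smul, ← add_smul, r2, if_pos rfl]
    · intro k _ hk
      rw [smul_smul, smul_smul, ← sub_smul, ← add_smul, r2, if_neg hk, zero_smul]
    · simp
  simp only [Finset.sum_add_distrib, Finset.sum_sub_distrib, ← Finset.smul_sum] at key
  have v0 : V 0 = v n * u m := by simp [hV]
  have v1 : V 1 = v (n - τ) * u (m + τ) := by simp [hV]
  have v2 : V 2 = v (n - τ * 2) * u (m + τ * 2) := by simp [hV]
  rw [h0, h1, h2, ← v0, ← v1, ← v2]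
  simp only [smul_add, show ∀ k, k + 1 + 1 = k + 2 from fun _ => rfl, zero_add]
  have e0 : (p₁ q * p₂ q) • gCoeff q 1 0 • V 0 = V 0 := by rw [smul_smul, r0, one_smul]
  have e1 : (p₁ q * p₂ q) • gCoeff q 1 1 • V 1 - (p₁ q + p₂ q) • gCoeff q 1 0 • V 1 =
      -((p₁ q + p₂ q) • V 1) := by rw [smul_smul, smul_smul, ← sub_smul, r1, neg_smul]
  rw [e0, ← key, sub_eq_add_neg (V 0), ← e1]
  abel

/-- An exchange relation with structure function `g` gives a quadratic relation. -/
theorem Exch.quadRel {q : ℂ} (hq : q ≠ 0) {s : ℤˣ} {u v : ℤ → T}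
    (h : Exch s (fun k => algebraMap ℂ T (gCoeff q 1 k)) u v) : QuadRel q s 1 u v := by
  intro m n
  have h1 := p₁_ne_zero hq
  have h2 := p₂_ne_zero hq
  simp only [Fin.sum_univ_three, one_smul]
  have e0 : ∀ m : ℤ, m + 2 - ((0 : Fin 3) : ℕ) = m + 2 := fun m => by simp
  have e1 : ∀ m : ℤ, m + 2 - ((1 : Fin 3) : ℕ) = m + 1 := fun m => by simp; ring
  have e2 : ∀ m : ℤ, m + 2 - ((2 : Fin 3) : ℕ) = m := fun m => by simp
  rw [e0, e1, e2, e0, e1, e2]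
  rcases Int.units_eq_one_or s with rfl | rfl
  · have h3 := h.polynomial hq m (n + 2)
    simp only [fCoeff, Units.val_one, zpow_one, one_mul] at h3 ⊢
    rw [show n + 2 - 1 = n + 1 by ring, show n + 2 - 2 = n by ring] at h3
    simp only [Matrix.cons_val_zero, Matrix.cons_val_one, Matrix.cons_val, one_smul, neg_smul]
    simp
    rw [sub_eq_add_neg, sub_eq_add_neg] at h3
    rw [← h3]
    abel
  · have h3 := h.polynomial hq (m + 2) n
    simp only [fCoeff, Units.val_neg, Units.val_one, zpow_neg, zpow_one, neg_one_mul] at h3 ⊢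
    rw [show m + 2 + -1 = m + 1 by ring, show m + 2 + -2 = m by ring, sub_neg_eq_add,
      sub_neg_eq_add] at h3
    have h4 : p₁ q * p₂ q ≠ 0 := mul_ne_zero h1 h2
    have h5 : Function.Injective fun t : T => (p₁ q * p₂ q) • t := smul_right_injective T h4
    rw [← h5.eq_iff]
    have h6 : p₁ q * p₂ q * ((p₁ q)⁻¹ + (p₂ q)⁻¹) = p₁ q + p₂ q := by field_simp; ring
    have h7 : p₁ q * p₂ q * ((p₁ q)⁻¹ * (p₂ q)⁻¹) = 1 := by field_simp
    simp [smul_smul, smul_add, h6, h7, -neg_add_rev]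
    rw [sub_eq_add_neg, sub_eq_add_neg] at h3
    rw [h3]
    abel

theorem QuadRel.rescale {q : ℂ} {s : ℤˣ} {ε : ℂ} {u v : ℤ → T} (h : QuadRel q s ε u v)
    {p : ℤ → T} (hp : ∀ m n, p (m + n) = p m * p n) (hpc : ∀ m t, Commute (p m) t) :
    QuadRel q s ε (fun m => u m * p m) fun n => v n * p n := by
  intro m n
  have key : ∀ (u v : ℤ → T) (a b : ℤ), u a * p a * (v b * p b) = u a * v b * p (a + b) := by
    intro u v a b
    rw [hp, mul_assoc, ← mul_assoc (p a), (hpc a (v b)).eq]; simp only [mul_assoc]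
  have h1 := congrArg (· * p (m + n + 2)) (h m n)
  simp only [smul_mul_assoc, Finset.sum_mul] at h1
  simp only [key]
  refine (Finset.sum_congr rfl fun i _ => ?_).trans (h1.trans
    (congrArg (ε • ·) (Finset.sum_congr rfl fun i _ => ?_)))
  · rw [show m + 2 - (i : ℕ) + (n + (i : ℕ)) = m + n + 2 by ring]
  · rw [show n + 2 - (i : ℕ) + (m + (i : ℕ)) = m + n + 2 by ring]

/-- A quadratic relation between the first factors. -/
theorem QuadRel.star_left {q : ℂ} {s : ℤˣ} {ε κ κ' : ℂ} {u v u' v' : ℤ → T}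
    (h : QuadRel q s ε u u') (hvv : ∀ m n, Commute (v m) (v' n)) (hst : Starrable u v)
    (hst' : Starrable u' v') (hvu : ∀ m n, v m * u' n = κ • (u' n * v m))
    (huv : ∀ m n, v' m * u n = κ' • (u n * v' m)) (hκ : κ' * κ' = 1) :
    QuadRel q s (ε * κ * κ') (star u v) (star u' v') := by
  intro m n
  ext j
  let _ : TopologicalSpace T := ⊥
  have _ : DiscreteTopology T := ⟨rfl⟩
  simp only [HahnSeries.coeff_sum, HahnSeries.coeff_smul]
  have h1 := hasSum_sum (s := Finset.univ) fun (t : Fin 3) _ =>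
    (hasSum_coeff_mul (star u v (m + 2 - (t : ℕ))) (star u' v' (n + (t : ℕ))) j).const_smul
      (fCoeff q s t)
  have h2 := (hasSum_sum (s := Finset.univ) fun (t : Fin 3) _ =>
    (hasSum_coeff_mul' (star u' v' (n + 2 - (t : ℕ))) (star u v (m + (t : ℕ))) j).const_smul
      (fCoeff q s t)).const_smul (ε * κ * κ')
  refine h1.unique ((congrArg (fun f => HasSum f _) (funext fun i => ?_)).mp h2)
  simp only [star_coeff hst, star_coeff hst']
  have e1 : ∀ a b : ℤ, u a * v i * (u' b * v' (j - i)) = κ • (u a * u' b * (v i * v' (j - i))) := by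
    intro a b
    rw [mul_assoc, ← mul_assoc (v i), hvu]
    simp only [mul_assoc, smul_mul_assoc, mul_smul_comm]
  have e2 : ∀ a b : ℤ, u' b * v' (j - i) * (u a * v i) =
      κ' • (u' b * u a * (v i * v' (j - i))) := by
    intro a b
    rw [mul_assoc, ← mul_assoc (v' _), huv, (hvv i _).eq]
    simp only [mul_assoc, smul_mul_assoc, mul_smul_comm]
  simp only [e1, e2]
  have h3 := congrArg (fun t => κ • (t * (v i * v' (j - i)))) (h (m - i) (n - (j - i)))
  simp only [smul_mul_assoc, Finset.sum_mul, Finset.smul_sum] at h3 ⊢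
  refine ((Finset.sum_congr rfl fun t _ => ?_).trans (h3.trans
    (Finset.sum_congr rfl fun t _ => ?_))).symm
  · rw [show m + 2 - (t : ℕ) - i = m - i + 2 - (t : ℕ) by ring,
      show n + (t : ℕ) - (j - i) = n - (j - i) + (t : ℕ) by ring, smul_comm]
  · rw [show n + 2 - (t : ℕ) - (j - i) = n - (j - i) + 2 - (t : ℕ) by ring,
      show m + (t : ℕ) - i = m - i + (t : ℕ) by ring]
    simp only [smul_smul]
    congr 1
    linear_combination (-ε * κ * fCoeff q s t) * hκ

/-- A quadratic relation between the second factors. -/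
theorem QuadRel.star_right {q : ℂ} {s : ℤˣ} {ε κ κ' : ℂ} {u v u' v' : ℤ → T}
    (h : QuadRel q s ε v v') (huu : ∀ m n, Commute (u m) (u' n)) (hst : Starrable u v)
    (hst' : Starrable u' v') (hvu : ∀ m n, v m * u' n = κ • (u' n * v m))
    (huv : ∀ m n, v' m * u n = κ' • (u n * v' m)) (hκ : κ' * κ' = 1) :
    QuadRel q s (ε * κ * κ') (star u v) (star u' v') := by
  intro m n
  ext j
  let _ : TopologicalSpace T := ⊥
  have _ : DiscreteTopology T := ⟨rfl⟩
  simp only [HahnSeries.coeff_sum, HahnSeries.coeff_smul]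
  have h1 := hasSum_sum (s := Finset.univ) fun (t : Fin 3) _ =>
    ((Equiv.addRight (2 - (t : ℤ))).hasSum_iff.2 (hasSum_coeff_mul (star u v (m + 2 - (t : ℕ)))
      (star u' v' (n + (t : ℕ))) j)).const_smul (fCoeff q s t)
  have h2 := (hasSum_sum (s := Finset.univ) fun (t : Fin 3) _ =>
    ((Equiv.addRight (t : ℤ)).hasSum_iff.2 (hasSum_coeff_mul' (star u' v' (n + 2 - (t : ℕ)))
      (star u v (m + (t : ℕ))) j)).const_smul (fCoeff q s t)).const_smul (ε * κ * κ')
  refine h1.unique ((congrArg (fun f => HasSum f _) (funext fun i => ?_)).mp h2)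
  simp only [star_coeff hst, star_coeff hst', Function.comp_apply, Equiv.coe_addRight]
  have e1 : ∀ a b c d : ℤ, u a * v c * (u' b * v' d) = κ • (u a * u' b * (v c * v' d)) := by
    intro a b c d
    rw [mul_assoc, ← mul_assoc (v c), hvu]
    simp only [mul_assoc, smul_mul_assoc, mul_smul_comm]
  have e2 : ∀ a b c d : ℤ, u' b * v' d * (u a * v c) = κ' • (u a * u' b * (v' d * v c)) := by
    intro a b c d
    rw [mul_assoc, ← mul_assoc (v' _), huv, (huu _ _).eq]
    simp only [mul_assoc, smul_mul_assoc, mul_smul_comm]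
  simp only [e1, e2]
  have h3 := congrArg (fun t => κ • (u (m - i) * u' (n + 2 - j + i) * t)) (h i (j - i - 2))
  simp only [mul_smul_comm, Finset.mul_sum, Finset.smul_sum] at h3 ⊢
  refine ((Finset.sum_congr rfl fun t _ => ?_).trans (h3.trans
    (Finset.sum_congr rfl fun t _ => ?_))).symm
  · rw [show m + 2 - (t : ℕ) - (i + (2 - (t : ℕ))) = m - i by ring,
      show n + (t : ℕ) - (j - (i + (2 - (t : ℕ)))) = n + 2 - j + i by ring,
      show i + (2 - ((t : ℕ) : ℤ)) = i + 2 - (t : ℕ) by ring,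
      show j - (i + 2 - ((t : ℕ) : ℤ)) = j - i - 2 + (t : ℕ) by ring, smul_comm]
  · rw [show n + 2 - (t : ℕ) - (j - (i + (t : ℕ))) = n + 2 - j + i by ring,
      show m + (t : ℕ) - (i + (t : ℕ)) = m - i by ring,
      show j - (i + ((t : ℕ) : ℤ)) = j - i - 2 + 2 - (t : ℕ) by ring]
    simp only [smul_smul]
    congr 1
    linear_combination (-ε * κ * fCoeff q s t) * hκ

/-- Two currents whose exchange factors cancel. -/
theorem star_anticommute {c : ℕ → T} {u v u' v' : ℤ → T} (hu : Truncated 1 u)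
    (hv' : Truncated (-1) v') (h1 : Exch 1 c u u') (h2 : Exch (-1) c v' v)
    (hvu : ∀ m n, v m * u' n = -(u' n * v m)) (huv : ∀ m n, Commute (v' m) (u n))
    (hc : ∀ k t, Commute (c k) t) (m n : ℤ) :
    star u v m * star u' v' n + star u' v' n * star u v m = 0 := by
  have hst : Starrable u v := Or.inl hu
  have hst' : Starrable u' v' := Or.inr hv'
  ext j
  let _ : TopologicalSpace T := ⊥
  have _ : DiscreteTopology T := ⟨rfl⟩
  rw [HahnSeries.coeff_add, HahnSeries.coeff_zero]
  set N : ℕ := m.natAbs + j.natAbs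
  let G : ℕ → ℤ → T := fun k i => c k * (u' (n - j + i - k) * u (m - i + k) * (v i * v' (j - i)))
  have hu0 : ∀ i, 0 < i → u i = 0 := fun i hi => hu i (by simpa using hi)
  have hv0 : ∀ i, i < 0 → v' i = 0 := fun i hi => hv' i (by simpa using hi)
  have hG : ∀ k, ∃ a, HasSum (G k) a := fun k => by
    refine (summable_of_hasFiniteSupport ((Set.finite_Icc m j).subset fun i hi => ?_) :
      Summable (G k))
    by_contra hij
    rw [Set.mem_Icc, not_and_or] at hij
    refine hi ?_
    rcases hij with h | h
    · simp only [G]; rw [hu0 (m - i + k) (by omega)]; simp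
    · simp only [G]; rw [hv0 (j - i) (by omega)]; simp
  choose a ha using hG
  have hs1 : HasSum (fun i => (star u v m).coeff i * (star u' v' n).coeff (j - i))
      (-∑ k ∈ Finset.range (N + 1), a k) := by
    refine (congrArg (fun f => HasSum f _) (funext fun i => ?_)).mp
      (hasSum_sum (s := Finset.range (N + 1)) fun k _ => ha k).neg
    rw [star_coeff hst, star_coeff hst', mul_assoc, ← mul_assoc (v i), hvu]
    by_cases hi : i < m
    · rw [hu0 (m - i) (by omega), zero_mul, neg_eq_zero]
      refine Finset.sum_eq_zero fun k _ => ?_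
      simp only [G]; rw [hu0 (m - i + k) (by omega)]; simp
    by_cases hj : j < i
    · rw [hv0 (j - i) (by omega), mul_zero, mul_zero, neg_eq_zero]
      refine Finset.sum_eq_zero fun k _ => ?_
      simp only [G]; rw [hv0 (j - i) (by omega)]; simp
    rw [neg_mul, mul_neg, neg_inj, mul_assoc (u' _), ← mul_assoc (u _),
      h1 (m - i) (n - (j - i)) N (by omega), Finset.sum_mul]
    refine Finset.sum_congr rfl fun k _ => ?_
    simp only [G, Units.val_one, one_mul, mul_assoc]
    rw [show n - (j - i) - (k : ℤ) = n - j + i - k by ring]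
  have hs2 : HasSum (fun i => (star u' v' n).coeff (j - i) * (star u v m).coeff i)
      (∑ k ∈ Finset.range (N + 1), a k) := by
    refine (congrArg (fun f => HasSum f _) (funext fun i => ?_)).mp
      (hasSum_sum (s := Finset.range (N + 1)) fun k _ =>
        (Equiv.addRight (k : ℤ)).hasSum_iff.2 (ha k))
    rw [star_coeff hst, star_coeff hst', mul_assoc, ← mul_assoc (v' _), (huv _ _).eq]
    simp only [Function.comp_apply, Equiv.coe_addRight]
    by_cases hi : i < m
    · rw [hu0 (m - i) (by omega), zero_mul, zero_mul, mul_zero]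
      refine Finset.sum_eq_zero fun k _ => ?_
      simp only [G]; rw [hu0 (m - (i + k) + k) (by omega)]; simp
    by_cases hj : j < i
    · rw [hv0 (j - i) (by omega), mul_zero, zero_mul, mul_zero]
      refine Finset.sum_eq_zero fun k _ => ?_
      simp only [G]; rw [hv0 (j - (i + k)) (by omega)]; simp
    rw [mul_assoc (u _), h2 (j - i) i N (by omega), Finset.mul_sum, Finset.mul_sum]
    refine Finset.sum_congr rfl fun k _ => ?_
    simp only [G, Units.val_neg, Units.val_one, neg_mul, one_mul, sub_neg_eq_add]
    rw [show n - j + (i + k) - (k : ℤ) = n - (j - i) by ring,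
      show m - (i + k) + (k : ℤ) = m - i by ring, show j - i + -(k : ℤ) = j - (i + k) by ring,
      ← mul_assoc (u _) (c k), ← (hc k (u _)).eq, mul_assoc (c k), ← mul_assoc (u' _) (c k),
      ← (hc k (u' _)).eq]
    simp only [mul_assoc]
  rw [(hasSum_coeff_mul _ _ j).unique hs1, (hasSum_coeff_mul' _ _ j).unique hs2, neg_add_cancel]

end Quadratic

/-! ### Two supercommuting copies of the relations -/

section Pair

variable {T : Type*} [Ring T] [Algebra ℂ T]

/-- Two families of elements that satisfy the relations, supercommute with each other, and whose
central elements `q^{c/2}` are central in the whole algebra. -/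
structure Pair (q : ℂ) (e₁ e₂ : Gen → T) : Prop where
  q_ne : q ≠ 0
  rel₁ : Relations q e₁
  rel₂ : Relations q e₂
  central₁ (t : T) : Commute (e₁ .gam) t
  central₂ (t : T) : Commute (e₂ .gam) t
  comm_left {y : Gen} (hy : y.sign = 1) (z : Gen) : Commute (e₁ y) (e₂ z)
  comm_right (y : Gen) {z : Gen} (hz : z.sign = 1) : Commute (e₁ y) (e₂ z)
  anticomm (s : ℤˣ) (m : ℤ) (s' : ℤˣ) (n : ℤ) :
    e₂ (.x s' n) * e₁ (.x s m) = -(e₁ (.x s m) * e₂ (.x s' n))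

/-- `q^{a m c₁ / 2} q^{b m c₂ / 2}`. -/
def chi (e₁ e₂ : Gen → T) (a b m : ℤ) : T := gamPow e₁ (a * m) * gamPow e₂ (b * m)

/-- The current `u(z q^{-a c₁ / 2 - b c₂ / 2})`. -/
def twistMode (e₁ e₂ : Gen → T) (a b : ℤ) (u : ℤ → T) (m : ℤ) : T := u m * chi e₁ e₂ a b m

/-- The power series `X(t q^{a c₁ / 2 + b c₂ / 2})`. -/
def twist (e₁ e₂ : Gen → T) (a b : ℤ) (X : PowerSeries T) : PowerSeries T :=
  PowerSeries.mk fun k => PowerSeries.coeff k X * chi e₁ e₂ a b k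

/-- The power series `g(t q^{a c₁ / 2 + b c₂ / 2})^s`. -/
def gTwist (q : ℂ) (e₁ e₂ : Gen → T) (s : ℤˣ) (a b : ℤ) : PowerSeries T :=
  PowerSeries.mk fun k => gCoeff q s k • chi e₁ e₂ a b k

/-- The mode family concentrated in degree `0`. -/
def unitMode (m : ℤ) : T := if m = 0 then 1 else 0

variable {q : ℂ} {e₁ e₂ : Gen → T}

theorem Pair.chi_central (h : Pair q e₁ e₂) (a b m : ℤ) (t : T) : Commute (chi e₁ e₂ a b m) t :=
  (h.rel₁.commute_gamPow (h.central₁ t) _).mul_left (h.rel₂.commute_gamPow (h.central₂ t) _)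

theorem Pair.chi_mul (h : Pair q e₁ e₂) (a b m a' b' m' a'' b'' m'' : ℤ)
    (ha : a * m + a' * m' = a'' * m'') (hb : b * m + b' * m' = b'' * m'') :
    chi e₁ e₂ a b m * chi e₁ e₂ a' b' m' = chi e₁ e₂ a'' b'' m'' := by
  simp only [chi]
  rw [← ha, ← hb, h.rel₁.gamPow_add, h.rel₂.gamPow_add, mul_assoc, ← mul_assoc (gamPow e₂ _),
    ← (h.rel₁.commute_gamPow (h.central₁ (gamPow e₂ (b * m))) _).eq]
  simp only [mul_assoc]

theorem chi_zero_right (a b : ℤ) : chi e₁ e₂ a b 0 = 1 := by simp [chi, gamPow_zero]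

theorem chi_zero_zero (m : ℤ) : chi e₁ e₂ 0 0 m = 1 := by simp [chi, gamPow_zero]

theorem Pair.twist_mul (h : Pair q e₁ e₂) (a b : ℤ) (X Y : PowerSeries T) :
    twist e₁ e₂ a b (X * Y) = twist e₁ e₂ a b X * twist e₁ e₂ a b Y := by
  ext k
  simp only [twist, PowerSeries.coeff_mk, PowerSeries.coeff_mul, Finset.sum_mul]
  refine Finset.sum_congr rfl fun ij hij => ?_
  rw [Finset.HasAntidiagonal.mem_antidiagonal] at hij
  rw [← h.chi_mul a b ij.1 a b ij.2 a b k (by rw [← hij]; push_cast; ring)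
    (by rw [← hij]; push_cast; ring), mul_assoc, mul_assoc,
    ← mul_assoc (chi e₁ e₂ a b ij.1), (h.chi_central _ _ _ (PowerSeries.coeff ij.2 Y)).eq]
  simp only [mul_assoc]

theorem Pair.twist_gTwist (h : Pair q e₁ e₂) (s : ℤˣ) (a b a' b' : ℤ) :
    twist e₁ e₂ a b (gTwist q e₁ e₂ s a' b') = gTwist q e₁ e₂ s (a + a') (b + b') := by
  ext k
  simp only [twist, gTwist, PowerSeries.coeff_mk, smul_mul_assoc]
  rw [h.chi_mul a' b' k a b k (a + a') (b + b') k (by ring) (by ring)]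

theorem gCoeff_sum_antidiagonal (hq : q ≠ 0) (s : ℤˣ) (k : ℕ) :
    ∑ ij ∈ Finset.HasAntidiagonal.antidiagonal k, gCoeff q s ij.1 * gCoeff q (-s) ij.2 =
      if k = 0 then 1 else 0 := by
  rw [← PowerSeries.coeff_one]
  have h : gSeries q * (gSeries q)⁻¹ = 1 := gSeries_mul_inv hq
  rcases Int.units_eq_one_or s with rfl | rfl
  · rw [← h, PowerSeries.coeff_mul]
    simp [gCoeff]
  · rw [← h, mul_comm, PowerSeries.coeff_mul]
    simp [gCoeff]

theorem Pair.gTwist_mul_neg (h : Pair q e₁ e₂) (s : ℤˣ) (a b : ℤ) :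
    gTwist q e₁ e₂ s a b * gTwist q e₁ e₂ (-s) a b = 1 := by
  ext k
  simp only [gTwist, PowerSeries.coeff_mk, PowerSeries.coeff_mul, PowerSeries.coeff_one,
    smul_mul_smul_comm]
  have : ∀ ij ∈ Finset.HasAntidiagonal.antidiagonal k, (gCoeff q s ij.1 * gCoeff q (-s) ij.2) •
      (chi e₁ e₂ a b ij.1 * chi e₁ e₂ a b ij.2) =
      (gCoeff q s ij.1 * gCoeff q (-s) ij.2) • chi e₁ e₂ a b k := by
    intro ij hij
    rw [Finset.HasAntidiagonal.mem_antidiagonal] at hij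
    rw [h.chi_mul a b ij.1 a b ij.2 a b k (by rw [← hij]; push_cast; ring)
      (by rw [← hij]; push_cast; ring)]
  rw [Finset.sum_congr rfl this, ← Finset.sum_smul, gCoeff_sum_antidiagonal h.q_ne]
  split_ifs with hk
  · subst hk; simp [chi_zero_right]
  · rw [zero_smul]

theorem Pair.gTwist_comm (h : Pair q e₁ e₂) (s s' : ℤˣ) (a b a' b' : ℤ) :
    gTwist q e₁ e₂ s a b * gTwist q e₁ e₂ s' a' b' =
      gTwist q e₁ e₂ s' a' b' * gTwist q e₁ e₂ s a b := by
  ext k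
  rw [PowerSeries.coeff_mul, PowerSeries.coeff_mul]
  refine Finset.sum_nbij' Prod.swap Prod.swap (fun ij hij => ?_) (fun ij hij => ?_)
    (fun _ _ => rfl) (fun _ _ => rfl) fun ij _ => ?_
  · rw [Finset.HasAntidiagonal.mem_antidiagonal] at *; rw [← hij, add_comm]; rfl
  · rw [Finset.HasAntidiagonal.mem_antidiagonal] at *; rw [← hij, add_comm]; rfl
  simp only [gTwist, PowerSeries.coeff_mk, Prod.fst_swap, Prod.snd_swap, smul_mul_smul_comm,
    (h.chi_central a b _ (chi e₁ e₂ a' b' _)).eq, mul_comm (gCoeff q s _)]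

theorem Pair.coeff_central (h : Pair q e₁ e₂) (s : ℤˣ) (a b : ℤ) (k : ℕ) (t : T) :
    Commute (PowerSeries.coeff k (gTwist q e₁ e₂ s a b)) t := by
  rw [gTwist, PowerSeries.coeff_mk]
  exact (h.chi_central _ _ _ _).smul_left _

/-- Power series with central coefficients. -/
def CentralSeries (X : PowerSeries T) : Prop := ∀ k t, Commute (PowerSeries.coeff k X) t

theorem CentralSeries.mul {X Y : PowerSeries T} (hX : CentralSeries X) (hY : CentralSeries Y) :
    CentralSeries (X * Y) := by
  intro k t
  rw [PowerSeries.coeff_mul]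
  exact Commute.sum_left _ _ _ fun ij _ => (hX _ t).mul_left (hY _ t)

theorem centralSeries_one : CentralSeries (1 : PowerSeries T) := by
  intro k t
  rw [PowerSeries.coeff_one]
  split_ifs
  · exact Commute.one_left t
  · exact Commute.zero_left t

theorem Pair.centralSeries (h : Pair q e₁ e₂) (s : ℤˣ) (a b : ℤ) :
    CentralSeries (gTwist q e₁ e₂ s a b) := fun k t => h.coeff_central s a b k t

/-- An exchange relation whose structure function is given as a power series. -/
def ExchS (τ : ℤˣ) (X : PowerSeries T) (u v : ℤ → T) : Prop :=
  Exch τ (fun k => PowerSeries.coeff k X) u v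

theorem Pair.twist_exch (h : Pair q e₁ e₂) {τ : ℤˣ} {X : PowerSeries T} {u v : ℤ → T}
    (hx : ExchS τ X u v) (a b a' b' : ℤ) :
    ExchS τ (twist e₁ e₂ (τ * (a' - a)) (τ * (b' - b)) X) (twistMode e₁ e₂ a b u)
      (twistMode e₁ e₂ a' b' v) := by
  have := Exch.rescale hx (p := chi e₁ e₂ a b) (r := chi e₁ e₂ a' b')
    (fun m n => (h.chi_mul _ _ _ _ _ _ _ _ _ (by ring) (by ring)).symm)
    (fun m n => (h.chi_mul _ _ _ _ _ _ _ _ _ (by ring) (by ring)).symm)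
    (fun m t => h.chi_central _ _ _ _) (fun m t => h.chi_central _ _ _ _)
  refine (congrArg (fun c => Exch τ c _ _) (funext fun k => ?_)).mp this
  rw [twist, PowerSeries.coeff_mk]
  congr 1
  exact h.chi_mul _ _ _ _ _ _ _ _ _ (by ring) (by ring)

theorem exchS_one {τ : ℤˣ} {u v : ℤ → T} (h : ∀ m n, Commute (u m) (v n)) : ExchS τ 1 u v := by
  intro m n N _
  rw [Finset.sum_eq_single 0]
  · simpa using (h m n).eq
  · intro k _ hk
    dsimp only
    rw [PowerSeries.coeff_one, if_neg hk, zero_mul]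
  · simp

theorem ExchS.inv {τ : ℤˣ} {X Y : PowerSeries T} {u v : ℤ → T} (h : ExchS τ X u v)
    (hu : Truncated τ u) (hv : Truncated (-τ) v) (hXY : Y * X = 1) : ExchS (-τ) Y v u := by
  intro m n N hN
  have h1 : ∀ k ∈ Finset.range (N + 1), PowerSeries.coeff k Y *
      (u (n - (-τ : ℤˣ) * k) * v (m + (-τ : ℤˣ) * k)) =
      ∑ l ∈ Finset.range (N + n.natAbs + 1), PowerSeries.coeff k Y * (PowerSeries.coeff l X *
        (v (m - τ * (k + l : ℕ)) * u (n + τ * (k + l : ℕ)))) := by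
    intro k hk
    rw [Finset.mem_range] at hk
    rw [h _ _ (N + n.natAbs), Finset.mul_sum]
    · refine Finset.sum_congr rfl fun l _ => ?_
      congr 4 <;> push_cast <;> ring
    · rcases Int.units_eq_one_or τ with rfl | rfl <;> simp <;> omega
  rw [Finset.sum_congr rfl h1]
  have h2 : ∀ k l : ℕ, N < k + l → PowerSeries.coeff k Y * (PowerSeries.coeff l X *
        (v (m - τ * (k + l : ℕ)) * u (n + τ * (k + l : ℕ)))) = 0 := by
    intro k l hkl
    rw [hv (m - τ * (k + l : ℕ)), zero_mul, mul_zero, mul_zero]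
    rcases Int.units_eq_one_or τ with rfl | rfl <;> simp <;> omega
  have h3 : ∀ k ∈ Finset.range (N + 1), ∑ l ∈ Finset.range (N + n.natAbs + 1),
      PowerSeries.coeff k Y * (PowerSeries.coeff l X *
        (v (m - τ * (k + l : ℕ)) * u (n + τ * (k + l : ℕ)))) =
      ∑ l ∈ Finset.range (N + 1), PowerSeries.coeff k Y * (PowerSeries.coeff l X *
        (v (m - τ * (k + l : ℕ)) * u (n + τ * (k + l : ℕ)))) := by
    intro k _
    refine (Finset.sum_subset (fun r hr => ?_) fun l _ hl => h2 k l ?_).symm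
    · simp only [Finset.mem_range] at *; omega
    · simp only [Finset.mem_range] at hl; omega
  rw [Finset.sum_congr rfl h3, ← sum_range_antidiagonal h2]
  rw [Finset.sum_eq_single 0]
  · have := congrArg (PowerSeries.coeff 0) hXY
    rw [PowerSeries.coeff_mul, PowerSeries.coeff_one, if_pos rfl] at this
    simp only [Finset.HasAntidiagonal.antidiagonal_zero, Finset.sum_singleton] at this ⊢
    rw [← mul_assoc, this]
    simp
  · intro K _ hK
    have := congrArg (PowerSeries.coeff K) hXY
    rw [PowerSeries.coeff_mul, PowerSeries.coeff_one, if_neg hK] at this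
    have h4 : ∀ kl ∈ Finset.HasAntidiagonal.antidiagonal K, PowerSeries.coeff kl.1 Y *
        (PowerSeries.coeff kl.2 X * (v (m - τ * (kl.1 + kl.2 : ℕ)) *
          u (n + τ * (kl.1 + kl.2 : ℕ)))) =
        PowerSeries.coeff kl.1 Y * PowerSeries.coeff kl.2 X * (v (m - τ * K) * u (n + τ * K)) := by
      intro kl hkl
      rw [Finset.HasAntidiagonal.mem_antidiagonal] at hkl
      rw [hkl, mul_assoc]
    rw [Finset.sum_congr rfl h4, ← Finset.sum_mul, this, zero_mul]
  · simp

theorem ExchS.star {τ : ℤˣ} {X Y : PowerSeries T} {u v u' v' : ℤ → T} (hu : Truncated τ u)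
    (hv : Truncated τ v) (hst : Starrable u v) (hst' : Starrable u' v') (h1 : ExchS τ X u u')
    (h2 : ExchS τ Y v v') (hvu : ∀ m n, Commute (v m) (u' n)) (huv : ∀ m n, Commute (u m) (v' n))
    (hY : CentralSeries Y) :
    Exch τ (fun K => HahnSeries.C (PowerSeries.coeff K (X * Y))) (star u v) (star u' v') := by
  have h := Exch.star hu hv hst hst' h1 h2 hvu huv hY
  refine (congrArg (fun c => Exch τ c _ _) (funext fun K => ?_)).mp h
  rw [PowerSeries.coeff_mul]

theorem Exch.add_right {R : Type*} [Ring R] {τ : ℤˣ} {c : ℕ → R} {u v v' : ℤ → R}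
    (h : Exch τ c u v) (h' : Exch τ c u v') : Exch τ c u fun n => v n + v' n := by
  intro m n N hN
  simp only [mul_add, add_mul, Finset.sum_add_distrib, h m n N hN, h' m n N hN]

end Pair

/-! ### The coproduct on the generators -/

section Coprod

variable {T : Type*} [Ring T] [Algebra ℂ T] {q : ℂ}

/-- The summand of `Δ(x^±(z))` concentrated on the first copy of `x^±`. -/
def xLeft (e₁ e₂ : Gen → T) (s : ℤˣ) : ℤ → HahnSeries ℤ T :=
  if s = 1 then star (fun m => e₁ (.x 1 m)) unitMode
  else star (twistMode e₁ e₂ 0 (-2) fun m => e₁ (.x (-1) m)) (twistMode e₁ e₂ 0 (-1) (psi e₂))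

/-- The summand of `Δ(x^±(z))` concentrated on the second copy of `x^±`. -/
def xRight (e₁ e₂ : Gen → T) (s : ℤˣ) : ℤ → HahnSeries ℤ T :=
  if s = 1 then star (twistMode e₁ e₂ (-1) 0 (phi e₁)) (twistMode e₁ e₂ (-2) 0 fun m => e₂ (.x 1 m))
  else star unitMode fun m => e₂ (.x (-1) m)

/-- The images of the generators under the coproduct. -/
def coprodGen (e₁ e₂ : Gen → T) : Gen → HahnSeries ℤ T
  | .gam => HahnSeries.C (e₁ .gam * e₂ .gam)
  | .gamInv => HahnSeries.C (e₁ .gamInv * e₂ .gamInv)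
  | .k => HahnSeries.C (e₁ .k * e₂ .k)
  | .kInv => HahnSeries.C (e₁ .kInv * e₂ .kInv)
  | .a n => HahnSeries.single 0 (e₁ (.a n) * gamPow e₂ (-(n + 1))) +
      HahnSeries.single (-(n + 1) : ℤ) (gamPow e₁ (n + 1) * e₂ (.a n))
  | .b n => HahnSeries.single 0 (e₁ (.b n) * gamPow e₂ (-(n + 1))) +
      HahnSeries.single ((n + 1) : ℤ) (gamPow e₁ (n + 1) * e₂ (.b n))
  | .x s n => xLeft e₁ e₂ s n + xRight e₁ e₂ s n

/-- Constant Laurent series, as a homomorphism of algebras. -/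
def constHom (T : Type*) [Ring T] [Algebra ℂ T] : T →ₐ[ℂ] HahnSeries ℤ T :=
  { (HahnSeries.C : T →+* HahnSeries ℤ T) with commutes' := fun _ => rfl }

theorem commute_single {i j : ℤ} {x y : T} (h : Commute x y) :
    Commute (HahnSeries.single i x) (HahnSeries.single j y) := by
  rw [Commute, SemiconjBy, HahnSeries.single_mul_single, HahnSeries.single_mul_single, h.eq,
    add_comm]

/-- The exponential of a sum of a series in the first copy and a series in the second copy. -/
theorem expCoeff_split {A : PowerSeries (HahnSeries ℤ T)} {A₁ A₂ : PowerSeries T} {c d : T}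
    {τ : ℤ} (hc : ∀ y, Commute c y) (hd : ∀ y, Commute d y)
    (h₁ : PowerSeries.coeff 0 A₁ = 0) (h₂ : PowerSeries.coeff 0 A₂ = 0)
    (h₁₂ : ∀ i j, Commute (PowerSeries.coeff i A₁) (PowerSeries.coeff j A₂))
    (hA : ∀ n, PowerSeries.coeff n A = HahnSeries.single 0 (c ^ n * PowerSeries.coeff n A₁) +
      HahnSeries.single (τ * n) (d ^ n * PowerSeries.coeff n A₂)) (n : ℕ) :
    expCoeff A n = ∑ ij ∈ Finset.HasAntidiagonal.antidiagonal n,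
      HahnSeries.single (τ * ij.2)
        (c ^ ij.1 * expCoeff A₁ ij.1 * (d ^ ij.2 * expCoeff A₂ ij.2)) := by
  set B₁ : PowerSeries (HahnSeries ℤ T) :=
    PowerSeries.mk fun n => HahnSeries.single 0 (c ^ n * PowerSeries.coeff n A₁) with hB₁
  set B₂ : PowerSeries (HahnSeries ℤ T) :=
    PowerSeries.mk fun n => HahnSeries.single (τ * n) (d ^ n * PowerSeries.coeff n A₂) with hB₂
  have hAB : A = B₁ + B₂ := by
    ext1 n
    rw [hA, map_add, hB₁, hB₂, PowerSeries.coeff_mk, PowerSeries.coeff_mk]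
  have hcomm : Commute B₁ B₂ := by
    ext1 n
    rw [PowerSeries.coeff_mul, PowerSeries.coeff_mul]
    refine Finset.sum_nbij' Prod.swap Prod.swap (fun ij hij => ?_) (fun ij hij => ?_)
      (fun _ _ => rfl) (fun _ _ => rfl) fun ij _ => ?_
    · rw [Finset.HasAntidiagonal.mem_antidiagonal] at *; rw [← hij, add_comm]; rfl
    · rw [Finset.HasAntidiagonal.mem_antidiagonal] at *; rw [← hij, add_comm]; rfl
    · simp only [hB₁, hB₂, PowerSeries.coeff_mk, Prod.fst_swap, Prod.snd_swap]
      refine commute_single ?_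
      exact ((hc _).pow_left _).mul_left (((hd _).pow_left _).symm.mul_right (h₁₂ _ _))
  have e₁ : ∀ n, expCoeff B₁ n = HahnSeries.single 0 (c ^ n * expCoeff A₁ n) := by
    intro n
    rw [expCoeff_scale (c := HahnSeries.C c) (A := PowerSeries.map (constHom T : T →+* _) A₁)
      (fun y => commute_C fun j => hc _)]
    · rw [← map_expCoeff, ← map_pow]
      exact (map_mul HahnSeries.C _ _).symm
    · intro n
      rw [hB₁, PowerSeries.coeff_mk, PowerSeries.coeff_map, ← map_pow]
      exact map_mul HahnSeries.C _ _
  have hd' : ∀ y : HahnSeries ℤ T, Commute (HahnSeries.single τ d) y := by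
    intro y
    ext j
    have h := HahnSeries.coeff_single_mul_add (r := d) (x := y) (a := j - τ) (b := τ)
    have h' := HahnSeries.coeff_mul_single_add (r := d) (x := y) (a := j - τ) (b := τ)
    rw [sub_add_cancel] at h h'
    rw [h, h', (hd _).eq]
  have e₂ : ∀ n, expCoeff B₂ n = HahnSeries.single (τ * n) (d ^ n * expCoeff A₂ n) := by
    intro n
    have hp : ∀ n : ℕ, (HahnSeries.single τ d) ^ n = HahnSeries.single (τ * n) (d ^ n) := by
      intro n
      rw [HahnSeries.single_pow, nsmul_eq_mul, mul_comm]
    have hm : ∀ (n : ℕ) (t : T), HahnSeries.single (τ * n) (d ^ n) * HahnSeries.C t =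
        HahnSeries.single (τ * n) (d ^ n * t) := by
      intro n t
      rw [HahnSeries.C_apply, HahnSeries.single_mul_single, add_zero]
    rw [expCoeff_scale (c := HahnSeries.single τ d)
      (A := PowerSeries.map (constHom T : T →+* _) A₂) hd']
    · rw [← map_expCoeff, hp]
      exact hm _ _
    · intro n
      rw [hB₂, PowerSeries.coeff_mk, PowerSeries.coeff_map, hp]
      exact (hm _ _).symm
  rw [hAB, expCoeff_add _ _ hcomm]
  · refine Finset.sum_congr rfl fun ij _ => ?_
    rw [e₁, e₂, HahnSeries.single_mul_single, zero_add]
  · rw [hB₁, PowerSeries.coeff_mk, h₁, mul_zero, HahnSeries.single_eq_zero]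
  · rw [hB₂, PowerSeries.coeff_mk, h₂, mul_zero, HahnSeries.single_eq_zero]

variable {e₁ e₂ : Gen → T}

theorem Pair.comm_phi_left (h : Pair q e₁ e₂) (m : ℤ) (z : Gen) : Commute (phi e₁ m) (e₂ z) :=
  (commute_phi_of_commute (h.comm_left rfl z).symm (fun _ => (h.comm_left rfl z).symm) m).symm

theorem Pair.comm_psi_left (h : Pair q e₁ e₂) (m : ℤ) (z : Gen) : Commute (psi e₁ m) (e₂ z) :=
  (commute_psi_of_commute (h.comm_left rfl z).symm (fun _ => (h.comm_left rfl z).symm) m).symm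

theorem Pair.comm_phi_right (h : Pair q e₁ e₂) (y : Gen) (m : ℤ) : Commute (e₁ y) (phi e₂ m) :=
  commute_phi_of_commute (h.comm_right y rfl) (fun _ => h.comm_right y rfl) m

theorem Pair.comm_psi_right (h : Pair q e₁ e₂) (y : Gen) (m : ℤ) : Commute (e₁ y) (psi e₂ m) :=
  commute_psi_of_commute (h.comm_right y rfl) (fun _ => h.comm_right y rfl) m

theorem Pair.comm_phi_phi (h : Pair q e₁ e₂) (m n : ℤ) : Commute (phi e₁ m) (phi e₂ n) :=
  commute_phi_of_commute (h.comm_phi_left m _) (fun _ => h.comm_phi_left m _) n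

theorem Pair.comm_phi_psi (h : Pair q e₁ e₂) (m n : ℤ) : Commute (phi e₁ m) (psi e₂ n) :=
  commute_psi_of_commute (h.comm_phi_left m _) (fun _ => h.comm_phi_left m _) n

theorem Pair.comm_psi_phi (h : Pair q e₁ e₂) (m n : ℤ) : Commute (psi e₁ m) (phi e₂ n) :=
  commute_phi_of_commute (h.comm_psi_left m _) (fun _ => h.comm_psi_left m _) n

theorem Pair.comm_psi_psi (h : Pair q e₁ e₂) (m n : ℤ) : Commute (psi e₁ m) (psi e₂ n) :=
  commute_psi_of_commute (h.comm_psi_left m _) (fun _ => h.comm_psi_left m _) n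

theorem Pair.twistMode_comm (h : Pair q e₁ e₂) {u v : ℤ → T} (huv : ∀ m n, Commute (u m) (v n))
    (a b a' b' : ℤ) (m n : ℤ) :
    Commute (twistMode e₁ e₂ a b u m) (twistMode e₁ e₂ a' b' v n) :=
  ((huv m n).mul_right (h.chi_central _ _ _ _).symm).mul_left (h.chi_central _ _ _ _)

theorem truncated_phi (e : Gen → T) : Truncated 1 (phi e) := fun m hm =>
  phi_of_pos e (by simpa using hm)

theorem truncated_psi (e : Gen → T) : Truncated (-1) (psi e) := fun m hm =>
  psi_of_neg e (by simpa using hm)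

theorem Truncated.twistMode {τ : ℤˣ} {u : ℤ → T} (hu : Truncated τ u) (a b : ℤ) :
    Truncated τ (twistMode e₁ e₂ a b u) := fun m hm => by
  rw [SuperCurrent.twistMode, hu m hm, zero_mul]

theorem truncated_unitMode (τ : ℤˣ) : Truncated τ (unitMode : ℤ → T) := fun m hm => by
  rw [unitMode, if_neg]
  rintro rfl
  simp at hm

theorem commute_unitMode (u : T) (n : ℤ) : Commute u (unitMode n) := by
  rw [unitMode]
  split_ifs
  · exact Commute.one_right u
  · exact Commute.zero_right u

/-- `Δ(φ(z)) = φ(z q^{-c₂/2}) ⊗ φ(z q^{c₁/2})`. -/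
theorem Pair.phi_coprodGen (h : Pair q e₁ e₂) :
    phi (coprodGen e₁ e₂) =
      star (twistMode e₁ e₂ 0 1 (phi e₁)) (twistMode e₁ e₂ (-1) 0 (phi e₂)) := by
  have hst : Starrable (twistMode e₁ e₂ 0 1 (phi e₁)) (twistMode e₁ e₂ (-1) 0 (phi e₂)) :=
    Or.inl ((truncated_phi e₁).twistMode _ _)
  funext m
  rcases lt_or_ge 0 m with hm | hm
  · rw [phi_of_pos _ hm, star_eq_zero ((truncated_phi e₁).twistMode _ _)
      ((truncated_phi e₂).twistMode _ _) hst m (by simpa using hm)]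
  obtain ⟨n, rfl⟩ : ∃ n : ℕ, m = -n := ⟨m.natAbs, by omega⟩
  have hd : ∀ y, Commute (e₂ .gamInv) y := fun y => by
    have := h.rel₂.commute_gamPow (h.central₂ y) (-1)
    rwa [show (-1 : ℤ) = -((1 : ℕ) : ℤ) from rfl, h.rel₂.gamPow_neg_natCast, pow_one] at this
  rw [phi_neg_natCast, expCoeff_split (A₁ := aSeries e₁) (A₂ := aSeries e₂) (c := e₂ .gamInv)
    (d := e₁ .gam) (τ := -1) hd h.central₁
    (coeff_zero_aSeries _) (coeff_zero_aSeries _)]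
  · ext j
    rw [star_coeff hst]
    simp only [coprodGen]
    rw [coeff_C_mul', HahnSeries.coeff_sum]
    simp only [HahnSeries.coeff_single, Finset.mul_sum]
    by_cases hj : -(n : ℤ) ≤ j ∧ j ≤ 0
    · obtain ⟨l, rfl⟩ : ∃ l : ℕ, j = -l := ⟨j.natAbs, by omega⟩
      obtain ⟨i, rfl⟩ : ∃ i : ℕ, n = i + l := ⟨n - l, by omega⟩
      rw [Finset.sum_eq_single (i, l)]
      · rw [if_pos (by ring)]
        rw [show -((i + l : ℕ) : ℤ) - -(l : ℤ) = -(i : ℤ) by push_cast; ring]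
        simp only [twistMode, phi_neg_natCast, chi, zero_mul, gamPow_zero, one_mul, mul_one]
        rw [neg_one_mul, neg_neg, gamPow_natCast, h.rel₂.gamPow_neg_natCast,
          ((hd (expCoeff (aSeries e₁) i)).pow_left i).eq,
          ((h.central₁ (expCoeff (aSeries e₂) l)).pow_left l).eq]
        have h1 : Commute (e₂ .k) (expCoeff (aSeries e₁) i * e₂ .gamInv ^ i) := by
          refine Commute.mul_right ?_ ((hd _).pow_left _).symm
          refine (Subalgebra.mem_centralizer_iff ℂ).1
            (expCoeff_mem (Subalgebra.centralizer ℂ {e₂ .k}) (fun i => ?_) _) _ rfl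
          rw [Subalgebra.mem_centralizer_iff]
          rintro z rfl
          cases i with
          | zero => rw [coeff_zero_aSeries, zero_mul, mul_zero]
          | succ i => rw [coeff_succ_aSeries]; exact (h.comm_left rfl _).symm
        rw [mul_assoc (e₁ .k), ← mul_assoc (e₂ .k), h1.eq]
        simp only [mul_assoc]
      · rintro ⟨a, b⟩ hab hne
        rw [Finset.HasAntidiagonal.mem_antidiagonal] at hab
        rw [if_neg, mul_zero]
        intro hl
        refine hne ?_
        simp only [Prod.mk.injEq]
        dsimp only at hab hl
        omega
      · intro hnot
        exact (hnot (by rw [Finset.HasAntidiagonal.mem_antidiagonal])).elim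
    · rw [Finset.sum_eq_zero]
      · symm
        rw [not_and_or] at hj
        rcases hj with hj | hj
        · rw [twistMode, phi_of_pos _ (by omega), zero_mul, zero_mul]
        · rw [twistMode, twistMode, phi_of_pos (m := j) _ (by omega), zero_mul, mul_zero]
      · rintro ⟨a, b⟩ hab
        rw [Finset.HasAntidiagonal.mem_antidiagonal] at hab
        rw [if_neg, mul_zero]
        dsimp only at hab ⊢
        omega
  · intro i j
    cases i with
    | zero => rw [coeff_zero_aSeries]; exact Commute.zero_left _
    | succ i =>
      cases j with
      | zero => rw [coeff_zero_aSeries]; exact Commute.zero_right _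
      | succ j => rw [coeff_succ_aSeries, coeff_succ_aSeries]; exact h.comm_left rfl _
  · intro n
    cases n with
    | zero => simp [coeff_zero_aSeries]
    | succ n =>
      simp only [coeff_succ_aSeries, coprodGen]
      rw [((hd (e₁ (.a n))).pow_left (n + 1)).eq, ← h.rel₂.gamPow_neg_natCast, ← gamPow_natCast]
      push_cast
      rw [neg_one_mul]

/-- `Δ(ψ(z)) = ψ(z q^{c₂/2}) ⊗ ψ(z q^{-c₁/2})`. -/
theorem Pair.psi_coprodGen (h : Pair q e₁ e₂) :
    psi (coprodGen e₁ e₂) =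
      star (twistMode e₁ e₂ 0 (-1) (psi e₁)) (twistMode e₁ e₂ 1 0 (psi e₂)) := by
  have hst : Starrable (twistMode e₁ e₂ 0 (-1) (psi e₁)) (twistMode e₁ e₂ 1 0 (psi e₂)) :=
    Or.inr ((truncated_psi e₂).twistMode _ _)
  funext m
  rcases lt_or_ge m 0 with hm | hm
  · rw [psi_of_neg _ hm, star_eq_zero ((truncated_psi e₁).twistMode _ _)
      ((truncated_psi e₂).twistMode _ _) hst m (by simpa using hm)]
  obtain ⟨n, rfl⟩ : ∃ n : ℕ, m = n := ⟨m.natAbs, by omega⟩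
  have hd : ∀ y, Commute (e₂ .gamInv) y := fun y => by
    have := h.rel₂.commute_gamPow (h.central₂ y) (-1)
    rwa [show (-1 : ℤ) = -((1 : ℕ) : ℤ) from rfl, h.rel₂.gamPow_neg_natCast, pow_one] at this
  rw [psi_natCast, expCoeff_split (A₁ := bSeries e₁) (A₂ := bSeries e₂) (c := e₂ .gamInv)
    (d := e₁ .gam) (τ := 1) hd h.central₁
    (coeff_zero_bSeries _) (coeff_zero_bSeries _)]
  · ext j
    rw [star_coeff hst]
    simp only [coprodGen]
    rw [coeff_C_mul', HahnSeries.coeff_sum]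
    simp only [HahnSeries.coeff_single, Finset.mul_sum]
    by_cases hj : 0 ≤ j ∧ j ≤ n
    · obtain ⟨l, rfl⟩ : ∃ l : ℕ, j = l := ⟨j.natAbs, by omega⟩
      obtain ⟨i, rfl⟩ : ∃ i : ℕ, n = i + l := ⟨n - l, by omega⟩
      rw [Finset.sum_eq_single (i, l)]
      · rw [if_pos (by ring)]
        rw [show ((i + l : ℕ) : ℤ) - (l : ℤ) = (i : ℤ) by push_cast; ring]
        simp only [twistMode, psi_natCast, chi, zero_mul, gamPow_zero, one_mul, mul_one]
        rw [neg_one_mul, gamPow_natCast, h.rel₂.gamPow_neg_natCast,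
          ((hd (expCoeff (bSeries e₁) i)).pow_left i).eq,
          ((h.central₁ (expCoeff (bSeries e₂) l)).pow_left l).eq]
        have h1 : Commute (e₂ .kInv) (expCoeff (bSeries e₁) i * e₂ .gamInv ^ i) := by
          refine Commute.mul_right ?_ ((hd _).pow_left _).symm
          refine (Subalgebra.mem_centralizer_iff ℂ).1
            (expCoeff_mem (Subalgebra.centralizer ℂ {e₂ .kInv}) (fun i => ?_) _) _ rfl
          rw [Subalgebra.mem_centralizer_iff]
          rintro z rfl
          cases i with
          | zero => rw [coeff_zero_bSeries, zero_mul, mul_zero]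
          | succ i => rw [coeff_succ_bSeries]; exact (h.comm_left rfl _).symm
        rw [mul_assoc (e₁ .kInv), ← mul_assoc (e₂ .kInv), h1.eq]
        simp only [mul_assoc]
      · rintro ⟨a, b⟩ hab hne
        rw [Finset.HasAntidiagonal.mem_antidiagonal] at hab
        rw [if_neg, mul_zero]
        intro hl
        refine hne ?_
        simp only [Prod.mk.injEq]
        dsimp only at hab hl
        omega
      · intro hnot
        exact (hnot (by rw [Finset.HasAntidiagonal.mem_antidiagonal])).elim
    · rw [Finset.sum_eq_zero]
      · symm
        rw [not_and_or] at hj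
        rcases hj with hj | hj
        · rw [twistMode, twistMode, psi_of_neg (m := j) _ (by omega), zero_mul, mul_zero]
        · rw [twistMode, psi_of_neg _ (by omega), zero_mul, zero_mul]
      · rintro ⟨a, b⟩ hab
        rw [Finset.HasAntidiagonal.mem_antidiagonal] at hab
        rw [if_neg, mul_zero]
        dsimp only at hab ⊢
        omega
  · intro i j
    cases i with
    | zero => rw [coeff_zero_bSeries]; exact Commute.zero_left _
    | succ i =>
      cases j with
      | zero => rw [coeff_zero_bSeries]; exact Commute.zero_right _
      | succ j => rw [coeff_succ_bSeries, coeff_succ_bSeries]; exact h.comm_left rfl _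
  · intro n
    cases n with
    | zero => simp [coeff_zero_bSeries]
    | succ n =>
      simp only [coeff_succ_bSeries, coprodGen]
      rw [((hd (e₁ (.b n))).pow_left (n + 1)).eq, ← h.rel₂.gamPow_neg_natCast, ← gamPow_natCast]
      push_cast
      rw [one_mul]

end Coprod

section Coprod

variable {T : Type*} [Ring T] [Algebra ℂ T] {q : ℂ} {e₁ e₂ : Gen → T}

/-! #### Exchange relations within one copy -/

theorem Pair.phi_x₁ (h : Pair q e₁ e₂) (s : ℤˣ) :
    ExchS 1 (gTwist q e₁ e₂ s (-s) 0) (phi e₁) fun n => e₁ (.x s n) := by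
  refine Exch.of_natAbs (truncated_phi e₁) fun m n => ?_
  rw [h.rel₁.phi_x]
  refine Finset.sum_congr rfl fun k _ => ?_
  simp [gTwist, chi, gamPow_zero]

theorem Pair.phi_x₂ (h : Pair q e₁ e₂) (s : ℤˣ) :
    ExchS 1 (gTwist q e₁ e₂ s 0 (-s)) (phi e₂) fun n => e₂ (.x s n) := by
  refine Exch.of_natAbs (truncated_phi e₂) fun m n => ?_
  rw [h.rel₂.phi_x]
  refine Finset.sum_congr rfl fun k _ => ?_
  simp [gTwist, chi, gamPow_zero]

theorem Pair.psi_x₁ (h : Pair q e₁ e₂) (s : ℤˣ) :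
    ExchS (-1) (gTwist q e₁ e₂ (-s) (-s) 0) (psi e₁) fun n => e₁ (.x s n) := by
  refine Exch.of_natAbs (truncated_psi e₁) fun m n => ?_
  rw [h.rel₁.psi_x]
  refine Finset.sum_congr rfl fun k _ => ?_
  simp [gTwist, chi, gamPow_zero, sub_eq_add_neg]

theorem Pair.psi_x₂ (h : Pair q e₁ e₂) (s : ℤˣ) :
    ExchS (-1) (gTwist q e₁ e₂ (-s) 0 (-s)) (psi e₂) fun n => e₂ (.x s n) := by
  refine Exch.of_natAbs (truncated_psi e₂) fun m n => ?_
  rw [h.rel₂.psi_x]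
  refine Finset.sum_congr rfl fun k _ => ?_
  simp [gTwist, chi, gamPow_zero, sub_eq_add_neg]

theorem Pair.gRatio₁ (h : Pair q e₁ e₂) (k : ℕ) :
    gRatio q e₁ k = PowerSeries.coeff k
      (gTwist q e₁ e₂ 1 (-2) 0 * gTwist q e₁ e₂ (-1) 2 0) := by
  rw [gRatio, PowerSeries.coeff_mul]
  refine Finset.sum_congr rfl fun ij _ => ?_
  simp only [gTwist, PowerSeries.coeff_mk, smul_mul_smul_comm, chi, zero_mul, gamPow_zero, mul_one]
  rw [← h.rel₁.gamPow_add]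
  congr 2
  ring

theorem Pair.gRatio₂ (h : Pair q e₁ e₂) (k : ℕ) :
    gRatio q e₂ k = PowerSeries.coeff k
      (gTwist q e₁ e₂ 1 0 (-2) * gTwist q e₁ e₂ (-1) 0 2) := by
  rw [gRatio, PowerSeries.coeff_mul]
  refine Finset.sum_congr rfl fun ij _ => ?_
  simp only [gTwist, PowerSeries.coeff_mk, smul_mul_smul_comm, chi, zero_mul, gamPow_zero, one_mul]
  rw [← h.rel₂.gamPow_add]
  congr 2
  ring

theorem Pair.phi_psi₁ (h : Pair q e₁ e₂) :
    ExchS 1 (gTwist q e₁ e₂ 1 (-2) 0 * gTwist q e₁ e₂ (-1) 2 0) (phi e₁) (psi e₁) := by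
  refine Exch.of_natAbs (truncated_phi e₁) fun m n => ?_
  rw [h.rel₁.phi_psi]
  refine Finset.sum_congr rfl fun k _ => ?_
  rw [h.gRatio₁, Units.val_one, one_mul]

theorem Pair.phi_psi₂ (h : Pair q e₁ e₂) :
    ExchS 1 (gTwist q e₁ e₂ 1 0 (-2) * gTwist q e₁ e₂ (-1) 0 2) (phi e₂) (psi e₂) := by
  refine Exch.of_natAbs (truncated_phi e₂) fun m n => ?_
  rw [h.rel₂.phi_psi]
  refine Finset.sum_congr rfl fun k _ => ?_
  rw [h.gRatio₂, Units.val_one, one_mul]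

theorem Pair.psi_phi₁ (h : Pair q e₁ e₂) :
    ExchS (-1) (gTwist q e₁ e₂ 1 2 0 * gTwist q e₁ e₂ (-1) (-2) 0) (psi e₁) (phi e₁) := by
  refine ExchS.inv h.phi_psi₁ (truncated_phi e₁) (truncated_psi e₁) ?_
  rw [h.gTwist_comm 1 (-1) (-2) 0 2 0, mul_assoc, ← mul_assoc (gTwist q e₁ e₂ (-1) (-2) 0),
    h.gTwist_comm (-1) (-1) (-2) 0 2 0, mul_assoc, h.gTwist_comm (-1) 1 (-2) 0 (-2) 0,
    h.gTwist_mul_neg, mul_one, h.gTwist_mul_neg]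

/-! #### Exchange relations of the coproducts -/

theorem Pair.exch_phi_psi (h : Pair q e₁ e₂) :
    Exch 1 (fun k => HahnSeries.C (PowerSeries.coeff k
      (gTwist q e₁ e₂ 1 (-2) (-2) * gTwist q e₁ e₂ (-1) 2 2)))
      (phi (coprodGen e₁ e₂)) (psi (coprodGen e₁ e₂)) := by
  rw [h.phi_coprodGen, h.psi_coprodGen]
  have h1 := h.twist_exch h.phi_psi₁ 0 1 0 (-1)
  have h2 := h.twist_exch h.phi_psi₂ (-1) 0 1 0
  simp only [h.twist_mul, h.twist_gTwist] at h1 h2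
  norm_num at h1 h2
  have := ExchS.star ((truncated_phi e₁).twistMode 0 1) ((truncated_phi e₂).twistMode (-1) 0)
    (Or.inl ((truncated_phi e₁).twistMode _ _)) (Or.inr ((truncated_psi e₂).twistMode _ _)) h1 h2
    (h.twistMode_comm (fun m n => (h.comm_psi_phi n m).symm) _ _ _ _)
    (h.twistMode_comm (fun m n => h.comm_phi_psi m n) _ _ _ _)
    ((h.centralSeries _ _ _).mul (h.centralSeries _ _ _))
  rwa [mul_assoc, ← mul_assoc (gTwist q e₁ e₂ (-1) 2 (-2)),
    h.gTwist_comm (-1) 1 2 (-2) 2 (-2), h.gTwist_mul_neg, one_mul] at this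

theorem Pair.exch_phi_xLeft (h : Pair q e₁ e₂) (s : ℤˣ) :
    Exch 1 (fun k => HahnSeries.C (PowerSeries.coeff k (gTwist q e₁ e₂ s (-s) (-s))))
      (phi (coprodGen e₁ e₂)) (xLeft e₁ e₂ s) := by
  rw [h.phi_coprodGen]
  rcases Int.units_eq_one_or s with rfl | rfl
  · have h1 := h.twist_exch (h.phi_x₁ 1) 0 1 0 0
    simp only [h.twist_gTwist] at h1
    norm_num at h1
    have := ExchS.star ((truncated_phi e₁).twistMode 0 1) ((truncated_phi e₂).twistMode (-1) 0)
      (Or.inl ((truncated_phi e₁).twistMode _ _))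
      (Or.inr (truncated_unitMode _) : Starrable (twistMode e₁ e₂ 0 0 fun m => e₁ (.x 1 m)) unitMode)
      h1 (exchS_one fun m n => commute_unitMode _ n)
      (h.twistMode_comm (fun m n => (h.comm_phi_right _ m).symm) _ _ _ _)
      (fun m n => commute_unitMode _ _) centralSeries_one
    rw [mul_one] at this
    refine (congrArg (fun v => Exch 1 _ _ v) ?_).mp this
    rw [xLeft, if_pos rfl]
    congr 1
    funext m
    rw [twistMode, chi_zero_zero, mul_one]
  · have h1 := h.twist_exch (h.phi_x₁ (-1)) 0 1 0 (-2)
    have h2 := h.twist_exch h.phi_psi₂ (-1) 0 0 (-1)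
    simp only [h.twist_mul, h.twist_gTwist] at h1 h2
    norm_num at h1 h2
    have := ExchS.star ((truncated_phi e₁).twistMode 0 1) ((truncated_phi e₂).twistMode (-1) 0)
      (Or.inl ((truncated_phi e₁).twistMode _ _)) (Or.inr ((truncated_psi e₂).twistMode _ _)) h1 h2
      (h.twistMode_comm (fun m n => (h.comm_phi_right _ m).symm) _ _ _ _)
      (h.twistMode_comm (fun m n => h.comm_phi_psi m n) _ _ _ _)
      ((h.centralSeries _ _ _).mul (h.centralSeries _ _ _))
    rw [← mul_assoc, h.gTwist_comm (-1) 1 1 (-3) 1 (-3), h.gTwist_mul_neg, one_mul] at this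
    simpa [xLeft] using this

theorem Pair.exch_phi_xRight (h : Pair q e₁ e₂) (s : ℤˣ) :
    Exch 1 (fun k => HahnSeries.C (PowerSeries.coeff k (gTwist q e₁ e₂ s (-s) (-s))))
      (phi (coprodGen e₁ e₂)) (xRight e₁ e₂ s) := by
  rw [h.phi_coprodGen]
  rcases Int.units_eq_one_or s with rfl | rfl
  · have h2 := h.twist_exch (h.phi_x₂ 1) (-1) 0 (-2) 0
    simp only [h.twist_gTwist] at h2
    norm_num at h2
    have := ExchS.star ((truncated_phi e₁).twistMode 0 1) ((truncated_phi e₂).twistMode (-1) 0)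
      (Or.inl ((truncated_phi e₁).twistMode _ _)) (Or.inl ((truncated_phi e₁).twistMode _ _))
      (exchS_one (h.twistMode_comm (fun m n => h.rel₁.phi_phi m n) 0 1 (-1) 0)) h2
      (h.twistMode_comm (fun m n => (h.comm_phi_phi n m).symm) _ _ _ _)
      (h.twistMode_comm (fun m n => h.comm_phi_left m _) _ _ _ _) (h.centralSeries _ _ _)
    rw [one_mul] at this
    simpa [xRight] using this
  · have h2 := h.twist_exch (h.phi_x₂ (-1)) (-1) 0 0 0
    simp only [h.twist_gTwist] at h2
    norm_num at h2
    have := ExchS.star ((truncated_phi e₁).twistMode 0 1) ((truncated_phi e₂).twistMode (-1) 0)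
      (Or.inl ((truncated_phi e₁).twistMode _ _))
      (Or.inl (truncated_unitMode _) :
        Starrable unitMode (twistMode e₁ e₂ 0 0 fun m => e₂ (.x (-1) m)))
      (exchS_one fun m n => commute_unitMode _ n) h2 (fun m n => commute_unitMode _ _)
      (h.twistMode_comm (fun m n => h.comm_phi_left m _) _ _ _ _) (h.centralSeries _ _ _)
    rw [one_mul] at this
    refine (congrArg₂ (fun c v => Exch 1 c _ v) ?_ ?_).mp this
    · simp
    · rw [xRight, if_neg (by decide)]
      congr 1
      funext m
      rw [twistMode, chi_zero_zero, mul_one]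

theorem Pair.exch_psi_xLeft (h : Pair q e₁ e₂) (s : ℤˣ) :
    Exch (-1) (fun k => HahnSeries.C (PowerSeries.coeff k (gTwist q e₁ e₂ (-s) (-s) (-s))))
      (psi (coprodGen e₁ e₂)) (xLeft e₁ e₂ s) := by
  rw [h.psi_coprodGen]
  rcases Int.units_eq_one_or s with rfl | rfl
  · have h1 := h.twist_exch (h.psi_x₁ 1) 0 (-1) 0 0
    simp only [h.twist_gTwist] at h1
    norm_num at h1
    have := ExchS.star ((truncated_psi e₁).twistMode 0 (-1)) ((truncated_psi e₂).twistMode 1 0)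
      (Or.inr ((truncated_psi e₂).twistMode _ _))
      (Or.inr (truncated_unitMode _) : Starrable (twistMode e₁ e₂ 0 0 fun m => e₁ (.x 1 m)) unitMode)
      h1 (exchS_one fun m n => commute_unitMode _ n)
      (h.twistMode_comm (fun m n => (h.comm_psi_right _ m).symm) _ _ _ _)
      (fun m n => commute_unitMode _ _) centralSeries_one
    rw [mul_one] at this
    refine (congrArg (fun v => Exch (-1) _ _ v) ?_).mp this
    rw [xLeft, if_pos rfl]
    congr 1
    funext m
    rw [twistMode, chi_zero_zero, mul_one]
  · have h1 := h.twist_exch (h.psi_x₁ (-1)) 0 (-1) 0 (-2)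
    simp only [h.twist_gTwist] at h1
    norm_num at h1
    have := ExchS.star ((truncated_psi e₁).twistMode 0 (-1)) ((truncated_psi e₂).twistMode 1 0)
      (Or.inr ((truncated_psi e₂).twistMode _ _)) (Or.inr ((truncated_psi e₂).twistMode _ _)) h1
      (exchS_one (h.twistMode_comm (fun m n => h.rel₂.psi_psi m n) 1 0 0 (-1)))
      (h.twistMode_comm (fun m n => (h.comm_psi_right _ m).symm) _ _ _ _)
      (h.twistMode_comm (fun m n => h.comm_psi_psi m n) _ _ _ _) centralSeries_one
    rw [mul_one] at this
    simpa [xLeft] using this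

theorem Pair.exch_psi_xRight (h : Pair q e₁ e₂) (s : ℤˣ) :
    Exch (-1) (fun k => HahnSeries.C (PowerSeries.coeff k (gTwist q e₁ e₂ (-s) (-s) (-s))))
      (psi (coprodGen e₁ e₂)) (xRight e₁ e₂ s) := by
  rw [h.psi_coprodGen]
  rcases Int.units_eq_one_or s with rfl | rfl
  · have h1 := h.twist_exch h.psi_phi₁ 0 (-1) (-1) 0
    have h2 := h.twist_exch (h.psi_x₂ 1) 1 0 (-2) 0
    simp only [h.twist_mul, h.twist_gTwist] at h1 h2
    norm_num at h1 h2
    have := ExchS.star ((truncated_psi e₁).twistMode 0 (-1)) ((truncated_psi e₂).twistMode 1 0)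
      (Or.inr ((truncated_psi e₂).twistMode _ _)) (Or.inl ((truncated_phi e₁).twistMode _ _)) h1 h2
      (h.twistMode_comm (fun m n => (h.comm_phi_psi n m).symm) _ _ _ _)
      (h.twistMode_comm (fun m n => h.comm_psi_left m _) _ _ _ _) (h.centralSeries _ _ _)
    rw [h.gTwist_comm 1 (-1) 3 (-1) (-1) (-1), mul_assoc, h.gTwist_mul_neg, mul_one] at this
    simpa [xRight] using this
  · have h2 := h.twist_exch (h.psi_x₂ (-1)) 1 0 0 0
    simp only [h.twist_gTwist] at h2
    norm_num at h2
    have := ExchS.star ((truncated_psi e₁).twistMode 0 (-1)) ((truncated_psi e₂).twistMode 1 0)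
      (Or.inr ((truncated_psi e₂).twistMode _ _))
      (Or.inl (truncated_unitMode _) :
        Starrable unitMode (twistMode e₁ e₂ 0 0 fun m => e₂ (.x (-1) m)))
      (exchS_one fun m n => commute_unitMode _ n) h2 (fun m n => commute_unitMode _ _)
      (h.twistMode_comm (fun m n => h.comm_psi_left m _) _ _ _ _) (h.centralSeries _ _ _)
    rw [one_mul] at this
    refine (congrArg₂ (fun c v => Exch (-1) c _ v) ?_ ?_).mp this
    · simp
    · rw [xRight, if_neg (by decide)]
      congr 1
      funext m
      rw [twistMode, chi_zero_zero, mul_one]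

end Coprod

section Coprod

variable {T : Type*} [Ring T] [Algebra ℂ T] {q : ℂ} {e₁ e₂ : Gen → T}

theorem star_unitMode_right (u : ℤ → T) (n : ℤ) : star u unitMode n = HahnSeries.single 0 (u n) := by
  ext j
  rw [star_coeff (Or.inr (truncated_unitMode _)), HahnSeries.coeff_single, unitMode]
  split_ifs with h
  · rw [h, sub_zero, mul_one]
  · rw [mul_zero]

theorem star_unitMode_left (v : ℤ → T) (n : ℤ) : star unitMode v n = HahnSeries.single n (v n) := by
  ext j
  rw [star_coeff (Or.inl (truncated_unitMode _)), HahnSeries.coeff_single, unitMode]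
  split_ifs with h h' h'
  · rw [one_mul, h']
  · omega
  · omega
  · rw [zero_mul]

theorem Pair.gamPow_coprodGen (h : Pair q e₁ e₂) (n : ℤ) :
    gamPow (coprodGen e₁ e₂) n = HahnSeries.C (chi e₁ e₂ 1 1 n) := by
  have hg : Commute (e₁ .gam) (e₂ .gam) := h.central₁ _
  have hi : Commute (e₁ .gamInv) (e₂ .gamInv) := h.comm_left rfl _
  rw [chi, one_mul]
  cases n with
  | ofNat n => simp only [gamPow, coprodGen]; rw [← map_pow, hg.mul_pow]
  | negSucc n => simp only [gamPow, coprodGen]; rw [← map_pow, hi.mul_pow]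

theorem Pair.gRatio_coprodGen (h : Pair q e₁ e₂) (k : ℕ) :
    gRatio q (coprodGen e₁ e₂) k = HahnSeries.C (PowerSeries.coeff k
      (gTwist q e₁ e₂ 1 (-2) (-2) * gTwist q e₁ e₂ (-1) 2 2)) := by
  rw [gRatio, PowerSeries.coeff_mul, map_sum]
  refine Finset.sum_congr rfl fun ij _ => ?_
  simp only [gTwist, PowerSeries.coeff_mk, smul_mul_smul_comm]
  rw [h.gamPow_coprodGen, h.chi_mul (-2) (-2) ij.1 2 2 ij.2 1 1 (2 * ((ij.2 : ℤ) - ij.1))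
    (by ring) (by ring)]
  exact (map_smul (constHom T) _ _).symm

/-- `q^{a c₁ / 2} q^{b c₂ / 2}`. -/
theorem chi_eq_one (a b m : ℤ) : chi e₁ e₂ a b m = chi e₁ e₂ (a * m) (b * m) 1 := by simp [chi]

theorem gamPow₁_eq_chi (e₁ e₂ : Gen → T) (a : ℤ) : gamPow e₁ a = chi e₁ e₂ a 0 1 := by
  simp [chi, gamPow_zero]

theorem gamPow₂_eq_chi (e₁ e₂ : Gen → T) (b : ℤ) : gamPow e₂ b = chi e₁ e₂ 0 b 1 := by
  simp [chi, gamPow_zero]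

theorem Pair.chi_one_mul (h : Pair q e₁ e₂) (a b a' b' : ℤ) :
    chi e₁ e₂ a b 1 * chi e₁ e₂ a' b' 1 = chi e₁ e₂ (a + a') (b + b') 1 :=
  h.chi_mul _ _ _ _ _ _ _ _ _ (by ring) (by ring)

/-- Move central factors to the right. -/
theorem Pair.chi_left (h : Pair q e₁ e₂) (a b : ℤ) (t : T) :
    chi e₁ e₂ a b 1 * t = t * chi e₁ e₂ a b 1 := (h.chi_central _ _ _ _).eq

theorem Pair.chi_mid (h : Pair q e₁ e₂) (a b : ℤ) (t t' : T) :
    t * chi e₁ e₂ a b 1 * t' = t * t' * chi e₁ e₂ a b 1 := by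
  rw [mul_assoc, h.chi_left, mul_assoc]

theorem Pair.chi_merge (h : Pair q e₁ e₂) (a b a' b' : ℤ) (t : T) :
    t * chi e₁ e₂ a b 1 * chi e₁ e₂ a' b' 1 = t * chi e₁ e₂ (a + a') (b + b') 1 := by
  rw [mul_assoc, h.chi_one_mul]

theorem Pair.chi_mul_mul (h : Pair q e₁ e₂) (a b a' b' : ℤ) (t t' : T) :
    t * chi e₁ e₂ a b 1 * (t' * chi e₁ e₂ a' b' 1) = t * t' * chi e₁ e₂ (a + a') (b + b') 1 := by
  rw [← mul_assoc, h.chi_mid, h.chi_merge]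

theorem Pair.chi_mul_left (h : Pair q e₁ e₂) (a b a' b' : ℤ) (t : T) :
    chi e₁ e₂ a b 1 * (t * chi e₁ e₂ a' b' 1) = t * chi e₁ e₂ (a + a') (b + b') 1 := by
  rw [← mul_assoc, h.chi_left, h.chi_merge]

theorem Pair.anticomm_left_left (h : Pair q e₁ e₂) (m n j : ℤ) :
    (xLeft e₁ e₂ 1 m * xLeft e₁ e₂ (-1) n + xLeft e₁ e₂ (-1) n * xLeft e₁ e₂ 1 m).coeff j =
      (q - q⁻¹)⁻¹ • (psi e₁ (m + n - j) * psi e₂ j * chi e₁ e₂ (m - n + j) (j - 2 * n) 1 -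
        phi e₁ (m + n - j) * psi e₂ j * chi e₁ e₂ (n - m - j) (j - 2 * n) 1) := by
  rw [xLeft, if_pos rfl, xLeft, if_neg (by decide), star_unitMode_right, ← HahnSeries.C_apply,
    HahnSeries.coeff_add, coeff_C_mul', coeff_mul_C',
    star_coeff (Or.inr ((truncated_psi e₂).twistMode _ _))]
  simp only [twistMode]
  rw [chi_eq_one 0 (-2), chi_eq_one 0 (-1)]
  have h1 := h.rel₁.xp_xm m (n - j)
  have h2 := (h.comm_psi_right (.x 1 m) j).eq
  simp only [h.chi_mul_mul]
  rw [h.chi_mid, ← mul_assoc, ← mul_assoc, mul_assoc (e₁ (.x (-1) (n - j))) (psi e₂ j), ← h2,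
    ← mul_assoc, ← add_mul, ← add_mul, h1, gamPow₁_eq_chi e₁ e₂, gamPow₁_eq_chi e₁ e₂,
    h.chi_left _ _ (psi e₁ _), h.chi_left _ _ (phi e₁ _)]
  simp only [smul_mul_assoc, sub_mul]
  rw [h.chi_mid _ _ (psi e₁ _) (psi e₂ j), h.chi_mid _ _ (phi e₁ _) (psi e₂ j), h.chi_merge,
    h.chi_merge]
  rw [show m + (n - j) = m + n - j by ring]
  congr 4 <;> ring

theorem Pair.anticomm_right_right (h : Pair q e₁ e₂) (m n j : ℤ) :
    (xRight e₁ e₂ 1 m * xRight e₁ e₂ (-1) n + xRight e₁ e₂ (-1) n * xRight e₁ e₂ 1 m).coeff j =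
      (q - q⁻¹)⁻¹ • (phi e₁ (m + n - j) * psi e₂ j * chi e₁ e₂ (n - m - j) (j - 2 * n) 1 -
        phi e₁ (m + n - j) * phi e₂ j * chi e₁ e₂ (n - m - j) (2 * n - j) 1) := by
  obtain ⟨i, rfl⟩ : ∃ i, j = i + n := ⟨j - n, by ring⟩
  rw [xRight, if_pos rfl, xRight, if_neg (by decide), star_unitMode_left,
    HahnSeries.coeff_add, HahnSeries.coeff_mul_single_add, HahnSeries.coeff_single_mul_add,
    star_coeff (Or.inl ((truncated_phi e₁).twistMode _ _))]
  simp only [twistMode]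
  rw [chi_eq_one (-1) 0, chi_eq_one (-2) 0]
  have h1 := h.rel₂.xp_xm i n
  have h2 := (h.comm_phi_left (m - i) (.x (-1) n)).eq
  simp only [h.chi_mul_mul]
  rw [h.chi_mid, ← mul_assoc, ← mul_assoc, ← h2, mul_assoc (phi e₁ _) (e₂ _),
    mul_assoc (phi e₁ _) (e₂ _), ← add_mul, ← mul_add, h1,
    gamPow₂_eq_chi e₁ e₂, gamPow₂_eq_chi e₁ e₂, h.chi_left _ _ (psi e₂ _),
    h.chi_left _ _ (phi e₂ _)]
  simp only [smul_mul_assoc, mul_smul_comm, mul_sub, sub_mul]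
  rw [← mul_assoc, ← mul_assoc, h.chi_merge, h.chi_merge]
  rw [show m + n - (i + n) = m - i by ring]
  congr 4 <;> ring

theorem Pair.anticomm_left_right (h : Pair q e₁ e₂) (m n : ℤ) :
    xLeft e₁ e₂ 1 m * xRight e₁ e₂ (-1) n + xRight e₁ e₂ (-1) n * xLeft e₁ e₂ 1 m = 0 := by
  rw [xLeft, if_pos rfl, xRight, if_neg (by decide), star_unitMode_left, star_unitMode_right,
    HahnSeries.single_mul_single, HahnSeries.single_mul_single, h.anticomm, add_zero, zero_add,
    HahnSeries.single_neg, add_neg_cancel]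

theorem Pair.anticomm_right_left (h : Pair q e₁ e₂) (m n : ℤ) :
    xRight e₁ e₂ 1 m * xLeft e₁ e₂ (-1) n + xLeft e₁ e₂ (-1) n * xRight e₁ e₂ 1 m = 0 := by
  have h1 := h.twist_exch (h.phi_x₁ (-1)) (-1) 0 0 (-2)
  have h2 := h.twist_exch (h.psi_x₂ 1) 0 (-1) (-2) 0
  simp only [h.twist_gTwist] at h1 h2
  norm_num at h1 h2
  have := star_anticommute ((truncated_phi e₁).twistMode _ _) ((truncated_psi e₂).twistMode _ _)
    h1 h2 (fun m n => ?_) (h.twistMode_comm (fun m n => (h.comm_phi_psi n m).symm) _ _ _ _)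
    (fun k t => h.coeff_central _ _ _ k t) m n
  · simpa [xRight, xLeft] using this
  · simp only [twistMode]
    rw [chi_eq_one (-2) 0, chi_eq_one 0 (-2)]
    simp only [h.chi_mul_mul, h.anticomm, neg_mul]
    rw [add_comm (0 * n), add_comm (0 * m)]

theorem Pair.quadRel_x₁ (h : Pair q e₁ e₂) (s : ℤˣ) :
    QuadRel q s (-1) (fun n => e₁ (.x s n)) fun n => e₁ (.x s n) :=
  (x_x_iff_quadRel h.q_ne s _).1 (h.rel₁.x_x s)

theorem Pair.quadRel_x₂ (h : Pair q e₁ e₂) (s : ℤˣ) :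
    QuadRel q s (-1) (fun n => e₂ (.x s n)) fun n => e₂ (.x s n) :=
  (x_x_iff_quadRel h.q_ne s _).1 (h.rel₂.x_x s)

theorem Pair.quadRel_twist (h : Pair q e₁ e₂) {s : ℤˣ} {ε : ℂ} {u v : ℤ → T}
    (huv : QuadRel q s ε u v) (a b : ℤ) :
    QuadRel q s ε (twistMode e₁ e₂ a b u) (twistMode e₁ e₂ a b v) :=
  huv.rescale (fun m n => (h.chi_mul _ _ _ _ _ _ _ _ _ (by ring) (by ring)).symm)
    fun m t => h.chi_central _ _ _ _

theorem exchS_gTwist_zero {τ : ℤˣ} {u v : ℤ → T} (h : ExchS τ (gTwist q e₁ e₂ 1 0 0) u v) :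
    Exch τ (fun k => algebraMap ℂ T (gCoeff q 1 k)) u v := by
  refine (congrArg (fun c => Exch τ c u v) (funext fun k => ?_)).mp h
  simp [gTwist, chi_zero_zero, Algebra.algebraMap_eq_smul_one]

theorem Pair.quadRel_left_left (h : Pair q e₁ e₂) (s : ℤˣ) :
    QuadRel q s (-1) (xLeft e₁ e₂ s) (xLeft e₁ e₂ s) := by
  rcases Int.units_eq_one_or s with rfl | rfl
  · have hs : Starrable (fun m => e₁ (.x 1 m)) unitMode := Or.inr (truncated_unitMode _)
    have := QuadRel.star_left (κ := 1) (κ' := 1) (h.quadRel_x₁ 1)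
      (fun m n => commute_unitMode (unitMode m) n) hs hs
      (fun m n => by rw [one_smul, (commute_unitMode _ _).eq])
      (fun m n => by rw [one_smul, (commute_unitMode _ _).eq]) (one_mul 1)
    simpa [xLeft] using this
  · have hs : Starrable (twistMode e₁ e₂ 0 (-2) fun m => e₁ (.x (-1) m))
      (twistMode e₁ e₂ 0 (-1) (psi e₂)) := Or.inr ((truncated_psi e₂).twistMode _ _)
    have hc := h.twistMode_comm (fun m n => (h.comm_psi_right (.x (-1) n) m).symm) 0 (-1) 0 (-2)
    have := QuadRel.star_left (κ := 1) (κ' := 1) (h.quadRel_twist (h.quadRel_x₁ (-1)) 0 (-2))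
      (h.twistMode_comm (fun m n => h.rel₂.psi_psi m n) 0 (-1) 0 (-1)) hs hs
      (fun m n => by rw [one_smul, (hc m n).eq]) (fun m n => by rw [one_smul, (hc m n).eq])
      (one_mul 1)
    simpa [xLeft] using this

theorem Pair.quadRel_right_right (h : Pair q e₁ e₂) (s : ℤˣ) :
    QuadRel q s (-1) (xRight e₁ e₂ s) (xRight e₁ e₂ s) := by
  rcases Int.units_eq_one_or s with rfl | rfl
  · have hs : Starrable (twistMode e₁ e₂ (-1) 0 (phi e₁))
      (twistMode e₁ e₂ (-2) 0 fun m => e₂ (.x 1 m)) := Or.inl ((truncated_phi e₁).twistMode _ _)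
    have hc := h.twistMode_comm (fun m n => (h.comm_phi_left n (.x 1 m)).symm) (-2) 0 (-1) 0
    have := QuadRel.star_right (κ := 1) (κ' := 1) (h.quadRel_twist (h.quadRel_x₂ 1) (-2) 0)
      (h.twistMode_comm (fun m n => h.rel₁.phi_phi m n) (-1) 0 (-1) 0) hs hs
      (fun m n => by rw [one_smul, (hc m n).eq]) (fun m n => by rw [one_smul, (hc m n).eq])
      (one_mul 1)
    simpa [xRight] using this
  · have hs : Starrable unitMode fun m => e₂ (.x (-1) m) := Or.inl (truncated_unitMode _)
    have := QuadRel.star_right (κ := 1) (κ' := 1) (h.quadRel_x₂ (-1))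
      (fun m n => commute_unitMode (unitMode m) n) hs hs
      (fun m n => by rw [one_smul, (commute_unitMode _ _).eq])
      (fun m n => by rw [one_smul, (commute_unitMode _ _).eq]) (one_mul 1)
    simpa [xRight] using this

theorem Pair.quadRel_left_right (h : Pair q e₁ e₂) (s : ℤˣ) :
    QuadRel q s (-1) (xLeft e₁ e₂ s) (xRight e₁ e₂ s) := by
  rcases Int.units_eq_one_or s with rfl | rfl
  · have h1 := h.twist_exch (h.phi_x₁ 1) (-1) 0 0 0
    simp only [h.twist_gTwist] at h1
    norm_num at h1
    have hu : twistMode e₁ e₂ 0 0 (fun m => e₁ (.x 1 m)) = fun m => e₁ (.x 1 m) := by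
      funext m; rw [twistMode, chi_zero_zero, mul_one]
    rw [hu] at h1
    have h2 := (Exch.quadRel h.q_ne (exchS_gTwist_zero h1)).symm (one_mul 1)
    have := QuadRel.star_left (κ := 1) (κ' := -1) (v := unitMode)
      (v' := twistMode e₁ e₂ (-2) 0 fun m => e₂ (.x 1 m)) h2
      (fun m n => (commute_unitMode _ _).symm) (Or.inr (truncated_unitMode _))
      (Or.inl ((truncated_phi e₁).twistMode _ _))
      (fun m n => by rw [one_smul, (commute_unitMode _ _).eq])
      (fun m n => by
        simp only [twistMode]
        rw [chi_eq_one (-2) 0, h.chi_mid, h.anticomm, neg_one_smul, neg_mul, mul_assoc])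
      (by norm_num)
    simpa [xLeft, xRight] using this
  · have h1 := h.twist_exch (h.psi_x₂ (-1)) 0 (-1) 0 0
    simp only [h.twist_gTwist] at h1
    norm_num at h1
    have hu : twistMode e₁ e₂ 0 0 (fun m => e₂ (.x (-1) m)) = fun m => e₂ (.x (-1) m) := by
      funext m; rw [twistMode, chi_zero_zero, mul_one]
    rw [hu] at h1
    have h2 := Exch.quadRel h.q_ne (exchS_gTwist_zero h1)
    have := QuadRel.star_right (κ := 1) (κ' := -1) (u' := unitMode)
      (u := twistMode e₁ e₂ 0 (-2) fun m => e₁ (.x (-1) m)) h2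
      (fun m n => commute_unitMode _ _) (Or.inr ((truncated_psi e₂).twistMode _ _))
      (Or.inl (truncated_unitMode _))
      (fun m n => by rw [one_smul, (commute_unitMode _ _).eq])
      (fun m n => by
        simp only [twistMode]
        rw [chi_eq_one 0 (-2), h.chi_mid, ← mul_assoc, h.anticomm, neg_one_smul, neg_mul])
      (by norm_num)
    simpa [xLeft, xRight] using this

/-- The coproducts of the generators satisfy the defining relations. -/
theorem Pair.relations_coprodGen (h : Pair q e₁ e₂) : Relations q (coprodGen e₁ e₂) := by
  have hcomm : ∀ y : Gen, y.sign = 1 → ∀ z, z.sign = 1 → Commute (e₁ y) (e₂ z) :=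
    fun y hy z _ => h.comm_left hy z
  have hC : ∀ a b c d : T, Commute b c → a * c = 1 → b * d = 1 →
      HahnSeries.C (a * b) * HahnSeries.C (c * d) = (1 : HahnSeries ℤ T) := by
    intro a b c d hbc h1 h2
    rw [← map_mul, ← map_one HahnSeries.C, mul_assoc, ← mul_assoc b, hbc.eq, mul_assoc c, h2,
      mul_one, h1]
  have hg : ∀ t, Commute (e₁ .gam * e₂ .gam) t := fun t => (h.central₁ t).mul_left (h.central₂ t)
  have hchi : ∀ (a b m : ℤ) (t : HahnSeries ℤ T), Commute (HahnSeries.C (chi e₁ e₂ a b m)) t :=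
    fun a b m t => commute_C fun j => h.chi_central _ _ _ _
  have haa : ∀ n m : ℕ, Commute (coprodGen e₁ e₂ (.a n)) (coprodGen e₁ e₂ (.a m)) := by
    intro n m
    simp only [coprodGen]
    rw [gamPow₁_eq_chi e₁ e₂, gamPow₂_eq_chi e₁ e₂, gamPow₁_eq_chi e₁ e₂,
      gamPow₂_eq_chi e₁ e₂]
    have c := fun a b t => h.chi_central a b 1 t
    refine Commute.add_left (Commute.add_right ?_ ?_) (Commute.add_right ?_ ?_) <;>
      refine commute_single ?_
    · exact ((h.rel₁.commute_a_a n m).mul_right (c _ _ _).symm).mul_left (c _ _ _)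
    · exact ((c _ _ _).symm.mul_right (h.comm_left (y := .a n) rfl _)).mul_left (c _ _ _)
    · exact (c _ _ _).mul_left ((h.comm_left (y := .a m) rfl _).symm.mul_right (c _ _ _).symm)
    · exact (c _ _ _).mul_left ((c _ _ _).symm.mul_right (h.rel₂.commute_a_a n m))
  have hbb : ∀ n m : ℕ, Commute (coprodGen e₁ e₂ (.b n)) (coprodGen e₁ e₂ (.b m)) := by
    intro n m
    simp only [coprodGen]
    rw [gamPow₁_eq_chi e₁ e₂, gamPow₂_eq_chi e₁ e₂, gamPow₁_eq_chi e₁ e₂,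
      gamPow₂_eq_chi e₁ e₂]
    have c := fun a b t => h.chi_central a b 1 t
    refine Commute.add_left (Commute.add_right ?_ ?_) (Commute.add_right ?_ ?_) <;>
      refine commute_single ?_
    · exact ((h.rel₁.commute_b_b n m).mul_right (c _ _ _).symm).mul_left (c _ _ _)
    · exact ((c _ _ _).symm.mul_right (h.comm_left (y := .b n) rfl _)).mul_left (c _ _ _)
    · exact (c _ _ _).mul_left ((h.comm_left (y := .b m) rfl _).symm.mul_right (c _ _ _).symm)
    · exact (c _ _ _).mul_left ((c _ _ _).symm.mul_right (h.rel₂.commute_b_b n m))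
  have hak : ∀ n : ℕ, Commute (coprodGen e₁ e₂ (.a n)) (coprodGen e₁ e₂ .k) := by
    intro n
    simp only [coprodGen]
    rw [gamPow₁_eq_chi e₁ e₂, gamPow₂_eq_chi e₁ e₂, HahnSeries.C_apply]
    have c := fun a b t => h.chi_central a b 1 t
    refine Commute.add_left ?_ ?_ <;> refine commute_single ?_
    · exact ((h.rel₁.commute_a_k n).mul_right (h.comm_left (y := .a n) rfl _)).mul_left (c _ _ _)
    · exact (c _ _ _).mul_left ((h.comm_left (y := .k) rfl _).symm.mul_right (h.rel₂.commute_a_k n))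
  have hbk : ∀ n : ℕ, Commute (coprodGen e₁ e₂ (.b n)) (coprodGen e₁ e₂ .kInv) := by
    intro n
    simp only [coprodGen]
    rw [gamPow₁_eq_chi e₁ e₂, gamPow₂_eq_chi e₁ e₂, HahnSeries.C_apply]
    have c := fun a b t => h.chi_central a b 1 t
    refine Commute.add_left ?_ ?_ <;> refine commute_single ?_
    · exact ((h.rel₁.commute_b_kInv n).mul_right (h.comm_left (y := .b n) rfl _)).mul_left (c _ _ _)
    · exact (c _ _ _).mul_left ((h.comm_left (y := .kInv) rfl _).symm.mul_right (h.rel₂.commute_b_kInv n))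
  have hchi' : ∀ (s : ℤˣ) (k : ℕ) (s' : ℤˣ) (t : HahnSeries ℤ T),
      HahnSeries.C (PowerSeries.coeff k (gTwist q e₁ e₂ s' (-s) (-s))) * t =
      gCoeff q s' k • (gamPow (coprodGen e₁ e₂) (-(s : ℤ) * k) * t) := by
    intro s k s' t
    rw [h.gamPow_coprodGen, gTwist, PowerSeries.coeff_mk, ← smul_mul_assoc]
    congr 1
    have h1 : chi e₁ e₂ (-s) (-s) k = chi e₁ e₂ 1 1 (-(s : ℤ) * k) := by simp [chi]
    rw [h1]
    exact map_smul (constHom T) _ _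
  refine ⟨?_, ?_, ?_, ?_, ?_, ?_, ?_, ?_, ?_, ?_, ?_, ?_⟩
  · exact hC _ _ _ _ (h.comm_left rfl _).symm h.rel₁.gam_gamInv h.rel₂.gam_gamInv
  · exact hC _ _ _ _ (h.comm_left rfl _).symm h.rel₁.gamInv_gam h.rel₂.gamInv_gam
  · exact hC _ _ _ _ (h.comm_left rfl _).symm h.rel₁.k_kInv h.rel₂.k_kInv
  · exact hC _ _ _ _ (h.comm_left rfl _).symm h.rel₁.kInv_k h.rel₂.kInv_k
  · intro y
    exact (commute_C fun j => hg _).eq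
  · intro m n
    refine commute_phi_of_commute ?_ (fun i => ?_) n
    · exact (commute_phi_of_commute (Commute.refl _) (fun i => (hak i).symm) m).symm
    · exact (commute_phi_of_commute (hak i) (fun j => haa i j) m).symm
  · intro m n
    refine commute_psi_of_commute ?_ (fun i => ?_) n
    · exact (commute_psi_of_commute (Commute.refl _) (fun i => (hbk i).symm) m).symm
    · exact (commute_psi_of_commute (hbk i) (fun j => hbb i j) m).symm
  · intro m n
    rw [h.exch_phi_psi m n _ le_rfl]
    refine Finset.sum_congr rfl fun k _ => ?_
    rw [h.gRatio_coprodGen, Units.val_one, one_mul]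
  · intro s m n
    have := Exch.add_right (h.exch_phi_xLeft s) (h.exch_phi_xRight s) m n _ le_rfl
    refine this.trans (Finset.sum_congr rfl fun k _ => ?_)
    rw [hchi', Units.val_one, one_mul]
    rfl
  · intro s m n
    have := Exch.add_right (h.exch_psi_xLeft s) (h.exch_psi_xRight s) m n _ le_rfl
    refine this.trans (Finset.sum_congr rfl fun k _ => ?_)
    rw [hchi', Units.val_neg, Units.val_one, neg_one_mul, sub_neg_eq_add, ← sub_eq_add_neg]
    rfl
  · intro m n
    have h1 : (xLeft e₁ e₂ 1 m + xRight e₁ e₂ 1 m) * (xLeft e₁ e₂ (-1) n + xRight e₁ e₂ (-1) n) +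
        (xLeft e₁ e₂ (-1) n + xRight e₁ e₂ (-1) n) * (xLeft e₁ e₂ 1 m + xRight e₁ e₂ 1 m) =
        (xLeft e₁ e₂ 1 m * xLeft e₁ e₂ (-1) n + xLeft e₁ e₂ (-1) n * xLeft e₁ e₂ 1 m) +
        (xRight e₁ e₂ 1 m * xRight e₁ e₂ (-1) n + xRight e₁ e₂ (-1) n * xRight e₁ e₂ 1 m) := by
      have h2 := h.anticomm_left_right m n
      have h3 := h.anticomm_right_left m n
      rw [add_eq_zero_iff_eq_neg] at h2 h3
      rw [add_mul, mul_add, mul_add, add_mul, mul_add, mul_add, h2, h3]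
      abel
    refine h1.trans ?_
    ext j
    rw [HahnSeries.coeff_add, h.anticomm_left_left, h.anticomm_right_right, h.phi_coprodGen,
      h.psi_coprodGen, h.gamPow_coprodGen, h.gamPow_coprodGen, HahnSeries.coeff_smul,
      HahnSeries.coeff_sub, coeff_C_mul', coeff_C_mul',
      star_coeff (Or.inl ((truncated_phi e₁).twistMode _ _)),
      star_coeff (Or.inr ((truncated_psi e₂).twistMode _ _)), ← smul_add, sub_add_sub_cancel]
    simp only [twistMode]
    rw [chi_eq_one 1 1 (m - n), chi_eq_one 1 1 (n - m), chi_eq_one 0 (-1), chi_eq_one 1 0,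
      chi_eq_one 0 1, chi_eq_one (-1) 0]
    simp only [h.chi_mul_mul, h.chi_mul_left]
    congr 4 <;> ring
  · intro s m n
    have hlr := h.quadRel_left_right s
    have h1 : QuadRel q s (-1) (xLeft e₁ e₂ s) fun n => xLeft e₁ e₂ s n + xRight e₁ e₂ s n :=
      (h.quadRel_left_left s).add_right hlr
    have h2 : QuadRel q s (-1) (xRight e₁ e₂ s) fun n => xLeft e₁ e₂ s n + xRight e₁ e₂ s n :=
      (hlr.symm (by norm_num)).add_right (h.quadRel_right_right s)
    exact (x_x_iff_quadRel h.q_ne s fun n => xLeft e₁ e₂ s n + xRight e₁ e₂ s n).2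
      (h1.add_left h2) m n

end Coprod

/-! ### The graded tensor square -/

section TensorSquare

variable {q : ℂ}

theorem exists_even_add_odd (u : U q) :
    ∃ v w : U q, u = v + w ∧ parity q v = v ∧ parity q w = -w := by
  refine ⟨(2⁻¹ : ℂ) • (u + parity q u), (2⁻¹ : ℂ) • (u - parity q u), ?_, ?_, ?_⟩
  · rw [← smul_add, add_add_sub_cancel, ← two_smul ℂ u, smul_smul]
    norm_num
  · rw [map_smul, map_add, parity_parity, add_comm]
  · rw [map_smul, map_sub, parity_parity, ← smul_neg, neg_sub]

theorem mem_parityPart_zero {u : U q} : u ∈ parityPart q 0 ↔ parity q u = u := by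
  simp [mem_parityPart]

theorem mem_parityPart_one {u : U q} : u ∈ parityPart q 1 ↔ parity q u = -u := by
  rw [mem_parityPart, show (1 : ZMod 2).val = 1 from rfl]
  simp

theorem tsq_mul_of_even {b : U q} (hb : parity q b = b) (a c d : U q) :
    (a ᵍ⊗ₜ[ℂ] b * c ᵍ⊗ₜ[ℂ] d : TensorSq q) = (a * c) ᵍ⊗ₜ[ℂ] (b * d) := by
  obtain ⟨v, w, rfl, hv, hw⟩ := exists_even_add_odd c
  have h0 := GradedTensorProduct.tmul_zero_coe_mul_coe_tmul (R := ℂ) (parityPart q) (parityPart q)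
    a ⟨b, mem_parityPart_zero.2 hb⟩ ⟨v, mem_parityPart_zero.2 hv⟩ d
  have h1 := GradedTensorProduct.tmul_zero_coe_mul_coe_tmul (R := ℂ) (parityPart q) (parityPart q)
    a ⟨b, mem_parityPart_zero.2 hb⟩ ⟨w, mem_parityPart_one.2 hw⟩ d
  dsimp only at h0 h1
  simp only [GradedTensorProduct.tmul, TensorProduct.add_tmul, map_add, mul_add] at h0 h1 ⊢
  rw [h0, h1]

theorem tsq_mul_of_odd {b : U q} (hb : parity q b = -b) (a c d : U q) :
    (a ᵍ⊗ₜ[ℂ] b * c ᵍ⊗ₜ[ℂ] d : TensorSq q) = (a * parity q c) ᵍ⊗ₜ[ℂ] (b * d) := by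
  obtain ⟨v, w, rfl, hv, hw⟩ := exists_even_add_odd c
  have h0 := GradedTensorProduct.tmul_coe_mul_zero_coe_tmul (R := ℂ) (parityPart q) (parityPart q)
    a ⟨b, mem_parityPart_one.2 hb⟩ ⟨v, mem_parityPart_zero.2 hv⟩ d
  have h1 := GradedTensorProduct.tmul_coe_mul_coe_tmul (R := ℂ) (parityPart q) (parityPart q)
    a ⟨b, mem_parityPart_one.2 hb⟩ ⟨w, mem_parityPart_one.2 hw⟩ d
  dsimp only at h0 h1
  rw [show ((1 : ZMod 2) * 1) = 1 from rfl, uzpow_one, Units.neg_smul, one_smul] at h1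
  rw [map_add, hv, hw]
  simp only [GradedTensorProduct.tmul, TensorProduct.add_tmul, map_add, mul_add, mul_neg,
    TensorProduct.neg_tmul, map_neg] at h0 h1 ⊢
  rw [h0, h1]

/-- The product in the graded tensor square. -/
theorem tsq_mul (a b c d : U q) :
    (a ᵍ⊗ₜ[ℂ] b * c ᵍ⊗ₜ[ℂ] d : TensorSq q) =
      (a * c) ᵍ⊗ₜ[ℂ] ((2⁻¹ : ℂ) • (b + parity q b) * d) +
        (a * parity q c) ᵍ⊗ₜ[ℂ] ((2⁻¹ : ℂ) • (b - parity q b) * d) := by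
  have hb : b = (2⁻¹ : ℂ) • (b + parity q b) + (2⁻¹ : ℂ) • (b - parity q b) := by
    rw [← smul_add, add_add_sub_cancel, ← two_smul ℂ b, smul_smul]
    norm_num
  rw [← tsq_mul_of_even (by rw [map_smul, map_add, parity_parity, add_comm]),
    ← tsq_mul_of_odd (by rw [map_smul, map_sub, parity_parity, ← smul_neg, neg_sub]), ← add_mul]
  congr 1
  conv_lhs => rw [hb]
  simp only [GradedTensorProduct.tmul, TensorProduct.tmul_add, map_add]

theorem tsq_mul_even_left {c : U q} (hc : parity q c = c) (a b d : U q) :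
    (a ᵍ⊗ₜ[ℂ] b * c ᵍ⊗ₜ[ℂ] d : TensorSq q) = (a * c) ᵍ⊗ₜ[ℂ] (b * d) := by
  obtain ⟨v, w, rfl, hv, hw⟩ := exists_even_add_odd b
  have h0 := tsq_mul_of_even hv a c d
  have h1 := tsq_mul_of_odd hw a c d
  rw [hc] at h1
  simp only [GradedTensorProduct.tmul, TensorProduct.tmul_add, map_add, add_mul] at h0 h1 ⊢
  rw [h0, h1]

theorem parity_gen_of_sign {y : Gen} (hy : y.sign = 1) : parity q (gen q y) = gen q y := by
  rw [parity_gen, hy, one_smul]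

theorem parity_gen_x (s : ℤˣ) (n : ℤ) : parity q (gen q (.x s n)) = -gen q (.x s n) := by
  rw [parity_gen, Gen.sign, neg_one_smul]

theorem relations_gen (q : ℂ) : Relations q (gen q) :=
  (PreU.relations q).map (PreU.toUHat q).rangeRestrict

theorem U_induction {p : U q → Prop} (hgen : ∀ y, p (gen q y)) (hC : ∀ r : ℂ, p (algebraMap ℂ _ r))
    (hadd : ∀ u v, p u → p v → p (u + v)) (hmul : ∀ u v, p u → p v → p (u * v)) (u : U q) : p u := by
  obtain ⟨u, rfl⟩ := AlgHom.rangeRestrict_surjective (PreU.toUHat q) u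
  obtain ⟨u, rfl⟩ := PreU.mk_surjective q u
  induction u using FreeAlgebra.induction with
  | grade0 r => rw [AlgHom.commutes, AlgHom.commutes]; exact hC r
  | grade1 y => exact hgen y
  | add a b ha hb => rw [map_add, map_add]; exact hadd _ _ ha hb
  | mul a b ha hb => rw [map_mul, map_mul]; exact hmul _ _ ha hb

theorem commute_of_commute_gen {c : U q} (h : ∀ y, Commute c (gen q y)) (u : U q) : Commute c u :=
  U_induction h (fun r => (Algebra.commutes r c).symm) (fun _ _ => Commute.add_right)
    (fun _ _ => Commute.mul_right) u

theorem gam_central (u : U q) : Commute (gen q .gam) u :=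
  commute_of_commute_gen (fun y => (relations_gen q).gam_central y) u

theorem gamPow_central (n : ℤ) (u : U q) : Commute (gamPow (gen q) n) u :=
  (relations_gen q).commute_gamPow (gam_central u) n

/-- The generators in the first tensor factor. -/
def genLeft (q : ℂ) (y : Gen) : TensorSq q := gen q y ᵍ⊗ₜ[ℂ] 1

/-- The generators in the second tensor factor. -/
def genRight (q : ℂ) (y : Gen) : TensorSq q := 1 ᵍ⊗ₜ[ℂ] gen q y

theorem tsq_commute {t : TensorSq q} (h : ∀ a b, Commute t (a ᵍ⊗ₜ[ℂ] b)) (t' : TensorSq q) :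
    Commute t t' := by
  have : ∀ x : U q ⊗[ℂ] U q, Commute t (GradedTensorProduct.of ℂ (parityPart q) (parityPart q) x) :=
    fun x => by
      induction x using TensorProduct.induction_on with
      | zero => rw [map_zero]; exact Commute.zero_right t
      | tmul a b => exact h a b
      | add x y hx hy => rw [map_add]; exact hx.add_right hy
  exact this ((GradedTensorProduct.of ℂ (parityPart q) (parityPart q)).symm t')

theorem pair_gen {q : ℂ} (hq : q ≠ 0) : Pair q (genLeft q) (genRight q) where
  q_ne := hq
  rel₁ := (relations_gen q).map (GradedTensorProduct.includeLeft (R := ℂ) (parityPart q) (parityPart q))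
  rel₂ := (relations_gen q).map
    (GradedTensorProduct.includeRight (R := ℂ) (parityPart q) (parityPart q))
  central₁ := tsq_commute fun a b => by
    rw [Commute, SemiconjBy, genLeft, tsq_mul_of_even (map_one _),
      tsq_mul_even_left (parity_gen_of_sign rfl), one_mul, mul_one, (gam_central a).eq]
  central₂ := tsq_commute fun a b => by
    rw [Commute, SemiconjBy, genRight, tsq_mul_of_even (parity_gen_of_sign rfl),
      tsq_mul_even_left (map_one _), one_mul, mul_one, (gam_central b).eq]
  comm_left hy z := by
    rw [Commute, SemiconjBy, genLeft, genRight, tsq_mul_of_even (map_one _),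
      tsq_mul_even_left (parity_gen_of_sign hy), one_mul, mul_one, mul_one, one_mul]
  comm_right y z hz := by
    rw [Commute, SemiconjBy, genLeft, genRight, tsq_mul_of_even (map_one _),
      tsq_mul_of_even (parity_gen_of_sign hz), one_mul, mul_one, mul_one, one_mul]
  anticomm s m s' n := by
    rw [genLeft, genRight, tsq_mul_of_even (map_one _), tsq_mul_of_odd (parity_gen_x s' n),
      parity_gen_x, one_mul, mul_one, mul_one, one_mul]
    simp only [GradedTensorProduct.tmul, TensorProduct.neg_tmul, map_neg]

/-- The coproduct on the algebra without the q-Serre relations. -/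
def PreU.comul {q : ℂ} (hq : q ≠ 0) : PreU q →ₐ[ℂ] FormalTensor q :=
  PreU.lift (pair_gen hq).relations_coprodGen

theorem PreU.comul_gen {q : ℂ} (hq : q ≠ 0) (y : Gen) :
    PreU.comul hq (PreU.gen q y) = coprodGen (genLeft q) (genRight q) y :=
  PreU.lift_gen _ y

end TensorSquare

/-! ### Division by the Vandermonde determinant, and restriction to lines -/

section Vandermonde

theorem hasSum_of_bijective_sumElim {α β γ M : Type*} [AddCommMonoid M] [TopologicalSpace M]
    [ContinuousAdd M] {f : α → M} {i : β → α} {j : γ → α} (h : Function.Bijective (Sum.elim i j))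
    {a b : M} (hi : HasSum (f ∘ i) a) (hj : HasSum (f ∘ j) b) : HasSum f (a + b) := by
  refine (Equiv.ofBijective _ h).hasSum_iff.1 (HasSum.sum hi hj)

variable {X : Type*} [AddCommGroup X] [Module ℂ X]

/-- The conditions on the coefficients of an antisymmetric formal series in three variables under
which it can be divided by the Vandermonde determinant. -/
structure AntisymmSeries (V : ℤ → AddSubgroup X) (F : ℤ → ℤ → ℤ → X) : Prop where
  swap₁₂ (a b c : ℤ) : F b a c = -F a b c
  swap₂₃ (a b c : ℤ) : F a c b = -F a b c
  small (N a b c : ℤ) (h : N ≤ c) : F a b c ∈ V N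

variable {V : ℤ → AddSubgroup X} {F : ℤ → ℤ → ℤ → X}

theorem AntisymmSeries.small_second (h : AntisymmSeries V F) {N a b c : ℤ} (hb : N ≤ b) :
    F a b c ∈ V N := by
  rw [← neg_mem_iff, ← h.swap₂₃]
  exact h.small _ _ _ _ hb

/-- The general term of the quotient by the Vandermonde determinant. -/
def quotTerm (F : ℤ → ℤ → ℤ → X) (a b c : ℤ) (r : ℕ × ℕ × ℕ) : X :=
  F (a - r.1 - r.2.1 - 2) (b + r.1 - r.2.2 - 1) (c + r.2.1 + r.2.2)

/-- The general term of the restriction to the line `z₁ = z₂ q^{-s} = z₃ q^{-2s}`. -/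
def lineTerm (q : ℂ) (s : ℤˣ) (G : ℤ → ℤ → ℤ → X) (n : ℤ) (bc : ℤ × ℤ) : X :=
  q ^ (-(s : ℤ) * (bc.1 + 2 * bc.2)) • G (n - bc.1 - bc.2) bc.1 bc.2

variable [UniformSpace X] [IsUniformAddGroup X]

/-- The restriction of `G(z₁,z₂,z₃)` to the line `z₁ = z₂ q^{-s} = z₃ q^{-2s}` is `L`. -/
def HasLine (q : ℂ) (s : ℤˣ) (G : ℤ → ℤ → ℤ → X) (L : ℤ → X) : Prop :=
  ∀ n, HasSum (lineTerm q s G n) (L n)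

theorem HasLine.sub {q : ℂ} {s : ℤˣ} {G G' : ℤ → ℤ → ℤ → X} {L L' : ℤ → X} (h : HasLine q s G L)
    (h' : HasLine q s G' L') : HasLine q s (fun a b c => G a b c - G' a b c) fun n => L n - L' n := by
  intro n
  refine (congrArg (fun f => HasSum f _) (funext fun bc => ?_)).mp ((h n).sub (h' n))
  simp only [lineTerm, smul_sub]

theorem HasLine.sum {q : ℂ} {s : ℤˣ} {ι : Type*} {t : Finset ι} {G : ι → ℤ → ℤ → ℤ → X}
    {L : ι → ℤ → X} (h : ∀ i ∈ t, HasLine q s (G i) (L i)) :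
    HasLine q s (fun a b c => ∑ i ∈ t, G i a b c) fun n => ∑ i ∈ t, L i n := by
  intro n
  refine (congrArg (fun f => HasSum f _) (funext fun bc => ?_)).mp
    (hasSum_sum fun i hi => h i hi n)
  simp only [lineTerm, Finset.smul_sum]

variable [ContinuousConstSMul ℂ X]

theorem HasLine.smul {q : ℂ} {s : ℤˣ} {G : ℤ → ℤ → ℤ → X} {L : ℤ → X} (h : HasLine q s G L)
    (κ : ℂ) : HasLine q s (fun a b c => κ • G a b c) fun n => κ • L n := by
  intro n
  refine (congrArg (fun f => HasSum f _) (funext fun bc => ?_)).mp ((h n).const_smul κ)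
  simp only [lineTerm, smul_comm κ]

theorem HasLine.shift {q : ℂ} (hq : q ≠ 0) {s : ℤˣ} {G : ℤ → ℤ → ℤ → X} {L : ℤ → X}
    (h : HasLine q s G L) (α β γ : ℤ) :
    HasLine q s (fun a b c => G (a + α) (b + β) (c + γ)) fun n =>
      q ^ ((s : ℤ) * (β + 2 * γ)) • L (n + α + β + γ) := by
  intro n
  have h1 := ((Equiv.addRight ((β, γ) : ℤ × ℤ)).hasSum_iff.2 (h (n + α + β + γ))).const_smul
    (q ^ ((s : ℤ) * (β + 2 * γ)))
  refine (congrArg (fun f => HasSum f _) (funext fun bc => ?_)).mp h1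
  simp only [lineTerm, Function.comp_apply, Equiv.coe_addRight, Prod.fst_add, Prod.snd_add,
    smul_smul]
  rw [← zpow_add₀ hq]
  congr 2
  · ring
  · ring

variable [T2Space X]

theorem eq_zero_of_hasSum_neg {α : Type*} {f : α → X} {T : X} (h : HasSum f T) (e : α ≃ α)
    (he : ∀ x, f (e x) = -f x) : T = 0 := by
  have h1 := e.hasSum_iff.2 h
  have h2 : HasSum (f ∘ e) (-T) :=
    (congrArg (fun f => HasSum f _) (funext fun x => (he x).symm)).mp h.neg
  have h3 : T = -T := h1.unique h2
  have h4 : (2 : ℂ) • T = 0 := by rw [two_smul]; nth_rewrite 2 [h3]; exact add_neg_cancel T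
  exact (smul_eq_zero.1 h4).resolve_left two_ne_zero

/-- The quotient of an antisymmetric series by the Vandermonde determinant is symmetric. -/
theorem quot_swap₁₂ (h : AntisymmSeries V F) {a b c : ℤ} {y y' : X}
    (hy : HasSum (quotTerm F a b c) y) (hy' : HasSum (quotTerm F b a c) y') : y = y' := by
  let f : ℤ × ℕ × ℕ → X := fun r => F (a - r.1 - r.2.1 - 2) (b + r.1 - r.2.2 - 1) (c + r.2.1 + r.2.2)
  let i : ℕ × ℕ × ℕ → ℤ × ℕ × ℕ := fun r => (r.1, r.2.1, r.2.2)
  let j : ℕ × ℕ × ℕ → ℤ × ℕ × ℕ := fun r => (-r.1 - 1, r.2.2, r.2.1)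
  have hij : Function.Bijective (Sum.elim i j) := by
    constructor
    · rintro (⟨r1, r2, r3⟩ | ⟨r1, r2, r3⟩) (⟨t1, t2, t3⟩ | ⟨t1, t2, t3⟩) h <;>
        simp only [Sum.elim_inl, Sum.elim_inr, i, j, Prod.mk.injEq] at h <;>
        first
        | (exfalso; omega)
        | (congr 1; ext <;> dsimp only <;> omega)
    · rintro ⟨r1, r2, r3⟩
      rcases le_or_gt 0 r1 with h | h
      · refine ⟨Sum.inl (r1.natAbs, r2, r3), ?_⟩
        simp only [Sum.elim_inl, i, Prod.mk.injEq, and_true]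
        omega
      · refine ⟨Sum.inr ((-r1 - 1).natAbs, r3, r2), ?_⟩
        simp only [Sum.elim_inr, j, Prod.mk.injEq, and_true]
        omega
  have h1 : HasSum f (y + -y') := by
    refine hasSum_of_bijective_sumElim hij hy ?_
    refine (congrArg (fun f => HasSum f _) (funext fun r => ?_)).mp hy'.neg
    simp only [f, j, Function.comp_apply, quotTerm, ← h.swap₁₂]
    congr 1 <;> ring
  let e : ℤ × ℕ × ℕ → ℤ × ℕ × ℕ := fun r => (a - b - r.1 - r.2.1 + r.2.2 - 1, r.2.1, r.2.2)
  have he : Function.Involutive e := fun r => by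
    simp only [e]
    ext <;> dsimp only
    ring
  have := eq_zero_of_hasSum_neg h1 he.toPerm fun r => by
    simp only [Function.Involutive.coe_toPerm, e, f, ← h.swap₁₂]
    congr 1 <;> ring
  rwa [← sub_eq_add_neg, sub_eq_zero] at this

theorem quot_swap₂₃ (h : AntisymmSeries V F) {a b c : ℤ} {y y' : X}
    (hy : HasSum (quotTerm F a b c) y) (hy' : HasSum (quotTerm F a c b) y') : y = y' := by
  let f : ℕ × ℕ × ℤ → X := fun r => F (a - r.1 - r.2.1 - 2) (b + r.1 - r.2.2 - 1) (c + r.2.1 + r.2.2)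
  let i : ℕ × ℕ × ℕ → ℕ × ℕ × ℤ := fun r => (r.1, r.2.1, r.2.2)
  let j : ℕ × ℕ × ℕ → ℕ × ℕ × ℤ := fun r => (r.2.1, r.1, -r.2.2 - 1)
  have hij : Function.Bijective (Sum.elim i j) := by
    constructor
    · rintro (⟨r1, r2, r3⟩ | ⟨r1, r2, r3⟩) (⟨t1, t2, t3⟩ | ⟨t1, t2, t3⟩) h <;>
        simp only [Sum.elim_inl, Sum.elim_inr, i, j, Prod.mk.injEq] at h <;>
        first
        | (exfalso; omega)
        | (congr 1; ext <;> dsimp only <;> omega)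
    · rintro ⟨r1, r2, r3⟩
      rcases le_or_gt 0 r3 with h | h
      · refine ⟨Sum.inl (r1, r2, r3.natAbs), ?_⟩
        simp only [Sum.elim_inl, i, Prod.mk.injEq, true_and]
        omega
      · refine ⟨Sum.inr (r2, r1, (-r3 - 1).natAbs), ?_⟩
        simp only [Sum.elim_inr, j, Prod.mk.injEq, true_and]
        omega
  have h1 : HasSum f (y + -y') := by
    refine hasSum_of_bijective_sumElim hij hy ?_
    refine (congrArg (fun f => HasSum f _) (funext fun r => ?_)).mp hy'.neg
    simp only [f, j, Function.comp_apply, quotTerm, ← h.swap₂₃]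
    congr 1 <;> ring
  let e : ℕ × ℕ × ℤ → ℕ × ℕ × ℤ := fun r => (r.1, r.2.1, b - c + r.1 - r.2.1 - r.2.2 - 1)
  have he : Function.Involutive e := fun r => by
    simp only [e]
    ext <;> dsimp only
    ring
  have := eq_zero_of_hasSum_neg h1 he.toPerm fun r => by
    simp only [Function.Involutive.coe_toPerm, e, f, ← h.swap₂₃]
    congr 1 <;> ring
  rwa [← sub_eq_add_neg, sub_eq_zero] at this

variable [CompleteSpace X]

theorem hasSum_telescope {β : Type*} [NonarchimedeanAddGroup X] {f : β × ℕ → X} {S S' : X}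
    (h : HasSum f S) (h' : HasSum (fun r : β × ℕ => f (r.1, r.2 + 1)) S') :
    HasSum (fun r : β => f (r, 0)) (S - S') := by
  have h0 : Summable (f ∘ fun r : β => (r, 0)) :=
    h.summable.comp_injective fun a b hab => (Prod.mk.inj hab).1
  have hij : Function.Bijective (Sum.elim (fun r : β => (r, 0)) fun r : β × ℕ => (r.1, r.2 + 1)) := by
    constructor
    · rintro (r | ⟨r1, r2⟩) (t | ⟨t1, t2⟩) h <;>
        simp only [Sum.elim_inl, Sum.elim_inr, Prod.mk.injEq] at h
      · rw [h.1]
      · exact absurd h.2 (by omega)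
      · exact absurd h.2 (by omega)
      · congr 1; exact Prod.ext h.1 (by dsimp only; omega)
    · rintro ⟨r, k⟩
      cases k with
      | zero => exact ⟨Sum.inl r, rfl⟩
      | succ k => exact ⟨Sum.inr (r, k), rfl⟩
  have h1 := hasSum_of_bijective_sumElim hij h0.hasSum h'
  have h2 := h.unique h1
  rw [h2, add_sub_cancel_right]
  exact h0.hasSum

variable (hV : (nhds (0 : X)).HasBasis (fun _ : ℤ => True) fun N => (V N : Set X))

include hV

theorem nonarchimedean_of_hasBasis : NonarchimedeanAddGroup X where
  is_nonarchimedean U hU := by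
    obtain ⟨N, -, hN⟩ := hV.mem_iff.1 hU
    exact ⟨⟨V N, (V N).isOpen_of_mem_nhds (hV.mem_of_mem trivial)⟩, hN⟩

theorem summable_of_finite_notMem {α : Type*} {f : α → X}
    (h : ∀ N, {x | f x ∉ V N}.Finite) : Summable f := by
  have := nonarchimedean_of_hasBasis hV
  refine NonarchimedeanAddGroup.summable_of_tendsto_cofinite_zero ?_
  rw [hV.tendsto_right_iff]
  exact fun N _ => h N

theorem summable_quotTerm (h : AntisymmSeries V F) (a b c : ℤ) : Summable (quotTerm F a b c) := by
  refine summable_of_finite_notMem hV fun N => ?_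
  refine Set.Finite.subset (((Finset.range (N - b + 1 + (N - c)).toNat) ×ˢ
    (Finset.range (N - c).toNat) ×ˢ (Finset.range (N - c).toNat)).finite_toSet) fun r hr => ?_
  have h1 : c + r.2.1 + r.2.2 < N := by
    by_contra hc
    exact hr (h.small _ _ _ _ (by omega))
  have h2 : b + r.1 - r.2.2 - 1 < N := by
    by_contra hc
    exact hr (h.small_second (by omega))
  simp only [Finset.coe_product, Finset.coe_range, Set.mem_prod, Set.mem_Iio]
  omega

theorem quot_small (h : AntisymmSeries V F) {N a b c : ℤ} {y : X}
    (hy : HasSum (quotTerm F a b c) y) (hc : N ≤ c) : y ∈ V N := by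
  have hcl : IsClosed (V N : Set X) := by
    refine AddSubgroup.isClosed_of_isOpen _ ?_
    exact (V N).isOpen_of_mem_nhds (hV.mem_of_mem trivial)
  refine hcl.mem_of_tendsto hy (Filter.Eventually.of_forall fun S => ?_)
  refine sum_mem fun r _ => h.small _ _ _ _ (by omega)

theorem summable_lineTerm {Y : ℤ → ℤ → ℤ → X} (q : ℂ) (s : ℤˣ) (n : ℤ)
    (hsm : ∀ (N : ℤ) (κ : ℂ), ∀ x ∈ V N, κ • x ∈ V N)
    (hY : ∀ N a b c, N ≤ a ∨ N ≤ b ∨ N ≤ c → Y a b c ∈ V N) : Summable (lineTerm q s Y n) := by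
  refine summable_of_finite_notMem hV fun N => ?_
  refine Set.Finite.subset ((Finset.Icc (n - 2 * N) N ×ˢ Finset.Icc (n - 2 * N) N).finite_toSet)
    fun bc hbc => ?_
  have h1 : ¬(N ≤ n - bc.1 - bc.2 ∨ N ≤ bc.1 ∨ N ≤ bc.2) := fun hc =>
    hbc (hsm _ _ _ (hY _ _ _ _ hc))
  simp only [Finset.coe_product, Finset.coe_Icc, Set.mem_prod, Set.mem_Icc]
  omega

theorem quot_small_any (h : AntisymmSeries V F) {Y : ℤ → ℤ → ℤ → X}
    (hY : ∀ a b c, HasSum (quotTerm F a b c) (Y a b c)) (N a b c : ℤ)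
    (hN : N ≤ a ∨ N ≤ b ∨ N ≤ c) : Y a b c ∈ V N := by
  rcases hN with hN | hN | hN
  · rw [quot_swap₁₂ h (hY a b c) (hY b a c), quot_swap₂₃ h (hY b a c) (hY b c a)]
    exact quot_small hV h (hY _ _ _) hN
  · rw [quot_swap₂₃ h (hY a b c) (hY a c b)]
    exact quot_small hV h (hY _ _ _) hN
  · exact quot_small hV h (hY _ _ _) hN

/-- The product of the quotient with the Vandermonde determinant is the original series. -/
theorem vandermonde_quot {Y : ℤ → ℤ → ℤ → X}
    (hY : ∀ a b c, HasSum (quotTerm F a b c) (Y a b c)) :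
    let Y₁ : ℤ → ℤ → ℤ → X := fun a b c => Y a (b + 1) c - Y a b (c + 1)
    let Y₂ : ℤ → ℤ → ℤ → X := fun a b c => Y₁ (a + 1) b c - Y₁ a b (c + 1)
    ∀ a b c, F a b c = Y₂ (a + 1) b c - Y₂ a (b + 1) c := by
  intro Y₁ Y₂ a b c
  have := nonarchimedean_of_hasBasis hV
  have h1 : ∀ a b c, HasSum (fun r : ℕ × ℕ => F (a - r.1 - r.2 - 2) (b + r.1) (c + r.2))
      (Y₁ a b c) := by
    intro a b c
    have h1 := (Equiv.prodAssoc ℕ ℕ ℕ).hasSum_iff.2 (hY a (b + 1) c)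
    have h2 := (Equiv.prodAssoc ℕ ℕ ℕ).hasSum_iff.2 (hY a b (c + 1))
    refine (congrArg (fun f => HasSum f _) (funext fun r => ?_)).mp (hasSum_telescope h1
      ((congrArg (fun f => HasSum f _) (funext fun r => ?_)).mp h2))
    · simp only [Function.comp_apply, Equiv.prodAssoc_apply, quotTerm]
      push_cast
      congr 1 <;> ring
    · simp only [Function.comp_apply, Equiv.prodAssoc_apply, quotTerm]
      push_cast
      congr 1 <;> ring
  have h2 : ∀ a b c, HasSum (fun r : ℕ => F (a - r - 1) (b + r) c) (Y₂ a b c) := by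
    intro a b c
    refine (congrArg (fun f => HasSum f _) (funext fun r => ?_)).mp (hasSum_telescope (h1 (a + 1) b c)
      ((congrArg (fun f => HasSum f _) (funext fun r => ?_)).mp (h1 a b (c + 1))))
    · push_cast
      congr 1 <;> ring
    · push_cast
      congr 1 <;> ring
  have h3 := (Equiv.punitProd.{0} ℕ).hasSum_iff.2 (h2 (a + 1) b c)
  have h4 := (Equiv.punitProd.{0} ℕ).hasSum_iff.2 (h2 a (b + 1) c)
  have h5 := hasSum_telescope h3
    ((congrArg (fun f => HasSum f _) (funext fun r => ?_)).mp h4)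
  · refine HasSum.unique ?_ h5
    refine (congrArg (fun f => HasSum f _) (funext fun r => ?_)).mp (hasSum_unique fun _ : PUnit => F a b c)
    simp only [Function.comp_apply, Equiv.punitProd_apply]
    push_cast
    congr 1 <;> ring
  · simp only [Function.comp_apply, Equiv.punitProd_apply]
    push_cast
    congr 1 <;> ring

/-- Restriction to the line of an antisymmetric series and of its quotient. -/
theorem hasLine_of_hasLine_quot {q : ℂ} (hq : q ≠ 0) {s : ℤˣ} {Y : ℤ → ℤ → ℤ → X} {L : ℤ → X}
    (hY : ∀ a b c, HasSum (quotTerm F a b c) (Y a b c)) (hL : HasLine q s Y L) :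
    HasLine q s F fun n => ((1 - q ^ (s : ℤ)) * (1 - q ^ (2 * (s : ℤ))) *
      (q ^ (s : ℤ) - q ^ (2 * (s : ℤ)))) • L (n + 3) := by
  have h := vandermonde_quot hV hY
  dsimp only at h
  have e1 := (hL.shift hq 0 1 0).sub (hL.shift hq 0 0 1)
  have e2 := (e1.shift hq 1 0 0).sub (e1.shift hq 0 0 1)
  have e3 := (e2.shift hq 1 0 0).sub (e2.shift hq 0 1 0)
  intro n
  have e4 := e3 n
  refine (congrArg₂ (fun f => HasSum f) (funext fun bc => ?_) ?_).mp e4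
  · simp only [lineTerm]
    rw [h]
    simp only [add_zero]
  · simp only [add_zero, zero_add, mul_zero, zpow_zero, one_smul, mul_one]
    simp only [show ∀ k : ℤ, k + 1 + 1 + 1 = k + 3 from fun k => by ring, ← sub_smul, smul_smul]
    congr 1
    rw [mul_comm (s : ℤ) 2]
    ring

end Vandermonde

/-! ### Products of three currents -/

section Triple

variable {T : Type*} [Ring T] [Algebra ℂ T]

/-- Coefficient of `z₁^{-a} z₂^{-b} z₃^{-c}` in
`∏_{i<j} (z_i - p₁^s z_j)(z_i - p₂^s z_j) u(z₁) v(z₂) w(z₃)`. -/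
def triple (q : ℂ) (s : ℤˣ) (u v w : ℤ → T) (a b c : ℤ) : T :=
  ∑ i : Fin 3, ∑ j : Fin 3, ∑ k : Fin 3, (fCoeff q s i * fCoeff q s j * fCoeff q s k) •
    (u (a + 4 - (i : ℕ) - (j : ℕ)) * v (b + (i : ℕ) + 2 - (k : ℕ)) * w (c + (j : ℕ) + (k : ℕ)))

theorem triple_swap₁₂ {q : ℂ} {s : ℤˣ} {u v w : ℤ → T} (h : QuadRel q s (-1) u v) (a b c : ℤ) :
    triple q s v u w b a c = -triple q s u v w a b c := by
  have h1 : ∀ j k : Fin 3, ∑ i : Fin 3, (fCoeff q s i * fCoeff q s j * fCoeff q s k) •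
      (v (b + 4 - (i : ℕ) - (j : ℕ)) * u (a + (i : ℕ) + 2 - (k : ℕ)) * w (c + (j : ℕ) + (k : ℕ))) =
      -∑ i : Fin 3, (fCoeff q s i * fCoeff q s k * fCoeff q s j) •
      (u (a + 4 - (i : ℕ) - (k : ℕ)) * v (b + (i : ℕ) + 2 - (j : ℕ)) *
        w (c + (k : ℕ) + (j : ℕ))) := by
    intro j k
    have h2 := congrArg (fun t => (fCoeff q s j * fCoeff q s k) • (t * w (c + (j : ℕ) + (k : ℕ))))
      (h.symm (by norm_num) (b + 2 - (j : ℕ)) (a + 2 - (k : ℕ)))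
    simp only [Finset.sum_mul, smul_mul_assoc, Finset.smul_sum, smul_smul] at h2
    rw [← Finset.sum_neg_distrib]
    refine (Finset.sum_congr rfl fun i _ => ?_).trans (h2.trans
      (Finset.sum_congr rfl fun i _ => ?_))
    · rw [show b + 4 - ((i : ℕ) : ℤ) - (j : ℕ) = b + 2 - (j : ℕ) + 2 - (i : ℕ) by ring,
        show a + ((i : ℕ) : ℤ) + 2 - (k : ℕ) = a + 2 - (k : ℕ) + (i : ℕ) by ring]
      congr 1
      ring
    · rw [show a + 4 - ((i : ℕ) : ℤ) - (k : ℕ) = a + 2 - (k : ℕ) + 2 - (i : ℕ) by ring,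
        show b + ((i : ℕ) : ℤ) + 2 - (j : ℕ) = b + 2 - (j : ℕ) + (i : ℕ) by ring,
        show c + ((k : ℕ) : ℤ) + (j : ℕ) = c + (j : ℕ) + (k : ℕ) by ring, ← neg_smul]
      congr 1
      ring
  have h3 : ∀ (u v : ℤ → T) (a b : ℤ), triple q s u v w a b c =
      ∑ j : Fin 3, ∑ k : Fin 3, ∑ i : Fin 3, (fCoeff q s i * fCoeff q s j * fCoeff q s k) •
        (u (a + 4 - (i : ℕ) - (j : ℕ)) * v (b + (i : ℕ) + 2 - (k : ℕ)) *
          w (c + (j : ℕ) + (k : ℕ))) := by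
    intro u v a b
    rw [triple, Finset.sum_comm]
    exact Finset.sum_congr rfl fun j _ => Finset.sum_comm
  rw [h3, h3, Finset.sum_congr rfl fun j _ => Finset.sum_congr rfl fun k _ => h1 j k]
  simp only [Finset.sum_neg_distrib]
  rw [Finset.sum_comm]

theorem triple_swap₂₃ {q : ℂ} {s : ℤˣ} {u v w : ℤ → T} (h : QuadRel q s (-1) v w) (a b c : ℤ) :
    triple q s u w v a c b = -triple q s u v w a b c := by
  have h1 : ∀ i j : Fin 3, ∑ k : Fin 3, (fCoeff q s i * fCoeff q s j * fCoeff q s k) •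
      (u (a + 4 - (i : ℕ) - (j : ℕ)) * w (c + (i : ℕ) + 2 - (k : ℕ)) * v (b + (j : ℕ) + (k : ℕ))) =
      -∑ k : Fin 3, (fCoeff q s j * fCoeff q s i * fCoeff q s k) •
      (u (a + 4 - (j : ℕ) - (i : ℕ)) * v (b + (j : ℕ) + 2 - (k : ℕ)) *
        w (c + (i : ℕ) + (k : ℕ))) := by
    intro i j
    have h2 := congrArg (fun t => (fCoeff q s i * fCoeff q s j) •
      (u (a + 4 - (i : ℕ) - (j : ℕ)) * t)) (h.symm (by norm_num) (c + (i : ℕ)) (b + (j : ℕ)))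
    simp only [Finset.mul_sum, mul_smul_comm, Finset.smul_sum, smul_smul] at h2
    rw [← Finset.sum_neg_distrib]
    refine (Finset.sum_congr rfl fun k _ => ?_).trans (h2.trans
      (Finset.sum_congr rfl fun k _ => ?_))
    · rw [mul_assoc (u _)]
    · rw [show a + 4 - ((j : ℕ) : ℤ) - (i : ℕ) = a + 4 - (i : ℕ) - (j : ℕ) by ring, mul_assoc (u _),
        ← neg_smul]
      congr 1
      ring
  rw [triple, triple, Finset.sum_congr rfl fun j _ => Finset.sum_congr rfl fun k _ => h1 j k]
  simp only [Finset.sum_neg_distrib]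
  rw [Finset.sum_comm]

theorem map_triple {S : Type*} [Ring S] [Algebra ℂ S] (q : ℂ) (s : ℤˣ) (f : T →ₐ[ℂ] S)
    (u v w : ℤ → T) (a b c : ℤ) : f (triple q s u v w a b c) =
      triple q s (fun n => f (u n)) (fun n => f (v n)) (fun n => f (w n)) a b c := by
  simp [triple]

end Triple

/-! ### Neighbourhoods of zero in the completion -/

/-- The closure of `smallIdeal q N` in the completion. -/
def hatSmall (q : ℂ) (N : ℤ) : Submodule ℂ (PreUHat q) :=
  (Submodule.map (PreU.coe q).toLinearMap ((smallIdeal q N).restrictScalars ℂ)).topologicalClosure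

theorem hasBasis_hatSmall (q : ℂ) : (nhds (0 : PreUHat q)).HasBasis (fun _ : ℤ => True)
    fun N => ((hatSmall q N).toAddSubgroup : Set (PreUHat q)) := by
  exact (PreU.hasBasis_nhds_zero q).hasBasis_of_isDenseInducing
    (UniformSpace.Completion.isDenseInducing_coe (α := PreU q))

theorem hatSmall_anti (q : ℂ) {M N : ℤ} (h : M ≤ N) : hatSmall q N ≤ hatSmall q M :=
  Submodule.topologicalClosure_mono (Submodule.map_mono fun _ hu => smallIdeal_anti q h hu)

theorem isClosed_hatSmall (q : ℂ) (N : ℤ) : IsClosed (hatSmall q N : Set (PreUHat q)) :=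
  Submodule.isClosed_topologicalClosure _

theorem coe_mem_hatSmall {q : ℂ} {N : ℤ} {u : PreU q} (hu : u ∈ smallIdeal q N) :
    (u : PreUHat q) ∈ hatSmall q N := subset_closure ⟨u, hu, rfl⟩

theorem isOpen_smallIdeal (q : ℂ) (N : ℤ) : IsOpen (smallIdeal q N : Set (PreU q)) :=
  (smallIdeal q N).toAddSubgroup.isOpen_of_mem_nhds
    ((PreU.hasBasis_nhds_zero q).mem_of_mem trivial)

theorem coe_mem_hatSmall_iff {q : ℂ} {N : ℤ} {u : PreU q} :
    (u : PreUHat q) ∈ hatSmall q N ↔ u ∈ smallIdeal q N := by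
  refine ⟨fun h => ?_, coe_mem_hatSmall⟩
  have h1 : u ∈ closure (smallIdeal q N : Set (PreU q)) := by
    rw [(UniformSpace.Completion.isDenseInducing_coe (α := PreU q)).isInducing.closure_eq_preimage_closure_image]
    exact h
  rwa [IsClosed.closure_eq] at h1
  exact AddSubgroup.isClosed_of_isOpen (smallIdeal q N).toAddSubgroup (isOpen_smallIdeal q N)

theorem mul_mem_hatSmall {q : ℂ} {N : ℤ} (z : PreUHat q) {w : PreUHat q} (hw : w ∈ hatSmall q N) :
    z * w ∈ hatSmall q N := by
  refine closure_minimal (t := (fun w => z * w) ⁻¹' (hatSmall q N : Set (PreUHat q))) ?_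
    ((isClosed_hatSmall q N).preimage (continuous_const_mul z)) hw
  rintro _ ⟨u, hu, rfl⟩
  change z * (u : PreUHat q) ∈ hatSmall q N
  induction z using UniformSpace.Completion.induction_on with
  | hp => exact (isClosed_hatSmall q N).preimage (continuous_mul_const _)
  | ih v =>
    rw [← UniformSpace.Completion.coe_mul]
    exact coe_mem_hatSmall (Ideal.mul_mem_left _ v hu)

theorem gen_mem_smallIdeal (q : ℂ) {y : Gen} {N : ℤ} (h : N ≤ y.weight) :
    PreU.gen q y ∈ smallIdeal q N := Ideal.subset_span ⟨[y], by simpa using h, by simp⟩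

theorem relations_hatGen (q : ℂ) : Relations q (hatGen q) := (PreU.relations q).map (PreU.coe q)

/-! ### Convergence of the q-Serre sums -/

/-- The modes of `x^s(z)` in the completion. -/
def hatX (q : ℂ) (s : ℤˣ) (n : ℤ) : PreUHat q := hatGen q (.x s n)

theorem tripleCoeff_eq (q : ℂ) (s : ℤˣ) (a b c : ℤ) :
    tripleCoeff q s a b c = triple q s (hatX q s) (hatX q s) (hatX q s) a b c := by
  rw [tripleCoeff, triple]
  rfl

theorem quadRel_hatX {q : ℂ} (hq : q ≠ 0) (s : ℤˣ) : QuadRel q s (-1) (hatX q s) (hatX q s) :=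
  (x_x_iff_quadRel hq s (hatX q s)).1 ((relations_hatGen q).x_x s)

theorem antisymmSeries_tripleCoeff {q : ℂ} (hq : q ≠ 0) (s : ℤˣ) :
    AntisymmSeries (fun N => (hatSmall q N).toAddSubgroup) (tripleCoeff q s) where
  swap₁₂ a b c := by rw [tripleCoeff_eq, tripleCoeff_eq, triple_swap₁₂ (quadRel_hatX hq s)]
  swap₂₃ a b c := by rw [tripleCoeff_eq, tripleCoeff_eq, triple_swap₂₃ (quadRel_hatX hq s)]
  small N a b c h := by
    refine sum_mem fun i _ => sum_mem fun j _ => sum_mem fun k _ => Submodule.smul_mem _ _ ?_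
    refine mul_mem_hatSmall _ (coe_mem_hatSmall (gen_mem_smallIdeal q ?_))
    simp only [Gen.weight]
    omega

theorem exists_yCoeff {q : ℂ} (hq : q ≠ 0) (s : ℤˣ) :
    ∃ Y : ℤ → ℤ → ℤ → PreUHat q, IsYCoeff q s Y ∧ ∃ L, HasLine q s Y L := by
  have h := antisymmSeries_tripleCoeff hq s
  have hs := summable_quotTerm (hasBasis_hatSmall q) h
  choose Y hY using hs
  refine ⟨Y, hY, ?_⟩
  have hl := fun n => summable_lineTerm (hasBasis_hatSmall q) (Y := Y) q s n
    (fun N κ x hx => Submodule.smul_mem _ _ hx) (quot_small_any (hasBasis_hatSmall q) h hY)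
  choose L hL using hl
  exact ⟨L, hL⟩

/-- The sums defining the q-Serre relations converge. -/
theorem serre_convergence {q : ℂ} (hq : q ≠ 0) (s : ℤˣ) :
    ∃ Y : ℤ → ℤ → ℤ → PreUHat q, IsYCoeff q s Y ∧ ∀ n : ℤ, ∃ z : PreUHat q,
      IsLineCoeff q s Y n z := by
  obtain ⟨Y, hY, L, hL⟩ := exists_yCoeff hq s
  exact ⟨Y, hY, fun n => ⟨L n, hL n⟩⟩

/-- Up to a non-zero factor, the q-Serre relations say that the restriction to the line of
`∏_{i<j} (z_i - p₁^s z_j)(z_i - p₂^s z_j) x^s(z₁) x^s(z₂) x^s(z₃)` vanishes. -/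
theorem exists_lineSum_tripleCoeff {q : ℂ} (hq : q ≠ 0) (s : ℤˣ) : ∃ L : ℤ → PreUHat q,
    (∀ n, HasSum (lineTerm q s (tripleCoeff q s) n) (((1 - q ^ (s : ℤ)) *
      (1 - q ^ (2 * (s : ℤ))) * (q ^ (s : ℤ) - q ^ (2 * (s : ℤ)))) • L (n + 3))) ∧
    ∀ Y n z, IsYCoeff q s Y → IsLineCoeff q s Y n z → z = L n := by
  obtain ⟨Y, hY, L, hL⟩ := exists_yCoeff hq s
  refine ⟨L, hasLine_of_hasLine_quot (hasBasis_hatSmall q) hq hY hL, fun Y' n z hY' hz => ?_⟩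
  have : Y' = Y := by
    funext a b c
    exact (hY' a b c).unique (hY a b c)
  subst this
  exact hz.unique (hL n)

theorem line_factor_ne_zero {q : ℂ} (hq : q ≠ 0) (hq4 : q ^ 4 ≠ 1) (s : ℤˣ) :
    (1 - q ^ (s : ℤ)) * (1 - q ^ (2 * (s : ℤ))) * (q ^ (s : ℤ) - q ^ (2 * (s : ℤ))) ≠ 0 := by
  have h1 : q ≠ 1 := fun h => hq4 (by rw [h, one_pow])
  have h2 : q ^ 2 ≠ 1 := fun h => hq4 (by rw [show q ^ 4 = (q ^ 2) ^ 2 by ring, h, one_pow])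
  have h3 : ∀ t : ℂ, t ≠ 0 → t ≠ 1 → t ^ 2 ≠ 1 → (1 - t) * (1 - t ^ 2) * (t - t ^ 2) ≠ 0 := by
    intro t h0 h1 h2
    have : t - t ^ 2 = t * (1 - t) := by ring
    rw [this]
    exact mul_ne_zero (mul_ne_zero (sub_ne_zero.2 h1.symm) (sub_ne_zero.2 h2.symm))
      (mul_ne_zero h0 (sub_ne_zero.2 h1.symm))
  have h4 : q ^ (2 * (s : ℤ)) = (q ^ (s : ℤ)) ^ 2 := by rw [mul_comm, zpow_mul]; rfl
  rw [h4]
  refine h3 _ (zpow_ne_zero _ hq) ?_ ?_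
  · rcases Int.units_eq_one_or s with rfl | rfl <;> simpa using h1
  · rcases Int.units_eq_one_or s with rfl | rfl <;> simpa using h2

/-! ### Weights -/

section Weight

variable {q : ℂ}

theorem one_mem_weightSpace : (1 : U q) ∈ weightSpace q 0 := Submodule.subset_span ⟨[], rfl, rfl⟩

theorem gen_mem_weightSpace (y : Gen) : gen q y ∈ weightSpace q y.weight :=
  Submodule.subset_span ⟨[y], by simp, by simp⟩

theorem mul_mem_weightSpace {m n : ℤ} {u v : U q} (hu : u ∈ weightSpace q m)
    (hv : v ∈ weightSpace q n) : u * v ∈ weightSpace q (m + n) := by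
  induction hu using Submodule.span_induction with
  | mem u hu =>
    obtain ⟨w, rfl, rfl⟩ := hu
    induction hv using Submodule.span_induction with
    | mem v hv =>
      obtain ⟨w', rfl, rfl⟩ := hv
      exact Submodule.subset_span ⟨w ++ w', by simp, by simp⟩
    | zero => rw [mul_zero]; exact zero_mem _
    | add x y _ _ hx hy => rw [mul_add]; exact add_mem hx hy
    | smul c x _ hx => rw [mul_smul_comm]; exact Submodule.smul_mem _ _ hx
  | zero => rw [zero_mul]; exact zero_mem _
  | add x y _ _ hx hy => rw [add_mul]; exact add_mem hx hy
  | smul c x _ hx => rw [smul_mul_assoc]; exact Submodule.smul_mem _ _ hx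

theorem mul_mem_weightSpace' {m n l : ℤ} {u v : U q} (hu : u ∈ weightSpace q m)
    (hv : v ∈ weightSpace q n) (h : m + n = l) : u * v ∈ weightSpace q l :=
  h ▸ mul_mem_weightSpace hu hv

theorem pow_mem_weightSpace_zero {u : U q} (hu : u ∈ weightSpace q 0) (n : ℕ) :
    u ^ n ∈ weightSpace q 0 := by
  induction n with
  | zero => rw [pow_zero]; exact one_mem_weightSpace
  | succ n ih => rw [pow_succ]; exact mul_mem_weightSpace' ih hu (zero_add 0)

theorem gamPow_mem_weightSpace (n : ℤ) : gamPow (gen q) n ∈ weightSpace q 0 := by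
  cases n with
  | ofNat n => exact pow_mem_weightSpace_zero (gen_mem_weightSpace .gam) n
  | negSucc n => exact pow_mem_weightSpace_zero (gen_mem_weightSpace .gamInv) (n + 1)

theorem expCoeff_mem_weightSpace {A : PowerSeries (U q)} {τ : ℤ}
    (h : ∀ n : ℕ, PowerSeries.coeff n A ∈ weightSpace q (τ * n)) (n : ℕ) :
    expCoeff A n ∈ weightSpace q (τ * n) := by
  have hp : ∀ (r n : ℕ), PowerSeries.coeff n (A ^ r) ∈ weightSpace q (τ * n) := by
    intro r
    induction r with
    | zero =>
      intro n
      rw [pow_zero, PowerSeries.coeff_one]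
      split_ifs with hn
      · rw [hn, Nat.cast_zero, mul_zero]; exact one_mem_weightSpace
      · exact zero_mem _
    | succ r ih =>
      intro n
      rw [pow_succ, PowerSeries.coeff_mul]
      refine sum_mem fun ij hij => mul_mem_weightSpace' (ih _) (h _) ?_
      rw [Finset.HasAntidiagonal.mem_antidiagonal] at hij
      rw [← hij]
      push_cast
      ring
  exact sum_mem fun r _ => Submodule.smul_mem _ _ (hp r n)

theorem aSeries_mem_weightSpace (n : ℕ) :
    PowerSeries.coeff n (aSeries (gen q)) ∈ weightSpace q (-1 * n) := by
  cases n with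
  | zero => rw [coeff_zero_aSeries]; exact zero_mem _
  | succ n =>
    rw [coeff_succ_aSeries]
    have := gen_mem_weightSpace (q := q) (.a n)
    simp only [Gen.weight] at this
    rwa [show (-1 * ((n + 1 : ℕ) : ℤ)) = -((n : ℤ) + 1) by push_cast; ring]

theorem bSeries_mem_weightSpace (n : ℕ) :
    PowerSeries.coeff n (bSeries (gen q)) ∈ weightSpace q (1 * n) := by
  cases n with
  | zero => rw [coeff_zero_bSeries]; exact zero_mem _
  | succ n =>
    rw [coeff_succ_bSeries]
    have := gen_mem_weightSpace (q := q) (.b n)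
    simp only [Gen.weight] at this
    rwa [show (1 * ((n + 1 : ℕ) : ℤ)) = (n : ℤ) + 1 by push_cast; ring]

theorem phi_mem_weightSpace (m : ℤ) : phi (gen q) m ∈ weightSpace q m := by
  rcases lt_or_ge 0 m with hm | hm
  · rw [phi_of_pos _ hm]; exact zero_mem _
  · obtain ⟨n, rfl⟩ : ∃ n : ℕ, m = -n := ⟨m.natAbs, by omega⟩
    rw [phi_neg_natCast]
    exact mul_mem_weightSpace' (gen_mem_weightSpace .k)
      (expCoeff_mem_weightSpace aSeries_mem_weightSpace n) (by simp [Gen.weight])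

theorem psi_mem_weightSpace (m : ℤ) : psi (gen q) m ∈ weightSpace q m := by
  rcases lt_or_ge m 0 with hm | hm
  · rw [psi_of_neg _ hm]; exact zero_mem _
  · obtain ⟨n, rfl⟩ : ∃ n : ℕ, m = n := ⟨m.natAbs, by omega⟩
    rw [psi_natCast]
    exact mul_mem_weightSpace' (gen_mem_weightSpace .kInv)
      (expCoeff_mem_weightSpace bSeries_mem_weightSpace n) (by simp [Gen.weight])

theorem parity_word (w : List Gen) : parity q ((w.map (gen q)).prod) =
    (w.map Gen.sign).prod • (w.map (gen q)).prod := by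
  induction w with
  | nil => simp
  | cons y w ih =>
    simp only [List.map_cons, List.prod_cons, map_mul, ih, parity_gen, smul_mul_assoc,
      mul_smul_comm, smul_smul]
    rw [mul_comm]

theorem parity_mem_weightSpace {n : ℤ} {u : U q} (hu : u ∈ weightSpace q n) :
    parity q u ∈ weightSpace q n := by
  induction hu using Submodule.span_induction with
  | mem u hu =>
    obtain ⟨w, hw, rfl⟩ := hu
    rw [parity_word]
    exact Submodule.smul_mem _ _ (Submodule.subset_span ⟨w, hw, rfl⟩)
  | zero => rw [map_zero]; exact zero_mem _
  | add x y _ _ hx hy => rw [map_add]; exact add_mem hx hy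
  | smul c x _ hx => rw [map_smul]; exact Submodule.smul_mem _ _ hx

/-! ### The coproduct of the generators -/

theorem parity_gamPow (n : ℤ) : parity q (gamPow (gen q) n) = gamPow (gen q) n := by
  rw [map_gamPow]
  cases n <;> simp [gamPow, parity_gen, Gen.sign]

theorem parity_aSeries : aSeries (fun y => parity q (gen q y)) = aSeries (gen q) := by
  ext n
  cases n with
  | zero => rw [coeff_zero_aSeries, coeff_zero_aSeries]
  | succ n => rw [coeff_succ_aSeries, coeff_succ_aSeries, parity_gen_of_sign rfl]

theorem parity_bSeries : bSeries (fun y => parity q (gen q y)) = bSeries (gen q) := by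
  ext n
  cases n with
  | zero => rw [coeff_zero_bSeries, coeff_zero_bSeries]
  | succ n => rw [coeff_succ_bSeries, coeff_succ_bSeries, parity_gen_of_sign rfl]

theorem parity_phi (n : ℤ) : parity q (phi (gen q) n) = phi (gen q) n := by
  rw [map_phi]
  simp only [phi, parity_aSeries, parity_gen_of_sign (q := q) (y := .k) rfl]

theorem parity_psi (n : ℤ) : parity q (psi (gen q) n) = psi (gen q) n := by
  rw [map_psi]
  simp only [psi, parity_bSeries, parity_gen_of_sign (q := q) (y := .kInv) rfl]

theorem phi_genLeft (n : ℤ) : phi (genLeft q) n = phi (gen q) n ᵍ⊗ₜ[ℂ] 1 :=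
  (map_phi (GradedTensorProduct.includeLeft (R := ℂ) (parityPart q) (parityPart q)) _ _).symm

theorem phi_genRight (n : ℤ) : phi (genRight q) n = 1 ᵍ⊗ₜ[ℂ] phi (gen q) n :=
  (map_phi (GradedTensorProduct.includeRight (R := ℂ) (parityPart q) (parityPart q)) _ _).symm

theorem psi_genLeft (n : ℤ) : psi (genLeft q) n = psi (gen q) n ᵍ⊗ₜ[ℂ] 1 :=
  (map_psi (GradedTensorProduct.includeLeft (R := ℂ) (parityPart q) (parityPart q)) _ _).symm

theorem psi_genRight (n : ℤ) : psi (genRight q) n = 1 ᵍ⊗ₜ[ℂ] psi (gen q) n :=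
  (map_psi (GradedTensorProduct.includeRight (R := ℂ) (parityPart q) (parityPart q)) _ _).symm

theorem gamPow_genLeft (n : ℤ) : gamPow (genLeft q) n = gamPow (gen q) n ᵍ⊗ₜ[ℂ] 1 :=
  (map_gamPow (GradedTensorProduct.includeLeft (R := ℂ) (parityPart q) (parityPart q)) _ _).symm

theorem gamPow_genRight (n : ℤ) : gamPow (genRight q) n = 1 ᵍ⊗ₜ[ℂ] gamPow (gen q) n :=
  (map_gamPow (GradedTensorProduct.includeRight (R := ℂ) (parityPart q) (parityPart q)) _ _).symm

theorem tmul_one_mul_one_tmul (u v : U q) :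
    (u ᵍ⊗ₜ[ℂ] 1 * 1 ᵍ⊗ₜ[ℂ] v : TensorSq q) = u ᵍ⊗ₜ[ℂ] v :=
  GradedTensorProduct.tmul_one_mul_one_tmul (parityPart q) (parityPart q) u v

theorem chi_gen (a b m : ℤ) : chi (genLeft q) (genRight q) a b m =
    gamPow (gen q) (a * m) ᵍ⊗ₜ[ℂ] gamPow (gen q) (b * m) := by
  rw [chi, gamPow_genLeft, gamPow_genRight, tmul_one_mul_one_tmul]

theorem twistMode_left (u : ℤ → U q) (a b m : ℤ) :
    twistMode (genLeft q) (genRight q) a b (fun n => u n ᵍ⊗ₜ[ℂ] 1) m =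
      (u m * gamPow (gen q) (a * m)) ᵍ⊗ₜ[ℂ] gamPow (gen q) (b * m) := by
  rw [twistMode, chi_gen, tsq_mul_of_even (map_one _), one_mul]

theorem twistMode_right (u : ℤ → U q) (a b m : ℤ) :
    twistMode (genLeft q) (genRight q) a b (fun n => 1 ᵍ⊗ₜ[ℂ] u n) m =
      gamPow (gen q) (a * m) ᵍ⊗ₜ[ℂ] (u m * gamPow (gen q) (b * m)) := by
  rw [twistMode, chi_gen, tsq_mul_even_left (parity_gamPow _), one_mul]

theorem phi_genLeft_eq : phi (genLeft q) = fun n => phi (gen q) n ᵍ⊗ₜ[ℂ] 1 := funext phi_genLeft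
theorem phi_genRight_eq : phi (genRight q) = fun n => 1 ᵍ⊗ₜ[ℂ] phi (gen q) n := funext phi_genRight
theorem psi_genLeft_eq : psi (genLeft q) = fun n => psi (gen q) n ᵍ⊗ₜ[ℂ] 1 := funext psi_genLeft
theorem psi_genRight_eq : psi (genRight q) = fun n => 1 ᵍ⊗ₜ[ℂ] psi (gen q) n := funext psi_genRight

theorem gamPow_gen_mul (m n : ℤ) :
    gamPow (gen q) m * gamPow (gen q) n = gamPow (gen q) (m + n) :=
  ((relations_gen q).gamPow_add m n).symm

theorem mul_gamPow_mul (u : U q) (m n : ℤ) :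
    u * gamPow (gen q) m * gamPow (gen q) n = u * gamPow (gen q) (m + n) := by
  rw [mul_assoc, gamPow_gen_mul]

theorem coeff_xLeft_pos (n j : ℤ) : (xLeft (genLeft q) (genRight q) 1 n).coeff j =
    if j = 0 then gen q (.x 1 n) ᵍ⊗ₜ[ℂ] 1 else 0 := by
  rw [xLeft, if_pos rfl, star_unitMode_right, HahnSeries.coeff_single]
  split_ifs <;> rfl

theorem coeff_xRight_pos (n j : ℤ) : (xRight (genLeft q) (genRight q) 1 n).coeff j =
    (phi (gen q) (n - j) * gamPow (gen q) (-(n + j))) ᵍ⊗ₜ[ℂ] gen q (.x 1 j) := by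
  rw [xRight, if_pos rfl, star_coeff (Or.inl ((truncated_phi _).twistMode _ _)), phi_genLeft_eq,
    twistMode_left]
  refine (congrArg _ (twistMode_right (fun n => gen q (.x 1 n)) _ _ _)).trans ?_
  rw [zero_mul, zero_mul, gamPow_zero, tsq_mul_of_even (map_one _), one_mul, mul_one,
    mul_gamPow_mul]
  congr 4
  ring

theorem coeff_xLeft_neg (n j : ℤ) : (xLeft (genLeft q) (genRight q) (-1) n).coeff j =
    gen q (.x (-1) (n - j)) ᵍ⊗ₜ[ℂ] (psi (gen q) j * gamPow (gen q) (j - 2 * n)) := by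
  rw [xLeft, if_neg (by decide), star_coeff (Or.inr ((truncated_psi _).twistMode _ _)),
    psi_genRight_eq, twistMode_right]
  refine (congrArg (· * _) (twistMode_left (fun n => gen q (.x (-1) n)) _ _ _)).trans ?_
  rw [zero_mul, zero_mul, gamPow_zero, mul_one, tsq_mul_of_even (parity_gamPow _), mul_one,
    (gamPow_central _ _).eq, mul_gamPow_mul,
    show -1 * j + -2 * (n - j) = j - 2 * n by ring]

theorem coeff_xRight_neg (n j : ℤ) : (xRight (genLeft q) (genRight q) (-1) n).coeff j =
    if j = n then 1 ᵍ⊗ₜ[ℂ] gen q (.x (-1) n) else 0 := by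
  rw [xRight, if_neg (by decide), star_unitMode_left, HahnSeries.coeff_single]
  split_ifs <;> rfl

theorem coeff_phi_coprodGen (hq : q ≠ 0) (n j : ℤ) :
    (phi (coprodGen (genLeft q) (genRight q)) n).coeff j =
    (phi (gen q) (n - j) * gamPow (gen q) (-j)) ᵍ⊗ₜ[ℂ]
      (gamPow (gen q) (n - j) * phi (gen q) j) := by
  rw [(pair_gen hq).phi_coprodGen, star_coeff (Or.inl ((truncated_phi _).twistMode _ _)),
    phi_genLeft_eq, twistMode_left, phi_genRight_eq, twistMode_right, zero_mul, zero_mul,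
    gamPow_zero, mul_one, mul_one, tsq_mul_of_even (parity_gamPow _), one_mul, neg_one_mul]

theorem coeff_psi_coprodGen (hq : q ≠ 0) (n j : ℤ) :
    (psi (coprodGen (genLeft q) (genRight q)) n).coeff j =
    (psi (gen q) (n - j) * gamPow (gen q) j) ᵍ⊗ₜ[ℂ]
      (gamPow (gen q) (-(n - j)) * psi (gen q) j) := by
  rw [(pair_gen hq).psi_coprodGen, star_coeff (Or.inr ((truncated_psi _).twistMode _ _)),
    psi_genLeft_eq, twistMode_left, psi_genRight_eq, twistMode_right, zero_mul, zero_mul,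
    gamPow_zero, mul_one, mul_one, tsq_mul_of_even (parity_gamPow _), one_mul, neg_one_mul]

/-! ### Bihomogeneity of the coproduct -/

/-- The span of the `a ⊗ b` with `a` of weight `m` and `b` of weight `n`. -/
def biweight (q : ℂ) (m n : ℤ) : Submodule ℂ (TensorSq q) :=
  Submodule.span ℂ {t | ∃ a ∈ weightSpace q m, ∃ b ∈ weightSpace q n, t = a ᵍ⊗ₜ[ℂ] b}

theorem tmul_mem_biweight {m n : ℤ} {a b : U q} (ha : a ∈ weightSpace q m)
    (hb : b ∈ weightSpace q n) : (a ᵍ⊗ₜ[ℂ] b : TensorSq q) ∈ biweight q m n :=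
  Submodule.subset_span ⟨a, ha, b, hb, rfl⟩

theorem mul_mem_biweight {m n m' n' : ℤ} {s t : TensorSq q} (hs : s ∈ biweight q m n)
    (ht : t ∈ biweight q m' n') : s * t ∈ biweight q (m + m') (n + n') := by
  induction hs using Submodule.span_induction with
  | mem s hs =>
    obtain ⟨a, ha, b, hb, rfl⟩ := hs
    induction ht using Submodule.span_induction with
    | mem t ht =>
      obtain ⟨c, hc, d, hd, rfl⟩ := ht
      rw [tsq_mul]
      refine add_mem (tmul_mem_biweight (mul_mem_weightSpace ha hc) (mul_mem_weightSpace ?_ hd))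
        (tmul_mem_biweight (mul_mem_weightSpace ha (parity_mem_weightSpace hc))
          (mul_mem_weightSpace ?_ hd))
      · exact Submodule.smul_mem _ _ (add_mem hb (parity_mem_weightSpace hb))
      · exact Submodule.smul_mem _ _ (sub_mem hb (parity_mem_weightSpace hb))
    | zero => rw [mul_zero]; exact zero_mem _
    | add x y _ _ hx hy => rw [mul_add]; exact add_mem hx hy
    | smul c x _ hx => rw [mul_smul_comm]; exact Submodule.smul_mem _ _ hx
  | zero => rw [zero_mul]; exact zero_mem _
  | add x y _ _ hx hy => rw [add_mul]; exact add_mem hx hy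
  | smul c x _ hx => rw [smul_mul_assoc]; exact Submodule.smul_mem _ _ hx

/-- The formal tensors all of whose components have total weight `W`. -/
def totalWeight (q : ℂ) (W : ℤ) : Submodule ℂ (FormalTensor q) where
  carrier := {t | ∀ j, t.coeff j ∈ biweight q (W - j) j}
  add_mem' hs ht j := by rw [HahnSeries.coeff_add]; exact add_mem (hs j) (ht j)
  zero_mem' j := by rw [HahnSeries.coeff_zero]; exact zero_mem _
  smul_mem' c t ht j := by rw [HahnSeries.coeff_smul]; exact Submodule.smul_mem _ _ (ht j)

theorem mul_mem_totalWeight {W W' : ℤ} {s t : FormalTensor q} (hs : s ∈ totalWeight q W)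
    (ht : t ∈ totalWeight q W') : s * t ∈ totalWeight q (W + W') := by
  intro j
  rw [HahnSeries.coeff_mul]
  refine sum_mem fun ij hij => ?_
  rw [Finset.mem_antidiagonal] at hij
  have := mul_mem_biweight (hs ij.1) (ht ij.2)
  rw [hij.2.2] at this
  rwa [show W - ij.1 + (W' - ij.2) = W + W' - j by rw [← hij.2.2]; ring] at this

theorem single_mem_totalWeight {W j : ℤ} {t : TensorSq q} (ht : t ∈ biweight q (W - j) j) :
    HahnSeries.single j t ∈ totalWeight q W := by
  intro i
  rw [HahnSeries.coeff_single]
  split_ifs with h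
  · rwa [h]
  · exact zero_mem _

theorem single_left_mem_totalWeight (y : Gen) (n : ℤ) :
    HahnSeries.single 0 (genLeft q y * gamPow (genRight q) n) ∈ totalWeight q y.weight := by
  refine single_mem_totalWeight ?_
  have h : genLeft q y * gamPow (genRight q) n = gen q y ᵍ⊗ₜ[ℂ] gamPow (gen q) n := by
    rw [gamPow_genRight]
    exact tmul_one_mul_one_tmul _ _
  rw [h, sub_zero]
  exact tmul_mem_biweight (gen_mem_weightSpace y) (gamPow_mem_weightSpace n)

theorem single_right_mem_totalWeight (y : Gen) (n : ℤ) :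
    HahnSeries.single y.weight (gamPow (genLeft q) n * genRight q y) ∈
      totalWeight q y.weight := by
  refine single_mem_totalWeight ?_
  have h : gamPow (genLeft q) n * genRight q y = gamPow (gen q) n ᵍ⊗ₜ[ℂ] gen q y := by
    rw [gamPow_genLeft]
    exact tmul_one_mul_one_tmul _ _
  rw [h, sub_self]
  exact tmul_mem_biweight (gamPow_mem_weightSpace n) (gen_mem_weightSpace y)

theorem C_mem_totalWeight {y : Gen} (hy : y.weight = 0) :
    HahnSeries.C (genLeft q y * genRight q y) ∈ totalWeight q y.weight := by
  refine single_mem_totalWeight ?_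
  have h : genLeft q y * genRight q y = gen q y ᵍ⊗ₜ[ℂ] gen q y := tmul_one_mul_one_tmul _ _
  have h' := gen_mem_weightSpace (q := q) y
  rw [hy] at h'
  rw [h, hy, sub_zero]
  exact tmul_mem_biweight h' h'

theorem coprodGen_a_mem (n : ℕ) :
    coprodGen (genLeft q) (genRight q) (.a n) ∈ totalWeight q (Gen.a n).weight :=
  Submodule.add_mem (totalWeight q (Gen.a n).weight)
    (x := HahnSeries.single 0 (genLeft q (.a n) * gamPow (genRight q) (-(n + 1))))
    (y := HahnSeries.single (-(n + 1) : ℤ) (gamPow (genLeft q) (n + 1) * genRight q (.a n)))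
    (single_left_mem_totalWeight (.a n) _) (single_right_mem_totalWeight (.a n) _)

theorem coprodGen_b_mem (n : ℕ) :
    coprodGen (genLeft q) (genRight q) (.b n) ∈ totalWeight q (Gen.b n).weight :=
  Submodule.add_mem (totalWeight q (Gen.b n).weight)
    (x := HahnSeries.single 0 (genLeft q (.b n) * gamPow (genRight q) (-(n + 1))))
    (y := HahnSeries.single ((n + 1) : ℤ) (gamPow (genLeft q) (n + 1) * genRight q (.b n)))
    (single_left_mem_totalWeight (.b n) _) (single_right_mem_totalWeight (.b n) _)

theorem xLeft_mem_totalWeight (s : ℤˣ) (n : ℤ) :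
    xLeft (genLeft q) (genRight q) s n ∈ totalWeight q n := by
  intro j
  rcases Int.units_eq_one_or s with rfl | rfl
  · rw [coeff_xLeft_pos]
    split_ifs with h
    · rw [h, sub_zero]
      exact tmul_mem_biweight (gen_mem_weightSpace (.x 1 n)) one_mem_weightSpace
    · exact zero_mem _
  · rw [coeff_xLeft_neg]
    exact tmul_mem_biweight (gen_mem_weightSpace (.x (-1) (n - j)))
      (mul_mem_weightSpace' (psi_mem_weightSpace _) (gamPow_mem_weightSpace _) (add_zero _))

theorem xRight_mem_totalWeight (s : ℤˣ) (n : ℤ) :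
    xRight (genLeft q) (genRight q) s n ∈ totalWeight q n := by
  intro j
  rcases Int.units_eq_one_or s with rfl | rfl
  · rw [coeff_xRight_pos]
    exact tmul_mem_biweight
      (mul_mem_weightSpace' (phi_mem_weightSpace _) (gamPow_mem_weightSpace _) (add_zero _))
      (gen_mem_weightSpace (.x 1 j))
  · rw [coeff_xRight_neg]
    split_ifs with h
    · rw [h, sub_self]
      exact tmul_mem_biweight one_mem_weightSpace (gen_mem_weightSpace (.x (-1) n))
    · exact zero_mem _

theorem coprodGen_mem_totalWeight (y : Gen) :
    coprodGen (genLeft q) (genRight q) y ∈ totalWeight q y.weight := by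
  cases y with
  | gam => exact C_mem_totalWeight (y := .gam) rfl
  | gamInv => exact C_mem_totalWeight (y := .gamInv) rfl
  | k => exact C_mem_totalWeight (y := .k) rfl
  | kInv => exact C_mem_totalWeight (y := .kInv) rfl
  | a n => exact coprodGen_a_mem n
  | b n => exact coprodGen_b_mem n
  | x s n =>
    exact Submodule.add_mem (totalWeight q n) (xLeft_mem_totalWeight s n)
      (xRight_mem_totalWeight s n)

theorem comul_word_mem_totalWeight (hq : q ≠ 0) (w : List Gen) :
    PreU.comul hq ((w.map (PreU.gen q)).prod) ∈ totalWeight q (w.map Gen.weight).sum := by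
  induction w with
  | nil =>
    simp only [List.map_nil, List.prod_nil, List.sum_nil, map_one]
    refine single_mem_totalWeight ?_
    rw [sub_zero]
    exact tmul_mem_biweight one_mem_weightSpace one_mem_weightSpace
  | cons y w ih =>
    simp only [List.map_cons, List.prod_cons, List.sum_cons, map_mul, PreU.comul_gen]
    exact mul_mem_totalWeight (coprodGen_mem_totalWeight y) ih

end Weight

/-! ### The topology of the completed quotient -/

section UHatTopology

variable (q : ℂ)

theorem UHat.mk_surjective : Function.Surjective (UHat.mk q) := Ideal.Quotient.mk_surjective

theorem UHat.mk_eq_zero {z : PreUHat q} : UHat.mk q z = 0 ↔ z ∈ serreIdeal q :=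
  Ideal.Quotient.eq_zero_iff_mem

theorem UHat.continuous_mk : Continuous (UHat.mk q) := continuous_coinduced_rng

theorem UHat.isOpenMap_mk : IsOpenMap (UHat.mk q) :=
  QuotientAddGroup.isOpenMap_coe (N := (serreIdeal q).toAddSubgroup)

theorem UHat.isOpenQuotientMap_mk : IsOpenQuotientMap (UHat.mk q) :=
  ⟨UHat.mk_surjective q, UHat.continuous_mk q, UHat.isOpenMap_mk q⟩

instance : IsTopologicalRing (UHat q) where
  continuous_add := by
    rw [((UHat.isOpenQuotientMap_mk q).prodMap
      (UHat.isOpenQuotientMap_mk q)).isQuotientMap.continuous_iff]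
    exact (UHat.continuous_mk q).comp continuous_add
  continuous_mul := by
    rw [((UHat.isOpenQuotientMap_mk q).prodMap
      (UHat.isOpenQuotientMap_mk q)).isQuotientMap.continuous_iff]
    exact (UHat.continuous_mk q).comp continuous_mul
  continuous_neg := by
    rw [(UHat.isOpenQuotientMap_mk q).isQuotientMap.continuous_iff]
    exact (UHat.continuous_mk q).comp continuous_neg

instance : ContinuousConstSMul ℂ (UHat q) where
  continuous_const_smul c := by
    simp only [Algebra.smul_def]
    exact continuous_const_mul _

instance : T2Space (UHat q) := by
  have h : IsClosed ({0} : Set (UHat q)) := by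
    rw [← (UHat.isOpenQuotientMap_mk q).isQuotientMap.isClosed_preimage]
    have : UHat.mk q ⁻¹' {0} = (serreIdeal q : Set (PreUHat q)) := by
      ext z
      exact UHat.mk_eq_zero q
    rw [this]
    exact isClosed_closure
  have : T1Space (UHat q) := IsTopologicalAddGroup.t1Space _ h
  infer_instance

/-- The image of `hatSmall q N` in the completed quotient. -/
def uhatSmall (N : ℤ) : Submodule ℂ (UHat q) := (hatSmall q N).map (UHat.mk q).toLinearMap

theorem hasBasis_uhatSmall : (nhds (0 : UHat q)).HasBasis (fun _ : ℤ => True)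
    fun N => ((uhatSmall q N).toAddSubgroup : Set (UHat q)) := by
  have h := (hasBasis_hatSmall q).map (UHat.mk q)
  rw [(UHat.isOpenQuotientMap_mk q).map_nhds_eq, map_zero] at h
  exact h

variable {q}

theorem uhatSmall_anti {M N : ℤ} (h : M ≤ N) : uhatSmall q N ≤ uhatSmall q M :=
  Submodule.map_mono (hatSmall_anti q h)

theorem mul_mem_uhatSmall {N : ℤ} (z : UHat q) {w : UHat q} (hw : w ∈ uhatSmall q N) :
    z * w ∈ uhatSmall q N := by
  obtain ⟨w, hw, rfl⟩ := hw
  obtain ⟨z, rfl⟩ := UHat.mk_surjective q z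
  exact ⟨z * w, mul_mem_hatSmall z hw, map_mul (UHat.mk q) z w⟩

theorem exists_uhatSmall_mul (v : UHat q) (N : ℤ) :
    ∃ M, ∀ w ∈ uhatSmall q M, w * v ∈ uhatSmall q N := by
  have h : Filter.Tendsto (fun w => w * v) (nhds 0) (nhds (0 : UHat q)) := by
    have := (continuous_mul_const v).tendsto (0 : UHat q)
    rwa [zero_mul] at this
  obtain ⟨M, -, hM⟩ := ((hasBasis_uhatSmall q).tendsto_iff (hasBasis_uhatSmall q)).1 h N trivial
  exact ⟨M, hM⟩

theorem eq_zero_of_mem_uhatSmall {z : UHat q} (h : ∀ N, z ∈ uhatSmall q N) : z = 0 := by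
  by_contra hz
  have : ({z}ᶜ : Set (UHat q)) ∈ nhds (0 : UHat q) := isOpen_compl_singleton.mem_nhds (Ne.symm hz)
  obtain ⟨N, -, hN⟩ := (hasBasis_uhatSmall q).mem_iff.1 this
  exact hN (h N) rfl

theorem PreUHat.parity_mem_hatSmall {N : ℤ} {z : PreUHat q} (hz : z ∈ hatSmall q N) :
    PreUHat.parity q z ∈ hatSmall q N := by
  refine map_mem_closure (PreUHat.continuous_parity q) hz ?_
  rintro _ ⟨u, hu, rfl⟩
  exact ⟨PreU.parity q u, PreU.parity_small q N hu, (PreUHat.parity_coe q u).symm⟩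

theorem UHat.parity_mem_uhatSmall {N : ℤ} {z : UHat q} (hz : z ∈ uhatSmall q N) :
    UHat.parity q z ∈ uhatSmall q N := by
  obtain ⟨z, hz, rfl⟩ := hz
  exact ⟨PreUHat.parity q z, PreUHat.parity_mem_hatSmall hz, rfl⟩

theorem toUHat_mem_uhatSmall {N : ℤ} {u : PreU q} (hu : u ∈ smallIdeal q N) :
    PreU.toUHat q u ∈ uhatSmall q N := ⟨u, coe_mem_hatSmall hu, rfl⟩

end UHatTopology

/-! ### Neighbourhoods of zero in the tensor square -/

section TensorSmall

variable {q : ℂ}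

/-- The elements of `U q` that are small in the completed quotient. -/
def uSmall (q : ℂ) (N : ℤ) : Submodule ℂ (U q) := (uhatSmall q N).comap (incl q)

theorem uSmall_anti {M N : ℤ} (h : M ≤ N) : uSmall q N ≤ uSmall q M :=
  Submodule.comap_mono (uhatSmall_anti h)

theorem mul_mem_uSmall {N : ℤ} (u : U q) {v : U q} (hv : v ∈ uSmall q N) : u * v ∈ uSmall q N :=
  mul_mem_uhatSmall (u : UHat q) hv

theorem exists_uSmall_mul (v : U q) (N : ℤ) : ∃ M, ∀ u ∈ uSmall q M, u * v ∈ uSmall q N := by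
  obtain ⟨M, hM⟩ := exists_uhatSmall_mul (v : UHat q) N
  exact ⟨M, fun u hu => hM u hu⟩

theorem parity_mem_uSmall {N : ℤ} {u : U q} (hu : u ∈ uSmall q N) : parity q u ∈ uSmall q N :=
  UHat.parity_mem_uhatSmall hu

theorem iInf_uSmall : ⨅ N, uSmall q N = ⊥ := by
  rw [eq_bot_iff]
  intro u hu
  rw [Submodule.mem_iInf] at hu
  exact Subtype.ext (eq_zero_of_mem_uhatSmall hu)

theorem weightSpace_le_uSmall {m N : ℤ} (h : N ≤ m) : weightSpace q m ≤ uSmall q N := by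
  rw [weightSpace, Submodule.span_le]
  rintro _ ⟨w, hw, rfl⟩
  have : ((w.map (gen q)).prod : U q) = (PreU.toUHat q).rangeRestrict ((w.map (PreU.gen q)).prod) := by
    rw [map_list_prod, List.map_map]
    rfl
  rw [this]
  exact toUHat_mem_uhatSmall (Ideal.subset_span ⟨w, by omega, rfl⟩)

/-- The tensors one of whose factors is small. -/
def tensorSmall (q : ℂ) (N : ℤ) : Submodule ℂ (TensorSq q) :=
  Submodule.span ℂ {t | ∃ a b : U q, (a ∈ uSmall q N ∨ b ∈ uSmall q N) ∧ t = a ᵍ⊗ₜ[ℂ] b}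

theorem tmul_mem_tensorSmall {N : ℤ} {a b : U q} (h : a ∈ uSmall q N ∨ b ∈ uSmall q N) :
    (a ᵍ⊗ₜ[ℂ] b : TensorSq q) ∈ tensorSmall q N := Submodule.subset_span ⟨a, b, h, rfl⟩

theorem tensorSmall_anti {M N : ℤ} (h : M ≤ N) : tensorSmall q N ≤ tensorSmall q M :=
  Submodule.span_mono fun _ ⟨a, b, hab, ht⟩ =>
    ⟨a, b, hab.imp (fun h' => uSmall_anti h h') (fun h' => uSmall_anti h h'), ht⟩

theorem biweight_le_tensorSmall {m n N : ℤ} (h : N ≤ m ∨ N ≤ n) :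
    biweight q m n ≤ tensorSmall q N := by
  refine Submodule.span_mono ?_
  rintro _ ⟨a, ha, b, hb, rfl⟩
  exact ⟨a, b, h.imp (fun h => weightSpace_le_uSmall h ha) (fun h => weightSpace_le_uSmall h hb),
    rfl⟩

theorem tsq_induction {p : TensorSq q → Prop} (h0 : p 0) (htmul : ∀ a b, p (a ᵍ⊗ₜ[ℂ] b))
    (hadd : ∀ s t, p s → p t → p (s + t)) (t : TensorSq q) : p t := by
  have : ∀ x : U q ⊗[ℂ] U q, p (GradedTensorProduct.of ℂ (parityPart q) (parityPart q) x) :=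
    fun x => by
      induction x using TensorProduct.induction_on with
      | zero => rw [map_zero]; exact h0
      | tmul a b => exact htmul a b
      | add x y hx hy => rw [map_add]; exact hadd _ _ hx hy
  exact this ((GradedTensorProduct.of ℂ (parityPart q) (parityPart q)).symm t)

theorem mul_mem_tensorSmall {N : ℤ} (s : TensorSq q) {t : TensorSq q} (ht : t ∈ tensorSmall q N) :
    s * t ∈ tensorSmall q N := by
  induction ht using Submodule.span_induction with
  | mem t ht =>
    obtain ⟨a, b, hab, rfl⟩ := ht
    induction s using tsq_induction with
    | h0 => rw [zero_mul]; exact zero_mem _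
    | hadd s t hs ht => rw [add_mul]; exact add_mem hs ht
    | htmul c d =>
      rw [tsq_mul]
      exact add_mem (tmul_mem_tensorSmall (hab.imp (mul_mem_uSmall _) (mul_mem_uSmall _)))
        (tmul_mem_tensorSmall (hab.imp (fun h => mul_mem_uSmall _ (parity_mem_uSmall h))
          (mul_mem_uSmall _)))
  | zero => rw [mul_zero]; exact zero_mem _
  | add x y _ _ hx hy => rw [mul_add]; exact add_mem hx hy
  | smul c x _ hx => rw [mul_smul_comm]; exact Submodule.smul_mem _ _ hx

theorem exists_tensorSmall_mul (t : TensorSq q) (N : ℤ) :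
    ∃ M, ∀ s ∈ tensorSmall q M, s * t ∈ tensorSmall q N := by
  induction t using tsq_induction with
  | h0 => exact ⟨0, fun s _ => by rw [mul_zero]; exact zero_mem _⟩
  | hadd t t' ht ht' =>
    obtain ⟨M, hM⟩ := ht
    obtain ⟨M', hM'⟩ := ht'
    refine ⟨max M M', fun s hs => ?_⟩
    rw [mul_add]
    exact add_mem (hM _ (tensorSmall_anti (le_max_left _ _) hs))
      (hM' _ (tensorSmall_anti (le_max_right _ _) hs))
  | htmul c d =>
    obtain ⟨M₁, h₁⟩ := exists_uSmall_mul c N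
    obtain ⟨M₂, h₂⟩ := exists_uSmall_mul (parity q c) N
    obtain ⟨M₃, h₃⟩ := exists_uSmall_mul d N
    refine ⟨max M₁ (max M₂ M₃), fun s hs => ?_⟩
    have l₁ := le_max_left M₁ (max M₂ M₃)
    have l₂ := (le_max_left M₂ M₃).trans (le_max_right M₁ (max M₂ M₃))
    have l₃ := (le_max_right M₂ M₃).trans (le_max_right M₁ (max M₂ M₃))
    induction hs using Submodule.span_induction with
    | mem s hs =>
      obtain ⟨a, b, hab, rfl⟩ := hs
      rw [tsq_mul]
      refine add_mem (tmul_mem_tensorSmall (hab.imp (fun h => h₁ _ (uSmall_anti l₁ h))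
        fun h => h₃ _ (uSmall_anti l₃ ?_))) (tmul_mem_tensorSmall
        (hab.imp (fun h => h₂ _ (uSmall_anti l₂ h)) fun h => h₃ _ (uSmall_anti l₃ ?_)))
      · exact Submodule.smul_mem _ _ (add_mem h (parity_mem_uSmall h))
      · exact Submodule.smul_mem _ _ (sub_mem h (parity_mem_uSmall h))
    | zero => rw [zero_mul]; exact zero_mem _
    | add x y _ _ hx hy => rw [add_mul]; exact add_mem hx hy
    | smul c x _ hx => rw [smul_mul_assoc]; exact Submodule.smul_mem _ _ hx

/-- A finite-dimensional subspace misses all sufficiently small members of a decreasing family of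
subspaces with trivial intersection. -/
theorem exists_inf_eq_bot {V : Type*} [AddCommGroup V] [Module ℂ V] {K : ℤ → Submodule ℂ V}
    (hK : Antitone K) (h0 : ⨅ N, K N = ⊥) (F : Submodule ℂ V) [FiniteDimensional ℂ F] :
    ∃ N₀ : ℤ, ∀ N, N₀ ≤ N → F ⊓ K N = ⊥ := by
  let f : ℕ →o (Submodule ℂ F)ᵒᵈ :=
    ⟨fun n => OrderDual.toDual ((K n).comap F.subtype), fun m n h =>
      Submodule.comap_mono (hK (by exact_mod_cast h))⟩
  obtain ⟨n, hn⟩ := IsArtinian.monotone_stabilizes f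
  refine ⟨n, fun N hN => ?_⟩
  rw [eq_bot_iff]
  rintro v ⟨hv, hvN⟩
  have hv' : v ∈ ⨅ N, K N := by
    rw [Submodule.mem_iInf]
    intro N'
    have h1 : (⟨v, hv⟩ : F) ∈ (K n).comap F.subtype := hK hN hvN
    have h2 : (K n).comap F.subtype = (K (max n N'.toNat : ℕ)).comap F.subtype :=
      hn (max n N'.toNat) (le_max_left _ _)
    rw [h2] at h1
    exact hK (by push_cast; omega) h1
  rwa [h0] at hv'

theorem eq_zero_of_mem_tensorSmall {t : TensorSq q} (ht : ∀ N, t ∈ tensorSmall q N) : t = 0 := by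
  set x := (GradedTensorProduct.of ℂ (parityPart q) (parityPart q)).symm t with hx
  have hker : ∀ N, TensorProduct.map (uSmall q N).mkQ (uSmall q N).mkQ x = 0 := by
    intro N
    have hle : tensorSmall q N ≤ LinearMap.ker
        ((TensorProduct.map (uSmall q N).mkQ (uSmall q N).mkQ).comp
          (GradedTensorProduct.of ℂ (parityPart q) (parityPart q)).symm.toLinearMap) := by
      rw [tensorSmall, Submodule.span_le]
      rintro _ ⟨a, b, hab, rfl⟩
      change (TensorProduct.map (uSmall q N).mkQ (uSmall q N).mkQ) (a ⊗ₜ[ℂ] b) = 0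
      rw [TensorProduct.map_tmul]
      rcases hab with h | h
      · rw [Submodule.mkQ_apply, (Submodule.Quotient.mk_eq_zero _).2 h, TensorProduct.zero_tmul]
      · rw [Submodule.mkQ_apply (uSmall q N) b, (Submodule.Quotient.mk_eq_zero _).2 h,
          TensorProduct.tmul_zero]
    exact hle (ht N)
  obtain ⟨F, G, hF, hG, hmem⟩ := TensorProduct.exists_finite_submodule_of_setFinite {x}
    (Set.finite_singleton x)
  have hFd : FiniteDimensional ℂ F := hF
  have hGd : FiniteDimensional ℂ G := hG
  obtain ⟨y, hy⟩ := hmem rfl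
  obtain ⟨N₁, h₁⟩ := exists_inf_eq_bot (fun _ _ h => uSmall_anti h) iInf_uSmall F
  obtain ⟨N₂, h₂⟩ := exists_inf_eq_bot (fun _ _ h => uSmall_anti h) iInf_uSmall G
  have inj : ∀ (F : Submodule ℂ (U q)) (N : ℤ), F ⊓ uSmall q N = ⊥ →
      Function.Injective ((uSmall q N).mkQ.comp F.subtype) := by
    intro F N h
    rw [← LinearMap.ker_eq_bot, LinearMap.ker_comp, Submodule.ker_mkQ, eq_bot_iff]
    rintro ⟨v, hv⟩ hv'
    have : v ∈ F ⊓ uSmall q N := ⟨hv, hv'⟩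
    rw [h] at this
    exact Subtype.ext this
  have hinj := TensorProduct.map_injective_of_flat_flat _ _
    (inj F _ (h₁ (max N₁ N₂) (le_max_left _ _))) (inj G _ (h₂ (max N₁ N₂) (le_max_right _ _)))
  have h3 := hker (max N₁ N₂)
  rw [← hy] at h3
  have h4 : y = 0 := by
    refine hinj ?_
    rw [map_zero, ← h3, TensorProduct.map_comp]
    rfl
  have h5 : x = 0 := by rw [← hy, h4, map_zero]
  exact (LinearEquiv.map_eq_zero_iff _).1 h5

end TensorSmall

/-! ### Elements of the completion on which the coproduct vanishes -/

section ComulKernel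

variable {q : ℂ}

/-- The component of the coproduct with second weight `n`. -/
def comulCoeff (hq : q ≠ 0) (n : ℤ) : PreU q →ₗ[ℂ] TensorSq q where
  toFun u := (PreU.comul hq u).coeff n
  map_add' u v := by rw [map_add, HahnSeries.coeff_add]
  map_smul' c u := by rw [map_smul, HahnSeries.coeff_smul, RingHom.id_apply]

theorem comulCoeff_mul_mem (hq : q ≠ 0) (n : ℤ) (u v : PreU q) (N : ℤ)
    (h : ∀ i j, i + j = n → comulCoeff hq i u * comulCoeff hq j v ∈ tensorSmall q N) :
    comulCoeff hq n (u * v) ∈ tensorSmall q N := by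
  change (PreU.comul hq (u * v)).coeff n ∈ _
  rw [map_mul, HahnSeries.coeff_mul]
  refine sum_mem fun ij hij => h _ _ ?_
  rw [Finset.mem_antidiagonal] at hij
  exact hij.2.2

theorem PreU.word_span (u : PreU q) :
    u ∈ Submodule.span ℂ {v | ∃ w : List Gen, v = (w.map (PreU.gen q)).prod} := by
  have hmul : ∀ x ∈ Submodule.span ℂ {v | ∃ w : List Gen, v = (w.map (PreU.gen q)).prod},
      ∀ y ∈ Submodule.span ℂ {v | ∃ w : List Gen, v = (w.map (PreU.gen q)).prod},
      x * y ∈ Submodule.span ℂ {v | ∃ w : List Gen, v = (w.map (PreU.gen q)).prod} := by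
    intro x hx y hy
    have := Submodule.mul_mem_mul hx hy
    rw [Submodule.span_mul_span] at this
    refine Submodule.span_mono ?_ this
    rintro _ ⟨_, ⟨w, rfl⟩, _, ⟨w', rfl⟩, rfl⟩
    exact ⟨w ++ w', by simp⟩
  obtain ⟨u, rfl⟩ := PreU.mk_surjective q u
  induction u using FreeAlgebra.induction with
  | grade0 r =>
    rw [AlgHom.commutes, Algebra.algebraMap_eq_smul_one]
    exact Submodule.smul_mem _ _ (Submodule.subset_span ⟨[], rfl⟩)
  | grade1 y => exact Submodule.subset_span ⟨[y], by simp [PreU.gen]⟩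
  | add a b ha hb => rw [map_add]; exact add_mem ha hb
  | mul a b ha hb => rw [map_mul]; exact hmul _ ha _ hb

theorem comulCoeff_word_mem (hq : q ≠ 0) (w : List Gen) (n : ℤ) :
    comulCoeff hq n ((w.map (PreU.gen q)).prod) ∈ biweight q ((w.map Gen.weight).sum - n) n :=
  comul_word_mem_totalWeight hq w n

theorem comulCoeff_mem_of_le (hq : q ≠ 0) {n N : ℤ} (h : N ≤ n) (u : PreU q) :
    comulCoeff hq n u ∈ tensorSmall q N := by
  induction PreU.word_span u using Submodule.span_induction with
  | mem u hu =>
    obtain ⟨w, rfl⟩ := hu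
    exact biweight_le_tensorSmall (Or.inr h) (comulCoeff_word_mem hq w n)
  | zero => rw [map_zero]; exact zero_mem _
  | add x y _ _ hx hy => rw [map_add]; exact add_mem hx hy
  | smul c x _ hx => rw [map_smul]; exact Submodule.smul_mem _ _ hx

theorem comulCoeff_mem_of_small (hq : q ≠ 0) {u : PreU q} {N : ℤ}
    (hu : u ∈ smallIdeal q (2 * N)) : ∀ n, comulCoeff hq n u ∈ tensorSmall q N := by
  induction hu using Submodule.span_induction with
  | mem u hu =>
    obtain ⟨w, hw, rfl⟩ := hu
    intro n
    exact biweight_le_tensorSmall (by omega) (comulCoeff_word_mem hq w n)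
  | zero => intro n; rw [map_zero]; exact zero_mem _
  | add x y _ _ hx hy => intro n; rw [map_add]; exact add_mem (hx n) (hy n)
  | smul c x _ hx =>
    intro n
    exact comulCoeff_mul_mem hq n c x N fun i j _ => mul_mem_tensorSmall _ (hx j)

theorem exists_comulCoeff_eq_zero (hq : q ≠ 0) (u : PreU q) :
    ∃ j₀, ∀ j, j < j₀ → comulCoeff hq j u = 0 := by
  by_cases h : PreU.comul hq u = 0
  · exact ⟨0, fun j _ => by change (PreU.comul hq u).coeff j = 0; rw [h]; rfl⟩
  · exact ⟨(PreU.comul hq u).order, fun j hj => HahnSeries.coeff_eq_zero_of_lt_order hj⟩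

theorem exists_coe_sub_mem (z : PreUHat q) {s : Set (PreUHat q)} (hs : s ∈ nhds (0 : PreUHat q)) :
    ∃ p : PreU q, z - p ∈ s := by
  have h1 : (fun y => z - y) ⁻¹' s ∈ nhds z := by
    refine (continuous_const.sub continuous_id).continuousAt.preimage_mem_nhds ?_
    simpa using hs
  obtain ⟨_, hy, p, rfl⟩ := mem_closure_iff_nhds.1
    ((UniformSpace.Completion.denseRange_coe (α := PreU q)) z) _ h1
  exact ⟨p, hy⟩

theorem hatSmall_mem_nhds (N : ℤ) : (hatSmall q N : Set (PreUHat q)) ∈ nhds (0 : PreUHat q) :=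
  (hasBasis_hatSmall q).mem_of_mem trivial

theorem exists_coe_sub_mem_hatSmall (z : PreUHat q) (N : ℤ) :
    ∃ p : PreU q, z - p ∈ hatSmall q N := exists_coe_sub_mem z (hatSmall_mem_nhds N)

theorem eventually_mul_mem_hatSmall (v : PreUHat q) (N : ℤ) :
    {w | w * v ∈ hatSmall q N} ∈ nhds (0 : PreUHat q) := by
  refine (continuous_mul_const v).continuousAt.preimage_mem_nhds ?_
  rw [zero_mul]
  exact hatSmall_mem_nhds N

/-- The elements of the completion that are approximated by elements on which the components of the
coproduct are small. -/
def comulKer (hq : q ≠ 0) : Set (PreUHat q) :=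
  {z | ∀ (n N : ℤ) (p : PreU q), z - p ∈ hatSmall q (2 * N) → comulCoeff hq n p ∈ tensorSmall q N}

theorem sub_mem_smallIdeal {z : PreUHat q} {N : ℤ} {p p' : PreU q} (h : z - p ∈ hatSmall q N)
    (h' : z - p' ∈ hatSmall q N) : p - p' ∈ smallIdeal q N := by
  rw [← coe_mem_hatSmall_iff, UniformSpace.Completion.coe_sub]
  have := sub_mem h' h
  rwa [sub_sub_sub_cancel_left] at this

theorem comulCoeff_congr (hq : q ≠ 0) {N : ℤ} {p p' : PreU q} (h : p - p' ∈ smallIdeal q (2 * N))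
    {n : ℤ} (hp : comulCoeff hq n p ∈ tensorSmall q N) : comulCoeff hq n p' ∈ tensorSmall q N := by
  have := sub_mem hp (comulCoeff_mem_of_small hq h n)
  rwa [← map_sub, sub_sub_cancel] at this

theorem mem_comulKer (hq : q ≠ 0) {z : PreUHat q} (h : ∀ n N : ℤ, ∃ p : PreU q,
    z - p ∈ hatSmall q (2 * N) ∧ comulCoeff hq n p ∈ tensorSmall q N) : z ∈ comulKer hq := by
  intro n N p hp
  obtain ⟨p', h1, h2⟩ := h n N
  exact comulCoeff_congr hq (sub_mem_smallIdeal h1 hp) h2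

theorem isClosed_comulKer (hq : q ≠ 0) : IsClosed (comulKer hq) := by
  rw [← closure_subset_iff_isClosed]
  intro z hz n N p hp
  have h1 : (fun y => z - y) ⁻¹' (hatSmall q (2 * N) : Set (PreUHat q)) ∈ nhds z := by
    refine (continuous_const.sub continuous_id).continuousAt.preimage_mem_nhds ?_
    simpa using hatSmall_mem_nhds (q := q) (2 * N)
  obtain ⟨y, hy, hy'⟩ := mem_closure_iff_nhds.1 hz _ h1
  refine hy' n N p ?_
  have := sub_mem hp hy
  rwa [sub_sub_sub_cancel_left] at this

theorem add_mem_comulKer (hq : q ≠ 0) {y z : PreUHat q} (hy : y ∈ comulKer hq)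
    (hz : z ∈ comulKer hq) : y + z ∈ comulKer hq := by
  refine mem_comulKer hq fun n N => ?_
  obtain ⟨p, hp⟩ := exists_coe_sub_mem_hatSmall y (2 * N)
  obtain ⟨p', hp'⟩ := exists_coe_sub_mem_hatSmall z (2 * N)
  refine ⟨p + p', ?_, ?_⟩
  · rw [UniformSpace.Completion.coe_add, add_sub_add_comm]
    exact add_mem hp hp'
  · rw [map_add]
    exact add_mem (hy n N p hp) (hz n N p' hp')

theorem mul_mem_comulKer (hq : q ≠ 0) (v : PreUHat q) {z : PreUHat q} (hz : z ∈ comulKer hq) :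
    v * z ∈ comulKer hq := by
  refine mem_comulKer hq fun n N => ?_
  obtain ⟨p, hp⟩ := exists_coe_sub_mem v (eventually_mul_mem_hatSmall z (2 * N))
  obtain ⟨p', hp'⟩ := exists_coe_sub_mem_hatSmall z (2 * N)
  refine ⟨p * p', ?_, ?_⟩
  · have : v * z - ((p * p' : PreU q) : PreUHat q) = (v - p) * z + p * (z - p') := by
      rw [UniformSpace.Completion.coe_mul]
      noncomm_ring
    rw [this]
    exact add_mem hp (mul_mem_hatSmall _ hp')
  · exact comulCoeff_mul_mem hq n p p' N fun i j _ => mul_mem_tensorSmall _ (hz j N p' hp')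

theorem exists_tensorSmall_mul_comulCoeff (hq : q ≠ 0) (u : PreU q) (N : ℤ) :
    ∃ M, ∀ (j : ℤ), ∀ t ∈ tensorSmall q M, t * comulCoeff hq j u ∈ tensorSmall q N := by
  obtain ⟨j₀, hj₀⟩ := exists_comulCoeff_eq_zero hq u
  choose M hM using fun j => exists_tensorSmall_mul (comulCoeff hq j u) N
  obtain ⟨B, hB⟩ := ((Finset.Ico j₀ N).image M).bddAbove
  refine ⟨B, fun j t ht => ?_⟩
  by_cases h1 : j < j₀
  · rw [hj₀ j h1, mul_zero]; exact zero_mem _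
  by_cases h2 : N ≤ j
  · exact mul_mem_tensorSmall _ (comulCoeff_mem_of_le hq h2 u)
  · refine hM j t (tensorSmall_anti (hB ?_) ht)
    exact Finset.mem_coe.2 (Finset.mem_image_of_mem _ (Finset.mem_Ico.2 ⟨by omega, by omega⟩))

theorem mul_mem_comulKer_right (hq : q ≠ 0) {z : PreUHat q} (hz : z ∈ comulKer hq)
    (v : PreUHat q) : z * v ∈ comulKer hq := by
  refine mem_comulKer hq fun n N => ?_
  obtain ⟨p, hp⟩ := exists_coe_sub_mem_hatSmall v (2 * N)
  obtain ⟨M, hM⟩ := exists_tensorSmall_mul_comulCoeff hq p N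
  obtain ⟨p', hp₁, hp₂⟩ := exists_coe_sub_mem z (Filter.inter_mem
    (eventually_mul_mem_hatSmall (p : PreUHat q) (2 * N)) (hatSmall_mem_nhds (2 * M)))
  refine ⟨p' * p, ?_, ?_⟩
  · have : z * v - ((p' * p : PreU q) : PreUHat q) = z * (v - p) + (z - p') * p := by
      rw [UniformSpace.Completion.coe_mul]
      noncomm_ring
    rw [this]
    exact add_mem (mul_mem_hatSmall _ hp) hp₁
  · exact comulCoeff_mul_mem hq n p' p N fun i j _ => hM j _ (hz i M p' hp₂)

theorem serreIdeal_subset_comulKer (hq : q ≠ 0) (h : serreSet q ⊆ comulKer hq) :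
    (serreIdeal q : Set (PreUHat q)) ⊆ comulKer hq := by
  refine closure_minimal (fun u hu => ?_) (isClosed_comulKer hq)
  refine Submodule.span_induction (p := fun u _ => u ∈ comulKer hq) ?_ ?_ ?_ ?_ hu
  · rintro _ ⟨z, hz, v, rfl⟩
    exact mul_mem_comulKer_right hq (h hz) v
  · exact mem_comulKer hq fun n N => ⟨0, by
      rw [UniformSpace.Completion.coe_zero, sub_zero]; exact zero_mem _, by
      rw [map_zero]; exact zero_mem _⟩
  · exact fun x y _ _ hx hy => add_mem_comulKer hq hx hy
  · exact fun c x _ hx => mul_mem_comulKer hq c hx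

theorem comul_eq_zero_of_mem_comulKer (hq : q ≠ 0) {u : PreU q}
    (h : (u : PreUHat q) ∈ comulKer hq) : PreU.comul hq u = 0 := by
  ext n
  refine eq_zero_of_mem_tensorSmall fun N => h n N u ?_
  rw [sub_self]
  exact zero_mem _

/-- A convergent sum on whose terms the coproduct sums to zero. -/
theorem hasSum_mem_comulKer (hq : q ≠ 0) {α : Type*} {f : α → PreU q} {z : PreUHat q}
    (hf : HasSum (fun i => (f i : PreUHat q)) z)
    (h : ∀ n N : ℤ, ∃ S₀ : Finset α, ∀ S, S₀ ⊆ S → ∑ i ∈ S, comulCoeff hq n (f i) ∈ tensorSmall q N) :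
    z ∈ comulKer hq := by
  classical
  refine mem_comulKer hq fun n N => ?_
  obtain ⟨S₀, hS₀⟩ := h n N
  have h1 : (fun y => z - y) ⁻¹' (hatSmall q (2 * N) : Set (PreUHat q)) ∈ nhds z := by
    refine (continuous_const.sub continuous_id).continuousAt.preimage_mem_nhds ?_
    simpa using hatSmall_mem_nhds (q := q) (2 * N)
  obtain ⟨S, hS⟩ := Filter.mem_atTop_sets.1 (hf h1)
  refine ⟨∑ i ∈ S ∪ S₀, f i, ?_, ?_⟩
  · have h2 := hS (S ∪ S₀) Finset.subset_union_left
    have h3 : ((∑ i ∈ S ∪ S₀, f i : PreU q) : PreUHat q) = ∑ i ∈ S ∪ S₀, (f i : PreUHat q) :=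
      map_sum (PreU.coe q) _ _
    rw [h3]
    exact h2
  · rw [map_sum]
    exact hS₀ _ Finset.subset_union_right

end ComulKernel

/-! ### Restrictions to the line that vanish -/

section Line

variable {X : Type*} [AddCommGroup X] [Module ℂ X] [UniformSpace X] [IsUniformAddGroup X]
  [ContinuousConstSMul ℂ X] {q : ℂ} {s : ℤˣ}

theorem HasLine.add {G G' : ℤ → ℤ → ℤ → X} {L L' : ℤ → X} (h : HasLine q s G L)
    (h' : HasLine q s G' L') : HasLine q s (fun a b c => G a b c + G' a b c) fun n => L n + L' n := by
  intro n
  refine (congrArg (fun f => HasSum f _) (funext fun bc => ?_)).mp ((h n).add (h' n))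
  simp only [lineTerm, smul_add]

theorem fCoeff_line₁ (hq : q ≠ 0) (s : ℤˣ) :
    ∑ i : Fin 3, fCoeff q s i * q ^ ((s : ℤ) * (1 * (i : ℕ))) = 0 := by
  rcases Int.units_eq_one_or s with rfl | rfl <;>
    simp [Fin.sum_univ_three, fCoeff, p₁, p₂] <;> field_simp <;> ring

theorem fCoeff_line₂ (hq : q ≠ 0) (s : ℤˣ) :
    ∑ i : Fin 3, fCoeff q s i * q ^ ((s : ℤ) * (-2 * (i : ℕ))) = 0 := by
  rcases Int.units_eq_one_or s with rfl | rfl <;>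
    simp [Fin.sum_univ_three, fCoeff, p₁, p₂] <;> field_simp <;> ring

/-- A combination of translates of a series restricts to zero on the line if its coefficients are
those of a polynomial that vanishes there. -/
theorem HasLine.comb_eq_zero (hq : q ≠ 0) {H : ℤ → ℤ → ℤ → X} {L : ℤ → X} (h : HasLine q s H L)
    {α β γ : Fin 3 → Fin 3 → ℤ} {e : Fin 3 → ℤ} {t : ℤ} (ht : t = 1 ∨ t = -2)
    (hsum : ∀ i j, α i j + β i j + γ i j = 4) (hw : ∀ i j, β i j + 2 * γ i j = e j + t * (i : ℕ)) :
    HasLine q s (fun a b c => ∑ j, ∑ i, (fCoeff q s i * fCoeff q s j) •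
      H (a + α i j) (b + β i j) (c + γ i j)) fun _ => 0 := by
  have h1 := HasLine.sum (q := q) (s := s) (t := Finset.univ) fun j (_ : j ∈ Finset.univ) =>
    HasLine.sum (q := q) (s := s) (t := Finset.univ) fun i (_ : i ∈ Finset.univ) =>
    (h.shift hq (α i j) (β i j) (γ i j)).smul (fCoeff q s i * fCoeff q s j)
  refine (congrArg (HasLine q s _) (funext fun n => ?_)).mp h1
  refine Finset.sum_eq_zero fun j _ => ?_
  have h2 : ∀ i, (fCoeff q s i * fCoeff q s j) • q ^ ((s : ℤ) * (β i j + 2 * γ i j)) •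
      L (n + α i j + β i j + γ i j) = (fCoeff q s i * q ^ ((s : ℤ) * (t * (i : ℕ)))) •
      (fCoeff q s j * q ^ ((s : ℤ) * e j)) • L (n + 4) := by
    intro i
    rw [hw, show n + α i j + β i j + γ i j = n + 4 by linarith [hsum i j], smul_smul, smul_smul,
      mul_add, zpow_add₀ hq]
    congr 1
    ring
  rw [Finset.sum_congr rfl fun i _ => h2 i, ← Finset.sum_smul]
  rcases ht with rfl | rfl
  · rw [fCoeff_line₁ hq, zero_smul]
  · rw [fCoeff_line₂ hq, zero_smul]

/-- A series that has, in each degree, only finitely many non-zero coefficients, since large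
exponents do not occur. -/
def BoundedSeries (H : ℤ → ℤ → ℤ → X) : Prop :=
  ∀ n, ∃ C, ∀ a b c, a + b + c = n → (C < a ∨ C < b ∨ C < c) → H a b c = 0

theorem BoundedSeries.exists_hasLine {H : ℤ → ℤ → ℤ → X} (h : BoundedSeries H) (q : ℂ) (s : ℤˣ) :
    ∃ L, HasLine q s H L := by
  have : ∀ n, Summable (lineTerm q s H n) := by
    intro n
    obtain ⟨C, hC⟩ := h n
    refine summable_of_hasFiniteSupport (((Set.finite_Icc (n - 2 * C) C).prod
      (Set.finite_Icc (n - 2 * C) C)).subset fun bc hbc => ?_)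
    by_contra hcon
    refine hbc ?_
    rw [lineTerm, hC, smul_zero]
    · ring
    · rw [Set.mem_prod, Set.mem_Icc, Set.mem_Icc] at hcon
      omega
  choose L hL using this
  exact ⟨L, hL⟩

theorem BoundedSeries.swap₁₂ {H : ℤ → ℤ → ℤ → X} (h : BoundedSeries H) :
    BoundedSeries fun a b c => H b a c := by
  intro n
  obtain ⟨C, hC⟩ := h n
  exact ⟨C, fun a b c hn hc => hC b a c (by omega) (by omega)⟩

theorem BoundedSeries.swap₂₃ {H : ℤ → ℤ → ℤ → X} (h : BoundedSeries H) :
    BoundedSeries fun a b c => H a c b := by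
  intro n
  obtain ⟨C, hC⟩ := h n
  exact ⟨C, fun a b c hn hc => hC a c b (by omega) (by omega)⟩

variable {T : Type*} [Ring T] [Algebra ℂ T] (D : T →ₗ[ℂ] X) {A B : ℤ → T}

/-- The partial product with `f(z₂, z₃)` only. -/
def pairRight (q : ℂ) (s : ℤˣ) (A B : ℤ → T) (a b c : ℤ) : X :=
  D (B a * ∑ k : Fin 3, fCoeff q s k • (A (b + 2 - (k : ℕ)) * A (c + (k : ℕ))))

/-- The partial product with `f(z₁, z₂)` only. -/
def pairLeft (q : ℂ) (s : ℤˣ) (A B : ℤ → T) (a b c : ℤ) : X :=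
  D ((∑ i : Fin 3, fCoeff q s i • (B (a + 2 - (i : ℕ)) * B (b + (i : ℕ)))) * A c)

theorem map_triple_right (a b c : ℤ) : D (triple q s B A A a b c) =
    ∑ j : Fin 3, ∑ i : Fin 3, (fCoeff q s i * fCoeff q s j) •
      pairRight D q s A B (a + (4 - (i : ℕ) - (j : ℕ))) (b + (i : ℕ)) (c + (j : ℕ)) := by
  rw [triple, Finset.sum_comm, map_sum]
  refine Finset.sum_congr rfl fun j _ => ?_
  rw [map_sum]
  refine Finset.sum_congr rfl fun i _ => ?_
  rw [pairRight, ← map_smul, Finset.mul_sum, Finset.smul_sum]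
  congr 1
  refine Finset.sum_congr rfl fun k _ => ?_
  rw [mul_smul_comm, smul_smul, ← mul_assoc, ← add_sub_assoc, ← add_sub_assoc]

theorem map_triple_left (a b c : ℤ) : D (triple q s B B A a b c) =
    ∑ k : Fin 3, ∑ j : Fin 3, (fCoeff q s j * fCoeff q s k) •
      pairLeft D q s A B (a + (2 - (j : ℕ))) (b + (2 - (k : ℕ))) (c + ((j : ℕ) + (k : ℕ))) := by
  have h : triple q s B B A a b c = ∑ k : Fin 3, ∑ j : Fin 3, ∑ i : Fin 3,
      (fCoeff q s i * fCoeff q s j * fCoeff q s k) • (B (a + 4 - (i : ℕ) - (j : ℕ)) *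
        B (b + (i : ℕ) + 2 - (k : ℕ)) * A (c + (j : ℕ) + (k : ℕ))) := by
    rw [triple, Finset.sum_comm, Finset.sum_congr rfl fun j _ => Finset.sum_comm, Finset.sum_comm]
  rw [h, map_sum]
  refine Finset.sum_congr rfl fun k _ => ?_
  rw [map_sum]
  refine Finset.sum_congr rfl fun j _ => ?_
  rw [pairLeft, ← map_smul, Finset.sum_mul, Finset.smul_sum]
  congr 1
  refine Finset.sum_congr rfl fun i _ => ?_
  rw [smul_mul_assoc, smul_smul]
  rw [show a + 4 - ((i : ℕ) : ℤ) - (j : ℕ) = a + (2 - (j : ℕ)) + 2 - (i : ℕ) by ring,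
    show b + ((i : ℕ) : ℤ) + 2 - (k : ℕ) = b + (2 - (k : ℕ)) + (i : ℕ) by ring,
    show c + ((j : ℕ) : ℤ) + (k : ℕ) = c + ((j : ℕ) + (k : ℕ)) by ring]
  congr 1
  ring

theorem triple_add (u v : ℤ → T) (a b c : ℤ) :
    triple q s (fun n => u n + v n) (fun n => u n + v n) (fun n => u n + v n) a b c =
      triple q s u u u a b c + triple q s v v v a b c +
      (triple q s v u u a b c + triple q s u v u a b c + triple q s u u v a b c) +
      (triple q s v v u a b c + triple q s v u v a b c + triple q s u v v a b c) := by
  simp only [triple, ← Finset.sum_add_distrib]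
  refine Finset.sum_congr rfl fun i _ => Finset.sum_congr rfl fun j _ =>
    Finset.sum_congr rfl fun k _ => ?_
  simp only [← smul_add]
  congr 1
  noncomm_ring

/-- The mixed terms in a product of three sums of currents restrict to zero on the line. -/
theorem hasLine_triple_add (hq : q ≠ 0) (hBA : QuadRel q s (-1) B A)
    (hR : BoundedSeries (pairRight D q s A B)) (hL : BoundedSeries (pairLeft D q s A B))
    (hA : HasLine q s (fun a b c => D (triple q s A A A a b c)) fun _ => 0)
    (hB : HasLine q s (fun a b c => D (triple q s B B B a b c)) fun _ => 0) :
    HasLine q s (fun a b c => D (triple q s (fun n => A n + B n) (fun n => A n + B n)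
      (fun n => A n + B n) a b c)) fun _ => 0 := by
  obtain ⟨_, h₁⟩ := hR.exists_hasLine q s
  obtain ⟨_, h₂⟩ := hR.swap₁₂.exists_hasLine q s
  obtain ⟨_, h₃⟩ := hR.swap₁₂.swap₂₃.exists_hasLine q s
  obtain ⟨_, h₄⟩ := hL.exists_hasLine q s
  obtain ⟨_, h₅⟩ := hL.swap₂₃.exists_hasLine q s
  obtain ⟨_, h₆⟩ := hL.swap₂₃.swap₁₂.exists_hasLine q s
  have k₁ := h₁.comb_eq_zero hq (t := 1) (α := fun i j => 4 - (i : ℕ) - (j : ℕ))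
    (β := fun i _ => (i : ℕ)) (γ := fun _ j => (j : ℕ)) (e := fun j => 2 * (j : ℕ)) (Or.inl rfl)
    (fun i j => by ring) (fun i j => by ring)
  have k₂ := h₂.comb_eq_zero hq (t := 1) (α := fun _ j => (j : ℕ))
    (β := fun i j => 4 - (j : ℕ) - (i : ℕ)) (γ := fun i _ => (i : ℕ)) (e := fun j => 4 - (j : ℕ))
    (Or.inl rfl) (fun i j => by ring) (fun i j => by ring)
  have k₃ := h₃.comb_eq_zero hq (t := -2) (α := fun i _ => (i : ℕ))
    (β := fun _ j => (j : ℕ)) (γ := fun i j => 4 - (i : ℕ) - (j : ℕ)) (e := fun j => 8 - (j : ℕ))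
    (Or.inr rfl) (fun i j => by ring) (fun i j => by ring)
  have k₄ := h₄.comb_eq_zero hq (t := 1) (α := fun _ j => 2 - (j : ℕ))
    (β := fun i _ => 2 - (i : ℕ)) (γ := fun i j => (j : ℕ) + (i : ℕ)) (e := fun j => 2 + 2 * (j : ℕ))
    (Or.inl rfl) (fun i j => by ring) (fun i j => by ring)
  have k₅ := h₅.comb_eq_zero hq (t := 1) (α := fun i _ => 2 - (i : ℕ))
    (β := fun i j => (i : ℕ) + (j : ℕ)) (γ := fun _ j => 2 - (j : ℕ)) (e := fun j => 4 - (j : ℕ))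
    (Or.inl rfl) (fun i j => by ring) (fun i j => by ring)
  have k₆ := h₆.comb_eq_zero hq (t := -2) (α := fun i j => (j : ℕ) + (i : ℕ))
    (β := fun _ j => 2 - (j : ℕ)) (γ := fun i _ => 2 - (i : ℕ)) (e := fun j => 6 - (j : ℕ))
    (Or.inr rfl) (fun i j => by ring) (fun i j => by ring)
  have key := ((hA.add hB).add ((k₁.sub k₂).add k₃)).add ((k₄.sub k₅).add k₆)
  simp only [sub_zero, add_zero] at key
  refine (congrArg (fun G => HasLine q s G _) (funext fun a => funext fun b => funext fun c => ?_)).mp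
    key
  rw [triple_add]
  simp only [map_add]
  have e₂ : D (triple q s A B A a b c) = -D (triple q s B A A b a c) := by
    rw [triple_swap₁₂ hBA, map_neg]
  have e₃ : D (triple q s A A B a b c) = D (triple q s B A A c a b) := by
    rw [triple_swap₂₃ hBA, triple_swap₁₂ hBA, neg_neg]
  have e₅ : D (triple q s B A B a b c) = -D (triple q s B B A a c b) := by
    rw [triple_swap₂₃ hBA, map_neg]
  have e₆ : D (triple q s A B B a b c) = D (triple q s B B A b c a) := by
    rw [triple_swap₁₂ hBA, triple_swap₂₃ hBA, neg_neg]
  rw [e₂, e₃, e₅, e₆, map_triple_right (A := A) (B := B) D a b c, map_triple_right (A := A) (B := B) D b a c, map_triple_right (A := A) (B := B) D c a b,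
    map_triple_left (A := A) (B := B) D a b c, map_triple_left (A := A) (B := B) D a c b, map_triple_left (A := A) (B := B) D b c a, ← sub_eq_add_neg, ← sub_eq_add_neg]
  have comm : ∀ g : Fin 3 → Fin 3 → X, ∑ j, ∑ i, (fCoeff q s i * fCoeff q s j) • g i j =
      ∑ j, ∑ i, (fCoeff q s i * fCoeff q s j) • g j i := fun g => by
    rw [Finset.sum_comm]
    exact Finset.sum_congr rfl fun j _ => Finset.sum_congr rfl fun i _ => by rw [mul_comm]
  refine congrArg₂ (· + ·) (congrArg₂ (· + ·) rfl (congrArg₂ (· + ·) (congrArg₂ (· - ·) rfl ?_)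
    rfl)) (congrArg₂ (· + ·) (congrArg₂ (· - ·) ?_ rfl) ?_)
  · exact comm fun i j => pairRight D q s A B (b + (4 - (j : ℕ) - (i : ℕ))) (a + (j : ℕ)) (c + (i : ℕ))
  · exact comm fun i j => pairLeft D q s A B (a + (2 - (j : ℕ))) (b + (2 - (i : ℕ)))
      (c + ((j : ℕ) + (i : ℕ)))
  · exact comm fun i j => pairLeft D q s A B (b + (2 - (j : ℕ))) (c + (2 - (i : ℕ)))
      (a + ((j : ℕ) + (i : ℕ)))

end Line

/-! ### Small formal tensors -/

section FormalSmall

variable {q : ℂ}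

/-- The formal tensors all of whose components are small. -/
def formalSmall (q : ℂ) (N : ℤ) : Submodule ℂ (FormalTensor q) where
  carrier := {t | ∀ j, t.coeff j ∈ tensorSmall q N}
  add_mem' hs ht j := by rw [HahnSeries.coeff_add]; exact add_mem (hs j) (ht j)
  zero_mem' j := by rw [HahnSeries.coeff_zero]; exact zero_mem _
  smul_mem' c t ht j := by rw [HahnSeries.coeff_smul]; exact Submodule.smul_mem _ _ (ht j)

theorem totalWeight_le_formalSmall {W N : ℤ} (h : 2 * N ≤ W) : totalWeight q W ≤ formalSmall q N :=
  fun _ ht j => biweight_le_tensorSmall (by omega) (ht j)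

theorem coeff_mul_mem {s t : FormalTensor q} {E : Submodule ℂ (TensorSq q)} {n : ℤ}
    (h : ∀ i j, i + j = n → s.coeff i * t.coeff j ∈ E) : (s * t).coeff n ∈ E := by
  rw [HahnSeries.coeff_mul]
  refine sum_mem fun ij hij => h _ _ ?_
  rw [Finset.mem_antidiagonal] at hij
  exact hij.2.2

theorem mul_mem_formalSmall {N : ℤ} (s : FormalTensor q) {t : FormalTensor q}
    (ht : t ∈ formalSmall q N) : s * t ∈ formalSmall q N :=
  fun _ => coeff_mul_mem fun _ j _ => mul_mem_tensorSmall _ (ht j)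

/-- The components of weight less than `d` vanish. -/
def LowerBounded (d : ℤ) (t : FormalTensor q) : Prop := ∀ j < d, t.coeff j = 0

theorem LowerBounded.mul {d e : ℤ} {s t : FormalTensor q} (hs : LowerBounded d s)
    (ht : LowerBounded e t) : LowerBounded (d + e) (s * t) := by
  intro n hn
  rw [← Submodule.mem_bot ℂ]
  refine coeff_mul_mem fun i j hij => ?_
  rw [Submodule.mem_bot]
  rcases lt_or_ge i d with h | h
  · rw [hs i h, zero_mul]
  · rw [ht j (by omega), mul_zero]

theorem LowerBounded.sum {d : ℤ} {ι : Type*} {S : Finset ι} {t : ι → FormalTensor q}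
    (h : ∀ i ∈ S, LowerBounded d (t i)) : LowerBounded d (∑ i ∈ S, t i) := by
  intro j hj
  rw [HahnSeries.coeff_sum]
  exact Finset.sum_eq_zero fun i hi => h i hi j hj

theorem LowerBounded.smul {d : ℤ} {t : FormalTensor q} (h : LowerBounded d t) (κ : ℂ) :
    LowerBounded d (κ • t) := fun j hj => by rw [HahnSeries.coeff_smul, h j hj, smul_zero]

theorem LowerBounded.mono {d e : ℤ} {t : FormalTensor q} (h : LowerBounded d t) (hed : e ≤ d) :
    LowerBounded e t := fun j hj => h j (hj.trans_le hed)

theorem lowerBounded_xLeft (s : ℤˣ) (n : ℤ) : LowerBounded 0 (xLeft (genLeft q) (genRight q) s n) := by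
  intro j hj
  rcases Int.units_eq_one_or s with rfl | rfl
  · rw [coeff_xLeft_pos, if_neg (by omega)]
  · rw [coeff_xLeft_neg, psi_of_neg _ hj, zero_mul, GradedTensorProduct.tmul,
      TensorProduct.tmul_zero, map_zero]

theorem lowerBounded_xRight (s : ℤˣ) (n : ℤ) :
    LowerBounded n (xRight (genLeft q) (genRight q) s n) := by
  intro j hj
  rcases Int.units_eq_one_or s with rfl | rfl
  · rw [coeff_xRight_pos, phi_of_pos _ (by omega), zero_mul, GradedTensorProduct.tmul,
      TensorProduct.zero_tmul, map_zero]
  · rw [coeff_xRight_neg, if_neg (by omega)]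

theorem exists_formalSmall_mul {t : FormalTensor q} (h0 : LowerBounded 0 t) {N : ℤ}
    (hN : ∀ j, N ≤ j → t.coeff j ∈ tensorSmall q N) :
    ∃ M, ∀ s ∈ formalSmall q M, s * t ∈ formalSmall q N := by
  choose M hM using fun j => exists_tensorSmall_mul (t.coeff j) N
  obtain ⟨C, hC⟩ := ((Finset.Ico 0 N).image M).bddAbove
  refine ⟨C, fun s hs n => coeff_mul_mem fun i j _ => ?_⟩
  rcases lt_or_ge j 0 with h | h
  · rw [h0 j h, mul_zero]; exact zero_mem _
  rcases le_or_gt N j with h' | h'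
  · exact mul_mem_tensorSmall _ (hN j h')
  · exact hM j _ (tensorSmall_anti
      (hC (Finset.mem_coe.2 (Finset.mem_image_of_mem _ (Finset.mem_Ico.2 ⟨h, h'⟩)))) (hs i))

/-- The quotient of the tensor square by the small tensors, a discrete space. -/
def SmallQuot (q : ℂ) (N : ℤ) : Type := TensorSq q ⧸ tensorSmall q N

instance (N : ℤ) : AddCommGroup (SmallQuot q N) :=
  inferInstanceAs (AddCommGroup (TensorSq q ⧸ tensorSmall q N))
instance (N : ℤ) : Module ℂ (SmallQuot q N) :=
  inferInstanceAs (Module ℂ (TensorSq q ⧸ tensorSmall q N))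
instance (N : ℤ) : UniformSpace (SmallQuot q N) := ⊥
instance (N : ℤ) : DiscreteUniformity (SmallQuot q N) := ⟨rfl⟩
instance (N : ℤ) : IsUniformAddGroup (SmallQuot q N) := ⟨DiscreteUniformity.uniformContinuous _ _⟩
instance (N : ℤ) : ContinuousConstSMul ℂ (SmallQuot q N) := ⟨fun _ => continuous_of_discreteTopology⟩

/-- The component of weight `m`. -/
def coeffMap (q : ℂ) (m : ℤ) : FormalTensor q →ₗ[ℂ] TensorSq q where
  toFun t := t.coeff m
  map_add' s t := HahnSeries.coeff_add
  map_smul' c t := by rw [HahnSeries.coeff_smul, RingHom.id_apply]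

/-- The component of weight `m`, up to small tensors. -/
def smallCoeff (q : ℂ) (N m : ℤ) : FormalTensor q →ₗ[ℂ] SmallQuot q N :=
  (tensorSmall q N).mkQ.comp (coeffMap q m)

theorem smallCoeff_eq_zero {N m : ℤ} {t : FormalTensor q} :
    smallCoeff q N m t = 0 ↔ t.coeff m ∈ tensorSmall q N :=
  Submodule.Quotient.mk_eq_zero (tensorSmall q N) (x := t.coeff m)

theorem quadSum_mem_formalSmall {s : ℤˣ} {u : ℤ → FormalTensor q} (h : QuadRel q s (-1) u u)
    {N C : ℤ} (hu : ∀ v n, C ≤ n → v * u n ∈ formalSmall q N) {b c : ℤ} (hbc : C ≤ b ∨ C ≤ c) :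
    ∑ k : Fin 3, fCoeff q s k • (u (b + 2 - (k : ℕ)) * u (c + (k : ℕ))) ∈ formalSmall q N := by
  rcases hbc with hb | hc
  · rw [h b c]
    exact Submodule.smul_mem _ _ (sum_mem fun k _ => Submodule.smul_mem _ _ (hu _ _ (by omega)))
  · exact sum_mem fun k _ => Submodule.smul_mem _ _ (hu _ _ (by omega))

theorem boundedSeries_pairRight (hq : q ≠ 0) (s : ℤˣ) (N m : ℤ) :
    BoundedSeries (pairRight (smallCoeff q N m) q s (xLeft (genLeft q) (genRight q) s)
      (xRight (genLeft q) (genRight q) s)) := by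
  intro n
  refine ⟨max m (2 * N), fun a b c _ habc => smallCoeff_eq_zero.2 ?_⟩
  by_cases ha : m < a
  · have h1 : LowerBounded 0 (∑ k : Fin 3, fCoeff q s k •
        (xLeft (genLeft q) (genRight q) s (b + 2 - (k : ℕ)) *
          xLeft (genLeft q) (genRight q) s (c + (k : ℕ)))) :=
      LowerBounded.sum fun k _ => ((lowerBounded_xLeft s _).mul (lowerBounded_xLeft s _)).smul _
    rw [((lowerBounded_xRight s a).mul h1) m (by omega)]
    exact zero_mem _
  · refine mul_mem_formalSmall _ (quadSum_mem_formalSmall ((pair_gen hq).quadRel_left_left s)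
      (C := 2 * N) (fun v n hn => ?_) (by omega)) m
    exact mul_mem_formalSmall _ (totalWeight_le_formalSmall hn (xLeft_mem_totalWeight s n))

theorem boundedSeries_pairLeft (hq : q ≠ 0) (s : ℤˣ) (N m : ℤ) :
    BoundedSeries (pairLeft (smallCoeff q N m) q s (xLeft (genLeft q) (genRight q) s)
      (xRight (genLeft q) (genRight q) s)) := by
  intro n
  have hA : ∀ c, ∃ M, ∀ t ∈ formalSmall q M,
      t * xLeft (genLeft q) (genRight q) s c ∈ formalSmall q N := fun c =>
    exists_formalSmall_mul (lowerBounded_xLeft s c) fun j hj =>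
      biweight_le_tensorSmall (Or.inr hj) (xLeft_mem_totalWeight s c j)
  choose M hM using hA
  obtain ⟨C, hC⟩ := ((Finset.Ico (n - m - 10) (2 * N)).image M).bddAbove
  refine ⟨max (2 * C) (2 * N), fun a b c habc h => smallCoeff_eq_zero.2 ?_⟩
  by_cases hc : 2 * N ≤ c
  · exact mul_mem_formalSmall _ (totalWeight_le_formalSmall hc (xLeft_mem_totalWeight s c)) m
  by_cases hc' : c < n - m - 10
  · have h1 : LowerBounded (a + b + 2) (∑ i : Fin 3, fCoeff q s i •
        (xRight (genLeft q) (genRight q) s (a + 2 - (i : ℕ)) *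
          xRight (genLeft q) (genRight q) s (b + (i : ℕ)))) :=
      LowerBounded.sum fun k _ => (((lowerBounded_xRight s _).mul (lowerBounded_xRight s _)).smul
        _).mono (by omega)
    rw [(h1.mul (lowerBounded_xLeft s c)) m (by omega)]
    exact zero_mem _
  · refine hM c _ (quadSum_mem_formalSmall ((pair_gen hq).quadRel_right_right s)
      (C := 2 * M c) (fun v n hn => ?_) ?_) m
    · exact mul_mem_formalSmall _ (totalWeight_le_formalSmall hn (xRight_mem_totalWeight s n))
    · have := hC (Finset.mem_coe.2 (Finset.mem_image_of_mem M
        (Finset.mem_Ico.2 ⟨not_lt.1 hc', not_le.1 hc⟩)))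
      omega

end FormalSmall

/-! ### The coproduct of the q-Serre relations -/

section LineComb

variable {X : Type*} [AddCommGroup X] [Module ℂ X] [UniformSpace X] [IsUniformAddGroup X]
  [ContinuousConstSMul ℂ X] {q : ℂ} {s : ℤˣ}

theorem hasLine_zero_of_comb {ι : Type*} (hq : q ≠ 0) {G : ℤ → ℤ → ℤ → X}
    (h : ∀ n, ∃ (S : Finset ι) (F : ι → ℤ → ℤ → ℤ → X) (α β γ : ι → ℤ),
      (∀ i, HasLine q s (F i) fun _ => 0) ∧ ∀ a b c, a + b + c = n →
        G a b c = ∑ i ∈ S, F i (a + α i) (b + β i) (c + γ i)) :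
    HasLine q s G fun _ => 0 := by
  intro n
  obtain ⟨S, F, α, β, γ, hF, hG⟩ := h n
  have h1 := HasLine.sum (q := q) (s := s) (t := S) (fun i _ => (hF i).shift hq (α i) (β i) (γ i)) n
  simp only [smul_zero, Finset.sum_const_zero] at h1
  refine (congrArg (fun f => HasSum f _) (funext fun bc => ?_)).mp h1
  rw [lineTerm, lineTerm, hG _ _ _ (by ring)]

end LineComb

section Serre

variable {q : ℂ}

/-- The modes of `x^s(z)`. -/
def genX (q : ℂ) (s : ℤˣ) (n : ℤ) : U q := gen q (.x s n)

theorem incl_triple (s : ℤˣ) (a b c : ℤ) :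
    incl q (triple q s (genX q s) (genX q s) (genX q s) a b c) =
      UHat.mk q (tripleCoeff q s a b c) := by
  rw [tripleCoeff_eq, map_triple]
  exact map_triple q s (U q).val _ _ _ a b c

theorem hasSum_incl_line (hq : q ≠ 0) (s : ℤˣ) (n : ℤ) :
    HasSum (fun bc => incl q (lineTerm q s (triple q s (genX q s) (genX q s) (genX q s)) n bc)) 0 := by
  obtain ⟨L, hL, hserre⟩ := exists_lineSum_tripleCoeff hq s
  have h0 : ∀ n, UHat.mk q (L n) = 0 := by
    intro n
    obtain ⟨Y, hY, hz⟩ := serre_convergence hq s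
    obtain ⟨z, hz⟩ := hz n
    rw [UHat.mk_eq_zero, ← hserre Y n z hY hz]
    exact subset_closure (Ideal.subset_span ⟨z, ⟨s, Y, n, hY, hz⟩, 1, (mul_one z).symm⟩)
  have h1 := (hL n).map (UHat.mk q) (UHat.continuous_mk q)
  rw [map_smul, h0, smul_zero] at h1
  refine (congrArg (fun f => HasSum f _) (funext fun bc => ?_)).mp h1
  rw [Function.comp_apply, lineTerm, lineTerm, map_smul, map_smul, incl_triple]

variable {X : Type*} [AddCommGroup X] [Module ℂ X] [UniformSpace X] [IsUniformAddGroup X]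
  [ContinuousConstSMul ℂ X]

theorem hasLine_genX (hq : q ≠ 0) (s : ℤˣ) (f : U q →ₗ[ℂ] X) {N : ℤ}
    (hf : ∀ u ∈ uSmall q N, f u = 0) :
    HasLine q s (fun a b c => f (triple q s (genX q s) (genX q s) (genX q s) a b c))
      fun _ => 0 := by
  intro n
  have h1 := (hasSum_incl_line hq s n).eventually
    ((hasBasis_uhatSmall q).mem_of_mem (i := N) trivial)
  refine Filter.Tendsto.congr' (f₁ := fun _ => 0) ?_ tendsto_const_nhds
  filter_upwards [h1] with S hS
  have h2 : ∑ bc ∈ S, lineTerm q s (triple q s (genX q s) (genX q s) (genX q s)) n bc ∈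
      uSmall q N := by
    rw [← map_sum] at hS
    exact hS
  rw [← hf _ h2, map_sum]
  exact Finset.sum_congr rfl fun bc _ => map_smul f _ _

theorem coeff_mul_of_lowerBounded {d e : ℤ} {s t : FormalTensor q} (hs : LowerBounded d s)
    (ht : LowerBounded e t) (m : ℤ) : (s * t).coeff m =
      ∑ i ∈ Finset.Icc 0 (m - d - e), s.coeff (d + i) * t.coeff (m - d - i) := by
  let _ : TopologicalSpace (TensorSq q) := ⊥
  have _ : DiscreteTopology (TensorSq q) := ⟨rfl⟩
  have h1 := (Equiv.addLeft d).hasSum_iff.2 (hasSum_coeff_mul s t m)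
  refine h1.unique ?_
  have h2 : ∀ i, ((fun i => s.coeff i * t.coeff (m - i)) ∘ Equiv.addLeft d) i =
      s.coeff (d + i) * t.coeff (m - d - i) := by
    intro i
    rw [Function.comp_apply, Equiv.coe_addLeft, sub_sub]
  rw [Finset.sum_congr rfl fun i _ => (h2 i).symm]
  refine hasSum_sum_of_ne_finset_zero fun i hi => ?_
  rw [h2]
  rw [Finset.mem_Icc, not_and_or] at hi
  rcases hi with hi | hi
  · rw [hs _ (by omega), zero_mul]
  · rw [ht _ (by omega), mul_zero]

theorem coeff_mul_mul_of_lowerBounded {d e f : ℤ} {r s t : FormalTensor q}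
    (hr : LowerBounded d r) (hs : LowerBounded e s) (ht : LowerBounded f t) (m : ℤ) :
    (r * s * t).coeff m = ∑ ij ∈ (Finset.Icc 0 (m - d - e - f)).sigma fun i => Finset.Icc 0 i,
      r.coeff (d + ij.2) * s.coeff (e + ij.1 - ij.2) * t.coeff (m - d - e - ij.1) := by
  rw [coeff_mul_of_lowerBounded (hr.mul hs) ht, Finset.sum_sigma, show m - (d + e) - f = m - d - e - f by ring]
  refine Finset.sum_congr rfl fun i _ => ?_
  rw [coeff_mul_of_lowerBounded hr hs, Finset.sum_mul, show d + e + i - d - e = i by ring,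
    show m - (d + e) - i = m - d - e - i by ring]
  refine Finset.sum_congr rfl fun j _ => ?_
  rw [show d + e + i - d - j = e + i - j by ring]

theorem mul_gamPow_mul_mul_gamPow (u v : U q) (m n : ℤ) :
    u * gamPow (gen q) m * (v * gamPow (gen q) n) = u * v * gamPow (gen q) (m + n) := by
  rw [mul_assoc, ← mul_assoc (gamPow (gen q) m), (gamPow_central m v).eq, mul_assoc v,
    gamPow_gen_mul, mul_assoc]

theorem parity_mul_gamPow {u : U q} (h : parity q u = u) (n : ℤ) :
    parity q (u * gamPow (gen q) n) = u * gamPow (gen q) n := by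
  rw [map_mul, h, parity_gamPow]

/-- A product of three currents `x(z) ⊗ η(z)`. -/
theorem coeff_left_mul {s : ℤˣ} {u : ℤ → FormalTensor q} {η : ℤ → U q} {α β : ℤ}
    (hb : ∀ n, LowerBounded 0 (u n)) (hη : ∀ j, parity q (η j) = η j)
    (hu : ∀ n j, (u n).coeff j = genX q s (n - j) ᵍ⊗ₜ[ℂ] (η j * gamPow (gen q) (α * j + β * n)))
    (a b c m : ℤ) : (u a * u b * u c).coeff m =
      ∑ ij ∈ (Finset.Icc 0 m).sigma fun i => Finset.Icc 0 i,
        (genX q s (a - ij.2) * genX q s (b - (ij.1 - ij.2)) * genX q s (c - (m - ij.1))) ᵍ⊗ₜ[ℂ]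
          (η ij.2 * η (ij.1 - ij.2) * η (m - ij.1) *
            gamPow (gen q) (α * m + β * (a + b + c))) := by
  rw [coeff_mul_mul_of_lowerBounded (hb a) (hb b) (hb c), sub_zero, sub_zero, sub_zero]
  refine Finset.sum_congr rfl fun ij _ => ?_
  rw [zero_add, zero_add, hu, hu, hu, tsq_mul_of_even (parity_mul_gamPow (hη _) _),
    mul_gamPow_mul_mul_gamPow, tsq_mul_of_even (parity_mul_gamPow (by rw [map_mul, hη, hη]) _),
    mul_gamPow_mul_mul_gamPow, show α * ij.2 + β * a + (α * (ij.1 - ij.2) + β * b) +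
      (α * (m - ij.1) + β * c) = α * m + β * (a + b + c) by ring]

/-- A product of three currents `η(z) ⊗ x(z)`. -/
theorem coeff_right_mul {s : ℤˣ} {u : ℤ → FormalTensor q} {η : ℤ → U q} {α β : ℤ}
    (hb : ∀ n, LowerBounded n (u n)) (hη : ∀ j, parity q (η j) = η j)
    (hu : ∀ n j, (u n).coeff j = (η (n - j) * gamPow (gen q) (α * j + β * n)) ᵍ⊗ₜ[ℂ] genX q s j)
    (a b c m : ℤ) : (u a * u b * u c).coeff m =
      ∑ ij ∈ (Finset.Icc 0 (m - (a + b + c))).sigma fun i => Finset.Icc 0 i,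
        (η (-ij.2) * η (-(ij.1 - ij.2)) * η (-(m - (a + b + c) - ij.1)) *
            gamPow (gen q) (α * m + β * (a + b + c))) ᵍ⊗ₜ[ℂ]
        (genX q s (a + ij.2) * genX q s (b + (ij.1 - ij.2)) *
          genX q s (c + (m - (a + b + c) - ij.1))) := by
  rw [coeff_mul_mul_of_lowerBounded (hb a) (hb b) (hb c),
    show m - a - b - c = m - (a + b + c) by ring]
  refine Finset.sum_congr rfl fun ij _ => ?_
  rw [hu, hu, hu, tsq_mul_even_left (parity_mul_gamPow (hη _) _),
    mul_gamPow_mul_mul_gamPow, tsq_mul_even_left (parity_mul_gamPow (hη _) _),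
    mul_gamPow_mul_mul_gamPow, show a - (a + ij.2) = -ij.2 by ring,
    show b - (b + ij.1 - ij.2) = -(ij.1 - ij.2) by ring,
    show c - (m - a - b - ij.1) = -(m - (a + b + c) - ij.1) by ring,
    show b + ij.1 - ij.2 = b + (ij.1 - ij.2) by ring,
    show m - a - b - ij.1 = c + (m - (a + b + c) - ij.1) by ring,
    show α * (a + ij.2) + β * a + (α * (b + (ij.1 - ij.2)) + β * b) +
      (α * (c + (m - (a + b + c) - ij.1)) + β * c) = α * m + β * (a + b + c) by ring]

/-- `v ↦ v ⊗ w` up to small tensors. -/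
def smallTmulLeft (q : ℂ) (N : ℤ) (w : U q) : U q →ₗ[ℂ] SmallQuot q N :=
  (tensorSmall q N).mkQ.comp ((GradedTensorProduct.of ℂ (parityPart q) (parityPart q)).toLinearMap.comp
    ((TensorProduct.mk ℂ (U q) (U q)).flip w))

/-- `v ↦ w ⊗ v` up to small tensors. -/
def smallTmulRight (q : ℂ) (N : ℤ) (w : U q) : U q →ₗ[ℂ] SmallQuot q N :=
  (tensorSmall q N).mkQ.comp ((GradedTensorProduct.of ℂ (parityPart q) (parityPart q)).toLinearMap.comp
    (TensorProduct.mk ℂ (U q) (U q) w))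

theorem smallTmulLeft_eq_zero {N : ℤ} (w : U q) (u : U q) (hu : u ∈ uSmall q N) :
    smallTmulLeft q N w u = 0 :=
  (Submodule.Quotient.mk_eq_zero (tensorSmall q N)).2 (tmul_mem_tensorSmall (Or.inl hu))

theorem smallTmulRight_eq_zero {N : ℤ} (w : U q) (u : U q) (hu : u ∈ uSmall q N) :
    smallTmulRight q N w u = 0 :=
  (Submodule.Quotient.mk_eq_zero (tensorSmall q N)).2 (tmul_mem_tensorSmall (Or.inr hu))

/-- The product `f · g · h` over the three pairs, as a sum over three indices. -/
theorem map_triple_comb {T V Z : Type*} [Ring T] [Algebra ℂ T] [Ring V] [Algebra ℂ V]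
    [AddCommGroup Z] [Module ℂ Z] {s : ℤˣ} {u : ℤ → T} {x : ℤ → V} {ι : Type*} {D : T →ₗ[ℂ] Z}
    {n : ℤ} {S : Finset ι} {f : ι → V →ₗ[ℂ] Z} {α β γ : ι → ℤ}
    (h : ∀ a b c, a + b + c = n + 6 → D (u a * u b * u c) =
      ∑ i ∈ S, f i (x (a + α i) * x (b + β i) * x (c + γ i)))
    {a b c : ℤ} (habc : a + b + c = n) : D (triple q s u u u a b c) =
      ∑ i ∈ S, f i (triple q s x x x (a + α i) (b + β i) (c + γ i)) := by
  simp only [triple, map_sum, map_smul]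
  symm
  refine Finset.sum_comm.trans ?_
  refine Finset.sum_congr rfl fun i _ => ?_
  refine Finset.sum_comm.trans ?_
  refine Finset.sum_congr rfl fun j _ => ?_
  refine Finset.sum_comm.trans ?_
  refine Finset.sum_congr rfl fun k _ => ?_
  rw [← Finset.smul_sum, h _ _ _ (by linarith)]
  congr 1
  refine Finset.sum_congr rfl fun l _ => ?_
  rw [show a + 4 - ((i : ℕ) : ℤ) - (j : ℕ) + α l = a + α l + 4 - (i : ℕ) - (j : ℕ) by ring,
    show b + ((i : ℕ) : ℤ) + 2 - (k : ℕ) + β l = b + β l + (i : ℕ) + 2 - (k : ℕ) by ring,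
    show c + ((j : ℕ) : ℤ) + (k : ℕ) + γ l = c + γ l + (j : ℕ) + (k : ℕ) by ring]

theorem hasLine_left (hq : q ≠ 0) {s : ℤˣ} {u : ℤ → FormalTensor q} {η : ℤ → U q} {α β : ℤ}
    (hb : ∀ n, LowerBounded 0 (u n)) (hη : ∀ j, parity q (η j) = η j)
    (hu : ∀ n j, (u n).coeff j = genX q s (n - j) ᵍ⊗ₜ[ℂ] (η j * gamPow (gen q) (α * j + β * n)))
    (N m : ℤ) : HasLine q s (fun a b c => smallCoeff q N m (triple q s u u u a b c))
      fun _ => 0 := by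
  refine hasLine_zero_of_comb (ι := (_ : ℤ) × ℤ) hq fun n => ⟨(Finset.Icc 0 m).sigma fun i => Finset.Icc 0 i,
    fun ij a b c => smallTmulLeft q N (η ij.2 * η (ij.1 - ij.2) * η (m - ij.1) *
      gamPow (gen q) (α * m + β * (n + 6))) (triple q s (genX q s) (genX q s) (genX q s) a b c),
    fun ij => -ij.2, fun ij => -(ij.1 - ij.2), fun ij => -(m - ij.1),
    fun ij => hasLine_genX hq s _ (smallTmulLeft_eq_zero _), fun a b c habc => ?_⟩
  refine map_triple_comb (fun a b c habc => ?_) habc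
  change (tensorSmall q N).mkQ ((u a * u b * u c).coeff m) = _
  rw [coeff_left_mul hb hη hu, map_sum, habc]
  rfl

theorem hasLine_right (hq : q ≠ 0) {s : ℤˣ} {u : ℤ → FormalTensor q} {η : ℤ → U q} {α β : ℤ}
    (hb : ∀ n, LowerBounded n (u n)) (hη : ∀ j, parity q (η j) = η j)
    (hu : ∀ n j, (u n).coeff j = (η (n - j) * gamPow (gen q) (α * j + β * n)) ᵍ⊗ₜ[ℂ] genX q s j)
    (N m : ℤ) : HasLine q s (fun a b c => smallCoeff q N m (triple q s u u u a b c))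
      fun _ => 0 := by
  refine hasLine_zero_of_comb (ι := (_ : ℤ) × ℤ) hq fun n =>
    ⟨(Finset.Icc 0 (m - (n + 6))).sigma fun i => Finset.Icc 0 i,
    fun ij a b c => smallTmulRight q N (η (-ij.2) * η (-(ij.1 - ij.2)) * η (-(m - (n + 6) - ij.1)) *
      gamPow (gen q) (α * m + β * (n + 6))) (triple q s (genX q s) (genX q s) (genX q s) a b c),
    fun ij => ij.2, fun ij => ij.1 - ij.2, fun ij => m - (n + 6) - ij.1,
    fun ij => hasLine_genX hq s _ (smallTmulRight_eq_zero _), fun a b c habc => ?_⟩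
  refine map_triple_comb (fun a b c habc => ?_) habc
  change (tensorSmall q N).mkQ ((u a * u b * u c).coeff m) = _
  rw [coeff_right_mul hb hη hu, map_sum, habc]
  rfl

theorem parity_unitMode (j : ℤ) : parity q (unitMode j) = unitMode j := by
  rw [unitMode]
  split_ifs
  · exact map_one _
  · exact map_zero _

theorem hasLine_xLeft (hq : q ≠ 0) (s : ℤˣ) (N m : ℤ) :
    HasLine q s (fun a b c => smallCoeff q N m (triple q s (xLeft (genLeft q) (genRight q) s)
      (xLeft (genLeft q) (genRight q) s) (xLeft (genLeft q) (genRight q) s) a b c)) fun _ => 0 := by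
  rcases Int.units_eq_one_or s with rfl | rfl
  · refine hasLine_left hq (η := unitMode) (α := 0) (β := 0) (lowerBounded_xLeft 1) parity_unitMode
      (fun n j => ?_) N m
    rw [coeff_xLeft_pos, unitMode, zero_mul, zero_mul, zero_add, gamPow_zero, mul_one]
    split_ifs with h
    · rw [h, sub_zero]; rfl
    · rw [GradedTensorProduct.tmul, TensorProduct.tmul_zero, map_zero]
  · refine hasLine_left hq (η := psi (gen q)) (α := 1) (β := -2) (lowerBounded_xLeft (-1)) parity_psi
      (fun n j => ?_) N m
    rw [coeff_xLeft_neg, show 1 * j + -2 * n = j - 2 * n by ring]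
    rfl

theorem hasLine_xRight (hq : q ≠ 0) (s : ℤˣ) (N m : ℤ) :
    HasLine q s (fun a b c => smallCoeff q N m (triple q s (xRight (genLeft q) (genRight q) s)
      (xRight (genLeft q) (genRight q) s) (xRight (genLeft q) (genRight q) s) a b c))
      fun _ => 0 := by
  rcases Int.units_eq_one_or s with rfl | rfl
  · refine hasLine_right hq (η := phi (gen q)) (α := -1) (β := -1) (lowerBounded_xRight 1) parity_phi
      (fun n j => ?_) N m
    rw [coeff_xRight_pos, show -1 * j + -1 * n = -(n + j) by ring]
    rfl
  · refine hasLine_right hq (η := unitMode) (α := 0) (β := 0) (lowerBounded_xRight (-1))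
      parity_unitMode (fun n j => ?_) N m
    rw [coeff_xRight_neg, unitMode, zero_mul, zero_mul, zero_add, gamPow_zero, mul_one]
    split_ifs with h h' h'
    · rw [h]; rfl
    · omega
    · omega
    · rw [GradedTensorProduct.tmul, TensorProduct.zero_tmul, map_zero]

theorem comul_triple (hq : q ≠ 0) (s : ℤˣ) (a b c : ℤ) :
    PreU.comul hq (triple q s (fun n => PreU.gen q (.x s n)) (fun n => PreU.gen q (.x s n))
      (fun n => PreU.gen q (.x s n)) a b c) =
    triple q s
      (fun n => xLeft (genLeft q) (genRight q) s n + xRight (genLeft q) (genRight q) s n)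
      (fun n => xLeft (genLeft q) (genRight q) s n + xRight (genLeft q) (genRight q) s n)
      (fun n => xLeft (genLeft q) (genRight q) s n + xRight (genLeft q) (genRight q) s n) a b c := by
  rw [map_triple]
  simp only [PreU.comul_gen, coprodGen]

theorem hasLine_comul (hq : q ≠ 0) (s : ℤˣ) (N m : ℤ) :
    HasLine q s (fun a b c => smallCoeff q N m (PreU.comul hq (triple q s
      (fun n => PreU.gen q (.x s n)) (fun n => PreU.gen q (.x s n))
      (fun n => PreU.gen q (.x s n)) a b c))) fun _ => 0 := by
  simp only [comul_triple]
  exact hasLine_triple_add _ hq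
    (((pair_gen hq).quadRel_left_right s).symm (by norm_num))
    (boundedSeries_pairRight hq s N m) (boundedSeries_pairLeft hq s N m)
    (hasLine_xLeft hq s N m) (hasLine_xRight hq s N m)

/-- The q-Serre relations are compatible with the coproduct. -/
theorem serreSet_subset_comulKer (hq : q ≠ 0) (hq4 : q ^ 4 ≠ 1) : serreSet q ⊆ comulKer hq := by
  rintro z ⟨s, Y, n, hY, hz⟩
  obtain ⟨L, hL, hserre⟩ := exists_lineSum_tripleCoeff hq s
  have hκ := line_factor_ne_zero hq hq4 s
  have hLn : (((1 - q ^ (s : ℤ)) * (1 - q ^ (2 * (s : ℤ))) *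
      (q ^ (s : ℤ) - q ^ (2 * (s : ℤ)))) • L n) ∈ comulKer hq := by
    have h1 := hL (n - 3)
    rw [sub_add_cancel] at h1
    refine hasSum_mem_comulKer hq (f := lineTerm q s (triple q s
      (fun n => PreU.gen q (.x s n)) (fun n => PreU.gen q (.x s n))
      (fun n => PreU.gen q (.x s n))) (n - 3)) ?_ fun m N => ?_
    · refine (congrArg (fun f => HasSum f _) (funext fun bc => ?_)).mp h1
      have h2 := map_smul (PreU.coe q)  (q ^ (-(s : ℤ) * (bc.1 + 2 * bc.2)))
        (triple q s (fun n => PreU.gen q (.x s n)) (fun n => PreU.gen q (.x s n))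
          (fun n => PreU.gen q (.x s n)) (n - 3 - bc.1 - bc.2) bc.1 bc.2)
      rw [map_triple] at h2
      rw [lineTerm, tripleCoeff_eq]
      exact h2.symm
    · have h2 := (hasLine_comul hq s N m (n - 3)).eventually
        (mem_nhds_discrete.2 (Set.mem_singleton (0 : SmallQuot q N)))
      obtain ⟨S₀, hS₀⟩ := Filter.eventually_atTop.1 h2
      refine ⟨S₀, fun S hS => ?_⟩
      have h3 := Set.mem_singleton_iff.1 (hS₀ S hS)
      rw [← map_sum]
      refine smallCoeff_eq_zero.1 ?_
      rw [map_sum, map_sum]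
      refine Eq.trans (Finset.sum_congr rfl fun bc _ => ?_) h3
      rw [lineTerm, lineTerm, map_smul, map_smul]
  have h3 := mul_mem_comulKer hq (algebraMap ℂ _ (((1 - q ^ (s : ℤ)) * (1 - q ^ (2 * (s : ℤ))) *
      (q ^ (s : ℤ) - q ^ (2 * (s : ℤ))))⁻¹)) hLn
  rw [← Algebra.smul_def, smul_smul, inv_mul_cancel₀ hκ, one_smul] at h3
  rwa [hserre Y n z hY hz]

end Serre

/-! ### The coproduct -/

section Comul

variable {q : ℂ}

theorem toU_surjective (q : ℂ) : Function.Surjective (PreU.toUHat q).rangeRestrict :=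
  AlgHom.rangeRestrict_surjective (PreU.toUHat q)

theorem ker_toU_le_ker_comul (hq : q ≠ 0) (hq4 : q ^ 4 ≠ 1) (u : PreU q)
    (hu : u ∈ RingHom.ker (PreU.toUHat q).rangeRestrict) : PreU.comul hq u = 0 := by
  refine comul_eq_zero_of_mem_comulKer hq
    (serreIdeal_subset_comulKer hq (serreSet_subset_comulKer hq hq4) ?_)
  exact (UHat.mk_eq_zero q).1 (congrArg Subtype.val hu)

/-- The coproduct. -/
def comul (hq : q ≠ 0) (hq4 : q ^ 4 ≠ 1) : U q →ₐ[ℂ] FormalTensor q :=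
  (Ideal.Quotient.liftₐ _ (PreU.comul hq) (ker_toU_le_ker_comul hq hq4)).comp
    (Ideal.quotientKerAlgEquivOfSurjective (toU_surjective q)).symm.toAlgHom

theorem comul_toU (hq : q ≠ 0) (hq4 : q ^ 4 ≠ 1) (u : PreU q) :
    comul hq hq4 ((PreU.toUHat q).rangeRestrict u) = PreU.comul hq u := by
  have h := Ideal.quotientKerAlgEquivOfSurjective_symm_apply (toU_surjective q) u
  exact congrArg (Ideal.Quotient.liftₐ _ (PreU.comul hq) (ker_toU_le_ker_comul hq hq4)) h

theorem comul_gen (hq : q ≠ 0) (hq4 : q ^ 4 ≠ 1) (y : Gen) :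
    comul hq hq4 (gen q y) = coprodGen (genLeft q) (genRight q) y :=
  (comul_toU hq hq4 _).trans (PreU.comul_gen hq y)

theorem comul_phi (hq : q ≠ 0) (hq4 : q ^ 4 ≠ 1) (n : ℤ) :
    comul hq hq4 (phi (gen q) n) = phi (coprodGen (genLeft q) (genRight q)) n := by
  rw [map_phi]
  simp only [comul_gen]

theorem comul_psi (hq : q ≠ 0) (hq4 : q ^ 4 ≠ 1) (n : ℤ) :
    comul hq hq4 (psi (gen q) n) = psi (coprodGen (genLeft q) (genRight q)) n := by
  rw [map_psi]
  simp only [comul_gen]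

theorem comul_mem_totalWeight (hq : q ≠ 0) (hq4 : q ^ 4 ≠ 1) {W : ℤ} {u : U q}
    (hu : u ∈ weightSpace q W) : comul hq hq4 u ∈ totalWeight q W := by
  induction hu using Submodule.span_induction with
  | mem u hu =>
    obtain ⟨w, rfl, rfl⟩ := hu
    have h := comul_word_mem_totalWeight hq w
    rw [← comul_toU hq hq4, map_list_prod, List.map_map] at h
    exact h
  | zero => rw [map_zero]; exact zero_mem _
  | add x y _ _ hx hy => rw [map_add]; exact add_mem hx hy
  | smul c x _ hx => rw [map_smul]; exact Submodule.smul_mem _ _ hx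

theorem iSup_weightSpace : ⨆ n, weightSpace q n = ⊤ := by
  rw [eq_top_iff]
  rintro u -
  obtain ⟨u, rfl⟩ := toU_surjective q u
  induction PreU.word_span u using Submodule.span_induction with
  | mem u hu =>
    obtain ⟨w, rfl⟩ := hu
    refine Submodule.mem_iSup_of_mem (w.map Gen.weight).sum (Submodule.subset_span ⟨w, rfl, ?_⟩)
    rw [map_list_prod, List.map_map]
    rfl
  | zero => rw [map_zero]; exact zero_mem _
  | add x y _ _ hx hy => rw [map_add]; exact add_mem hx hy
  | smul c x _ hx => rw [map_smul]; exact Submodule.smul_mem _ _ hx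

/-- Induction over homogeneous elements. -/
theorem weight_induction {p : U q → Prop} (h : ∀ n, ∀ u ∈ weightSpace q n, p u) (h0 : p 0)
    (hadd : ∀ u v, p u → p v → p (u + v)) (u : U q) : p u := by
  have hu : u ∈ ⨆ n, weightSpace q n := iSup_weightSpace ▸ Submodule.mem_top
  exact Submodule.iSup_induction _ (motive := p) hu h h0 hadd

theorem comul_mem_completedTensor (hq : q ≠ 0) (hq4 : q ^ 4 ≠ 1) (u : U q) :
    comul hq hq4 u ∈ completedTensor q := by
  induction u using weight_induction with
  | h0 => rw [map_zero]; exact zero_mem _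
  | hadd u v hu hv => rw [map_add]; exact add_mem hu hv
  | h W u hu =>
    intro n
    have h := comul_mem_totalWeight hq hq4 hu n
    generalize (comul hq hq4 u).coeff n = t at h ⊢
    induction h using Submodule.span_induction with
    | mem t ht =>
      obtain ⟨a, -, b, hb, rfl⟩ := ht
      exact ⟨a ⊗ₜ ⟨b, hb⟩, rfl⟩
    | zero => rw [map_zero]; exact zero_mem _
    | add x y _ _ hx hy => rw [map_add]; exact add_mem hx hy
    | smul c x _ hx => rw [map_smul]; exact Submodule.smul_mem _ _ hx

end Comul

/-! ### The counit -/

section Counit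

variable {q : ℂ}

/-- The images of the generators under the counit. -/
def counitGen : Gen → ℂ
  | .gam => 1
  | .gamInv => 1
  | .k => 1
  | .kInv => 1
  | .a _ => 0
  | .b _ => 0
  | .x _ _ => 0

theorem aSeries_counitGen : aSeries counitGen = 0 := by
  ext n
  cases n with
  | zero => rw [coeff_zero_aSeries, map_zero]
  | succ n => rw [coeff_succ_aSeries, map_zero]; rfl

theorem bSeries_counitGen : bSeries counitGen = 0 := by
  ext n
  cases n with
  | zero => rw [coeff_zero_bSeries, map_zero]
  | succ n => rw [coeff_succ_bSeries, map_zero]; rfl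

theorem phi_counitGen (m : ℤ) : phi counitGen m = if m = 0 then 1 else 0 := by
  simp only [phi, aSeries_counitGen, expCoeff_zero, Int.natAbs_eq_zero, counitGen, one_mul]
  split_ifs <;> first | rfl | omega

theorem psi_counitGen (m : ℤ) : psi counitGen m = if m = 0 then 1 else 0 := by
  simp only [psi, bSeries_counitGen, expCoeff_zero, Int.natAbs_eq_zero, counitGen, one_mul]
  split_ifs <;> first | rfl | omega

theorem gamPow_counitGen (n : ℤ) : gamPow counitGen n = 1 := by cases n <;> simp [gamPow, counitGen]

theorem gRatio_counitGen (hq : q ≠ 0) (k : ℕ) : gRatio q counitGen k = if k = 0 then 1 else 0 := by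
  rw [← gCoeff_sum_antidiagonal hq 1 k, gRatio]
  simp only [gamPow_counitGen, smul_eq_mul, mul_one]

theorem relations_counitGen (hq : q ≠ 0) : Relations q counitGen where
  gam_gamInv := by simp [counitGen]
  gamInv_gam := by simp [counitGen]
  k_kInv := by simp [counitGen]
  kInv_k := by simp [counitGen]
  gam_central y := mul_comm _ _
  phi_phi m n := mul_comm _ _
  psi_psi m n := mul_comm _ _
  phi_psi m n := by
    rw [Finset.sum_eq_single 0]
    · rw [gRatio_counitGen hq, if_pos rfl, one_mul, Nat.cast_zero, sub_zero, add_zero, mul_comm]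
    · intro k _ hk
      rw [gRatio_counitGen hq, if_neg hk, zero_mul]
    · simp
  phi_x s m n := by simp [counitGen]
  psi_x s m n := by simp [counitGen]
  xp_xm m n := by simp [counitGen, phi_counitGen, psi_counitGen, gamPow_counitGen]
  x_x s m n := by simp [counitGen]

/-- The counit on the algebra without the q-Serre relations. -/
def PreU.counit (hq : q ≠ 0) : PreU q →ₐ[ℂ] ℂ := PreU.lift (relations_counitGen hq)

theorem PreU.counit_gen (hq : q ≠ 0) (y : Gen) : PreU.counit hq (PreU.gen q y) = counitGen y :=
  PreU.lift_gen _ y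

theorem counitGen_eq_zero {y : Gen} (hy : y.weight ≠ 0) : counitGen y = 0 := by
  cases y <;> simp_all [Gen.weight, counitGen]

theorem counit_word_eq_zero (hq : q ≠ 0) {w : List Gen} (hw : (w.map Gen.weight).sum ≠ 0) :
    PreU.counit hq ((w.map (PreU.gen q)).prod) = 0 := by
  induction w with
  | nil => simp at hw
  | cons y w ih =>
    rw [List.map_cons, List.prod_cons, map_mul]
    by_cases hy : y.weight = 0
    · rw [ih (by simpa [hy] using hw), mul_zero]
    · rw [PreU.counit_gen, counitGen_eq_zero hy, zero_mul]

theorem PreU.counit_small (hq : q ≠ 0) {u : PreU q} (hu : u ∈ smallIdeal q 1) :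
    PreU.counit hq u = 0 := by
  induction hu using Submodule.span_induction with
  | mem u hu =>
    obtain ⟨w, hw, rfl⟩ := hu
    exact counit_word_eq_zero hq (by omega)
  | zero => exact map_zero _
  | add x y _ _ hx hy => rw [map_add, hx, hy, add_zero]
  | smul c x _ hx => rw [smul_eq_mul, map_mul, hx, mul_zero]

theorem PreU.continuous_counit (hq : q ≠ 0) :
    Continuous ((PreU.counit hq : PreU q →ₐ[ℂ] ℂ) : PreU q →+* ℂ) := by
  refine continuous_of_continuousAt_zero _ ?_
  rw [ContinuousAt, map_zero]
  refine Filter.Tendsto.congr' (f₁ := fun _ => 0) ?_ tendsto_const_nhds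
  filter_upwards [(PreU.hasBasis_nhds_zero q).mem_of_mem (i := 1) trivial] with u hu
  exact (PreU.counit_small hq hu).symm

/-- The counit on the completion. -/
def PreUHat.counit (hq : q ≠ 0) : PreUHat q →ₐ[ℂ] ℂ :=
  { UniformSpace.Completion.extensionHom ((PreU.counit hq : PreU q →ₐ[ℂ] ℂ) : PreU q →+* ℂ)
      (PreU.continuous_counit hq) with
    commutes' := fun r => (UniformSpace.Completion.extensionHom_coe _ (PreU.continuous_counit hq)
      (algebraMap ℂ (PreU q) r)).trans (AlgHom.commutes (PreU.counit hq) r) }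

theorem PreUHat.counit_coe (hq : q ≠ 0) (u : PreU q) :
    PreUHat.counit hq (u : PreUHat q) = PreU.counit hq u :=
  UniformSpace.Completion.extensionHom_coe _ (PreU.continuous_counit hq) u

theorem PreUHat.continuous_counit (hq : q ≠ 0) : Continuous (PreUHat.counit hq) :=
  UniformSpace.Completion.continuous_extension

theorem PreUHat.counit_tripleCoeff (hq : q ≠ 0) (s : ℤˣ) (a b c : ℤ) :
    PreUHat.counit hq (tripleCoeff q s a b c) = 0 := by
  have h : ∀ n, PreUHat.counit hq (hatGen q (.x s n)) = 0 := fun n => by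
    rw [hatGen, PreUHat.counit_coe, PreU.counit_gen]; rfl
  simp [tripleCoeff, h]

theorem PreUHat.counit_serreIdeal (hq : q ≠ 0) {z : PreUHat q} (hz : z ∈ serreIdeal q) :
    PreUHat.counit hq z = 0 := by
  refine closure_minimal (t := PreUHat.counit hq ⁻¹' {0}) (fun u hu => ?_)
    (isClosed_singleton.preimage (PreUHat.continuous_counit hq)) hz
  refine Submodule.span_induction (p := fun u _ => PreUHat.counit hq u = 0) ?_ ?_ ?_ ?_ hu
  · rintro _ ⟨z, ⟨s, Y, n, hY, hz⟩, v, rfl⟩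
    have h1 : ∀ a b c, PreUHat.counit hq (Y a b c) = 0 := by
      intro a b c
      have h := (hY a b c).map (PreUHat.counit hq) (PreUHat.continuous_counit hq)
      simp only [Function.comp_def, PreUHat.counit_tripleCoeff] at h
      exact h.unique hasSum_zero
    have h := hz.map (PreUHat.counit hq) (PreUHat.continuous_counit hq)
    simp only [Function.comp_def, map_smul, h1, smul_zero] at h
    rw [map_mul, h.unique hasSum_zero, zero_mul]
  · exact map_zero _
  · intro x y _ _ hx hy
    rw [map_add, hx, hy, add_zero]
  · intro c x _ hx
    rw [smul_eq_mul, map_mul, hx, mul_zero]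

/-- The counit. -/
def counit (hq : q ≠ 0) : U q →ₐ[ℂ] ℂ :=
  (Ideal.Quotient.liftₐ (serreIdeal q) (PreUHat.counit hq)
    fun _ hz => PreUHat.counit_serreIdeal hq hz).comp (U q).val

theorem counit_toU (hq : q ≠ 0) (u : PreU q) :
    counit hq ((PreU.toUHat q).rangeRestrict u) = PreU.counit hq u := PreUHat.counit_coe hq u

theorem counit_gen (hq : q ≠ 0) (y : Gen) : counit hq (gen q y) = counitGen y :=
  (counit_toU hq _).trans (PreU.counit_gen hq y)

theorem counit_phi (hq : q ≠ 0) (n : ℤ) : counit hq (phi (gen q) n) = if n = 0 then 1 else 0 := by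
  rw [map_phi, ← phi_counitGen]
  simp only [counit_gen]

theorem counit_psi (hq : q ≠ 0) (n : ℤ) : counit hq (psi (gen q) n) = if n = 0 then 1 else 0 := by
  rw [map_psi, ← psi_counitGen]
  simp only [counit_gen]

theorem counit_gamPow (hq : q ≠ 0) (n : ℤ) : counit hq (gamPow (gen q) n) = 1 := by
  rw [map_gamPow, ← gamPow_counitGen n]
  simp only [counit_gen]

theorem counit_weight (hq : q ≠ 0) {W : ℤ} (hW : W ≠ 0) {u : U q} (hu : u ∈ weightSpace q W) :
    counit hq u = 0 := by
  induction hu using Submodule.span_induction with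
  | mem u hu =>
    obtain ⟨w, rfl, rfl⟩ := hu
    have h := counit_word_eq_zero hq hW
    rw [← counit_toU hq, map_list_prod, List.map_map] at h
    exact h
  | zero => exact map_zero _
  | add x y _ _ hx hy => rw [map_add, hx, hy, add_zero]
  | smul c x _ hx => rw [map_smul, hx, smul_zero]

theorem counit_parity (hq : q ≠ 0) (u : U q) : counit hq (parity q u) = counit hq u := by
  induction u using U_induction with
  | hgen y =>
    rw [parity_gen, map_smul, counit_gen]
    cases y <;> simp [counitGen, Gen.sign]
  | hC r => rw [AlgHom.commutes]
  | hadd u v hu hv => rw [map_add, map_add, map_add, hu, hv]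
  | hmul u v hu hv => rw [map_mul, map_mul, map_mul, hu, hv]

end Counit

/-! ### Sums with finitely many non-zero terms -/

section FSum

variable {α β M M' : Type*} [AddCommMonoid M] [AddCommMonoid M']

/-- `f` has finitely many non-zero values, with sum `a`. -/
def FSum (f : α → M) (a : M) : Prop := ∃ S : Finset α, (∀ i ∉ S, f i = 0) ∧ ∑ i ∈ S, f i = a

theorem FSum.sum_eq {f : α → M} {a : M} {S : Finset α} (h : FSum f a) (hS : ∀ i ∉ S, f i = 0) :
    ∑ i ∈ S, f i = a := by
  classical
  obtain ⟨S', h1, rfl⟩ := h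
  rw [Finset.sum_subset (Finset.subset_union_left (s₂ := S')) fun i _ hi => hS i hi,
    Finset.sum_subset (Finset.subset_union_right (s₁ := S)) fun i _ hi => h1 i hi]

theorem FSum.unique {f : α → M} {a b : M} (h : FSum f a) (h' : FSum f b) : a = b := by
  obtain ⟨S, h1, rfl⟩ := h
  exact h'.sum_eq h1

theorem FSum.map {f : α → M} {a : M} (h : FSum f a) (g : M →+ M') : FSum (fun i => g (f i)) (g a) := by
  obtain ⟨S, h1, rfl⟩ := h
  exact ⟨S, fun i hi => by beta_reduce; rw [h1 i hi, map_zero], (map_sum g _ _).symm⟩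

theorem FSum.add {f g : α → M} {a b : M} (h : FSum f a) (h' : FSum g b) :
    FSum (fun i => f i + g i) (a + b) := by
  classical
  obtain ⟨S, h1, h2⟩ := h
  obtain ⟨S', h1', h2'⟩ := h'
  refine ⟨S ∪ S', fun i hi => ?_, ?_⟩
  · rw [Finset.mem_union, not_or] at hi
    beta_reduce
    rw [h1 i hi.1, h1' i hi.2, add_zero]
  · rw [Finset.sum_add_distrib, FSum.sum_eq ⟨S, h1, h2⟩ fun i hi => h1 i fun h =>
      hi (Finset.mem_union_left _ h), FSum.sum_eq ⟨S', h1', h2'⟩ fun i hi => h1' i fun h =>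
      hi (Finset.mem_union_right _ h)]

theorem FSum.zero : FSum (fun _ : α => (0 : M)) 0 := ⟨∅, fun _ _ => rfl, Finset.sum_empty⟩

theorem FSum.equiv {f : α → M} {a : M} (h : FSum f a) (e : β ≃ α) : FSum (fun i => f (e i)) a := by
  obtain ⟨S, h1, rfl⟩ := h
  refine ⟨S.map e.symm.toEmbedding, fun i hi => h1 _ fun h => hi ?_, ?_⟩
  · exact Finset.mem_map.2 ⟨e i, h, e.symm_apply_apply i⟩
  · rw [Finset.sum_map]
    exact Finset.sum_congr rfl fun i _ => by simp

theorem FSum.prod {f : α × β → M} {g : α → M} {a : M} (h : ∀ x, FSum (fun y => f (x, y)) (g x))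
    {S : Finset α} (hS : ∀ x ∉ S, ∀ y, f (x, y) = 0) (hg : FSum g a) : FSum f a := by
  classical
  choose T h1 h2 using h
  have hg' : ∑ x ∈ S, g x = a := hg.sum_eq fun x hx => by
    rw [← h2, Finset.sum_eq_zero fun y _ => hS x hx y]
  refine ⟨(S.sigma T).map (Equiv.sigmaEquivProd α β).toEmbedding, fun xy hxy => ?_, ?_⟩
  · by_cases hx : xy.1 ∈ S
    · by_cases hy : xy.2 ∈ T xy.1
      · exact absurd (Finset.mem_map.2 ⟨(⟨xy.1, xy.2⟩ : (_ : α) × β), Finset.mem_sigma.2 ⟨hx, hy⟩, rfl⟩) hxy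
      · exact h1 xy.1 xy.2 hy
    · exact hS xy.1 hx xy.2
  · rw [Finset.sum_map, Finset.sum_sigma, ← hg']
    exact Finset.sum_congr rfl fun x _ => h2 x

end FSum

/-! ### Products in tensor products of superspaces -/

section Super

variable {A B A' B' : Type*} [AddCommGroup A] [Module ℂ A] [AddCommGroup B] [Module ℂ B]
  [AddCommGroup A'] [Module ℂ A'] [AddCommGroup B'] [Module ℂ B']

/-- The even part with respect to an involution. -/
def evenPart (p : A →ₗ[ℂ] A) : A →ₗ[ℂ] A := (2⁻¹ : ℂ) • (LinearMap.id + p)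

/-- The odd part with respect to an involution. -/
def oddPart (p : A →ₗ[ℂ] A) : A →ₗ[ℂ] A := (2⁻¹ : ℂ) • (LinearMap.id - p)

/-- The product `(a ⊗ b)(c ⊗ d) = (-1)^{[b][c]} ac ⊗ bd` in the tensor product of two superspaces
with products, whose gradings are given by involutions. -/
def superMul (mA : A →ₗ[ℂ] A →ₗ[ℂ] A) (pA : A →ₗ[ℂ] A) (mB : B →ₗ[ℂ] B →ₗ[ℂ] B)
    (pB : B →ₗ[ℂ] B) : A ⊗[ℂ] B →ₗ[ℂ] A ⊗[ℂ] B →ₗ[ℂ] A ⊗[ℂ] B :=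
  TensorProduct.map₂ mA (mB.comp (evenPart pB)) +
    TensorProduct.map₂ (mA.compl₂ pA) (mB.comp (oddPart pB))

theorem superMul_tmul (mA : A →ₗ[ℂ] A →ₗ[ℂ] A) (pA : A →ₗ[ℂ] A) (mB : B →ₗ[ℂ] B →ₗ[ℂ] B)
    (pB : B →ₗ[ℂ] B) (a c : A) (b d : B) : superMul mA pA mB pB (a ⊗ₜ b) (c ⊗ₜ d) =
      mA a c ⊗ₜ mB (evenPart pB b) d + mA a (pA c) ⊗ₜ mB (oddPart pB b) d := by
  simp [superMul]

variable (mA : A →ₗ[ℂ] A →ₗ[ℂ] A) (pA : A →ₗ[ℂ] A) (mB : B →ₗ[ℂ] B →ₗ[ℂ] B)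
    (pB : B →ₗ[ℂ] B)

theorem superMul_even {b : B} (hb : pB b = b) (a c : A) (d : B) :
    superMul mA pA mB pB (a ⊗ₜ b) (c ⊗ₜ d) = mA a c ⊗ₜ mB b d := by
  have h₀ : evenPart pB b = b := by
    rw [evenPart, LinearMap.smul_apply, LinearMap.add_apply, LinearMap.id_apply, hb,
      ← two_smul ℂ b, smul_smul]
    norm_num
  have h₁ : oddPart pB b = 0 := by simp [oddPart, hb]
  rw [superMul_tmul, h₀, h₁, map_zero, LinearMap.zero_apply, TensorProduct.tmul_zero, add_zero]

theorem superMul_odd {b : B} (hb : pB b = -b) (a c : A) (d : B) :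
    superMul mA pA mB pB (a ⊗ₜ b) (c ⊗ₜ d) = mA a (pA c) ⊗ₜ mB b d := by
  have h₀ : evenPart pB b = 0 := by simp [evenPart, hb]
  have h₁ : oddPart pB b = b := by
    rw [oddPart, LinearMap.smul_apply, LinearMap.sub_apply, LinearMap.id_apply, hb,
      sub_neg_eq_add, ← two_smul ℂ b, smul_smul]
    norm_num
  rw [superMul_tmul, h₀, h₁, map_zero, LinearMap.zero_apply, TensorProduct.tmul_zero, zero_add]

end Super

section TensorProducts

variable (q : ℂ)

/-- The product in the tensor square. -/
def tsqMul : U q ⊗[ℂ] U q →ₗ[ℂ] U q ⊗[ℂ] U q →ₗ[ℂ] U q ⊗[ℂ] U q :=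
  superMul (LinearMap.mul ℂ (U q)) (parity q).toLinearMap (LinearMap.mul ℂ (U q))
    (parity q).toLinearMap

/-- The parity of the tensor square. -/
def tsqParity : U q ⊗[ℂ] U q →ₗ[ℂ] U q ⊗[ℂ] U q :=
  TensorProduct.map (parity q).toLinearMap (parity q).toLinearMap

theorem tsqMul_eq (s t : TensorSq q) :
    (GradedTensorProduct.of ℂ (parityPart q) (parityPart q)).symm (s * t) =
      tsqMul q ((GradedTensorProduct.of ℂ (parityPart q) (parityPart q)).symm s)
        ((GradedTensorProduct.of ℂ (parityPart q) (parityPart q)).symm t) := by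
  induction s using tsq_induction with
  | h0 => rw [zero_mul, map_zero, map_zero, LinearMap.zero_apply]
  | hadd s s' hs hs' => rw [add_mul, map_add, map_add, map_add, LinearMap.add_apply, hs, hs']
  | htmul a b =>
    induction t using tsq_induction with
    | h0 => rw [mul_zero, map_zero, map_zero]
    | hadd s s' hs hs' => rw [mul_add, map_add, map_add, map_add, hs, hs']
    | htmul c d =>
      rw [tsq_mul]
      exact (superMul_tmul (LinearMap.mul ℂ (U q)) (parity q).toLinearMap (LinearMap.mul ℂ (U q))
        (parity q).toLinearMap a c b d).symm

theorem tsqParity_tmul (a b : U q) : tsqParity q (a ⊗ₜ b) = parity q a ⊗ₜ parity q b := rfl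

theorem tensor_parity_induction {A : Type*} [AddCommGroup A] [Module ℂ A] {P : A ⊗[ℂ] U q → Prop}
    (h0 : P 0) (hadd : ∀ s t, P s → P t → P (s + t))
    (heven : ∀ a b, parity q b = b → P (a ⊗ₜ b)) (hodd : ∀ a b, parity q b = -b → P (a ⊗ₜ b))
    (t : A ⊗[ℂ] U q) : P t := by
  induction t using TensorProduct.induction_on with
  | zero => exact h0
  | tmul a b =>
    obtain ⟨v, w, rfl, hv, hw⟩ := exists_even_add_odd b
    rw [TensorProduct.tmul_add]
    exact hadd _ _ (heven a v hv) (hodd a w hw)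
  | add s t hs ht => exact hadd s t hs ht

theorem tsqParity_tsqMul (s t : U q ⊗[ℂ] U q) :
    tsqParity q (tsqMul q s t) = tsqMul q (tsqParity q s) (tsqParity q t) := by
  induction s using tensor_parity_induction with
  | h0 => simp
  | hadd s s' hs hs' => simp only [map_add, LinearMap.add_apply, hs, hs']
  | heven a b hb =>
    induction t using TensorProduct.induction_on with
    | zero => simp
    | add s s' hs hs' => simp only [map_add, hs, hs']
    | tmul c d =>
      rw [tsqMul, superMul_even _ _ _ _ hb, tsqParity_tmul, tsqParity_tmul, tsqParity_tmul, superMul_even]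
      · simp
      · exact congrArg (parity q) hb
  | hodd a b hb =>
    induction t using TensorProduct.induction_on with
    | zero => simp
    | add s s' hs hs' => simp only [map_add, hs, hs']
    | tmul c d =>
      rw [tsqMul, superMul_odd _ _ _ _ hb, tsqParity_tmul, tsqParity_tmul, tsqParity_tmul, superMul_odd]
      · simp
      · exact (parity_parity q b).trans (by rw [hb, neg_neg])

theorem eq_of_homogeneous {A M : Type*} [AddCommGroup A] [Module ℂ A] [AddCommGroup M] [Module ℂ M]
    {f g : A ⊗[ℂ] U q →ₗ[ℂ] M} (h : ∀ a b, (parity q b = b ∨ parity q b = -b) →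
      f (a ⊗ₜ b) = g (a ⊗ₜ b)) : f = g := by
  refine LinearMap.ext fun t => ?_
  induction t using tensor_parity_induction with
  | h0 => rw [map_zero, map_zero]
  | hadd s t hs ht => rw [map_add, map_add, hs, ht]
  | heven a b hb => exact h a b (Or.inl hb)
  | hodd a b hb => exact h a b (Or.inr hb)

theorem eq_of_homogeneous₃ {M : Type*} [AddCommGroup M] [Module ℂ M]
    {f g : (U q ⊗[ℂ] U q) ⊗[ℂ] U q →ₗ[ℂ] M} (h : ∀ a₁ a₂ b,
      (parity q a₂ = a₂ ∨ parity q a₂ = -a₂) → (parity q b = b ∨ parity q b = -b) →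
      f ((a₁ ⊗ₜ a₂) ⊗ₜ b) = g ((a₁ ⊗ₜ a₂) ⊗ₜ b)) : f = g := by
  refine eq_of_homogeneous q fun a b hb => ?_
  refine LinearMap.congr_fun (f := f ∘ₗ (TensorProduct.mk ℂ _ _).flip b)
    (g := g ∘ₗ (TensorProduct.mk ℂ _ _).flip b) (eq_of_homogeneous q fun a₁ a₂ h₂ => ?_) a
  exact h a₁ a₂ b h₂ hb

/-- The product in the tensor cube, associated to the right. -/
def cubeMul : U q ⊗[ℂ] (U q ⊗[ℂ] U q) →ₗ[ℂ] U q ⊗[ℂ] (U q ⊗[ℂ] U q) →ₗ[ℂ]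
    U q ⊗[ℂ] (U q ⊗[ℂ] U q) :=
  superMul (LinearMap.mul ℂ (U q)) (parity q).toLinearMap (tsqMul q) (tsqParity q)

/-- The product in the tensor cube, associated to the left. -/
def cubeMul' : (U q ⊗[ℂ] U q) ⊗[ℂ] U q →ₗ[ℂ] (U q ⊗[ℂ] U q) ⊗[ℂ] U q →ₗ[ℂ]
    (U q ⊗[ℂ] U q) ⊗[ℂ] U q :=
  superMul (tsqMul q) (tsqParity q) (LinearMap.mul ℂ (U q)) (parity q).toLinearMap

theorem assoc_cubeMul' (s t : (U q ⊗[ℂ] U q) ⊗[ℂ] U q) :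
    TensorProduct.assoc ℂ (U q) (U q) (U q) (cubeMul' q s t) =
      cubeMul q (TensorProduct.assoc ℂ (U q) (U q) (U q) s)
        (TensorProduct.assoc ℂ (U q) (U q) (U q) t) := by
  have key : ∀ (a₁ a₂ b c₁ c₂ d : U q), (parity q a₂ = a₂ ∨ parity q a₂ = -a₂) →
      (parity q b = b ∨ parity q b = -b) →
      TensorProduct.assoc ℂ (U q) (U q) (U q)
        (cubeMul' q ((a₁ ⊗ₜ a₂) ⊗ₜ b) ((c₁ ⊗ₜ c₂) ⊗ₜ d)) =
      cubeMul q (a₁ ⊗ₜ (a₂ ⊗ₜ b)) (c₁ ⊗ₜ (c₂ ⊗ₜ d)) := by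
    intro a₁ a₂ b c₁ c₂ d h₂ hb
    rcases h₂ with h₂ | h₂ <;> rcases hb with hb | hb
    · rw [cubeMul', superMul_even _ _ _ _ hb, tsqMul, superMul_even _ _ _ _ h₂,
        TensorProduct.assoc_tmul, cubeMul, superMul_even, tsqMul, superMul_even _ _ _ _ hb]
      rw [tsqParity_tmul, h₂, hb]
    · rw [cubeMul', superMul_odd _ _ _ _ hb, tsqParity_tmul, tsqMul, superMul_even _ _ _ _ h₂,
        TensorProduct.assoc_tmul, cubeMul, superMul_odd, tsqMul, superMul_odd _ _ _ _ hb]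
      · rfl
      · rw [tsqParity_tmul, h₂, hb, TensorProduct.tmul_neg]
    · rw [cubeMul', superMul_even _ _ _ _ hb, tsqMul, superMul_odd _ _ _ _ h₂,
        TensorProduct.assoc_tmul, cubeMul, superMul_odd, tsqMul, superMul_even _ _ _ _ hb]
      rw [tsqParity_tmul, h₂, hb, TensorProduct.neg_tmul]
    · rw [cubeMul', superMul_odd _ _ _ _ hb, tsqParity_tmul, tsqMul, superMul_odd _ _ _ _ h₂,
        TensorProduct.assoc_tmul, cubeMul, superMul_even, tsqMul, superMul_odd _ _ _ _ hb]
      · simp [parity_parity]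
      · rw [tsqParity_tmul, h₂, hb, TensorProduct.neg_tmul, TensorProduct.tmul_neg, neg_neg]
  have hs : ∀ (c₁ c₂ d : U q) (s : (U q ⊗[ℂ] U q) ⊗[ℂ] U q),
      TensorProduct.assoc ℂ (U q) (U q) (U q) (cubeMul' q s ((c₁ ⊗ₜ c₂) ⊗ₜ d)) =
      cubeMul q (TensorProduct.assoc ℂ (U q) (U q) (U q) s) (c₁ ⊗ₜ (c₂ ⊗ₜ d)) := by
    intro c₁ c₂ d s
    refine LinearMap.congr_fun (eq_of_homogeneous₃ q
      (f := (TensorProduct.assoc ℂ (U q) (U q) (U q)).toLinearMap ∘ₗ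
        (cubeMul' q).flip ((c₁ ⊗ₜ c₂) ⊗ₜ d))
      (g := (cubeMul q).flip (c₁ ⊗ₜ (c₂ ⊗ₜ d)) ∘ₗ
        (TensorProduct.assoc ℂ (U q) (U q) (U q)).toLinearMap) fun a₁ a₂ b h₂ hb => ?_) s
    exact key a₁ a₂ b c₁ c₂ d h₂ hb
  refine LinearMap.congr_fun (TensorProduct.ext_threefold
    (g := (TensorProduct.assoc ℂ (U q) (U q) (U q)).toLinearMap ∘ₗ cubeMul' q s)
    (h := cubeMul q (TensorProduct.assoc ℂ (U q) (U q) (U q) s) ∘ₗ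
      (TensorProduct.assoc ℂ (U q) (U q) (U q)).toLinearMap) fun c₁ c₂ d => ?_) t
  exact hs c₁ c₂ d s

end TensorProducts

/-! ### The components of the coproduct -/

section Delta

variable {q : ℂ} (hq : q ≠ 0) (hq4 : q ^ 4 ≠ 1)

/-- The component of the coproduct whose second tensor factor has weight `n`. -/
def delta (n : ℤ) : U q →ₗ[ℂ] U q ⊗[ℂ] U q := component (comul hq hq4) n

variable {hq hq4}

theorem fsum_coeff_mul (s t : FormalTensor q) (n : ℤ) :
    FSum (fun i => s.coeff i * t.coeff (n - i)) ((s * t).coeff n) := by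
  refine ⟨(Finset.antidiagonal s.isPWO_support t.isPWO_support n).image Prod.fst,
    fun i hi => ?_, ?_⟩
  · by_contra h0
    refine hi (Finset.mem_image.2 ⟨(i, n - i), ?_, rfl⟩)
    rw [Finset.mem_antidiagonal]
    exact ⟨left_ne_zero_of_mul h0, right_ne_zero_of_mul h0, by simp⟩
  · rw [HahnSeries.coeff_mul, Finset.sum_image]
    · refine Finset.sum_congr rfl fun ij hij => ?_
      rw [Finset.mem_antidiagonal] at hij
      rw [show n - ij.1 = ij.2 by omega]
    · intro a ha b hb hab
      rw [Finset.mem_coe, Finset.mem_antidiagonal] at ha hb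
      exact Prod.ext hab (by omega)

theorem delta_mul (u v : U q) (n : ℤ) :
    FSum (fun i => tsqMul q (delta hq hq4 i u) (delta hq hq4 (n - i) v))
      (delta hq hq4 n (u * v)) := by
  have h := (fsum_coeff_mul (comul hq hq4 u) (comul hq hq4 v) n).map
    (GradedTensorProduct.of ℂ (parityPart q) (parityPart q)).symm.toLinearMap.toAddMonoidHom
  rw [← map_mul] at h
  exact (congrArg (fun f => FSum f _) (funext fun i => tsqMul_eq q _ _)).mp h

theorem delta_eq_zero (u : U q) : ∃ d, ∀ n < d, delta hq hq4 n u = 0 := by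
  by_cases h : comul hq hq4 u = 0
  · exact ⟨0, fun n _ => by rw [delta, component]; simp [h]⟩
  · refine ⟨(comul hq hq4 u).order, fun n hn => ?_⟩
    have h1 := HahnSeries.coeff_eq_zero_of_lt_order hn
    change (GradedTensorProduct.of ℂ (parityPart q) (parityPart q)).symm _ = 0
    rw [h1, map_zero]

theorem delta_eq_of_coeff {n : ℤ} {u a b : U q} (h : (comul hq hq4 u).coeff n = a ᵍ⊗ₜ[ℂ] b) :
    delta hq hq4 n u = a ⊗ₜ b :=
  congrArg (GradedTensorProduct.of ℂ (parityPart q) (parityPart q)).symm h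

theorem coeff_C_ite (t : TensorSq q) (n : ℤ) :
    (HahnSeries.C t : FormalTensor q).coeff n = if n = 0 then t else 0 := by
  rw [HahnSeries.C_apply, HahnSeries.coeff_single]
  split_ifs <;> rfl

theorem coeff_single_ite (i : ℤ) (t : TensorSq q) (n : ℤ) :
    (HahnSeries.single i t : FormalTensor q).coeff n = if n = i then t else 0 := by
  rw [HahnSeries.coeff_single]
  split_ifs <;> rfl

/-- The generators that are group-like. -/
def Gen.IsGroupLike : Gen → Prop
  | .gam => True
  | .gamInv => True
  | .k => True
  | .kInv => True
  | _ => False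

theorem delta_one (n : ℤ) : delta hq hq4 n 1 = if n = 0 then 1 ⊗ₜ 1 else 0 := by
  change (GradedTensorProduct.of ℂ (parityPart q) (parityPart q)).symm
    ((comul hq hq4 1).coeff n) = _
  rw [map_one, ← map_one HahnSeries.C, coeff_C_ite]
  split_ifs <;> rfl

theorem comul_groupLike {y : Gen} (hy : y.IsGroupLike) :
    comul hq hq4 (gen q y) = HahnSeries.C (gen q y ᵍ⊗ₜ[ℂ] gen q y) := by
  rw [comul_gen]
  have h : ∀ y, genLeft q y * genRight q y = gen q y ᵍ⊗ₜ[ℂ] gen q y := fun y =>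
    tmul_one_mul_one_tmul _ _
  cases y with
  | gam => exact congrArg HahnSeries.C (h _)
  | gamInv => exact congrArg HahnSeries.C (h _)
  | k => exact congrArg HahnSeries.C (h _)
  | kInv => exact congrArg HahnSeries.C (h _)
  | _ => exact hy.elim

theorem delta_groupLike {y : Gen} (hy : y.IsGroupLike) (n : ℤ) :
    delta hq hq4 n (gen q y) = if n = 0 then gen q y ⊗ₜ gen q y else 0 := by
  change (GradedTensorProduct.of ℂ (parityPart q) (parityPart q)).symm
    ((comul hq hq4 (gen q y)).coeff n) = _
  rw [comul_groupLike hy, coeff_C_ite]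
  split_ifs <;> rfl

theorem coeff_single_add (i : ℤ) (a b c d : U q) (n : ℤ) :
    (GradedTensorProduct.of ℂ (parityPart q) (parityPart q)).symm
      ((HahnSeries.single 0 (a ᵍ⊗ₜ[ℂ] b) + HahnSeries.single i (c ᵍ⊗ₜ[ℂ] d) :
        FormalTensor q).coeff n) =
      (if n = 0 then a ⊗ₜ b else 0) + if n = i then c ⊗ₜ d else 0 := by
  rw [HahnSeries.coeff_add, coeff_single_ite, coeff_single_ite, map_add]
  congr 1

theorem genLeft_mul_gamPow (y : Gen) (n : ℤ) :
    genLeft q y * gamPow (genRight q) n = gen q y ᵍ⊗ₜ[ℂ] gamPow (gen q) n := by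
  rw [gamPow_genRight]
  exact tmul_one_mul_one_tmul _ _

theorem gamPow_mul_genRight (y : Gen) (n : ℤ) :
    gamPow (genLeft q) n * genRight q y = gamPow (gen q) n ᵍ⊗ₜ[ℂ] gen q y := by
  rw [gamPow_genLeft]
  exact tmul_one_mul_one_tmul _ _

theorem delta_a (l : ℕ) (n : ℤ) : delta hq hq4 n (gen q (.a l)) =
    (if n = 0 then gen q (.a l) ⊗ₜ gamPow (gen q) (-(l + 1)) else 0) +
      if n = -(l + 1) then gamPow (gen q) (l + 1) ⊗ₜ gen q (.a l) else 0 := by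
  rw [← coeff_single_add, ← genLeft_mul_gamPow, ← gamPow_mul_genRight]
  change (GradedTensorProduct.of ℂ (parityPart q) (parityPart q)).symm
    ((comul hq hq4 (gen q (.a l))).coeff n) = _
  rw [comul_gen]
  rfl

theorem delta_b (l : ℕ) (n : ℤ) : delta hq hq4 n (gen q (.b l)) =
    (if n = 0 then gen q (.b l) ⊗ₜ gamPow (gen q) (-(l + 1)) else 0) +
      if n = l + 1 then gamPow (gen q) (l + 1) ⊗ₜ gen q (.b l) else 0 := by
  rw [← coeff_single_add, ← genLeft_mul_gamPow, ← gamPow_mul_genRight]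
  change (GradedTensorProduct.of ℂ (parityPart q) (parityPart q)).symm
    ((comul hq hq4 (gen q (.b l))).coeff n) = _
  rw [comul_gen]
  rfl

theorem coeff_comul_x_pos (r n : ℤ) : (comul hq hq4 (gen q (.x 1 r))).coeff n =
    (if n = 0 then gen q (.x 1 r) ᵍ⊗ₜ[ℂ] 1 else 0) +
      (phi (gen q) (r - n) * gamPow (gen q) (-(r + n))) ᵍ⊗ₜ[ℂ] gen q (.x 1 n) := by
  rw [comul_gen, coprodGen, HahnSeries.coeff_add, coeff_xLeft_pos, coeff_xRight_pos]

theorem coeff_comul_x_neg (r n : ℤ) : (comul hq hq4 (gen q (.x (-1) r))).coeff n =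
    (if n = r then 1 ᵍ⊗ₜ[ℂ] gen q (.x (-1) r) else 0) +
      gen q (.x (-1) (r - n)) ᵍ⊗ₜ[ℂ] (psi (gen q) n * gamPow (gen q) (n - 2 * r)) := by
  rw [comul_gen, coprodGen, HahnSeries.coeff_add, coeff_xLeft_neg, coeff_xRight_neg, add_comm]

theorem delta_x_pos (r n : ℤ) : delta hq hq4 n (gen q (.x 1 r)) =
    (if n = 0 then gen q (.x 1 r) ⊗ₜ 1 else 0) +
      (phi (gen q) (r - n) * gamPow (gen q) (-(r + n))) ⊗ₜ gen q (.x 1 n) := by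
  change (GradedTensorProduct.of ℂ (parityPart q) (parityPart q)).symm
    ((comul hq hq4 (gen q (.x 1 r))).coeff n) = _
  rw [coeff_comul_x_pos, map_add]
  congr 1

theorem delta_x_neg (r n : ℤ) : delta hq hq4 n (gen q (.x (-1) r)) =
    (if n = r then 1 ⊗ₜ gen q (.x (-1) r) else 0) +
      gen q (.x (-1) (r - n)) ⊗ₜ (psi (gen q) n * gamPow (gen q) (n - 2 * r)) := by
  change (GradedTensorProduct.of ℂ (parityPart q) (parityPart q)).symm
    ((comul hq hq4 (gen q (.x (-1) r))).coeff n) = _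
  rw [coeff_comul_x_neg, map_add]
  congr 1

theorem delta_phi (r n : ℤ) : delta hq hq4 n (phi (gen q) r) =
    (phi (gen q) (r - n) * gamPow (gen q) (-n)) ⊗ₜ (gamPow (gen q) (r - n) * phi (gen q) n) :=
  delta_eq_of_coeff (by rw [comul_phi, coeff_phi_coprodGen hq])

theorem delta_psi (r n : ℤ) : delta hq hq4 n (psi (gen q) r) =
    (psi (gen q) (r - n) * gamPow (gen q) n) ⊗ₜ (gamPow (gen q) (-(r - n)) * psi (gen q) n) :=
  delta_eq_of_coeff (by rw [comul_psi, coeff_psi_coprodGen hq])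

theorem delta_groupLike_mul {u g : U q}
    (h : ∀ n, delta hq hq4 n g = if n = 0 then g ⊗ₜ g else 0) (n : ℤ) :
    delta hq hq4 n (u * g) = tsqMul q (delta hq hq4 n u) (g ⊗ₜ g) := by
  refine (delta_mul u g n).unique ⟨{n}, fun i hi => ?_, ?_⟩
  · beta_reduce
    rw [h, if_neg (by rw [Finset.mem_singleton] at hi; omega), map_zero]
  · rw [Finset.sum_singleton, h, if_pos (sub_self n)]

theorem tsqMul_tmul_of_even_right {c : U q} (hc : parity q c = c) (a b d : U q) :
    tsqMul q (a ⊗ₜ b) (c ⊗ₜ d) = (a * c) ⊗ₜ (b * d) :=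
  (tsqMul_eq q (a ᵍ⊗ₜ[ℂ] b) (c ᵍ⊗ₜ[ℂ] d)).symm.trans
    (congrArg (GradedTensorProduct.of ℂ (parityPart q) (parityPart q)).symm
      (tsq_mul_even_left hc a b d))

theorem delta_pow {g : U q} (hg : parity q g = g)
    (h : ∀ n, delta hq hq4 n g = if n = 0 then g ⊗ₜ g else 0) (r : ℕ) (n : ℤ) :
    delta hq hq4 n (g ^ r) = if n = 0 then (g ^ r) ⊗ₜ (g ^ r) else 0 := by
  induction r with
  | zero => rw [pow_zero, delta_one]
  | succ r ih =>
    rw [pow_succ, delta_groupLike_mul h, ih]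
    split_ifs
    · rw [tsqMul_tmul_of_even_right hg]
    · rw [map_zero, LinearMap.zero_apply]

theorem delta_gamPow (r n : ℤ) : delta hq hq4 n (gamPow (gen q) r) =
    if n = 0 then gamPow (gen q) r ⊗ₜ gamPow (gen q) r else 0 := by
  cases r with
  | ofNat r => exact delta_pow (parity_gen_of_sign rfl) (delta_groupLike (y := .gam) trivial) r n
  | negSucc r =>
    exact delta_pow (parity_gen_of_sign rfl) (delta_groupLike (y := .gamInv) trivial) (r + 1) n

theorem delta_mul_gamPow (u : U q) (r n : ℤ) : delta hq hq4 n (u * gamPow (gen q) r) =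
    tsqMul q (delta hq hq4 n u) (gamPow (gen q) r ⊗ₜ gamPow (gen q) r) :=
  delta_groupLike_mul (delta_gamPow r) n

theorem delta_phi_mul_gamPow (r s n : ℤ) : delta hq hq4 n (phi (gen q) r * gamPow (gen q) s) =
    (phi (gen q) (r - n) * gamPow (gen q) (s - n)) ⊗ₜ
      (phi (gen q) n * gamPow (gen q) (r - n + s)) := by
  rw [delta_mul_gamPow, delta_phi, tsqMul_tmul_of_even_right (parity_gamPow s), mul_gamPow_mul,
    (gamPow_central _ _).eq, mul_gamPow_mul, neg_add_eq_sub]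

theorem delta_psi_mul_gamPow (r s n : ℤ) : delta hq hq4 n (psi (gen q) r * gamPow (gen q) s) =
    (psi (gen q) (r - n) * gamPow (gen q) (n + s)) ⊗ₜ
      (psi (gen q) n * gamPow (gen q) (-(r - n) + s)) := by
  rw [delta_mul_gamPow, delta_psi, tsqMul_tmul_of_even_right (parity_gamPow s), mul_gamPow_mul,
    (gamPow_central _ _).eq, mul_gamPow_mul]

theorem tsqParity_delta (n : ℤ) (u : U q) :
    tsqParity q (delta hq hq4 n u) = delta hq hq4 n (parity q u) := by
  revert n
  induction u using U_induction with
  | hC r =>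
    intro n
    rw [AlgHom.commutes, Algebra.algebraMap_eq_smul_one, map_smul, map_smul, delta_one]
    split_ifs
    · rw [tsqParity_tmul, map_one]
    · rw [map_zero]
  | hadd u v hu hv => intro n; rw [map_add, map_add, map_add, map_add, hu, hv]
  | hmul u v hu hv =>
    intro n
    have h := (delta_mul (hq := hq) (hq4 := hq4) u v n).map (tsqParity q).toAddMonoidHom
    refine h.unique ?_
    rw [map_mul (parity q)]
    refine (congrArg (fun f => FSum f _) (funext fun i => ?_)).mp
      (delta_mul (parity q u) (parity q v) n)
    rw [← hu, ← hv, ← tsqParity_tsqMul]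
    rfl
  | hgen y =>
    intro n
    have hg : ∀ y : Gen, y.IsGroupLike → y.sign = 1 →
        tsqParity q (delta hq hq4 n (gen q y)) = delta hq hq4 n (parity q (gen q y)) := by
      intro y hy hs
      rw [parity_gen_of_sign hs, delta_groupLike hy]
      split_ifs
      · rw [tsqParity_tmul, parity_gen_of_sign hs]
      · rw [map_zero]
    cases y with
    | gam => exact hg _ trivial rfl
    | gamInv => exact hg _ trivial rfl
    | k => exact hg _ trivial rfl
    | kInv => exact hg _ trivial rfl
    | a l =>
      have h : parity q (gen q (.a l)) = gen q (.a l) := parity_gen_of_sign rfl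
      rw [h, delta_a, map_add]
      congr 1 <;> split_ifs <;> simp only [tsqParity_tmul, parity_gamPow, h, map_zero]
    | b l =>
      have h : parity q (gen q (.b l)) = gen q (.b l) := parity_gen_of_sign rfl
      rw [h, delta_b, map_add]
      congr 1 <;> split_ifs <;> simp only [tsqParity_tmul, parity_gamPow, h, map_zero]
    | x s r =>
      rw [parity_gen_x, map_neg]
      rcases Int.units_eq_one_or s with rfl | rfl
      · rw [delta_x_pos, map_add, neg_add (ite _ _ _)]
        congr 1
        · split_ifs
          · rw [tsqParity_tmul, parity_gen_x, map_one, TensorProduct.neg_tmul]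
          · rw [map_zero, neg_zero]
        · rw [tsqParity_tmul, parity_gen_x, map_mul, parity_phi, parity_gamPow,
            TensorProduct.tmul_neg]
      · rw [delta_x_neg, map_add, neg_add (ite _ _ _)]
        congr 1
        · split_ifs
          · rw [tsqParity_tmul, parity_gen_x, map_one, TensorProduct.tmul_neg]
          · rw [map_zero, neg_zero]
        · rw [tsqParity_tmul, parity_gen_x, map_mul, parity_psi, parity_gamPow,
            TensorProduct.neg_tmul]

end Delta

/-! ### Coassociativity -/

section Coassoc

variable {q : ℂ} (hq : q ≠ 0) (hq4 : q ^ 4 ≠ 1)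

/-- `Δ_m ⊗ id`. -/
def deltaLeft (m : ℤ) : U q ⊗[ℂ] U q →ₗ[ℂ] (U q ⊗[ℂ] U q) ⊗[ℂ] U q :=
  TensorProduct.map (delta hq hq4 m) LinearMap.id

/-- `id ⊗ Δ_n`. -/
def deltaRight (n : ℤ) : U q ⊗[ℂ] U q →ₗ[ℂ] U q ⊗[ℂ] (U q ⊗[ℂ] U q) :=
  TensorProduct.map LinearMap.id (delta hq hq4 n)

variable {hq hq4}

theorem deltaLeft_tmul (m : ℤ) (a b : U q) :
    deltaLeft hq hq4 m (a ⊗ₜ b) = delta hq hq4 m a ⊗ₜ b := rfl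

theorem deltaRight_tmul (m : ℤ) (a b : U q) :
    deltaRight hq hq4 m (a ⊗ₜ b) = a ⊗ₜ delta hq hq4 m b := rfl

theorem tsqMul_even {b : U q} (hb : parity q b = b) (a c d : U q) :
    tsqMul q (a ⊗ₜ b) (c ⊗ₜ d) = (a * c) ⊗ₜ (b * d) :=
  superMul_even (LinearMap.mul ℂ (U q)) (parity q).toLinearMap (LinearMap.mul ℂ (U q))
    (parity q).toLinearMap hb a c d

theorem tsqMul_odd {b : U q} (hb : parity q b = -b) (a c d : U q) :
    tsqMul q (a ⊗ₜ b) (c ⊗ₜ d) = (a * parity q c) ⊗ₜ (b * d) :=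
  superMul_odd (LinearMap.mul ℂ (U q)) (parity q).toLinearMap (LinearMap.mul ℂ (U q))
    (parity q).toLinearMap hb a c d

theorem deltaLeft_tsqMul (s t : U q ⊗[ℂ] U q) (m : ℤ) :
    FSum (fun i => cubeMul' q (deltaLeft hq hq4 i s) (deltaLeft hq hq4 (m - i) t))
      (deltaLeft hq hq4 m (tsqMul q s t)) := by
  induction s using tensor_parity_induction with
  | h0 => simpa only [map_zero, LinearMap.zero_apply] using FSum.zero
  | hadd s s' hs hs' => simpa only [map_add, LinearMap.add_apply] using hs.add hs'
  | heven a b hb =>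
    induction t using TensorProduct.induction_on with
    | zero => simpa only [map_zero] using FSum.zero
    | add t t' ht ht' => simpa only [map_add] using ht.add ht'
    | tmul c d =>
      rw [tsqMul_even hb, deltaLeft_tmul]
      refine (congrArg (fun f => FSum f _) (funext fun i => ?_)).mp
        ((delta_mul a c m).map ((TensorProduct.mk ℂ _ _).flip (b * d)).toAddMonoidHom)
      exact (superMul_even (tsqMul q) (tsqParity q) (LinearMap.mul ℂ (U q))
        (parity q).toLinearMap hb (delta hq hq4 i a) (delta hq hq4 (m - i) c) d).symm
  | hodd a b hb =>
    induction t using TensorProduct.induction_on with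
    | zero => simpa only [map_zero] using FSum.zero
    | add t t' ht ht' => simpa only [map_add] using ht.add ht'
    | tmul c d =>
      rw [tsqMul_odd hb, deltaLeft_tmul]
      refine (congrArg (fun f => FSum f _) (funext fun i => ?_)).mp
        ((delta_mul a (parity q c) m).map
          ((TensorProduct.mk ℂ _ _).flip (b * d)).toAddMonoidHom)
      rw [← tsqParity_delta]
      exact (superMul_odd (tsqMul q) (tsqParity q) (LinearMap.mul ℂ (U q))
        (parity q).toLinearMap hb (delta hq hq4 i a) (delta hq hq4 (m - i) c) d).symm

theorem deltaRight_tsqMul (s t : U q ⊗[ℂ] U q) (n : ℤ) :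
    FSum (fun i => cubeMul q (deltaRight hq hq4 i s) (deltaRight hq hq4 (n - i) t))
      (deltaRight hq hq4 n (tsqMul q s t)) := by
  induction s using tensor_parity_induction with
  | h0 => simpa only [map_zero, LinearMap.zero_apply] using FSum.zero
  | hadd s s' hs hs' => simpa only [map_add, LinearMap.add_apply] using hs.add hs'
  | heven a b hb =>
    induction t using TensorProduct.induction_on with
    | zero => simpa only [map_zero] using FSum.zero
    | add t t' ht ht' => simpa only [map_add] using ht.add ht'
    | tmul c d =>
      rw [tsqMul_even hb, deltaRight_tmul]
      refine (congrArg (fun f => FSum f _) (funext fun i => ?_)).mp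
        ((delta_mul b d n).map (TensorProduct.mk ℂ _ _ (a * c)).toAddMonoidHom)
      exact (superMul_even (LinearMap.mul ℂ (U q)) (parity q).toLinearMap (tsqMul q) (tsqParity q)
        (by rw [tsqParity_delta, hb]) a c (delta hq hq4 (n - i) d)).symm
  | hodd a b hb =>
    induction t using TensorProduct.induction_on with
    | zero => simpa only [map_zero] using FSum.zero
    | add t t' ht ht' => simpa only [map_add] using ht.add ht'
    | tmul c d =>
      rw [tsqMul_odd hb, deltaRight_tmul]
      refine (congrArg (fun f => FSum f _) (funext fun i => ?_)).mp
        ((delta_mul b d n).map (TensorProduct.mk ℂ _ _ (a * parity q c)).toAddMonoidHom)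
      exact (superMul_odd (LinearMap.mul ℂ (U q)) (parity q).toLinearMap (tsqMul q) (tsqParity q)
        (by rw [tsqParity_delta, hb, map_neg]) a c (delta hq hq4 (n - i) d)).symm

variable (hq hq4) in
/-- `(Δ ⊗ id) Δ`. -/
def cubeLeft (m n : ℤ) : U q →ₗ[ℂ] U q ⊗[ℂ] (U q ⊗[ℂ] U q) :=
  (TensorProduct.assoc ℂ (U q) (U q) (U q)).toLinearMap ∘ₗ deltaLeft hq hq4 m ∘ₗ delta hq hq4 n

variable (hq hq4) in
/-- `(id ⊗ Δ) Δ`. -/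
def cubeRight (m n : ℤ) : U q →ₗ[ℂ] U q ⊗[ℂ] (U q ⊗[ℂ] U q) :=
  deltaRight hq hq4 n ∘ₗ delta hq hq4 (m + n)

theorem exists_delta_finset (u v : U q) (n : ℤ) : ∃ S : Finset ℤ, ∀ i ∉ S,
    delta hq hq4 i u = 0 ∨ delta hq hq4 (n - i) v = 0 := by
  obtain ⟨d, hd⟩ := delta_eq_zero (hq := hq) (hq4 := hq4) u
  obtain ⟨e, he⟩ := delta_eq_zero (hq := hq) (hq4 := hq4) v
  refine ⟨Finset.Icc d (n - e), fun i hi => ?_⟩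
  rw [Finset.mem_Icc, not_and_or] at hi
  exact hi.imp (fun h => hd i (by omega)) fun h => he _ (by omega)

theorem cubeLeft_mul (u v : U q) (m n : ℤ) :
    FSum (fun nm : ℤ × ℤ => cubeMul q (cubeLeft hq hq4 nm.2 nm.1 u)
      (cubeLeft hq hq4 (m - nm.2) (n - nm.1) v)) (cubeLeft hq hq4 m n (u * v)) := by
  obtain ⟨S, hS⟩ := exists_delta_finset (hq := hq) (hq4 := hq4) u v n
  have h1 := (delta_mul (hq := hq) (hq4 := hq4) u v n).map
    ((TensorProduct.assoc ℂ (U q) (U q) (U q)).toLinearMap ∘ₗ deltaLeft hq hq4 m).toAddMonoidHom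
  refine FSum.prod (fun i => ?_) (S := S) (fun i hi j => ?_) h1
  · refine (congrArg (fun f => FSum f _) (funext fun j => ?_)).mp
      ((deltaLeft_tsqMul (hq := hq) (hq4 := hq4) (delta hq hq4 i u) (delta hq hq4 (n - i) v) m).map
      (TensorProduct.assoc ℂ (U q) (U q) (U q)).toLinearMap.toAddMonoidHom)
    exact assoc_cubeMul' q _ _
  · rcases hS i hi with h | h
    · simp only [cubeLeft, LinearMap.comp_apply, h, map_zero, LinearMap.zero_apply]
    · simp only [cubeLeft, LinearMap.comp_apply, h, map_zero]

theorem cubeRight_mul (u v : U q) (m n : ℤ) :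
    FSum (fun nm : ℤ × ℤ => cubeMul q (cubeRight hq hq4 nm.2 nm.1 u)
      (cubeRight hq hq4 (m - nm.2) (n - nm.1) v)) (cubeRight hq hq4 m n (u * v)) := by
  obtain ⟨S, hS⟩ := exists_delta_finset (hq := hq) (hq4 := hq4) u v (m + n)
  have h1 := (delta_mul (hq := hq) (hq4 := hq4) u v (m + n)).map
    (deltaRight hq hq4 n).toAddMonoidHom
  have h2 : FSum (fun kn : ℤ × ℤ => cubeMul q (deltaRight hq hq4 kn.2 (delta hq hq4 kn.1 u))
      (deltaRight hq hq4 (n - kn.2) (delta hq hq4 (m + n - kn.1) v)))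
      (cubeRight hq hq4 m n (u * v)) := by
    have h3 : ∀ i, FSum (fun j => cubeMul q (deltaRight hq hq4 j (delta hq hq4 i u))
        (deltaRight hq hq4 (n - j) (delta hq hq4 (m + n - i) v)))
        (deltaRight hq hq4 n (tsqMul q (delta hq hq4 i u) (delta hq hq4 (m + n - i) v))) :=
      fun i => deltaRight_tsqMul _ _ n
    have h4 : ∀ i ∉ S, ∀ j, cubeMul q (deltaRight hq hq4 j (delta hq hq4 i u))
        (deltaRight hq hq4 (n - j) (delta hq hq4 (m + n - i) v)) = 0 := fun i hi j => by
      rcases hS i hi with h | h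
      · rw [h, LinearMap.map_zero, LinearMap.map_zero, LinearMap.zero_apply]
      · rw [h, LinearMap.map_zero, LinearMap.map_zero]
    exact FSum.prod (f := fun kn : ℤ × ℤ => cubeMul q (deltaRight hq hq4 kn.2 (delta hq hq4 kn.1 u))
      (deltaRight hq hq4 (n - kn.2) (delta hq hq4 (m + n - kn.1) v))) h3 h4 h1
  let e : ℤ × ℤ ≃ ℤ × ℤ :=
    { toFun := fun nm => (nm.2 + nm.1, nm.1)
      invFun := fun kn => (kn.2, kn.1 - kn.2)
      left_inv := fun nm => by simp
      right_inv := fun kn => by simp }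
  refine (congrArg (fun f => FSum f _) (funext fun nm => ?_)).mp (h2.equiv e)
  have : m + n - (nm.2 + nm.1) = m - nm.2 + (n - nm.1) := by ring
  simp only [cubeRight, LinearMap.comp_apply, e, Equiv.coe_fn_mk, this]

variable (hq hq4) in
/-- `(Δ_m ⊗ id)`, with values in `U ⊗ (U ⊗ U)`. -/
def assocLeft (m : ℤ) : U q ⊗[ℂ] U q →ₗ[ℂ] U q ⊗[ℂ] (U q ⊗[ℂ] U q) :=
  (TensorProduct.assoc ℂ (U q) (U q) (U q)).toLinearMap ∘ₗ deltaLeft hq hq4 m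

theorem cubeLeft_apply (m n : ℤ) (u : U q) :
    cubeLeft hq hq4 m n u = assocLeft hq hq4 m (delta hq hq4 n u) := rfl

theorem cubeRight_apply (m n : ℤ) (u : U q) :
    cubeRight hq hq4 m n u = deltaRight hq hq4 n (delta hq hq4 (m + n) u) := rfl

theorem map_ite_add_ite {A B : Type*} [AddCommGroup A] [Module ℂ A] [AddCommGroup B] [Module ℂ B]
    (f : A →ₗ[ℂ] B) (P Q : Prop) [Decidable P] [Decidable Q] (s t : A) :
    f ((if P then s else 0) + if Q then t else 0) =
      (if P then f s else 0) + if Q then f t else 0 := by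
  rw [map_add]
  congr 1 <;> split_ifs <;> simp

theorem assocLeft_tmul {m : ℤ} {a : U q} {P Q : Prop} [Decidable P] [Decidable Q]
    {a₁ a₂ a₃ a₄ : U q}
    (h : delta hq hq4 m a = (if P then a₁ ⊗ₜ a₂ else 0) + if Q then a₃ ⊗ₜ a₄ else 0) (b : U q) :
    assocLeft hq hq4 m (a ⊗ₜ b) =
      (if P then a₁ ⊗ₜ (a₂ ⊗ₜ b) else 0) + if Q then a₃ ⊗ₜ (a₄ ⊗ₜ b) else 0 := by
  have h1 : assocLeft hq hq4 m (a ⊗ₜ b) =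
      ((TensorProduct.assoc ℂ (U q) (U q) (U q)).toLinearMap ∘ₗ
        (TensorProduct.mk ℂ (U q ⊗[ℂ] U q) (U q)).flip b) (delta hq hq4 m a) := rfl
  rw [h1, h]
  exact map_ite_add_ite ((TensorProduct.assoc ℂ (U q) (U q) (U q)).toLinearMap ∘ₗ
        (TensorProduct.mk ℂ (U q ⊗[ℂ] U q) (U q)).flip b) P Q _ _

theorem deltaRight_tmul' {n : ℤ} {b : U q} {P Q : Prop} [Decidable P] [Decidable Q]
    {b₁ b₂ b₃ b₄ : U q}
    (h : delta hq hq4 n b = (if P then b₁ ⊗ₜ b₂ else 0) + if Q then b₃ ⊗ₜ b₄ else 0) (a : U q) :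
    deltaRight hq hq4 n (a ⊗ₜ b) =
      (if P then a ⊗ₜ (b₁ ⊗ₜ b₂) else 0) + if Q then a ⊗ₜ (b₃ ⊗ₜ b₄) else 0 := by
  rw [deltaRight_tmul, h]
  exact map_ite_add_ite (TensorProduct.mk ℂ (U q) (U q ⊗[ℂ] U q) a) P Q _ _

theorem ite_add_ite_false {A : Type*} [AddCommGroup A] (P : Prop) [Decidable P] (s t : A) :
    (if P then s else 0) = (if P then s else 0) + if False then t else 0 := by simp

theorem ite_add_ite_true {A : Type*} [AddCommGroup A] (P : Prop) [Decidable P] (s t : A) :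
    (if P then s else 0) + t = (if P then s else 0) + if True then t else 0 := by simp

theorem ite_false_add_ite_true {A : Type*} [AddCommGroup A] (s t : A) :
    t = (if False then s else 0) + if True then t else 0 := by simp

theorem cubeLeft_groupLike {g : U q} (h : ∀ n, delta hq hq4 n g = if n = 0 then g ⊗ₜ g else 0)
    (m n : ℤ) : cubeLeft hq hq4 m n g = cubeRight hq hq4 m n g := by
  have h' : ∀ n, delta hq hq4 n g = (if n = 0 then g ⊗ₜ g else 0) + if False then g ⊗ₜ g else 0 :=
    fun n => (h n).trans (ite_add_ite_false _ _ _)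
  rw [cubeLeft_apply, cubeRight_apply, h', h', map_ite_add_ite, map_ite_add_ite,
    assocLeft_tmul (h' m), deltaRight_tmul' (h' n)]
  by_cases hn : n = 0 <;> by_cases hm : m = 0 <;> by_cases hmn : m + n = 0 <;>
    first
    | omega
    | simp only [hn, hm, hmn, if_true, if_false, add_zero, ite_self]

variable (hq hq4) in
theorem delta_gamPow' (r n : ℤ) : delta hq hq4 n (gamPow (gen q) r) =
    (if n = 0 then gamPow (gen q) r ⊗ₜ gamPow (gen q) r else 0) +
      if False then (0 : U q) ⊗ₜ (0 : U q) else 0 :=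
  (delta_gamPow r n).trans (ite_add_ite_false _ _ _)

variable (hq hq4) in
theorem delta_one' (n : ℤ) : delta hq hq4 n 1 =
    (if n = 0 then 1 ⊗ₜ 1 else 0) + if False then (0 : U q) ⊗ₜ (0 : U q) else 0 :=
  (delta_one n).trans (ite_add_ite_false _ _ _)

variable (hq hq4) in
theorem delta_x_pos' (r n : ℤ) : delta hq hq4 n (gen q (.x 1 r)) =
    (if n = 0 then gen q (.x 1 r) ⊗ₜ 1 else 0) + if True then
      (phi (gen q) (r - n) * gamPow (gen q) (-(r + n))) ⊗ₜ gen q (.x 1 n) else 0 :=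
  (delta_x_pos r n).trans (ite_add_ite_true _ _ _)

variable (hq hq4) in
theorem delta_x_neg' (r n : ℤ) : delta hq hq4 n (gen q (.x (-1) r)) =
    (if n = r then 1 ⊗ₜ gen q (.x (-1) r) else 0) + if True then
      gen q (.x (-1) (r - n)) ⊗ₜ (psi (gen q) n * gamPow (gen q) (n - 2 * r)) else 0 :=
  (delta_x_neg r n).trans (ite_add_ite_true _ _ _)

variable (hq hq4) in
theorem delta_phi_mul_gamPow' (r s n : ℤ) : delta hq hq4 n (phi (gen q) r * gamPow (gen q) s) =
    (if False then (0 : U q) ⊗ₜ (0 : U q) else 0) + if True then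
      (phi (gen q) (r - n) * gamPow (gen q) (s - n)) ⊗ₜ
        (phi (gen q) n * gamPow (gen q) (r - n + s)) else 0 :=
  (delta_phi_mul_gamPow r s n).trans (ite_false_add_ite_true _ _)

variable (hq hq4) in
theorem delta_psi_mul_gamPow' (r s n : ℤ) : delta hq hq4 n (psi (gen q) r * gamPow (gen q) s) =
    (if False then (0 : U q) ⊗ₜ (0 : U q) else 0) + if True then
      (psi (gen q) (r - n) * gamPow (gen q) (n + s)) ⊗ₜ
        (psi (gen q) n * gamPow (gen q) (-(r - n) + s)) else 0 :=
  (delta_psi_mul_gamPow r s n).trans (ite_false_add_ite_true _ _)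

variable (hq hq4) in
theorem coassoc_a (l : ℕ) (m n : ℤ) :
    cubeLeft hq hq4 m n (gen q (.a l)) = cubeRight hq hq4 m n (gen q (.a l)) := by
  rw [cubeLeft_apply, cubeRight_apply, delta_a, delta_a, map_ite_add_ite, map_ite_add_ite,
    assocLeft_tmul (delta_a l m), deltaRight_tmul' (delta_a l n),
    assocLeft_tmul (delta_gamPow' hq hq4 _ m), deltaRight_tmul' (delta_gamPow' hq hq4 _ n)]
  split_ifs <;> first | (exfalso; omega) | simp only [add_zero, zero_add]

variable (hq hq4) in
theorem coassoc_b (l : ℕ) (m n : ℤ) :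
    cubeLeft hq hq4 m n (gen q (.b l)) = cubeRight hq hq4 m n (gen q (.b l)) := by
  rw [cubeLeft_apply, cubeRight_apply, delta_b, delta_b, map_ite_add_ite, map_ite_add_ite,
    assocLeft_tmul (delta_b l m), deltaRight_tmul' (delta_b l n),
    assocLeft_tmul (delta_gamPow' hq hq4 _ m), deltaRight_tmul' (delta_gamPow' hq hq4 _ n)]
  split_ifs <;> first | (exfalso; omega) | simp only [add_zero, zero_add]

variable (hq hq4) in
theorem coassoc_x_pos (r m n : ℤ) :
    cubeLeft hq hq4 m n (gen q (.x 1 r)) = cubeRight hq hq4 m n (gen q (.x 1 r)) := by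
  rw [cubeLeft_apply, cubeRight_apply, delta_x_pos', delta_x_pos', map_ite_add_ite,
    map_ite_add_ite, assocLeft_tmul (delta_x_pos' hq hq4 r m),
    assocLeft_tmul (delta_phi_mul_gamPow' hq hq4 _ _ m), deltaRight_tmul' (delta_one' hq hq4 n),
    deltaRight_tmul' (delta_x_pos' hq hq4 _ n)]
  have h1 : r - n - m = r - (m + n) := by ring
  have h2 : -(r + n) - m = -(r + (m + n)) := by ring
  have h3 : m + n - n = m := by ring
  have h4 : r - n - m + -(r + n) = -(m + n + n) := by ring
  rw [h4, h2, h3, h1]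
  by_cases hn : n = 0
  · subst hn
    by_cases hm : m = 0
    · subst hm
      simp only [if_true, if_false, add_zero, zero_add, add_assoc]
    · simp only [hm, if_true, if_false, add_zero, zero_add]
  · by_cases hm : m + n = 0
    · simp only [hm, hn, if_true, if_false, add_zero, zero_add]
    · simp only [hm, hn, if_true, if_false, add_zero, zero_add]

variable (hq hq4) in
theorem coassoc_x_neg (r m n : ℤ) :
    cubeLeft hq hq4 m n (gen q (.x (-1) r)) = cubeRight hq hq4 m n (gen q (.x (-1) r)) := by
  rw [cubeLeft_apply, cubeRight_apply, delta_x_neg', delta_x_neg', map_ite_add_ite,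
    map_ite_add_ite, assocLeft_tmul (delta_x_neg' hq hq4 _ m),
    assocLeft_tmul (delta_one' hq hq4 m), deltaRight_tmul' (delta_psi_mul_gamPow' hq hq4 _ _ n),
    deltaRight_tmul' (delta_x_neg' hq hq4 _ n)]
  have h1 : r - n - m = r - (m + n) := by ring
  have h2 : n + (m + n - 2 * r) = m - 2 * (r - n) := by ring
  have h3 : m + n - n = m := by ring
  have h4 : -m + (m + n - 2 * r) = n - 2 * r := by ring
  have h5 : m = r - n ↔ m + n = r := by omega
  rw [h3, h4, h2, h1]
  simp only [if_true, if_false, zero_add, add_zero, h5]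
  by_cases hm : m + n = r
  · simp only [hm, if_true]
    by_cases hn : n = r
    · have : m = 0 := by omega
      subst hn this
      simp only [if_true, add_assoc]
    · have : m ≠ 0 := by omega
      simp only [hn, if_false, zero_add, ← add_assoc]
  · by_cases hn : n = r
    · have : m ≠ 0 := by omega
      subst hn
      simp only [hm, this, if_true, if_false, zero_add]
    · simp only [hm, hn, if_false, zero_add]

theorem coassoc_delta (u : U q) : ∀ m n, cubeLeft hq hq4 m n u = cubeRight hq hq4 m n u := by
  induction u using U_induction with
  | hC r =>
    intro m n
    rw [Algebra.algebraMap_eq_smul_one, map_smul, map_smul, cubeLeft_groupLike delta_one]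
  | hadd u v hu hv => intro m n; rw [map_add, map_add, hu, hv]
  | hmul u v hu hv =>
    intro m n
    refine (cubeLeft_mul u v m n).unique ?_
    simp only [hu, hv]
    exact cubeRight_mul u v m n
  | hgen y =>
    intro m n
    cases y with
    | gam => exact cubeLeft_groupLike (delta_groupLike (y := .gam) trivial) m n
    | gamInv => exact cubeLeft_groupLike (delta_groupLike (y := .gamInv) trivial) m n
    | k => exact cubeLeft_groupLike (delta_groupLike (y := .k) trivial) m n
    | kInv => exact cubeLeft_groupLike (delta_groupLike (y := .kInv) trivial) m n
    | a l => exact coassoc_a hq hq4 l m n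
    | b l => exact coassoc_b hq hq4 l m n
    | x s r =>
      rcases Int.units_eq_one_or s with rfl | rfl
      · exact coassoc_x_pos hq hq4 r m n
      · exact coassoc_x_neg hq hq4 r m n

end Coassoc

/-! ### The counit axioms -/

section CounitAxioms

variable {q : ℂ} (hq : q ≠ 0) (hq4 : q ^ 4 ≠ 1)

/-- `a ⊗ b ↦ ε(a) b`. -/
def epsLeft : U q ⊗[ℂ] U q →ₗ[ℂ] U q :=
  (TensorProduct.lid ℂ (U q)).toLinearMap ∘ₗ
    TensorProduct.map (counit hq).toLinearMap LinearMap.id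

/-- `a ⊗ b ↦ ε(b) a`. -/
def epsRight : U q ⊗[ℂ] U q →ₗ[ℂ] U q :=
  (TensorProduct.rid ℂ (U q)).toLinearMap ∘ₗ
    TensorProduct.map LinearMap.id (counit hq).toLinearMap

theorem epsLeft_tmul (a b : U q) : epsLeft hq (a ⊗ₜ b) = counit hq a • b := rfl

theorem epsRight_tmul (a b : U q) : epsRight hq (a ⊗ₜ b) = counit hq b • a := rfl

theorem counit_eq_zero_of_odd {b : U q} (hb : parity q b = -b) : counit hq b = 0 := by
  have h := counit_parity hq b
  rw [hb, map_neg] at h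
  exact self_eq_neg.1 h.symm

theorem eps_tsqMul (s t : U q ⊗[ℂ] U q) :
    epsLeft hq (tsqMul q s t) = epsLeft hq s * epsLeft hq t ∧
      epsRight hq (tsqMul q s t) = epsRight hq s * epsRight hq t := by
  induction s using tensor_parity_induction with
  | h0 => simp only [map_zero, LinearMap.zero_apply, zero_mul, and_self]
  | hadd s s' hs hs' =>
    simp only [map_add, LinearMap.add_apply, add_mul, hs.1, hs.2, hs'.1, hs'.2, and_self]
  | heven a b hb =>
    induction t using TensorProduct.induction_on with
    | zero => simp only [map_zero, mul_zero, and_self]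
    | add t t' ht ht' => simp only [map_add, mul_add, ht.1, ht.2, ht'.1, ht'.2, and_self]
    | tmul c d =>
      simp only [tsqMul_even hb, epsLeft_tmul, epsRight_tmul, map_mul, smul_mul_smul_comm, and_self]
  | hodd a b hb =>
    induction t using TensorProduct.induction_on with
    | zero => simp only [map_zero, mul_zero, and_self]
    | add t t' ht ht' => simp only [map_add, mul_add, ht.1, ht.2, ht'.1, ht'.2, and_self]
    | tmul c d =>
      simp only [tsqMul_odd hb, epsLeft_tmul, epsRight_tmul, map_mul, smul_mul_smul_comm,
        counit_parity, counit_eq_zero_of_odd hq hb, zero_mul, zero_smul, and_self]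

theorem epsLeft_delta_mul {u v : U q} {m n : ℤ}
    (hu : ∀ i, epsLeft hq (delta hq hq4 i u) = if i = m then u else 0)
    (hv : ∀ i, epsLeft hq (delta hq hq4 i v) = if i = n then v else 0) (i : ℤ) :
    epsLeft hq (delta hq hq4 i (u * v)) = if i = m + n then u * v else 0 := by
  refine ((delta_mul (hq := hq) (hq4 := hq4) u v i).map (epsLeft hq).toAddMonoidHom).unique
    ⟨{m}, fun j hj => ?_, ?_⟩
  · refine (eps_tsqMul hq _ _).1.trans ?_
    rw [hu, if_neg fun h => hj (Finset.mem_singleton.2 h), zero_mul]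
  · rw [Finset.sum_singleton]
    refine (eps_tsqMul hq _ _).1.trans ?_
    rw [hu, hv, if_pos rfl, mul_ite, mul_zero]
    exact if_congr (by omega) rfl rfl

theorem epsRight_delta_mul {u v : U q}
    (hu : ∀ i, epsRight hq (delta hq hq4 i u) = if i = 0 then u else 0)
    (hv : ∀ i, epsRight hq (delta hq hq4 i v) = if i = 0 then v else 0) (i : ℤ) :
    epsRight hq (delta hq hq4 i (u * v)) = if i = 0 then u * v else 0 := by
  refine ((delta_mul (hq := hq) (hq4 := hq4) u v i).map (epsRight hq).toAddMonoidHom).unique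
    ⟨{0}, fun j hj => ?_, ?_⟩
  · refine (eps_tsqMul hq _ _).2.trans ?_
    rw [hu, if_neg fun h => hj (Finset.mem_singleton.2 h), zero_mul]
  · rw [Finset.sum_singleton]
    refine (eps_tsqMul hq _ _).2.trans ?_
    rw [hu, hv, if_pos rfl, mul_ite, mul_zero]
    exact if_congr (by omega) rfl rfl

theorem eps_ite_add_ite {P Q : Prop} [Decidable P] [Decidable Q] (a b c d : U q) :
    epsLeft hq ((if P then a ⊗ₜ b else 0) + if Q then c ⊗ₜ d else 0) =
        (if P then counit hq a • b else 0) + (if Q then counit hq c • d else 0) ∧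
      epsRight hq ((if P then a ⊗ₜ b else 0) + if Q then c ⊗ₜ d else 0) =
        (if P then counit hq b • a else 0) + if Q then counit hq d • c else 0 :=
  ⟨map_ite_add_ite _ _ _ _ _, map_ite_add_ite _ _ _ _ _⟩

theorem eps_delta_groupLike {g : U q} (hg : counit hq g = 1)
    (h : ∀ n, delta hq hq4 n g = if n = 0 then g ⊗ₜ g else 0) (n : ℤ) :
    epsLeft hq (delta hq hq4 n g) = (if n = 0 then g else 0) ∧
      epsRight hq (delta hq hq4 n g) = if n = 0 then g else 0 := by
  rw [h, ite_add_ite_false _ _ (g ⊗ₜ g), (eps_ite_add_ite hq _ _ _ _).1,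
    (eps_ite_add_ite hq _ _ _ _).2]
  simp only [hg, one_smul, if_false, add_zero, and_self]

theorem eps_delta_gen (y : Gen) (n : ℤ) :
    epsLeft hq (delta hq hq4 n (gen q y)) = (if n = y.weight then gen q y else 0) ∧
      epsRight hq (delta hq hq4 n (gen q y)) = if n = 0 then gen q y else 0 := by
  cases y with
  | gam => exact eps_delta_groupLike hq hq4 (counit_gen hq _) (delta_groupLike (y := .gam) trivial) n
  | gamInv =>
    exact eps_delta_groupLike hq hq4 (counit_gen hq _) (delta_groupLike (y := .gamInv) trivial) n
  | k => exact eps_delta_groupLike hq hq4 (counit_gen hq _) (delta_groupLike (y := .k) trivial) n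
  | kInv =>
    exact eps_delta_groupLike hq hq4 (counit_gen hq _) (delta_groupLike (y := .kInv) trivial) n
  | a l =>
    change _ = (if n = -((l : ℤ) + 1) then _ else 0) ∧ _
    rw [delta_a, (eps_ite_add_ite hq _ _ _ _).1, (eps_ite_add_ite hq _ _ _ _).2]
    simp only [counit_gen, counit_gamPow, counitGen, one_smul, zero_smul, ite_self, zero_add,
      add_zero, and_self]
  | b l =>
    change _ = (if n = (l : ℤ) + 1 then _ else 0) ∧ _
    rw [delta_b, (eps_ite_add_ite hq _ _ _ _).1, (eps_ite_add_ite hq _ _ _ _).2]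
    simp only [counit_gen, counit_gamPow, counitGen, one_smul, zero_smul, ite_self, zero_add,
      add_zero, and_self]
  | x s r =>
    change _ = (if n = r then _ else 0) ∧ _
    rcases Int.units_eq_one_or s with rfl | rfl
    · rw [delta_x_pos', (eps_ite_add_ite hq _ _ _ _).1, (eps_ite_add_ite hq _ _ _ _).2]
      simp only [counit_gen, counit_gamPow, counitGen, map_mul, map_one, counit_phi, mul_one,
        one_smul, zero_smul, ite_self, zero_add, add_zero, if_true, and_true, ite_smul,
        sub_eq_zero, eq_comm (a := r)]
      split_ifs with h
      · rw [h]
      · rfl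
    · rw [delta_x_neg', (eps_ite_add_ite hq _ _ _ _).1, (eps_ite_add_ite hq _ _ _ _).2]
      simp only [counit_gen, counit_gamPow, counitGen, map_mul, map_one, counit_psi, mul_one,
        one_smul, zero_smul, ite_self, zero_add, add_zero, if_true, true_and, ite_smul]
      split_ifs with h
      · rw [h, sub_zero]
      · rfl

theorem epsLeft_delta {W : ℤ} {u : U q} (hu : u ∈ weightSpace q W) (n : ℤ) :
    epsLeft hq (delta hq hq4 n u) = if n = W then u else 0 := by
  induction hu using Submodule.span_induction with
  | mem u hu =>
    obtain ⟨w, rfl, rfl⟩ := hu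
    revert n
    induction w with
    | nil => exact fun n => (eps_delta_groupLike hq hq4 (map_one _) delta_one n).1
    | cons y w ih =>
      simp only [List.map_cons, List.prod_cons, List.sum_cons]
      exact epsLeft_delta_mul hq hq4 (fun i => (eps_delta_gen hq hq4 y i).1) ih
  | zero => simp only [map_zero, ite_self]
  | add u v _ _ hu hv => rw [map_add, map_add, hu, hv]; split_ifs <;> simp
  | smul c u _ hu => rw [map_smul, map_smul, hu]; split_ifs <;> simp

theorem epsRight_delta (u : U q) (n : ℤ) :
    epsRight hq (delta hq hq4 n u) = if n = 0 then u else 0 := by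
  revert n
  induction u using U_induction with
  | hgen y => exact fun n => (eps_delta_gen hq hq4 y n).2
  | hC r =>
    intro n
    rw [Algebra.algebraMap_eq_smul_one, map_smul, map_smul,
      (eps_delta_groupLike hq hq4 (map_one _) delta_one n).2]
    split_ifs <;> simp
  | hadd u v hu hv => intro n; rw [map_add, map_add, hu, hv]; split_ifs <;> simp
  | hmul u v hu hv => exact epsRight_delta_mul hq hq4 hu hv

theorem hasSum_epsLeft_delta (u : U q) :
    HasSum (fun n => incl q (epsLeft hq (delta hq hq4 n u))) (incl q u) := by
  induction u using weight_induction with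
  | h W u hu =>
    simp only [epsLeft_delta hq hq4 hu, apply_ite (incl q), map_zero]
    exact hasSum_ite_eq W (incl q u)
  | h0 => simpa only [map_zero] using hasSum_zero
  | hadd u v hu hv => simpa only [map_add] using hu.add hv

theorem hasSum_epsRight_delta (u : U q) :
    HasSum (fun n => incl q (epsRight hq (delta hq hq4 n u))) (incl q u) := by
  simp only [epsRight_delta hq hq4, apply_ite (incl q), map_zero]
  exact hasSum_ite_eq 0 (incl q u)

end CounitAxioms

/-! ### Closures of the weight spaces -/

section HatWeight

variable {q : ℂ}

theorem isOpen_uhatSmall (N : ℤ) : IsOpen (uhatSmall q N : Set (UHat q)) :=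
  (uhatSmall q N).toAddSubgroup.isOpen_of_mem_nhds (g := 0)
    ((hasBasis_uhatSmall q).mem_of_mem (i := N) trivial)

variable (q) in
/-- The closure of the weight space in the completion. -/
def hatWeight (n : ℤ) : Submodule ℂ (UHat q) := ((weightSpace q n).map (incl q)).topologicalClosure

theorem incl_mem_hatWeight {n : ℤ} {u : U q} (hu : u ∈ weightSpace q n) :
    incl q u ∈ hatWeight q n := Submodule.le_topologicalClosure _ ⟨u, hu, rfl⟩

theorem hatWeight_le_uhatSmall (n : ℤ) : hatWeight q n ≤ uhatSmall q n := by
  refine Submodule.topologicalClosure_minimal _ ?_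
    ((uhatSmall q n).toAddSubgroup.isClosed_of_isOpen (isOpen_uhatSmall n))
  rintro _ ⟨u, hu, rfl⟩
  exact weightSpace_le_uSmall le_rfl hu

theorem mul_mem_hatWeight {m n : ℤ} {y z : UHat q} (hy : y ∈ hatWeight q m)
    (hz : z ∈ hatWeight q n) : y * z ∈ hatWeight q (m + n) := by
  refine map_mem_closure₂ continuous_mul hy hz ?_
  rintro _ ⟨u, hu, rfl⟩ _ ⟨v, hv, rfl⟩
  exact ⟨u * v, mul_mem_weightSpace hu hv, rfl⟩

theorem summable_of_mem_uhatSmall {ι : Type*} {t : ι → UHat q} (N : ι → ℤ)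
    (ht : ∀ i, t i ∈ uhatSmall q (N i)) (hN : ∀ K, {i | t i ≠ 0 ∧ N i < K}.Finite) :
    Summable t := by
  have h : ∀ i, ∃ s ∈ hatSmall q (N i), UHat.mk q s = t i ∧ (t i = 0 → s = 0) := fun i => by
    by_cases h : t i = 0
    · exact ⟨0, zero_mem _, by rw [h, map_zero], fun _ => rfl⟩
    · obtain ⟨s, hs, hst⟩ := ht i
      exact ⟨s, hs, hst, fun h' => absurd h' h⟩
  choose s hs hst hs0 using h
  have h1 : Summable s := by
    refine summable_of_finite_notMem (hasBasis_hatSmall q) fun K => (hN K).subset fun i hi => ?_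
    refine ⟨fun h => hi ?_, not_le.1 fun h => hi (hatSmall_anti q h (hs i))⟩
    rw [hs0 i h]
    exact zero_mem _
  have h2 := h1.map (UHat.mk q) (UHat.continuous_mk q)
  exact (funext hst : UHat.mk q ∘ s = t) ▸ h2

end HatWeight

/-! ### Convolution -/

section Convolution

variable {q : ℂ} (hq : q ≠ 0) (hq4 : q ^ 4 ≠ 1)

/-- The tensors whose second factor has weight `n`. -/
def rightWeight (q : ℂ) (n : ℤ) : Submodule ℂ (U q ⊗[ℂ] U q) :=
  Submodule.span ℂ {t | ∃ a, ∃ b ∈ weightSpace q n, t = a ⊗ₜ b}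

theorem delta_mem_biweight {W : ℤ} {u : U q} (hu : u ∈ weightSpace q W) (n : ℤ) :
    delta hq hq4 n u ∈ Submodule.span ℂ {t : U q ⊗[ℂ] U q | ∃ a ∈ weightSpace q (W - n),
      ∃ b ∈ weightSpace q n, t = a ⊗ₜ b} :=
  comul_mem_totalWeight hq hq4 hu n

theorem delta_mem_rightWeight (u : U q) (n : ℤ) : delta hq hq4 n u ∈ rightWeight q n := by
  induction u using weight_induction with
  | h0 => rw [map_zero]; exact zero_mem _
  | hadd u v hu hv => rw [map_add]; exact add_mem hu hv
  | h W u hu =>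
    refine Submodule.span_mono ?_ (delta_mem_biweight hq hq4 hu n)
    rintro _ ⟨a, -, b, hb, rfl⟩
    exact ⟨a, b, hb, rfl⟩

variable (q) in
/-- The linear maps that preserve weights. -/
def gradedHom : Submodule ℂ (U q →ₗ[ℂ] UHat q) where
  carrier := {f | ∀ n, ∀ u ∈ weightSpace q n, f u ∈ hatWeight q n}
  add_mem' hf hg n u hu := add_mem (hf n u hu) (hg n u hu)
  zero_mem' _ _ _ := zero_mem _
  smul_mem' c _ hf n u hu := Submodule.smul_mem _ c (hf n u hu)

theorem mulMap_tmul (f h : U q →ₗ[ℂ] UHat q) (a b : U q) : mulMap f h (a ⊗ₜ b) = f a * h b := rfl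

theorem mulMap_mem_uhatSmall (f : U q →ₗ[ℂ] UHat q) {h : U q →ₗ[ℂ] UHat q} (hh : h ∈ gradedHom q)
    {n : ℤ} {t : U q ⊗[ℂ] U q} (ht : t ∈ rightWeight q n) : mulMap f h t ∈ uhatSmall q n := by
  induction ht using Submodule.span_induction with
  | mem t ht =>
    obtain ⟨a, b, hb, rfl⟩ := ht
    exact mul_mem_uhatSmall _ (hatWeight_le_uhatSmall n (hh n b hb))
  | zero => rw [map_zero]; exact zero_mem _
  | add x y _ _ hx hy => rw [map_add]; exact add_mem hx hy
  | smul c x _ hx => rw [map_smul]; exact Submodule.smul_mem _ _ hx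

theorem summable_mulMap_delta (f : U q →ₗ[ℂ] UHat q) (h : gradedHom q) (u : U q) :
    Summable fun n => mulMap f h (delta hq hq4 n u) := by
  obtain ⟨d, hd⟩ := delta_eq_zero (hq := hq) (hq4 := hq4) u
  refine summable_of_mem_uhatSmall id
    (fun n => mulMap_mem_uhatSmall f h.2 (delta_mem_rightWeight hq hq4 u n)) fun K =>
    (Set.finite_Icc d K).subset fun n hn => ⟨not_lt.1 fun h' => hn.1 ?_, hn.2.le⟩
  rw [hd n h', map_zero]

/-- The convolution product. -/
def conv (f : U q →ₗ[ℂ] UHat q) (h : gradedHom q) : U q →ₗ[ℂ] UHat q where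
  toFun u := ∑' n, mulMap f h (delta hq hq4 n u)
  map_add' u v := by
    simp only [map_add]
    exact (summable_mulMap_delta hq hq4 f h u).tsum_add (summable_mulMap_delta hq hq4 f h v)
  map_smul' c u := by
    simp only [map_smul, RingHom.id_apply]
    exact (summable_mulMap_delta hq hq4 f h u).tsum_const_smul c

theorem hasSum_conv (f : U q →ₗ[ℂ] UHat q) (h : gradedHom q) (u : U q) :
    HasSum (fun n => mulMap f h (delta hq hq4 n u)) (conv hq hq4 f h u) :=
  (summable_mulMap_delta hq hq4 f h u).hasSum

theorem conv_mem (f h : gradedHom q) : conv hq hq4 f h ∈ gradedHom q := by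
  intro W u hu
  refine (Submodule.isClosed_topologicalClosure _).mem_of_tendsto (hasSum_conv hq hq4 f h u)
    (Filter.Eventually.of_forall fun S => sum_mem fun n _ => ?_)
  have h1 := delta_mem_biweight hq hq4 hu n
  generalize delta hq hq4 n u = t at h1 ⊢
  induction h1 using Submodule.span_induction with
  | mem t ht =>
    obtain ⟨a, ha, b, hb, rfl⟩ := ht
    have := mul_mem_hatWeight (f.2 _ a ha) (h.2 _ b hb)
    rwa [sub_add_cancel] at this
  | zero => rw [map_zero]; exact zero_mem _
  | add x y _ _ hx hy => rw [map_add]; exact add_mem hx hy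
  | smul c x _ hx => rw [map_smul]; exact Submodule.smul_mem _ _ hx

/-- `a ⊗ (b ⊗ c) ↦ f(a) g(b) h(c)`. -/
def mulMap₃ (f g h : U q →ₗ[ℂ] UHat q) : U q ⊗[ℂ] (U q ⊗[ℂ] U q) →ₗ[ℂ] UHat q :=
  (LinearMap.mul' ℂ (UHat q)).comp (TensorProduct.map f (mulMap g h))

theorem mulMap₃_assocLeft (f g h : U q →ₗ[ℂ] UHat q) (m : ℤ) (a b : U q) :
    mulMap₃ f g h (assocLeft hq hq4 m (a ⊗ₜ b)) = mulMap f g (delta hq hq4 m a) * h b := by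
  change ((mulMap₃ f g h).comp ((TensorProduct.assoc ℂ (U q) (U q) (U q)).toLinearMap ∘ₗ
    (TensorProduct.mk ℂ (U q ⊗[ℂ] U q) (U q)).flip b)) (delta hq hq4 m a) =
      ((LinearMap.mulRight ℂ (h b)).comp (mulMap f g)) (delta hq hq4 m a)
  refine LinearMap.congr_fun (TensorProduct.ext' fun c d => ?_) _
  exact (mul_assoc (f c) (g d) (h b)).symm

theorem hasSum_mulMap₃_deltaRight (f : U q →ₗ[ℂ] UHat q) (g h : gradedHom q)
    (t : U q ⊗[ℂ] U q) :
    HasSum (fun n => mulMap₃ f g h (deltaRight hq hq4 n t)) (mulMap f (conv hq hq4 g h) t) := by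
  induction t using TensorProduct.induction_on with
  | zero => simpa only [map_zero] using hasSum_zero
  | add s t hs ht => simpa only [map_add] using hs.add ht
  | tmul a b => exact (hasSum_conv hq hq4 g h b).mul_left (f a)

theorem hasSum_mulMap₃_assocLeft (f : U q →ₗ[ℂ] UHat q) (g : gradedHom q) (h : U q →ₗ[ℂ] UHat q)
    (t : U q ⊗[ℂ] U q) :
    HasSum (fun n => mulMap₃ f g h (assocLeft hq hq4 n t)) (mulMap (conv hq hq4 f g) h t) := by
  induction t using TensorProduct.induction_on with
  | zero => simpa only [map_zero] using hasSum_zero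
  | add s t hs ht => simpa only [map_add] using hs.add ht
  | tmul a b =>
    simp only [mulMap₃_assocLeft]
    exact (hasSum_conv hq hq4 f g a).mul_right (h b)

theorem mulMap₃_mem_uhatSmall (f : U q →ₗ[ℂ] UHat q) (g h : gradedHom q) {m n : ℤ}
    {t : U q ⊗[ℂ] U q} (ht : t ∈ rightWeight q n) :
    mulMap₃ f g h (assocLeft hq hq4 m t) ∈ uhatSmall q (max n (m + n)) := by
  induction ht using Submodule.span_induction with
  | mem t ht =>
    obtain ⟨a, b, hb, rfl⟩ := ht
    rw [mulMap₃_assocLeft]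
    have h1 := delta_mem_rightWeight hq hq4 a m
    rcases max_choice n (m + n) with h' | h'
    · rw [h']
      exact mul_mem_uhatSmall _ (hatWeight_le_uhatSmall n (h.2 n b hb))
    · rw [h']
      generalize delta hq hq4 m a = t at h1 ⊢
      induction h1 using Submodule.span_induction with
      | mem t ht =>
        obtain ⟨c, d, hd, rfl⟩ := ht
        rw [mulMap_tmul, mul_assoc]
        exact mul_mem_uhatSmall _ (hatWeight_le_uhatSmall _
          (mul_mem_hatWeight (g.2 m d hd) (h.2 n b hb)))
      | zero => rw [map_zero, zero_mul]; exact zero_mem _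
      | add x y _ _ hx hy => rw [map_add, add_mul]; exact add_mem hx hy
      | smul c x _ hx => rw [map_smul, smul_mul_assoc]; exact Submodule.smul_mem _ _ hx
  | zero => rw [LinearMap.map_zero, LinearMap.map_zero]; exact zero_mem _
  | add x y _ _ hx hy => rw [LinearMap.map_add, LinearMap.map_add]; exact add_mem hx hy
  | smul c x _ hx => rw [LinearMap.map_smul, LinearMap.map_smul]; exact Submodule.smul_mem _ _ hx

theorem summable_mulMap₃_cubeLeft (f : U q →ₗ[ℂ] UHat q) (g h : gradedHom q) (u : U q) :
    Summable fun nm : ℤ × ℤ => mulMap₃ f g h (cubeLeft hq hq4 nm.2 nm.1 u) := by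
  obtain ⟨d, hd⟩ := delta_eq_zero (hq := hq) (hq4 := hq4) u
  refine summable_of_mem_uhatSmall (fun nm : ℤ × ℤ => max nm.1 (nm.2 + nm.1))
    (fun nm => mulMap₃_mem_uhatSmall hq hq4 f g h (delta_mem_rightWeight hq hq4 u nm.1)) fun K =>
    ((Set.finite_Icc d K).prod (Set.finite_Icc (d - K) (K - d))).subset ?_
  rintro ⟨n, m⟩ ⟨h0, h3⟩
  have h1 : d ≤ n := not_lt.1 fun h' => h0 (by
    rw [cubeLeft_apply, hd _ h', LinearMap.map_zero, LinearMap.map_zero])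
  have h2 : d ≤ m + n := not_lt.1 fun h' => h0 (by
    rw [coassoc_delta, cubeRight_apply, hd _ h', LinearMap.map_zero, LinearMap.map_zero])
  rw [max_lt_iff] at h3
  simp only [Set.mem_prod, Set.mem_Icc]
  omega

theorem eq_of_hasSum_fiber {T : ℤ → ℤ → UHat q} (hT : Summable fun nm : ℤ × ℤ => T nm.2 nm.1)
    {y z : ℤ → UHat q} (hy : ∀ n, HasSum (fun m => T m n) (y n))
    (hz : ∀ k, HasSum (fun n => T (k - n) n) (z k)) {a b : UHat q} (ha : HasSum y a)
    (hb : HasSum z b) : a = b := by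
  have h1 := hT.hasSum.prod_fiberwise hy
  let e : ℤ × ℤ ≃ ℤ × ℤ :=
    { toFun := fun kn => (kn.2, kn.1 - kn.2)
      invFun := fun nm => (nm.2 + nm.1, nm.1)
      left_inv := fun kn => by simp
      right_inv := fun nm => by simp }
  have h2 := (e.hasSum_iff.2 hT.hasSum).prod_fiberwise hz
  exact (ha.unique h1).trans (hb.unique h2).symm

theorem conv_assoc_apply (f : U q →ₗ[ℂ] UHat q) (g h : gradedHom q) (u : U q) {y z : UHat q}
    (hy : HasSum (fun n => mulMap (conv hq hq4 f g) h (delta hq hq4 n u)) y)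
    (hz : HasSum (fun n => mulMap f (conv hq hq4 g h) (delta hq hq4 n u)) z) : y = z := by
  have h3 : ∀ k n, mulMap₃ f g h (cubeLeft hq hq4 (k - n) n u) =
      mulMap₃ f g h (deltaRight hq hq4 n (delta hq hq4 k u)) := fun k n => by
    rw [coassoc_delta, cubeRight_apply, sub_add_cancel]
  have h4 : ∀ k, HasSum (fun n => mulMap₃ f g h (cubeLeft hq hq4 (k - n) n u))
      (mulMap f (conv hq hq4 g h) (delta hq hq4 k u)) := fun k => by
    simp only [h3]
    exact hasSum_mulMap₃_deltaRight hq hq4 f g h (delta hq hq4 k u)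
  have h5 : ∀ n, HasSum (fun m => mulMap₃ f g h (cubeLeft hq hq4 m n u))
      (mulMap (conv hq hq4 f g) h (delta hq hq4 n u)) :=
    fun n => hasSum_mulMap₃_assocLeft hq hq4 f g h (delta hq hq4 n u)
  exact eq_of_hasSum_fiber (T := fun m n => mulMap₃ f g h (cubeLeft hq hq4 m n u))
    (summable_mulMap₃_cubeLeft hq hq4 f g h u) h5 h4 hy hz

theorem conv_assoc (f : U q →ₗ[ℂ] UHat q) (g h : gradedHom q) :
    conv hq hq4 (conv hq hq4 f g) h = conv hq hq4 f ⟨conv hq hq4 g h, conv_mem hq hq4 g h⟩ :=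
  LinearMap.ext fun u => conv_assoc_apply hq hq4 f g h u (hasSum_conv hq hq4 _ h u)
    (hasSum_conv hq hq4 f ⟨conv hq hq4 g h, conv_mem hq hq4 g h⟩ u)

/-- The unit for the convolution product. -/
def convOne : gradedHom q :=
  ⟨(Algebra.linearMap ℂ (UHat q)).comp (counit hq).toLinearMap, fun n u hu => by
    by_cases hn : n = 0
    · subst hn
      exact incl_mem_hatWeight (u := algebraMap ℂ (U q) (counit hq u))
        (by rw [Algebra.algebraMap_eq_smul_one]; exact Submodule.smul_mem _ _ one_mem_weightSpace)
    · change algebraMap ℂ (UHat q) (counit hq u) ∈ _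
      rw [counit_weight hq hn hu, map_zero]
      exact zero_mem _⟩

theorem conv_one (f : U q →ₗ[ℂ] UHat q) : conv hq hq4 f (convOne hq) = f := by
  ext u
  refine (hasSum_conv hq hq4 f _ u).unique ?_
  have h1 : mulMap f (convOne hq) = f ∘ₗ epsRight hq := TensorProduct.ext' fun a b => by
    rw [mulMap_tmul, LinearMap.comp_apply, epsRight_tmul, map_smul, Algebra.smul_def,
      Algebra.commutes]
    rfl
  simp only [h1, LinearMap.comp_apply, epsRight_delta, apply_ite f, map_zero]
  exact hasSum_ite_eq 0 (f u)

theorem one_conv (f : gradedHom q) : conv hq hq4 (convOne hq) f = f := by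
  ext u
  refine (hasSum_conv hq hq4 _ f u).unique ?_
  have h1 : mulMap (convOne hq) (f : U q →ₗ[ℂ] UHat q) = (f : U q →ₗ[ℂ] UHat q) ∘ₗ epsLeft hq :=
    TensorProduct.ext' fun a b => by
      rw [mulMap_tmul, LinearMap.comp_apply, epsLeft_tmul, map_smul, Algebra.smul_def]
      rfl
  simp only [h1, LinearMap.comp_apply]
  induction u using weight_induction with
  | h W u hu =>
    simp only [epsLeft_delta hq hq4 hu, apply_ite (f : U q →ₗ[ℂ] UHat q), map_zero]
    exact hasSum_ite_eq W _
  | h0 => simpa only [map_zero] using hasSum_zero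
  | hadd u v hu hv => simpa only [map_add] using hu.add hv

/-- The weight preserving linear maps, with the convolution product. -/
def ConvRing (_ : q ≠ 0) (_ : q ^ 4 ≠ 1) : Type := gradedHom q

instance : AddCommGroup (ConvRing hq hq4) := inferInstanceAs (AddCommGroup (gradedHom q))

/-- The underlying linear map. -/
def ConvRing.toLin : ConvRing hq hq4 →+ (U q →ₗ[ℂ] UHat q) := (gradedHom q).subtype.toAddMonoidHom

/-- A weight preserving map as an element of the convolution ring. -/
def ConvRing.mk (f : U q →ₗ[ℂ] UHat q) (hf : f ∈ gradedHom q) : ConvRing hq hq4 := ⟨f, hf⟩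

variable {hq hq4}

theorem ConvRing.toLin_mem (f : ConvRing hq hq4) : f.toLin hq hq4 ∈ gradedHom q := f.2

theorem ConvRing.ext {f g : ConvRing hq hq4} (h : ∀ u, f.toLin hq hq4 u = g.toLin hq hq4 u) :
    f = g := Subtype.ext (LinearMap.ext h)

instance : Mul (ConvRing hq hq4) := ⟨fun f g => ⟨conv hq hq4 f.1 g, conv_mem hq hq4 f g⟩⟩

theorem ConvRing.hasSum_mul (f g : ConvRing hq hq4) (u : U q) :
    HasSum (fun n => mulMap (f.toLin hq hq4) (g.toLin hq hq4) (delta hq hq4 n u))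
      ((f * g).toLin hq hq4 u) := hasSum_conv hq hq4 f.1 g u

instance : Ring (ConvRing hq hq4) :=
  { (inferInstance : AddCommGroup (ConvRing hq hq4)),
    (inferInstance : Mul (ConvRing hq hq4)) with
    one := convOne hq
    mul_assoc := fun f g h => Subtype.ext (conv_assoc hq hq4 f.1 g h)
    one_mul := fun f => Subtype.ext (one_conv hq hq4 f)
    mul_one := fun f => Subtype.ext (conv_one hq hq4 f.1)
    zero_mul := fun f => ConvRing.ext fun u => by
      refine (ConvRing.hasSum_mul 0 f u).unique ?_
      simp [mulMap]
    mul_zero := fun f => ConvRing.ext fun u => by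
      refine (ConvRing.hasSum_mul f 0 u).unique ?_
      simp [mulMap]
    left_distrib := fun f g h => ConvRing.ext fun u => by
      refine (ConvRing.hasSum_mul f (g + h) u).unique ?_
      simpa [mulMap, TensorProduct.map_add_right] using
        (ConvRing.hasSum_mul f g u).add (ConvRing.hasSum_mul f h u)
    right_distrib := fun f g h => ConvRing.ext fun u => by
      refine (ConvRing.hasSum_mul (f + g) h u).unique ?_
      simpa [mulMap, TensorProduct.map_add_left] using
        (ConvRing.hasSum_mul f h u).add (ConvRing.hasSum_mul g h u) }

end Convolution

/-! ### Convolution inverses and coalgebra filtrations -/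

section Filtration

variable {q : ℂ} {hq : q ≠ 0} {hq4 : q ^ 4 ≠ 1}

/-- The filtration of the tensor square defined by a filtration `F`. -/
def tensorFil (F : ℕ → Submodule ℂ (U q)) (N : ℕ) : Submodule ℂ (U q ⊗[ℂ] U q) :=
  Submodule.span ℂ {t | ∃ i j, i + j ≤ N ∧ ∃ a ∈ F i, ∃ b ∈ F j, t = a ⊗ₜ b}

variable (hq hq4) in
/-- Increasing filtrations with `Δ(F_N) ⊆ ∑_{i + j = N} F_i ⊗ F_j`. -/
structure IsCoalgFiltration (F : ℕ → Submodule ℂ (U q)) : Prop where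
  mono : Monotone F
  delta_mem : ∀ N, ∀ u ∈ F N, ∀ n, delta hq hq4 n u ∈ tensorFil F N

variable (hq hq4) in
/-- The maps that vanish on `F_i` for `i < k`. -/
def vanish (F : ℕ → Submodule ℂ (U q)) (k : ℕ) : AddSubgroup (ConvRing hq hq4) where
  carrier := {f | ∀ i < k, ∀ u ∈ F i, f.toLin hq hq4 u = 0}
  add_mem' hf hg i hi u hu := by
    rw [map_add, LinearMap.add_apply, hf i hi u hu, hg i hi u hu, add_zero]
  zero_mem' i _ u _ := by rw [map_zero, LinearMap.zero_apply]
  neg_mem' hf i hi u hu := by rw [map_neg, LinearMap.neg_apply, hf i hi u hu, neg_zero]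

theorem ConvRing.eq_of_sub_mem_vanish {F : ℕ → Submodule ℂ (U q)} {f g : ConvRing hq hq4} {k i : ℕ}
    (h : f - g ∈ vanish hq hq4 F k) (hi : i < k) {u : U q} (hu : u ∈ F i) :
    f.toLin hq hq4 u = g.toLin hq hq4 u := by
  have := h i hi u hu
  rwa [map_sub, LinearMap.sub_apply, sub_eq_zero] at this

variable {F : ℕ → Submodule ℂ (U q)}

theorem IsCoalgFiltration.mul_mem_vanish (hF : IsCoalgFiltration hq hq4 F) {f g : ConvRing hq hq4}
    {k l : ℕ} (hf : f ∈ vanish hq hq4 F k) (hg : g ∈ vanish hq hq4 F l) :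
    f * g ∈ vanish hq hq4 F (k + l) := by
  intro N hN u hu
  refine (ConvRing.hasSum_mul f g u).unique ?_
  have h : ∀ n, mulMap (f.toLin hq hq4) (g.toLin hq hq4) (delta hq hq4 n u) = 0 := fun n => by
    have h1 := hF.delta_mem N u hu n
    generalize delta hq hq4 n u = t at h1 ⊢
    induction h1 using Submodule.span_induction with
    | mem t ht =>
      obtain ⟨i, j, hij, a, ha, b, hb, rfl⟩ := ht
      rw [mulMap_tmul]
      rcases lt_or_ge i k with h | h
      · rw [hf i h a ha, zero_mul]
      · rw [hg j (by omega) b hb, mul_zero]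
    | zero => rw [map_zero]
    | add x y _ _ hx hy => rw [map_add, hx, hy, add_zero]
    | smul c x _ hx => rw [map_smul, hx, smul_zero]
  simpa only [h] using hasSum_zero

theorem mem_vanish_zero (f : ConvRing hq hq4) : f ∈ vanish hq hq4 F 0 :=
  fun _ h => absurd h (Nat.not_lt_zero _)

theorem IsCoalgFiltration.pow_mem_vanish (hF : IsCoalgFiltration hq hq4 F) {f : ConvRing hq hq4}
    (hf : f ∈ vanish hq hq4 F 1) (k : ℕ) : f ^ k ∈ vanish hq hq4 F k := by
  induction k with
  | zero => exact mem_vanish_zero _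
  | succ k ih => rw [pow_succ]; exact hF.mul_mem_vanish ih hf

variable (q) in
/-- A weight preserving linear projection onto the union of a filtration. -/
structure IsGradedProj (F : ℕ → Submodule ℂ (U q)) (p : U q →ₗ[ℂ] U q) : Prop where
  weight : ∀ n, ∀ u ∈ weightSpace q n, p u ∈ weightSpace q n
  mem : ∀ u, ∃ N, p u ∈ F N
  id : ∀ N, ∀ u ∈ F N, p u = u

theorem IsCoalgFiltration.exists_geom (hF : IsCoalgFiltration hq hq4 F) {p : U q →ₗ[ℂ] U q}
    (hp : IsGradedProj q F p) {f : ConvRing hq hq4} (hf : f ∈ vanish hq hq4 F 1) :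
    ∃ R : ConvRing hq hq4, ∀ N, R - ∑ k ∈ Finset.range N, f ^ k ∈ vanish hq hq4 F N := by
  choose M hM using hp.mem
  have h1 : ∀ u N, p u ∈ F N → ∀ K, N < K →
      (∑ k ∈ Finset.range K, f ^ k).toLin hq hq4 (p u) =
        (∑ k ∈ Finset.range (M u + 1), f ^ k).toLin hq hq4 (p u) := fun u N hu K hK => by
    simp only [map_sum, LinearMap.sum_apply]
    rcases le_total (M u + 1) K with h | h
    · refine (Finset.sum_subset (Finset.range_mono h) fun k _ hk => ?_).symm
      rw [Finset.mem_range, not_lt] at hk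
      exact hF.pow_mem_vanish hf k (M u) hk _ (hM u)
    · refine Finset.sum_subset (Finset.range_mono h) fun k _ hk => ?_
      rw [Finset.mem_range, not_lt] at hk
      exact hF.pow_mem_vanish hf k N (hK.trans_le hk) _ hu
  let R : U q →ₗ[ℂ] UHat q :=
    { toFun := fun u => (∑ k ∈ Finset.range (M u + 1), f ^ k).toLin hq hq4 (p u)
      map_add' := fun u v => by
        have hu := hF.mono (le_max_left (M u) (M v)) (hM u)
        have hv := hF.mono (le_max_right (M u) (M v)) (hM v)
        have huv : p (u + v) ∈ F (max (M u) (M v)) := by rw [map_add]; exact add_mem hu hv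
        rw [← h1 u _ hu _ (lt_add_one _), ← h1 v _ hv _ (lt_add_one _),
          ← h1 _ _ huv _ (lt_add_one _), map_add p, map_add]
      map_smul' := fun c u => by
        have hu : p (c • u) ∈ F (M u) := by rw [map_smul]; exact Submodule.smul_mem _ c (hM u)
        rw [← h1 _ _ hu _ (lt_add_one _), map_smul p, map_smul]
        rfl }
  refine ⟨ConvRing.mk hq hq4 R fun n u hu =>
      (∑ k ∈ Finset.range (M u + 1), f ^ k).toLin_mem n _ (hp.weight n u hu),
    fun N i hi u hu => ?_⟩
  have hu' : p u ∈ F i := by rwa [hp.id i u hu]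
  rw [map_sub, LinearMap.sub_apply, sub_eq_zero]
  change (∑ k ∈ Finset.range (M u + 1), f ^ k).toLin hq hq4 (p u) = _
  rw [← h1 u i hu' N hi, hp.id i u hu]

theorem IsCoalgFiltration.exists_inverse (hF : IsCoalgFiltration hq hq4 F) {p : U q →ₗ[ℂ] U q}
    (hp : IsGradedProj q F p) {f : ConvRing hq hq4} (hf : 1 - f ∈ vanish hq hq4 F 1) :
    ∃ R : ConvRing hq hq4, ∀ N, R * f - 1 ∈ vanish hq hq4 F N ∧ f * R - 1 ∈ vanish hq hq4 F N := by
  obtain ⟨R, hR⟩ := hF.exists_geom hp hf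
  refine ⟨R, fun N => ⟨?_, ?_⟩⟩
  · have h : R * f - 1 = (R - ∑ k ∈ Finset.range N, (1 - f) ^ k) * f - (1 - f) ^ N := by
      have := geom_sum_mul_neg (1 - f) N
      rw [sub_sub_cancel] at this
      rw [sub_mul, this]
      abel
    rw [h]
    exact sub_mem (hF.mul_mem_vanish (hR N) (mem_vanish_zero f)) (hF.pow_mem_vanish hf N)
  · have h : f * R - 1 = f * (R - ∑ k ∈ Finset.range N, (1 - f) ^ k) - (1 - f) ^ N := by
      have := mul_neg_geom_sum (1 - f) N
      rw [sub_sub_cancel] at this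
      rw [mul_sub, this]
      abel
    rw [h]
    have := hF.mul_mem_vanish (mem_vanish_zero f) (hR N)
    rw [zero_add] at this
    exact sub_mem this (hF.pow_mem_vanish hf N)

theorem IsCoalgFiltration.exists_left_right_inverse (hF : IsCoalgFiltration hq hq4 F)
    {p : U q →ₗ[ℂ] U q} (hp : IsGradedProj q F p) {e l r : ConvRing hq hq4}
    (hl : 1 - l * e ∈ vanish hq hq4 F 1) (hr : 1 - e * r ∈ vanish hq hq4 F 1) :
    ∃ l' r' : ConvRing hq hq4, ∀ N, 1 - l' * e ∈ vanish hq hq4 F N ∧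
      1 - e * r' ∈ vanish hq hq4 F N := by
  obtain ⟨L, hL⟩ := hF.exists_inverse hp hl
  obtain ⟨R, hR⟩ := hF.exists_inverse hp hr
  refine ⟨L * l, r * R, fun N => ⟨?_, ?_⟩⟩
  · rw [← neg_sub, mul_assoc]
    exact neg_mem (hL N).1
  · rw [← neg_sub, ← mul_assoc]
    exact neg_mem (hR N).2

end Filtration

/-! ### Filtrations by degrees of words -/

section WordFiltration

variable {q : ℂ} {hq : q ≠ 0} {hq4 : q ^ 4 ≠ 1}

variable (q) in
/-- The span of the words of degree at most `N` in a set of generators. -/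
def wordFil (A : Set Gen) (d : Gen → ℕ) (N : ℕ) : Submodule ℂ (U q) :=
  Submodule.span ℂ {u | ∃ w : List Gen, (∀ y ∈ w, y ∈ A) ∧ (w.map d).sum ≤ N ∧
    u = (w.map (gen q)).prod}

variable {A : Set Gen} {d : Gen → ℕ}

theorem wordFil_mono : Monotone (wordFil q A d) := fun _ _ h =>
  Submodule.span_mono fun _ ⟨w, hw, hd, hu⟩ => ⟨w, hw, hd.trans h, hu⟩

theorem one_mem_wordFil (N : ℕ) : (1 : U q) ∈ wordFil q A d N :=
  Submodule.subset_span ⟨[], by simp, by simp, by simp⟩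

theorem gen_mem_wordFil {y : Gen} (hy : y ∈ A) : gen q y ∈ wordFil q A d (d y) :=
  Submodule.subset_span ⟨[y], by simpa using hy, by simp, by simp⟩

theorem mul_mem_wordFil {M N K : ℕ} (h : M + N ≤ K) {u v : U q} (hu : u ∈ wordFil q A d M)
    (hv : v ∈ wordFil q A d N) : u * v ∈ wordFil q A d K := by
  induction hu using Submodule.span_induction with
  | mem u hu =>
    obtain ⟨w, hwA, hw, rfl⟩ := hu
    induction hv using Submodule.span_induction with
    | mem v hv =>
      obtain ⟨w', hwA', hw', rfl⟩ := hv
      refine Submodule.subset_span ⟨w ++ w', fun y hy => ?_, ?_, by simp⟩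
      · exact (List.mem_append.1 hy).elim (hwA y) (hwA' y)
      · rw [List.map_append, List.sum_append]
        omega
    | zero => rw [mul_zero]; exact zero_mem _
    | add x y _ _ hx hy => rw [mul_add]; exact add_mem hx hy
    | smul c x _ hx => rw [mul_smul_comm]; exact Submodule.smul_mem _ _ hx
  | zero => rw [zero_mul]; exact zero_mem _
  | add x y _ _ hx hy => rw [add_mul]; exact add_mem hx hy
  | smul c x _ hx => rw [smul_mul_assoc]; exact Submodule.smul_mem _ _ hx

theorem parity_mem_wordFil {N : ℕ} {u : U q} (hu : u ∈ wordFil q A d N) :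
    parity q u ∈ wordFil q A d N := by
  induction hu using Submodule.span_induction with
  | mem u hu =>
    obtain ⟨w, hwA, hw, rfl⟩ := hu
    rw [parity_word]
    exact Submodule.smul_mem _ _ (Submodule.subset_span ⟨w, hwA, hw, rfl⟩)
  | zero => rw [map_zero]; exact zero_mem _
  | add x y _ _ hx hy => rw [map_add]; exact add_mem hx hy
  | smul c x _ hx => rw [map_smul]; exact Submodule.smul_mem _ _ hx

theorem tmul_mem_tensorFil {F : ℕ → Submodule ℂ (U q)} {i j N : ℕ} (h : i + j ≤ N) {a b : U q}
    (ha : a ∈ F i) (hb : b ∈ F j) : a ⊗ₜ b ∈ tensorFil F N :=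
  Submodule.subset_span ⟨i, j, h, a, ha, b, hb, rfl⟩

theorem tsqMul_mem_tensorFil {M N : ℕ} {s t : U q ⊗[ℂ] U q}
    (hs : s ∈ tensorFil (wordFil q A d) M) (ht : t ∈ tensorFil (wordFil q A d) N) :
    tsqMul q s t ∈ tensorFil (wordFil q A d) (M + N) := by
  induction hs using Submodule.span_induction with
  | mem s hs =>
    obtain ⟨i, j, hij, a, ha, b, hb, rfl⟩ := hs
    induction ht using Submodule.span_induction with
    | mem t ht =>
      obtain ⟨i', j', hij', a', ha', b', hb', rfl⟩ := ht
      have h := superMul_tmul (LinearMap.mul ℂ (U q)) (parity q).toLinearMap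
        (LinearMap.mul ℂ (U q)) (parity q).toLinearMap a a' b b'
      refine h ▸ add_mem
        (tmul_mem_tensorFil (i := i + i') (j := j + j') (by omega) (mul_mem_wordFil le_rfl ha ha')
          (mul_mem_wordFil le_rfl ?_ hb'))
        (tmul_mem_tensorFil (i := i + i') (j := j + j') (by omega)
          (mul_mem_wordFil le_rfl ha (parity_mem_wordFil ha')) (mul_mem_wordFil le_rfl ?_ hb'))
      · exact Submodule.smul_mem _ _ (add_mem hb (parity_mem_wordFil hb))
      · exact Submodule.smul_mem _ _ (sub_mem hb (parity_mem_wordFil hb))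
    | zero => rw [map_zero]; exact zero_mem _
    | add x y _ _ hx hy => rw [map_add]; exact add_mem hx hy
    | smul c x _ hx => rw [map_smul]; exact Submodule.smul_mem _ _ hx
  | zero => rw [map_zero]; exact zero_mem _
  | add x y _ _ hx hy => rw [map_add]; exact add_mem hx hy
  | smul c x _ hx => rw [map_smul]; exact Submodule.smul_mem _ _ hx

theorem tensorFil_mono {F : ℕ → Submodule ℂ (U q)} {M N : ℕ} (h : M ≤ N) :
    tensorFil F M ≤ tensorFil F N :=
  Submodule.span_mono fun _ ⟨i, j, hij, ht⟩ => ⟨i, j, hij.trans h, ht⟩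

theorem isCoalgFiltration_wordFil
    (h : ∀ y ∈ A, ∀ n, delta hq hq4 n (gen q y) ∈ tensorFil (wordFil q A d) (d y)) :
    IsCoalgFiltration hq hq4 (wordFil q A d) where
  mono := wordFil_mono
  delta_mem N u hu := by
    induction hu using Submodule.span_induction with
    | mem u hu =>
      obtain ⟨w, hwA, hw, rfl⟩ := hu
      refine fun n => tensorFil_mono hw ?_
      clear hw
      revert n
      induction w with
      | nil =>
        intro n
        change delta hq hq4 n 1 ∈ tensorFil _ 0
        rw [delta_one]
        split_ifs
        · exact tmul_mem_tensorFil (zero_add 0).le (one_mem_wordFil 0) (one_mem_wordFil 0)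
        · exact zero_mem _
      | cons y w ih =>
        intro n
        simp only [List.map_cons, List.prod_cons, List.sum_cons]
        obtain ⟨S, -, hS⟩ := delta_mul (hq := hq) (hq4 := hq4) (gen q y) (w.map (gen q)).prod n
        rw [← hS]
        exact sum_mem fun i _ => tsqMul_mem_tensorFil (h y (hwA y List.mem_cons_self) i)
          (ih (fun z hz => hwA z (List.mem_cons_of_mem _ hz)) _)
    | zero => intro n; rw [map_zero]; exact zero_mem _
    | add x y _ _ hx hy => intro n; rw [map_add]; exact add_mem (hx n) (hy n)
    | smul c x _ hx => intro n; rw [map_smul]; exact Submodule.smul_mem _ _ (hx n)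

variable (q A d) in
/-- The words of degree zero span a subalgebra. -/
def wordAlgebra : Subalgebra ℂ (U q) :=
  (wordFil q A d 0).toSubalgebra (one_mem_wordFil 0) fun _ _ hu hv =>
    mul_mem_wordFil (zero_add 0).le hu hv

theorem gamPow_mem_wordAlgebra (h : .gam ∈ A) (h' : .gamInv ∈ A) (hd : d .gam = 0)
    (hd' : d .gamInv = 0) (n : ℤ) : gamPow (gen q) n ∈ wordAlgebra q A d := by
  have h1 := gen_mem_wordFil (q := q) (d := d) h
  have h2 := gen_mem_wordFil (q := q) (d := d) h'
  rw [hd] at h1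
  rw [hd'] at h2
  change _ ∈ wordAlgebra q A d at h1 h2
  cases n with
  | ofNat n => exact pow_mem h1 n
  | negSucc n => exact pow_mem h2 (n + 1)

end WordFiltration

/-! ### Existence of the antipode -/

section GroupLike

variable {q : ℂ} (hq : q ≠ 0) (hq4 : q ^ 4 ≠ 1)

variable (q) in
/-- The products of group-like generators. -/
def groupLikes : Set (U q) :=
  {g | ∃ w : List Gen, (∀ y ∈ w, y.IsGroupLike) ∧ g = (w.map (gen q)).prod}

theorem Gen.IsGroupLike.sign {y : Gen} (hy : y.IsGroupLike) : y.sign = 1 := by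
  cases y with
  | x s n => exact hy.elim
  | _ => rfl

theorem Gen.IsGroupLike.exists_inv {y : Gen} (hy : y.IsGroupLike) :
    ∃ y' : Gen, y'.IsGroupLike ∧ gen q y * gen q y' = 1 ∧ gen q y' * gen q y = 1 := by
  cases y with
  | gam => exact ⟨.gamInv, trivial, (relations_gen q).gam_gamInv, (relations_gen q).gamInv_gam⟩
  | gamInv => exact ⟨.gam, trivial, (relations_gen q).gamInv_gam, (relations_gen q).gam_gamInv⟩
  | k => exact ⟨.kInv, trivial, (relations_gen q).k_kInv, (relations_gen q).kInv_k⟩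
  | kInv => exact ⟨.k, trivial, (relations_gen q).kInv_k, (relations_gen q).k_kInv⟩
  | _ => exact hy.elim

theorem parity_groupLike {g : U q} (hg : g ∈ groupLikes q) : parity q g = g := by
  obtain ⟨w, hw, rfl⟩ := hg
  rw [parity_word, List.prod_eq_one, one_smul]
  simp only [List.mem_map]
  rintro _ ⟨y, hy, rfl⟩
  exact (hw y hy).sign

theorem delta_groupLikes {g : U q} (hg : g ∈ groupLikes q) :
    (∀ n, delta hq hq4 n g = if n = 0 then g ⊗ₜ g else 0) ∧ counit hq g = 1 ∧
      ∃ h ∈ groupLikes q, g * h = 1 ∧ h * g = 1 := by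
  obtain ⟨w, hw, rfl⟩ := hg
  induction w with
  | nil => exact ⟨delta_one, map_one _, 1, ⟨[], by simp, rfl⟩, mul_one _, mul_one _⟩
  | cons y w ih =>
    have hw' : ∀ z ∈ w, z.IsGroupLike := fun z hz => hw z (List.mem_cons_of_mem _ hz)
    have hy : y.IsGroupLike := hw y List.mem_cons_self
    obtain ⟨h1, h2, _, ⟨w', hw₂, rfl⟩, h3, h4⟩ := ih hw'
    obtain ⟨y', hy', h5, h6⟩ := hy.exists_inv (q := q)
    refine ⟨fun n => ?_, ?_, ((w' ++ [y']).map (gen q)).prod, ⟨w' ++ [y'], ?_, rfl⟩, ?_, ?_⟩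
    · rw [List.map_cons, List.prod_cons, delta_groupLike_mul h1, delta_groupLike hy]
      split_ifs
      · exact tsqMul_tmul_of_even_right (parity_groupLike ⟨w, hw', rfl⟩) _ _ _
      · rw [map_zero, LinearMap.zero_apply]
    · rw [List.map_cons, List.prod_cons, map_mul, h2, mul_one, counit_gen]
      cases y with
      | a n => exact hy.elim
      | b n => exact hy.elim
      | x s n => exact hy.elim
      | _ => rfl
    · intro z hz
      rcases List.mem_append.1 hz with hz | hz
      · exact hw₂ z hz
      · rw [List.mem_singleton.1 hz]
        exact hy'
    · simp only [List.map_cons, List.prod_cons, List.map_append, List.prod_append, List.map_nil,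
        List.prod_nil, mul_one]
      rw [mul_assoc, ← mul_assoc _ _ (gen q y'), h3, one_mul, h5]
    · simp only [List.map_cons, List.prod_cons, List.map_append, List.prod_append, List.map_nil,
        List.prod_nil, mul_one]
      rw [mul_assoc, ← mul_assoc (gen q y'), h6, one_mul, h4]

include hq hq4 in
theorem linearIndependent_groupLikes : LinearIndependent ℂ ((↑) : groupLikes q → U q) := by
  classical
  rw [linearIndependent_iff']
  intro s
  induction s using Finset.induction_on with
  | empty => exact fun _ _ i hi => absurd hi (Finset.notMem_empty i)
  | insert h t ht ih =>
    intro c hc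
    have h1 : ∀ φ : U q →ₗ[ℂ] ℂ, ∑ g ∈ t, (c g * φ ((g : U q) - h)) • (g : U q) = 0 := fun φ => by
      let P : U q ⊗[ℂ] U q →ₗ[ℂ] U q :=
        (TensorProduct.rid ℂ (U q)).toLinearMap ∘ₗ TensorProduct.map LinearMap.id φ
      have hP : ∀ a b, P (a ⊗ₜ b) = φ b • a := fun _ _ => rfl
      have h2 : ∑ g ∈ insert h t, (c g * φ (g : U q)) • (g : U q) = 0 := by
        have := congrArg (fun u => P (delta hq hq4 0 u)) hc
        simpa only [map_sum, map_smul, (delta_groupLikes hq hq4 (Subtype.prop _)).1, if_true, hP,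
          smul_smul, map_zero] using this
      have h3 : ∑ g ∈ insert h t, (c g * φ h) • (g : U q) = 0 := by
        simp only [mul_comm _ (φ h), ← smul_smul, ← Finset.smul_sum, hc, smul_zero]
      have h4 : ∑ g ∈ insert h t, (c g * φ ((g : U q) - h)) • (g : U q) = 0 := by
        simp only [map_sub, mul_sub, sub_smul, Finset.sum_sub_distrib, h2, h3, sub_zero]
      rwa [Finset.sum_insert ht, sub_self, map_zero, mul_zero, zero_smul, zero_add] at h4
    have h5 : ∀ g ∈ t, c g = 0 := fun g hg => by
      by_contra hcg
      have h6 : (g : U q) - h = 0 := (Module.forall_dual_apply_eq_zero_iff ℂ _).1 fun φ =>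
        (mul_eq_zero.1 (ih _ (h1 φ) g hg)).resolve_left hcg
      exact ht (Subtype.ext (sub_eq_zero.1 h6) ▸ hg)
    rw [Finset.sum_insert ht, Finset.sum_eq_zero fun g hg => by rw [h5 g hg, zero_smul],
      add_zero] at hc
    have h7 := congrArg (counit hq) hc
    rw [map_smul, (delta_groupLikes hq hq4 h.2).2.1, map_zero, smul_eq_mul, mul_one] at h7
    intro g hg
    rcases Finset.mem_insert.1 hg with rfl | hg
    · exact h7
    · exact h5 g hg

include hq hq4 in
theorem exists_groupLike_inverse :
    ∃ s : U q →ₗ[ℂ] U q, ∀ g ∈ groupLikes q, s g ∈ groupLikes q ∧ g * s g = 1 ∧ s g * g = 1 := by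
  choose i hi using fun g : groupLikes q => (delta_groupLikes hq hq4 g.2).2.2
  have hli := linearIndependent_groupLikes hq hq4
  obtain ⟨s, hs⟩ := LinearMap.exists_extend ((Module.Basis.span hli).constr ℂ i)
  refine ⟨s, fun g hg => ?_⟩
  have h : s g = i ⟨g, hg⟩ := by
    have h1 := (Module.Basis.span hli).constr_basis ℂ i ⟨g, hg⟩
    rw [← hs, LinearMap.comp_apply] at h1
    rw [← h1]
    exact congrArg s (congrArg Subtype.val (Module.Basis.span_apply hli ⟨g, hg⟩)).symm
  rw [h]
  exact hi ⟨g, hg⟩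

end GroupLike

section GradedProj

variable {q : ℂ} (hq : q ≠ 0) (hq4 : q ^ 4 ≠ 1)

theorem epsLeft_delta_mem (u : U q) (n : ℤ) : epsLeft hq (delta hq hq4 n u) ∈ weightSpace q n := by
  have h := delta_mem_rightWeight hq hq4 u n
  generalize delta hq hq4 n u = t at h ⊢
  induction h using Submodule.span_induction with
  | mem t ht =>
    obtain ⟨a, b, hb, rfl⟩ := ht
    exact Submodule.smul_mem _ _ hb
  | zero => rw [map_zero]; exact zero_mem _
  | add x y _ _ hx hy => rw [map_add]; exact add_mem hx hy
  | smul c x _ hx => rw [map_smul]; exact Submodule.smul_mem _ _ hx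

include hq hq4 in
theorem exists_gradedProj (A : Set Gen) (d : Gen → ℕ) : ∃ p, IsGradedProj q (wordFil q A d) p := by
  set V : Submodule ℂ (U q) := ⨆ N, wordFil q A d N with hV
  have h1 : ∀ n, ∃ r : U q →ₗ[ℂ] U q, (∀ u, r u ∈ V ∧ r u ∈ weightSpace q n) ∧
      ∀ u ∈ V, u ∈ weightSpace q n → r u = u := fun n => by
    obtain ⟨g, hg⟩ := LinearMap.exists_leftInverse_of_injective (V ⊓ weightSpace q n).subtype
      (Submodule.ker_subtype _)
    exact ⟨(V ⊓ weightSpace q n).subtype ∘ₗ g, fun u => (g u).2, fun u hu hu' =>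
      congrArg Subtype.val (LinearMap.congr_fun hg ⟨u, hu, hu'⟩)⟩
  choose r hr hr' using h1
  have h2 : ∀ n, ∀ u ∈ weightSpace q n, FSum (fun i => r i (epsLeft hq (delta hq hq4 i u))) (r n u) :=
    fun n u hu => by
      refine ⟨{n}, fun i hi => ?_, ?_⟩
      · beta_reduce
        rw [epsLeft_delta hq hq4 hu, if_neg (fun h => hi (Finset.mem_singleton.2 h)), map_zero]
      · rw [Finset.sum_singleton, epsLeft_delta hq hq4 hu, if_pos rfl]
  have h3 : ∀ u, ∃ v, FSum (fun i => r i (epsLeft hq (delta hq hq4 i u))) v := fun u => by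
    induction u using weight_induction with
    | h n u hu => exact ⟨_, h2 n u hu⟩
    | h0 => exact ⟨0, by simpa only [map_zero] using FSum.zero⟩
    | hadd u v hu hv =>
      obtain ⟨_, hu⟩ := hu
      obtain ⟨_, hv⟩ := hv
      exact ⟨_, by simpa only [map_add] using hu.add hv⟩
  choose p hp using h3
  let P : U q →ₗ[ℂ] U q :=
    { toFun := p
      map_add' := fun u v => (hp (u + v)).unique (by simpa only [map_add] using (hp u).add (hp v))
      map_smul' := fun c u => (hp (c • u)).unique (by
        simp only [map_smul]
        exact (hp u).map (LinearMap.lsmul ℂ (U q) c).toAddMonoidHom) }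
  have h4 : ∀ n, ∀ u ∈ weightSpace q n, P u = r n u := fun n u hu => (hp u).unique (h2 n u hu)
  refine ⟨P, ⟨fun n u hu => ?_, fun u => ?_, fun N u hu => ?_⟩⟩
  · rw [h4 n u hu]
    exact (hr n u).2
  · have h5 : P u ∈ V := by
      obtain ⟨S, -, hS⟩ := hp u
      change p u ∈ V
      rw [← hS]
      exact sum_mem fun i _ => (hr i _).1
    exact (Submodule.mem_iSup_of_directed _ wordFil_mono.directed_le).1 h5
  · induction hu using Submodule.span_induction with
    | mem u hu =>
      have hw := hu
      obtain ⟨w, -, -, rfl⟩ := hw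
      have h6 : (w.map (gen q)).prod ∈ weightSpace q (w.map Gen.weight).sum :=
        Submodule.subset_span ⟨w, rfl, rfl⟩
      rw [h4 _ _ h6]
      exact hr' _ _ (Submodule.mem_iSup_of_mem N (Submodule.subset_span hu)) h6
    | zero => exact map_zero P
    | add x y _ _ hx hy => rw [map_add, hx, hy]
    | smul c x _ hx => rw [map_smul, hx]

end GradedProj

section Antipode

variable {q : ℂ} (hq : q ≠ 0) (hq4 : q ^ 4 ≠ 1)

/-- The generators other than the `x^±(n)`. -/
def Gen.evens : Set Gen := {y | y.sign = 1}

/-- The degree in the `ā(m)`, `b̄(m)`. -/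
def Gen.degAB : Gen → ℕ
  | .a _ => 1
  | .b _ => 1
  | _ => 0

/-- The degree in the `x^±(n)`. -/
def Gen.degX : Gen → ℕ
  | .x _ _ => 1
  | _ => 0

theorem Gen.isGroupLike_of_degAB {y : Gen} (hy : y ∈ Gen.evens) (h : y.degAB = 0) :
    y.IsGroupLike := by
  cases y with
  | a n => exact absurd h one_ne_zero
  | b n => exact absurd h one_ne_zero
  | x s n =>
    change (-1 : ℂ) = 1 at hy
    norm_num at hy
  | _ => trivial

theorem ite_mem_tensorFil {F : ℕ → Submodule ℂ (U q)} {N : ℕ} {P Q : Prop} [Decidable P]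
    [Decidable Q] {s t : U q ⊗[ℂ] U q} (hs : s ∈ tensorFil F N) (ht : t ∈ tensorFil F N) :
    ((if P then s else 0) + if Q then t else 0) ∈ tensorFil F N := by
  refine add_mem ?_ ?_ <;> split_ifs <;> first | assumption | exact zero_mem _

theorem delta_even_mem_tensorFil {A : Set Gen} {d : Gen → ℕ} (hA : Gen.evens ⊆ A)
    (hd : ∀ y : Gen, y.IsGroupLike → d y = 0) {y : Gen} (hy : y ∈ Gen.evens) (n : ℤ) :
    delta hq hq4 n (gen q y) ∈ tensorFil (wordFil q A d) (d y) := by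
  have hγ : ∀ n, gamPow (gen q) n ∈ wordFil q A d 0 := fun n =>
    gamPow_mem_wordAlgebra (hA rfl) (hA rfl) (hd _ trivial) (hd _ trivial) n
  have h1 : ∀ y, y ∈ Gen.evens → gen q y ∈ wordFil q A d (d y) := fun y hy => gen_mem_wordFil (hA hy)
  by_cases hg : y.IsGroupLike
  · have h2 := h1 y hy
    rw [hd y hg] at h2 ⊢
    rw [delta_groupLike hg]
    split_ifs
    · exact tmul_mem_tensorFil (add_zero 0).le h2 h2
    · exact zero_mem _
  · cases y with
    | a l =>
      rw [delta_a]
      exact ite_mem_tensorFil (tmul_mem_tensorFil (add_zero _).le (h1 _ hy) (hγ _))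
        (tmul_mem_tensorFil (zero_add _).le (hγ _) (h1 _ hy))
    | b l =>
      rw [delta_b]
      exact ite_mem_tensorFil (tmul_mem_tensorFil (add_zero _).le (h1 _ hy) (hγ _))
        (tmul_mem_tensorFil (zero_add _).le (hγ _) (h1 _ hy))
    | x s n =>
      change (-1 : ℂ) = 1 at hy
      norm_num at hy
    | _ => exact absurd trivial hg

theorem isCoalgFiltration_degAB : IsCoalgFiltration hq hq4 (wordFil q Gen.evens Gen.degAB) :=
  isCoalgFiltration_wordFil fun _ hy n => delta_even_mem_tensorFil hq hq4 subset_rfl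
    (fun y hy => by cases y <;> first | rfl | exact hy.elim) hy n

theorem phi_psi_mem_wordFil (n : ℤ) : phi (gen q) n ∈ wordAlgebra q Set.univ Gen.degX ∧
    psi (gen q) n ∈ wordAlgebra q Set.univ Gen.degX := by
  have h : ∀ y : Gen, y.degX = 0 → gen q y ∈ wordAlgebra q Set.univ Gen.degX := fun y hy => by
    have := gen_mem_wordFil (q := q) (A := Set.univ) (d := Gen.degX) (Set.mem_univ y)
    rwa [hy] at this
  constructor
  · unfold phi
    split_ifs
    · refine mul_mem (h _ rfl) (expCoeff_mem _ (fun i => ?_) _)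
      cases i with
      | zero => rw [coeff_zero_aSeries]; exact zero_mem _
      | succ i => rw [coeff_succ_aSeries]; exact h _ rfl
    · exact zero_mem _
  · unfold psi
    split_ifs
    · refine mul_mem (h _ rfl) (expCoeff_mem _ (fun i => ?_) _)
      cases i with
      | zero => rw [coeff_zero_bSeries]; exact zero_mem _
      | succ i => rw [coeff_succ_bSeries]; exact h _ rfl
    · exact zero_mem _

theorem isCoalgFiltration_degX : IsCoalgFiltration hq hq4 (wordFil q Set.univ Gen.degX) := by
  refine isCoalgFiltration_wordFil fun y _ n => ?_
  by_cases hy : y ∈ Gen.evens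
  · exact delta_even_mem_tensorFil hq hq4 (Set.subset_univ _)
      (fun y hy => by cases y <;> first | rfl | exact hy.elim) hy n
  · cases y with
    | x s r =>
      have hγ : ∀ n, gamPow (gen q) n ∈ wordAlgebra q Set.univ Gen.degX := fun n =>
        gamPow_mem_wordAlgebra (Set.mem_univ _) (Set.mem_univ _) rfl rfl n
      have h1 : ∀ n, gen q (.x s n) ∈ wordFil q Set.univ Gen.degX 1 :=
        fun n => Submodule.subset_span ⟨[.x s n], fun _ _ => trivial, le_rfl, (mul_one _).symm⟩
      have hφ : ∀ m n, phi (gen q) m * gamPow (gen q) n ∈ wordFil q Set.univ Gen.degX 0 :=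
        fun m n => mul_mem (S := Subalgebra ℂ (U q)) (phi_psi_mem_wordFil m).1 (hγ n)
      have hψ : ∀ m n, psi (gen q) m * gamPow (gen q) n ∈ wordFil q Set.univ Gen.degX 0 :=
        fun m n => mul_mem (S := Subalgebra ℂ (U q)) (phi_psi_mem_wordFil m).2 (hγ n)
      change _ ∈ tensorFil _ 1
      rcases Int.units_eq_one_or s with rfl | rfl
      · rw [delta_x_pos']
        exact ite_mem_tensorFil
          (tmul_mem_tensorFil (i := 1) (j := 0) le_rfl (h1 _) (one_mem_wordFil 0))
          (tmul_mem_tensorFil (i := 0) (j := 1) le_rfl (hφ _ _) (h1 _))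
      · rw [delta_x_neg']
        exact ite_mem_tensorFil
          (tmul_mem_tensorFil (i := 0) (j := 1) le_rfl (one_mem_wordFil 0) (h1 _))
          (tmul_mem_tensorFil (i := 1) (j := 0) le_rfl (h1 _) (hψ _ _))
    | _ => exact (hy (Eq.refl (1 : ℂ))).elim

/-- The inclusion of the algebra in its completion. -/
def convIncl : ConvRing hq hq4 := ConvRing.mk hq hq4 (incl q) fun _ _ hu => incl_mem_hatWeight hu

theorem mem_vanish_wordFil_one {A : Set Gen} {d : Gen → ℕ} {f : ConvRing hq hq4}
    (h : ∀ w : List Gen, (∀ y ∈ w, y ∈ A ∧ d y = 0) →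
      f.toLin hq hq4 (w.map (gen q)).prod = 0) : f ∈ vanish hq hq4 (wordFil q A d) 1 := by
  intro i hi u hu
  obtain rfl := Nat.lt_one_iff.1 hi
  induction hu using Submodule.span_induction with
  | mem u hu =>
    obtain ⟨w, hwA, hw, rfl⟩ := hu
    refine h w fun y hy => ⟨hwA y hy, ?_⟩
    exact List.sum_eq_zero_iff.1 (Nat.le_zero.1 hw) _ (List.mem_map_of_mem hy)
  | zero => exact map_zero _
  | add x y _ _ hx hy => rw [map_add, hx, hy, add_zero]
  | smul c x _ hx => rw [map_smul, hx, smul_zero]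

theorem ConvRing.one_toLin (u : U q) :
    (1 : ConvRing hq hq4).toLin hq hq4 u = algebraMap ℂ (UHat q) (counit hq u) := rfl

theorem exists_groupLike_antipode : ∃ s : ConvRing hq hq4,
    1 - s * convIncl hq hq4 ∈ vanish hq hq4 (wordFil q Gen.evens Gen.degAB) 1 ∧
      1 - convIncl hq hq4 * s ∈ vanish hq hq4 (wordFil q Gen.evens Gen.degAB) 1 := by
  obtain ⟨s, hs⟩ := exists_groupLike_inverse hq hq4
  let π : U q →ₗ[ℂ] U q := epsLeft hq ∘ₗ delta hq hq4 0
  have h1 : ∀ g ∈ groupLikes q, π g = g := fun g hg => by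
    obtain ⟨h, h', -⟩ := delta_groupLikes hq hq4 hg
    rw [LinearMap.comp_apply, h, if_pos rfl, epsLeft_tmul, h', one_smul]
  let S : ConvRing hq hq4 := ConvRing.mk hq hq4 (incl q ∘ₗ π ∘ₗ s ∘ₗ π) fun n u hu => by
    by_cases hn : n = 0
    · subst hn
      exact incl_mem_hatWeight (epsLeft_delta_mem hq hq4 _ _)
    · have : π u = 0 := by
        rw [LinearMap.comp_apply, epsLeft_delta hq hq4 hu, if_neg (Ne.symm hn)]
      change incl q (π (s (π u))) ∈ _
      rw [this, map_zero, map_zero, map_zero]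
      exact zero_mem _
  have h2 : ∀ g ∈ groupLikes q, S.toLin hq hq4 g = incl q (s g) := fun g hg => by
    change incl q (π (s (π g))) = _
    rw [h1 g hg, h1 _ (hs g hg).1]
  have h3 : ∀ (f h : ConvRing hq hq4), ∀ g ∈ groupLikes q,
      (f * h).toLin hq hq4 g = f.toLin hq hq4 g * h.toLin hq hq4 g := fun f h g hg => by
    refine (ConvRing.hasSum_mul f h g).unique ?_
    simp only [(delta_groupLikes hq hq4 hg).1, apply_ite (mulMap (f.toLin hq hq4) (h.toLin hq hq4)),
      map_zero]
    exact hasSum_ite_eq 0 _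
  have h4 : ∀ w : List Gen, (∀ y ∈ w, y ∈ Gen.evens ∧ y.degAB = 0) →
      (w.map (gen q)).prod ∈ groupLikes q := fun w hw =>
    ⟨w, fun y hy => Gen.isGroupLike_of_degAB (hw y hy).1 (hw y hy).2, rfl⟩
  refine ⟨S, mem_vanish_wordFil_one hq hq4 fun w hw => ?_,
    mem_vanish_wordFil_one hq hq4 fun w hw => ?_⟩
  · have hg := h4 w hw
    rw [map_sub, LinearMap.sub_apply, h3 _ _ _ hg, h2 _ hg, ConvRing.one_toLin,
      (delta_groupLikes hq hq4 hg).2.1, map_one, sub_eq_zero]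
    exact (congrArg (incl q) (hs _ hg).2.2).symm
  · have hg := h4 w hw
    rw [map_sub, LinearMap.sub_apply, h3 _ _ _ hg, h2 _ hg, ConvRing.one_toLin,
      (delta_groupLikes hq hq4 hg).2.1, map_one, sub_eq_zero]
    exact (congrArg (incl q) (hs _ hg).2.1).symm

theorem exists_mem_wordFil_degX (u : U q) : ∃ N, u ∈ wordFil q Set.univ Gen.degX N := by
  induction u using U_induction with
  | hgen y => exact ⟨_, gen_mem_wordFil (Set.mem_univ y)⟩
  | hC r =>
    rw [Algebra.algebraMap_eq_smul_one]
    exact ⟨0, Submodule.smul_mem _ _ (one_mem_wordFil 0)⟩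
  | hadd u v hu hv =>
    obtain ⟨M, hu⟩ := hu
    obtain ⟨N, hv⟩ := hv
    exact ⟨max M N, add_mem (wordFil_mono (le_max_left _ _) hu) (wordFil_mono (le_max_right _ _) hv)⟩
  | hmul u v hu hv =>
    obtain ⟨M, hu⟩ := hu
    obtain ⟨N, hv⟩ := hv
    exact ⟨M + N, mul_mem_wordFil le_rfl hu hv⟩

theorem mem_vanish_degX_one {f : ConvRing hq hq4}
    (h : ∀ N, f ∈ vanish hq hq4 (wordFil q Gen.evens Gen.degAB) N) :
    f ∈ vanish hq hq4 (wordFil q Set.univ Gen.degX) 1 := by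
  refine mem_vanish_wordFil_one hq hq4 fun w hw => ?_
  refine h ((w.map Gen.degAB).sum + 1) _ (lt_add_one _) _
    (Submodule.subset_span ⟨w, fun y hy => ?_, le_rfl, rfl⟩)
  have h1 := (hw y hy).2
  cases y with
  | x s n => exact absurd h1 one_ne_zero
  | _ => rfl

theorem exists_antipode : ∃ S : ConvRing hq hq4,
    S * convIncl hq hq4 = 1 ∧ convIncl hq hq4 * S = 1 := by
  obtain ⟨s, hs⟩ := exists_groupLike_antipode hq hq4
  obtain ⟨p, hp⟩ := exists_gradedProj hq hq4 Gen.evens Gen.degAB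
  obtain ⟨l, r, hlr⟩ := (isCoalgFiltration_degAB hq hq4).exists_left_right_inverse hp hs.1 hs.2
  obtain ⟨p', hp'⟩ := exists_gradedProj hq hq4 Set.univ Gen.degX
  obtain ⟨L, R, hLR⟩ := (isCoalgFiltration_degX hq hq4).exists_left_right_inverse hp'
    (mem_vanish_degX_one hq hq4 fun N => (hlr N).1) (mem_vanish_degX_one hq hq4 fun N => (hlr N).2)
  have h1 : ∀ f : ConvRing hq hq4, (∀ N, 1 - f ∈ vanish hq hq4 (wordFil q Set.univ Gen.degX) N) →
      f = 1 := fun f hf => ConvRing.ext fun u => by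
    obtain ⟨N, hN⟩ := exists_mem_wordFil_degX u
    exact (ConvRing.eq_of_sub_mem_vanish (hf (N + 1)) (lt_add_one N) hN).symm
  have hL := h1 _ fun N => (hLR N).1
  have hR := h1 _ fun N => (hLR N).2
  exact ⟨L, hL, left_inv_eq_right_inv hL hR ▸ hR⟩

end Antipode

/-! ### Properties of the antipode -/

section AntipodeProperties

variable {q : ℂ} (hq : q ≠ 0) (hq4 : q ^ 4 ≠ 1)

theorem incl_mul (u v : U q) : incl q (u * v) = incl q u * incl q v := rfl

/-- The antipode, as an element of the convolution ring. -/
def antipodeConv : ConvRing hq hq4 := (exists_antipode hq hq4).choose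

/-- The antipode. -/
def antipode : U q →ₗ[ℂ] UHat q := (antipodeConv hq hq4).toLin hq hq4

theorem hasSum_antipode_left (u : U q) :
    HasSum (fun n => mulMap (antipode hq hq4) (incl q) (delta hq hq4 n u))
      (algebraMap ℂ (UHat q) (counit hq u)) := by
  have h := ConvRing.hasSum_mul (antipodeConv hq hq4) (convIncl hq hq4) u
  rwa [antipodeConv, (exists_antipode hq hq4).choose_spec.1, ConvRing.one_toLin] at h

theorem hasSum_antipode_right (u : U q) :
    HasSum (fun n => mulMap (incl q) (antipode hq hq4) (delta hq hq4 n u))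
      (algebraMap ℂ (UHat q) (counit hq u)) := by
  have h := ConvRing.hasSum_mul (convIncl hq hq4) (antipodeConv hq hq4) u
  rwa [antipodeConv, (exists_antipode hq hq4).choose_spec.2, ConvRing.one_toLin] at h

theorem eq_mul_antipode {f : U q →ₗ[ℂ] UHat q} {z : UHat q}
    (h : ∀ u, HasSum (fun n => mulMap f (incl q) (delta hq hq4 n u)) (counit hq u • z)) (u : U q) :
    f u = z * antipode hq hq4 u := by
  have h1 : conv hq hq4 f (convIncl hq hq4) = LinearMap.mulLeft ℂ z ∘ₗ (convOne hq).1 :=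
    LinearMap.ext fun u => by
      have h0 : conv hq hq4 f (convIncl hq hq4) u = counit hq u • z :=
        (hasSum_conv hq hq4 f (convIncl hq hq4) u).unique (h u)
      rw [h0, Algebra.smul_def, Algebra.commutes]
      rfl
  have h2 : f = conv hq hq4 (conv hq hq4 f (convIncl hq hq4)) (antipodeConv hq hq4) := by
    refine (conv_one hq hq4 f).symm.trans (Eq.trans ?_ (conv_assoc hq hq4 f _ _).symm)
    exact congrArg (conv hq hq4 f) (exists_antipode hq hq4).choose_spec.2.symm
  rw [h2, h1]
  refine (hasSum_conv hq hq4 _ _ u).unique ?_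
  have h3 : mulMap (LinearMap.mulLeft ℂ z ∘ₗ (convOne hq).1) (antipode hq hq4) =
      LinearMap.mulLeft ℂ z ∘ₗ mulMap (convOne hq).1 (antipode hq hq4) :=
    TensorProduct.ext' fun a b => mul_assoc _ _ _
  have h4 := (hasSum_conv hq hq4 (convOne hq) (antipodeConv hq hq4) u).mul_left z
  have h5 : conv hq hq4 (convOne hq) (antipodeConv hq hq4) = antipode hq hq4 :=
    one_conv hq hq4 (antipodeConv hq hq4)
  rw [h5] at h4
  exact (congrArg (fun F => HasSum (fun n => F (delta hq hq4 n u)) _) h3).mpr h4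

theorem UHat.continuous_parity : Continuous (UHat.parity q) :=
  continuous_coinduced_dom.2 ((UHat.continuous_mk q).comp (PreUHat.continuous_parity q))

theorem parity_antipode (u : U q) :
    UHat.parity q (antipode hq hq4 u) = antipode hq hq4 (parity q u) := by
  have h := eq_mul_antipode hq hq4 (z := 1) (f := (UHat.parity q).toLinearMap ∘ₗ
    antipode hq hq4 ∘ₗ (parity q).toLinearMap) (fun u => ?_) (parity q u)
  · rw [one_mul, LinearMap.comp_apply, LinearMap.comp_apply] at h
    refine Eq.trans ?_ h
    exact congrArg (fun u => UHat.parity q (antipode hq hq4 u)) (parity_parity q u).symm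
  · have h1 := (hasSum_antipode_left hq hq4 (parity q u)).map (UHat.parity q)
      UHat.continuous_parity
    rw [AlgHom.commutes, counit_parity, Algebra.algebraMap_eq_smul_one] at h1
    refine (congrArg (fun f => HasSum f _) (funext fun n => ?_)).mp h1
    rw [Function.comp_apply, ← tsqParity_delta]
    have h2 : (UHat.parity q).toLinearMap ∘ₗ mulMap (antipode hq hq4) (incl q) ∘ₗ tsqParity q =
        mulMap ((UHat.parity q).toLinearMap ∘ₗ antipode hq hq4 ∘ₗ (parity q).toLinearMap)
          (incl q) := TensorProduct.ext' fun a b => by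
      refine (map_mul (UHat.parity q) _ _).trans (congrArg₂ (· * ·) rfl ?_)
      exact congrArg Subtype.val (parity_parity q b)
    exact LinearMap.congr_fun h2 _

theorem FSum.hasSum {t : ℤ → UHat q} {a : UHat q} (h : FSum t a) : HasSum t a := by
  obtain ⟨S, h1, rfl⟩ := h
  exact hasSum_sum_of_ne_finset_zero h1

theorem tsqMul_mem_rightWeight {m n : ℤ} {s t : U q ⊗[ℂ] U q} (hs : s ∈ rightWeight q m)
    (ht : t ∈ rightWeight q n) : tsqMul q s t ∈ rightWeight q (m + n) := by
  induction hs using Submodule.span_induction with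
  | mem s hs =>
    obtain ⟨a, b, hb, rfl⟩ := hs
    induction ht using Submodule.span_induction with
    | mem t ht =>
      obtain ⟨c, d, hd, rfl⟩ := ht
      have h := superMul_tmul (LinearMap.mul ℂ (U q)) (parity q).toLinearMap
        (LinearMap.mul ℂ (U q)) (parity q).toLinearMap a c b d
      refine h ▸ add_mem (Submodule.subset_span ⟨_, _, mul_mem_weightSpace ?_ hd, rfl⟩)
        (Submodule.subset_span ⟨_, _, mul_mem_weightSpace ?_ hd, rfl⟩)
      · exact Submodule.smul_mem _ _ (add_mem hb (parity_mem_weightSpace hb))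
      · exact Submodule.smul_mem _ _ (sub_mem hb (parity_mem_weightSpace hb))
    | zero => rw [map_zero]; exact zero_mem _
    | add x y _ _ hx hy => rw [map_add]; exact add_mem hx hy
    | smul c x _ hx => rw [map_smul]; exact Submodule.smul_mem _ _ hx
  | zero => rw [map_zero]; exact zero_mem _
  | add x y _ _ hx hy => rw [map_add]; exact add_mem hx hy
  | smul c x _ hx => rw [map_smul]; exact Submodule.smul_mem _ _ hx

theorem mulMap_tsqMul (f : U q →ₗ[ℂ] UHat q) (s : U q ⊗[ℂ] U q) (c d : U q) :
    mulMap f (incl q) (tsqMul q s (c ⊗ₜ d)) =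
      mulMap f (incl q) (tsqMul q s (c ⊗ₜ 1)) * incl q d := by
  induction s using tensor_parity_induction with
  | h0 => simp only [map_zero, LinearMap.zero_apply, zero_mul]
  | hadd s s' hs hs' => simp only [map_add, LinearMap.add_apply, hs, hs', add_mul]
  | heven a b hb =>
    rw [tsqMul_even hb, tsqMul_even hb, mul_one]
    exact (mul_assoc _ _ _).symm
  | hodd a b hb =>
    rw [tsqMul_odd hb, tsqMul_odd hb, mul_one]
    exact (mul_assoc _ _ _).symm

theorem summable_mulMap_tsqMul (f : U q →ₗ[ℂ] UHat q) (u v : U q) :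
    Summable fun ji : ℤ × ℤ =>
      mulMap f (incl q) (tsqMul q (delta hq hq4 ji.2 u) (delta hq hq4 ji.1 v)) := by
  obtain ⟨d, hd⟩ := delta_eq_zero (hq := hq) (hq4 := hq4) u
  obtain ⟨e, he⟩ := delta_eq_zero (hq := hq) (hq4 := hq4) v
  refine summable_of_mem_uhatSmall (fun ji : ℤ × ℤ => ji.2 + ji.1)
    (fun ji => mulMap_mem_uhatSmall f (convIncl hq hq4).toLin_mem (tsqMul_mem_rightWeight
      (delta_mem_rightWeight hq hq4 u ji.2) (delta_mem_rightWeight hq hq4 v ji.1))) fun K =>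
    ((Set.finite_Icc e (K - d)).prod (Set.finite_Icc d (K - e))).subset ?_
  rintro ⟨j, i⟩ ⟨h0, h3⟩
  have h1 : d ≤ i := not_lt.1 fun h' => h0 (by
    rw [hd _ h', LinearMap.map_zero, LinearMap.zero_apply, LinearMap.map_zero])
  have h2 : e ≤ j := not_lt.1 fun h' => h0 (by
    rw [he _ h', LinearMap.map_zero, LinearMap.map_zero])
  simp only [Set.mem_prod, Set.mem_Icc]
  dsimp only at h3
  omega

theorem hasSum_mulMap_delta_mul (u v : U q) :
    HasSum (fun n => mulMap (antipode hq hq4) (incl q) (tsqMul q (delta hq hq4 n u) (v ⊗ₜ 1)))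
      (counit hq u • antipode hq hq4 v) := by
  set f := antipode hq hq4 with hf
  have hs : ∀ v : U q,
      Summable fun n => mulMap f (incl q) (tsqMul q (delta hq hq4 n u) (v ⊗ₜ 1)) := fun v => by
    obtain ⟨d, hd⟩ := delta_eq_zero (hq := hq) (hq4 := hq4) u
    have h1 : v ⊗ₜ 1 ∈ rightWeight q 0 := Submodule.subset_span ⟨v, 1, one_mem_weightSpace, rfl⟩
    refine summable_of_mem_uhatSmall (fun n => n + 0)
      (fun n => mulMap_mem_uhatSmall f (convIncl hq hq4).toLin_mem (tsqMul_mem_rightWeight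
        (delta_mem_rightWeight hq hq4 u n) h1)) fun K =>
      (Set.finite_Icc d K).subset fun n hn => ⟨not_lt.1 fun h' => hn.1 ?_, (by
        have : n + 0 < K := hn.2; omega)⟩
    rw [hd n h', LinearMap.map_zero, LinearMap.zero_apply, map_zero]
  let C : U q →ₗ[ℂ] UHat q :=
    { toFun := fun v => ∑' n, mulMap f (incl q) (tsqMul q (delta hq hq4 n u) (v ⊗ₜ 1))
      map_add' := fun v w => by
        simp only [TensorProduct.add_tmul, map_add]
        exact (hs v).tsum_add (hs w)
      map_smul' := fun c v => by
        simp only [← TensorProduct.smul_tmul', map_smul, RingHom.id_apply]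
        exact (hs v).tsum_const_smul c }
  have hC : ∀ v, HasSum (fun n => mulMap f (incl q) (tsqMul q (delta hq hq4 n u) (v ⊗ₜ 1))) (C v) :=
    fun v => (hs v).hasSum
  have h1 : ∀ t : U q ⊗[ℂ] U q,
      HasSum (fun n => mulMap f (incl q) (tsqMul q (delta hq hq4 n u) t)) (mulMap C (incl q) t) :=
    fun t => by
      induction t using TensorProduct.induction_on with
      | zero => simpa only [map_zero] using hasSum_zero
      | add s t hs ht => simpa only [map_add] using hs.add ht
      | tmul c d =>
        simp only [mulMap_tsqMul f _ c d]
        exact (hC c).mul_right (incl q d)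
  have h2 := eq_mul_antipode hq hq4 (f := C) (z := algebraMap ℂ (UHat q) (counit hq u)) (fun v => by
    have hsum : Summable fun j => mulMap C (incl q) (delta hq hq4 j v) :=
      summable_mulMap_delta hq hq4 C (convIncl hq hq4) v
    have h3 := eq_of_hasSum_fiber (T := fun i j => mulMap f (incl q)
      (tsqMul q (delta hq hq4 i u) (delta hq hq4 j v))) (summable_mulMap_tsqMul hq hq4 f u v)
      (fun j => h1 (delta hq hq4 j v)) (z := fun k => mulMap f (incl q) (delta hq hq4 k (u * v)))
      (fun k => by
        have h4 := ((delta_mul (hq := hq) (hq4 := hq4) u v k).map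
          (mulMap f (incl q)).toAddMonoidHom).equiv (Equiv.subLeft k)
        refine (congrArg (fun F => HasSum F _) (funext fun j => ?_)).mp h4.hasSum
        simp only [Equiv.subLeft_apply, sub_sub_cancel]
        rfl) hsum.hasSum (hasSum_antipode_left hq hq4 (u * v))
    have h5 := hsum.hasSum
    rw [h3, map_mul, map_mul, ← Algebra.commutes, ← Algebra.smul_def] at h5
    exact h5) v
  rw [Algebra.smul_def, ← h2]
  exact hC v

theorem antipode_mul_even (u : U q) {v : U q} (hv : parity q v = v) :
    antipode hq hq4 (u * v) = antipode hq hq4 v * antipode hq hq4 u := by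
  refine eq_mul_antipode hq hq4 (f := antipode hq hq4 ∘ₗ LinearMap.mulRight ℂ v) (fun u => ?_) u
  refine (congrArg (fun F => HasSum F _) (funext fun n => ?_)).mp
    (hasSum_mulMap_delta_mul hq hq4 u v)
  generalize delta hq hq4 n u = t
  induction t using TensorProduct.induction_on with
  | zero => simp only [map_zero, LinearMap.zero_apply]
  | add s t hs ht => simp only [map_add, LinearMap.add_apply, hs, ht]
  | tmul a b =>
    rw [tsqMul_tmul_of_even_right hv, mul_one]
    rfl

theorem antipode_mul_odd (u : U q) {v : U q} (hv : parity q v = -v) :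
    antipode hq hq4 (u * v) = antipode hq hq4 v * antipode hq hq4 (parity q u) := by
  have h := eq_mul_antipode hq hq4 (f := antipode hq hq4 ∘ₗ LinearMap.mulRight ℂ v ∘ₗ
    (parity q).toLinearMap) (z := antipode hq hq4 v) (fun u => ?_) (parity q u)
  · refine Eq.trans ?_ h
    exact congrArg (fun u => antipode hq hq4 (u * v)) (parity_parity q u).symm
  · have h1 := hasSum_mulMap_delta_mul hq hq4 (parity q u) v
    rw [counit_parity] at h1
    refine (congrArg (fun F => HasSum F _) (funext fun n => ?_)).mp h1
    rw [← tsqParity_delta]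
    generalize delta hq hq4 n u = t
    induction t using tensor_parity_induction with
    | h0 => simp only [map_zero, LinearMap.zero_apply]
    | hadd s t hs ht => simp only [map_add, LinearMap.add_apply, hs, ht]
    | heven a b hb =>
      rw [tsqParity_tmul, hb, tsqMul_even hb, mul_one]
      rfl
    | hodd a b hb =>
      rw [tsqParity_tmul, hb, tsqMul_odd (by rw [map_neg, hb]), mul_one, hv, mul_neg,
        TensorProduct.neg_tmul, TensorProduct.tmul_neg, neg_neg]
      rfl

theorem antipode_mul {i j : ZMod 2} {u v : U q} (hu : u ∈ parityPart q i) (hv : v ∈ parityPart q j) :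
    antipode hq hq4 (u * v) =
      (-1 : ℂ) ^ (i.val * j.val) • (antipode hq hq4 v * antipode hq hq4 u) := by
  rw [mem_parityPart] at hu hv
  obtain rfl | rfl : j = 0 ∨ j = 1 := (by decide : ∀ j : ZMod 2, j = 0 ∨ j = 1) j
  · rw [ZMod.val_zero, pow_zero, one_smul] at hv
    rw [antipode_mul_even hq hq4 u hv, ZMod.val_zero, mul_zero, pow_zero, one_smul]
  · rw [ZMod.val_one, pow_one, neg_one_smul] at hv
    rw [antipode_mul_odd hq hq4 u hv, hu, map_smul, mul_smul_comm, ZMod.val_one, mul_one]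

end AntipodeProperties

/-! ### Formulas for the antipode -/

section AntipodeFormulas

variable {q : ℂ} (hq : q ≠ 0) (hq4 : q ^ 4 ≠ 1)

theorem antipode_gamPow (n : ℤ) :
    antipode hq hq4 (gamPow (gen q) n) = incl q (gamPow (gen q) (-n)) := by
  have h := hasSum_antipode_left hq hq4 (gamPow (gen q) n)
  simp only [delta_gamPow, apply_ite (mulMap (antipode hq hq4) (incl q)), map_zero, mulMap_tmul,
    counit_gamPow, map_one] at h
  have h1 := h.unique (hasSum_ite_eq 0 _)
  have h2 : incl q (gamPow (gen q) n) * incl q (gamPow (gen q) (-n)) = 1 :=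
    congrArg (incl q) ((relations_gen q).gamPow_mul_neg n)
  rw [← one_mul (incl q (gamPow (gen q) (-n))), h1, mul_assoc, h2, mul_one]

theorem antipode_mul_gamPow {u : U q} (hu : parity q u = u) (n : ℤ) :
    antipode hq hq4 (u * gamPow (gen q) n) =
      antipode hq hq4 u * incl q (gamPow (gen q) (-n)) := by
  rw [← (gamPow_central n u).eq, antipode_mul_even hq hq4 _ hu, antipode_gamPow]

/-- A one-sided inverse of a formal series agrees with any inverse. -/
theorem eq_of_series_inverse {τ : ℤ} (hτ : τ * τ = 1) {f : ℤ → UHat q} {p p' : ℤ → U q}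
    (hf : ∀ n, τ * n < 0 → f n = 0) (hp : ∀ n, τ * n < 0 → p n = 0)
    (h : ∀ r, HasSum (fun n => f (r - n) * incl q (p n)) (if r = 0 then 1 else 0))
    (h' : ∀ N : ℕ, ∑ ij ∈ Finset.HasAntidiagonal.antidiagonal N, p (τ * ij.1) * p' (τ * ij.2) =
      if N = 0 then 1 else 0) (N : ℕ) : f (τ * N) = incl q (p' (τ * N)) := by
  have h1 : PowerSeries.mk (fun i : ℕ => f (τ * i)) *
      PowerSeries.mk (fun i : ℕ => incl q (p (τ * i))) = 1 := by
    ext N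
    simp only [PowerSeries.coeff_mul, PowerSeries.coeff_mk, PowerSeries.coeff_one]
    have h2 := h (τ * N)
    have h3 : (τ * N = 0) ↔ N = 0 := by
      rw [mul_eq_zero, Nat.cast_eq_zero]
      exact or_iff_right fun h0 => by rw [h0] at hτ; norm_num at hτ
    simp only [h3] at h2
    rw [h2.unique (hasSum_sum_of_ne_finset_zero (s := (Finset.HasAntidiagonal.antidiagonal
      N).image fun ij => τ * (ij.2 : ℤ)) fun n hn => ?_), Finset.sum_image]
    · refine Finset.sum_congr rfl fun ij hij => ?_
      rw [← mul_sub, ← Finset.HasAntidiagonal.mem_antidiagonal.1 hij, Nat.cast_add,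
        add_sub_cancel_right]
    · intro a ha b hb hab
      have h4 : (a.2 : ℤ) = b.2 := by
        have := congrArg (τ * ·) hab
        simpa only [← mul_assoc, hτ, one_mul] using this
      rw [Finset.mem_coe, Finset.HasAntidiagonal.mem_antidiagonal] at ha hb
      exact Prod.ext (by omega) (by omega)
    · by_cases h5 : τ * n < 0
      · rw [hp n h5, map_zero, mul_zero]
      · rw [hf, zero_mul]
        rw [mul_sub, ← mul_assoc, hτ, one_mul]
        by_contra h6
        refine hn (Finset.mem_image.2 ⟨(N - (τ * n).toNat, (τ * n).toNat),
          Finset.HasAntidiagonal.mem_antidiagonal.2 (by dsimp only; omega), ?_⟩)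
        dsimp only
        rw [Int.toNat_of_nonneg (not_lt.1 h5), ← mul_assoc, hτ, one_mul]
  have h2 : PowerSeries.mk (fun i : ℕ => incl q (p (τ * i))) *
      PowerSeries.mk (fun i : ℕ => incl q (p' (τ * i))) = 1 := by
    ext N
    simp only [PowerSeries.coeff_mul, PowerSeries.coeff_mk, PowerSeries.coeff_one]
    have h3 := congrArg (incl q) (h' N)
    rw [map_sum] at h3
    refine h3.trans ?_
    split_ifs <;> rfl
  have h3 := congrArg (PowerSeries.coeff N) (left_inv_eq_right_inv h1 h2)
  simpa only [PowerSeries.coeff_mk] using h3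

theorem antipode_phi (n : ℤ) : antipode hq hq4 (phi (gen q) n) = incl q (phiInv (gen q) n) := by
  by_cases hn : 0 < n
  · rw [phi_of_pos _ hn, phiInv, if_neg (by omega), map_zero, map_zero]
  obtain ⟨N, rfl⟩ : ∃ N : ℕ, n = -1 * N := ⟨(-n).toNat, by omega⟩
  refine eq_of_series_inverse (τ := -1) (by norm_num)
    (f := fun n => antipode hq hq4 (phi (gen q) n)) (p := phi (gen q)) (p' := phiInv (gen q))
    (fun n hn => by rw [phi_of_pos _ (by omega), map_zero])
    (fun n hn => phi_of_pos _ (by omega)) (fun r => ?_) (fun N => ?_) N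
  · have h := (hasSum_antipode_left hq hq4 (phi (gen q) r)).mul_right
      (incl q (gamPow (gen q) (-r)))
    rw [counit_phi] at h
    refine (congrArg₂ (fun f a => HasSum f a) (funext fun n => ?_) ?_).mp h
    · rw [delta_phi, mulMap_tmul, antipode_mul_gamPow hq hq4 (parity_phi _), mul_assoc, mul_assoc,
        ← incl_mul, ← incl_mul, neg_neg, mul_assoc (gamPow (gen q) (r - n)), ← mul_assoc (gamPow (gen q) n),
        gamPow_gen_mul, ← mul_assoc,
        ← (gamPow_central (-r) _).eq, ← mul_assoc, gamPow_gen_mul, add_sub_cancel, neg_add_cancel,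
        gamPow_zero, one_mul]
    · split_ifs with hr
      · rw [hr, neg_zero, gamPow_zero, map_one, one_mul]
        rfl
      · rw [map_zero, zero_mul]
  · have h : ∀ n : ℕ, phiInv (gen q) (-1 * n) = expCoeff (-aSeries (gen q)) n * gen q .kInv :=
      fun n => by rw [phiInv, if_pos (by omega), show ((-1 : ℤ) * n).natAbs = n by omega]
    have h' : ∀ n : ℕ, phi (gen q) (-1 * n) = gen q .k * expCoeff (aSeries (gen q)) n :=
      fun n => by rw [neg_one_mul, phi_neg_natCast]
    have h₂ : ∀ u v : U q, gen q .k * u * (v * gen q .kInv) = gen q .k * (u * v) * gen q .kInv :=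
      fun u v => by simp only [mul_assoc]
    simp only [h, h', h₂]
    rw [← Finset.sum_mul, ← Finset.mul_sum, expCoeff_mul_neg (coeff_zero_aSeries _)]
    split_ifs
    · rw [mul_one, (relations_gen q).k_kInv]
    · rw [mul_zero, zero_mul]

theorem antipode_psi (n : ℤ) : antipode hq hq4 (psi (gen q) n) = incl q (psiInv (gen q) n) := by
  by_cases hn : n < 0
  · rw [psi_of_neg _ hn, psiInv, if_neg (by omega), map_zero, map_zero]
  obtain ⟨N, rfl⟩ : ∃ N : ℕ, n = 1 * N := ⟨n.toNat, by omega⟩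
  refine eq_of_series_inverse (τ := 1) (by norm_num)
    (f := fun n => antipode hq hq4 (psi (gen q) n)) (p := psi (gen q)) (p' := psiInv (gen q))
    (fun n hn => by rw [psi_of_neg _ (by omega), map_zero])
    (fun n hn => psi_of_neg _ (by omega)) (fun r => ?_) (fun N => ?_) N
  · have h := (hasSum_antipode_left hq hq4 (psi (gen q) r)).mul_right
      (incl q (gamPow (gen q) r))
    rw [counit_psi] at h
    refine (congrArg₂ (fun f a => HasSum f a) (funext fun n => ?_) ?_).mp h
    · rw [delta_psi, mulMap_tmul, antipode_mul_gamPow hq hq4 (parity_psi _), mul_assoc, mul_assoc,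
        ← incl_mul, ← incl_mul, mul_assoc (gamPow (gen q) (-(r - n))), ← mul_assoc (gamPow (gen q) (-n)),
        gamPow_gen_mul, ← mul_assoc,
        ← (gamPow_central r _).eq, ← mul_assoc, gamPow_gen_mul, show r + (-n + -(r - n)) = 0 by ring, gamPow_zero, one_mul]
    · split_ifs with hr
      · rw [hr, gamPow_zero, map_one, one_mul]
        rfl
      · rw [map_zero, zero_mul]
  · have h : ∀ n : ℕ, psiInv (gen q) (1 * n) = expCoeff (-bSeries (gen q)) n * gen q .k :=
      fun n => by rw [psiInv, if_pos (by omega), show ((1 : ℤ) * n).natAbs = n by omega]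
    have h' : ∀ n : ℕ, psi (gen q) (1 * n) = gen q .kInv * expCoeff (bSeries (gen q)) n :=
      fun n => by rw [one_mul, psi_natCast]
    have h₂ : ∀ u v : U q, gen q .kInv * u * (v * gen q .k) = gen q .kInv * (u * v) * gen q .k :=
      fun u v => by simp only [mul_assoc]
    simp only [h, h', h₂]
    rw [← Finset.sum_mul, ← Finset.mul_sum, expCoeff_mul_neg (coeff_zero_bSeries _)]
    split_ifs
    · rw [mul_one, (relations_gen q).kInv_k]
    · rw [mul_zero, zero_mul]

theorem antipode_x_pos (n : ℤ) : HasSum (fun l : ℤ => incl q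
    (-(phiInv (gen q) (n - l) * gamPow (gen q) (n + l) * gen q (.x 1 l))))
    (antipode hq hq4 (gen q (.x 1 n))) := by
  have h := (hasSum_antipode_left hq hq4 (gen q (.x 1 n))).sub
    (hasSum_ite_eq (0 : ℤ) (antipode hq hq4 (gen q (.x 1 n))))
  rw [counit_gen, counitGen, map_zero, zero_sub] at h
  have h' := h.neg
  rw [neg_neg] at h'
  refine (congrArg (fun f => HasSum f _) (funext fun l => ?_)).mp h'
  have h1 : antipode hq hq4 (gen q (.x 1 n)) * incl q 1 = antipode hq hq4 (gen q (.x 1 n)) :=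
    mul_one _
  rw [delta_x_pos, map_add, apply_ite (mulMap _ _), map_zero, mulMap_tmul, mulMap_tmul, h1,
    add_sub_cancel_left, antipode_mul_gamPow hq hq4 (parity_phi _), antipode_phi, neg_neg, map_neg,
    incl_mul, incl_mul]

theorem antipode_x_neg (n : ℤ) : HasSum (fun l : ℤ => incl q
    (-(gen q (.x (-1) (n - l)) * gamPow (gen q) (2 * n - l) * psiInv (gen q) l)))
    (antipode hq hq4 (gen q (.x (-1) n))) := by
  have h := (hasSum_antipode_right hq hq4 (gen q (.x (-1) n))).sub
    (hasSum_ite_eq n (antipode hq hq4 (gen q (.x (-1) n))))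
  rw [counit_gen, counitGen, map_zero, zero_sub] at h
  have h' := h.neg
  rw [neg_neg] at h'
  refine (congrArg (fun f => HasSum f _) (funext fun l => ?_)).mp h'
  have h1 : incl q 1 * antipode hq hq4 (gen q (.x (-1) n)) = antipode hq hq4 (gen q (.x (-1) n)) :=
    one_mul _
  rw [delta_x_neg, map_add, apply_ite (mulMap _ _), map_zero, mulMap_tmul, mulMap_tmul, h1,
    add_sub_cancel_left, antipode_mul_gamPow hq hq4 (parity_psi _), antipode_psi, neg_sub, map_neg,
    mul_assoc, (gamPow_central _ (psiInv (gen q) l)).eq, incl_mul, incl_mul]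

end AntipodeFormulas

end SuperCurrent

end

theorem mainTheorem4 (q : ℂ) (hq : q ≠ 0) (hq4 : q ^ 4 ≠ 1) :
    (∀ s : ℤˣ, ∃ Y : ℤ → ℤ → ℤ → SuperCurrent.PreUHat q, SuperCurrent.IsYCoeff q s Y ∧
      ∀ n : ℤ, ∃ z : SuperCurrent.PreUHat q, SuperCurrent.IsLineCoeff q s Y n z) ∧
    ∃ (Δ : SuperCurrent.U q →ₐ[ℂ] SuperCurrent.FormalTensor q) (ε : SuperCurrent.U q →ₐ[ℂ] ℂ)
      (S : SuperCurrent.U q →ₗ[ℂ] SuperCurrent.UHat q),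
      SuperCurrent.IsHopfSuperalgebra q Δ ε S ∧ SuperCurrent.HasDrinfeldFormulas q Δ ε S := by
  refine ⟨SuperCurrent.serre_convergence hq, SuperCurrent.comul hq hq4, SuperCurrent.counit hq,
    SuperCurrent.antipode hq hq4, ?_, ?_⟩
  · exact
      { comul_mem := SuperCurrent.comul_mem_completedTensor hq hq4
        comul_even := fun n u => SuperCurrent.tsqParity_delta n u
        counit_even := SuperCurrent.counit_parity hq
        antipode_even := SuperCurrent.parity_antipode hq hq4
        coassoc := fun m n u => SuperCurrent.coassoc_delta u m n
        counit_comul := SuperCurrent.hasSum_epsLeft_delta hq hq4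
        comul_counit := SuperCurrent.hasSum_epsRight_delta hq hq4
        antipode_mul := fun _ _ _ hu _ hv => SuperCurrent.antipode_mul hq hq4 hu hv
        antipode_left := SuperCurrent.hasSum_antipode_left hq hq4
        antipode_right := SuperCurrent.hasSum_antipode_right hq hq4 }
  · exact
      { comul_gam := fun j => by
          rw [SuperCurrent.comul_groupLike (y := .gam) trivial, SuperCurrent.coeff_C_ite]
        comul_x_pos := SuperCurrent.coeff_comul_x_pos
        comul_x_neg := SuperCurrent.coeff_comul_x_neg
        comul_phi := fun n j => by
          rw [SuperCurrent.comul_phi, SuperCurrent.coeff_phi_coprodGen hq]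
        comul_psi := fun n j => by
          rw [SuperCurrent.comul_psi, SuperCurrent.coeff_psi_coprodGen hq]
        counit_gam := SuperCurrent.counit_gen hq _
        counit_phi := SuperCurrent.counit_phi hq
        counit_psi := SuperCurrent.counit_psi hq
        counit_x := fun _ _ => SuperCurrent.counit_gen hq _
        antipode_gam := by
          have h := SuperCurrent.antipode_gamPow hq hq4 1
          exact (congrArg _ (pow_one _).symm).trans (h.trans (congrArg _ (pow_one _)))
        antipode_x_pos := SuperCurrent.antipode_x_pos hq hq4
        antipode_x_neg := SuperCurrent.antipode_x_neg hq hq4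
        antipode_phi := SuperCurrent.antipode_phi hq hq4
        antipode_psi := SuperCurrent.antipode_psi hq hq4 }
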